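/- An instance of the many-to-one classified popular matching problem consists of a bipartite graph $G=(A\cup P,E)$ between applicants $A$ and posts $P$; for every applicant a ranking of its neighbours, possibly with ties; for every post $p$ a quota $q(p)\ge 1$ and a classification $\mathcal C_p$, that is, a family of subsets (classes) $C$ of the set of neighbours of $p$, each with a quota $q(C)\in\mathbb{N}$. A feasible matching is a set $M\subseteq E$ that contains at most one edge at every applicant and satisfies $|M(p)|\le q(p)$ and $|M(p)\cap C|\le q(C)$ for every post $p$ and every $C\in\mathcal C_p$, where $M(p)$ is the set of applicants matched to $p$. In a comparison of two feasible matchings every applicant votes for the one in which it gets the post that it ranks better, if any; being matched is better than being unmatched. A feasible matching is popular (among the feasible matchings) if no feasible matching gets more votes than it in their comparison. Theorem. There is an algorithm that, given such an instance in which every classification is a laminar family (any two classes of a post are disjoint or nested), decides whether a popular matching exists and outputs one if it does. On a random access machine with the uniform cost measure, with addition and truncated subtraction as its arithmetic operations, its running time is $O(|A||E|)$ if $E\neq\emptyset$ and no post is isolated, and $O(|A||E|+|A|+|P|+1)$ for arbitrary instances. The input lists the neighbours of every applicant with their ranks, and for every post its quota and its classes with their quotas and their members, all lists being in arbitrary order.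 -/

import Mathlib

/-! ### Instances, feasible matchings and popularity -/

/-- An instance with applicants `Fin n` and posts `Fin m`.  Applicants have quota one; posts have a
quota and a classification.  `rank a p` is the rank of the post `p` in the preference list of `a`
(smaller is better, equal ranks are ties); its values are used on edges only, and `classQuota p C`
is used only for classes `C` of `p`. -/
structure CPMInstance (n m : ℕ) where
  edges : Finset (Fin n × Fin m)
  rank : Fin n → Fin m → ℕ
  quota : Fin m → ℕ
  quota_pos : ∀ p, 0 < quota p
  classes : Fin m → Finset (Finset (Fin n))
  classQuota : Fin m → Finset (Fin n) → ℕ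
  /-- Every class of a post consists of neighbours of that post. -/
  classes_subset : ∀ p, ∀ C ∈ classes p, ∀ a ∈ C, (a, p) ∈ edges

namespace CPMInstance

variable {n m : ℕ}

/-- The set of posts that a set of edges `M` assigns to the applicant `a`. -/
def postsOf (M : Finset (Fin n × Fin m)) (a : Fin n) : Finset (Fin m) :=
  Finset.univ.filter fun p => (a, p) ∈ M

/-- The set of applicants that a set of edges `M` assigns to the post `p`. -/
def applicantsOf (M : Finset (Fin n × Fin m)) (p : Fin m) : Finset (Fin n) :=
  Finset.univ.filter fun a => (a, p) ∈ M

/-- Every classification is a laminar family. -/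
def Laminar (I : CPMInstance n m) : Prop :=
  ∀ p, ∀ C ∈ I.classes p, ∀ D ∈ I.classes p, C ⊆ D ∨ D ⊆ C ∨ C ∩ D = ∅

/-- Feasible matchings: sets of edges that respect the quota one of every applicant and the quotas
of all posts and of all classes. -/
structure Feasible (I : CPMInstance n m) (M : Finset (Fin n × Fin m)) : Prop where
  subset_edges : M ⊆ I.edges
  applicant_quota : ∀ a, (postsOf M a).card ≤ 1
  post_quota : ∀ p, (applicantsOf M p).card ≤ I.quota p
  class_quota : ∀ p, ∀ C ∈ I.classes p, (applicantsOf M p ∩ C).card ≤ I.classQuota p C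

/-- The applicant `a` prefers `M` to `M'` (for feasible `M` and `M'`): `a` is matched in `M`, and is
either unmatched in `M'` or matched in `M'` to a post of strictly larger rank. -/
def Prefers (I : CPMInstance n m) (a : Fin n) (M M' : Finset (Fin n × Fin m)) : Prop :=
  ∃ p ∈ postsOf M a, ∀ p' ∈ postsOf M' a, I.rank a p < I.rank a p'

open Classical in
/-- The number of applicants that vote for `M` in the comparison with `M'`. -/
noncomputable def votes (I : CPMInstance n m) (M M' : Finset (Fin n × Fin m)) : ℕ :=
  (Finset.univ.filter fun a => I.Prefers a M M').card

/-- `M` is more popular than `M'`. -/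
def MorePopular (I : CPMInstance n m) (M M' : Finset (Fin n × Fin m)) : Prop :=
  I.votes M' M < I.votes M M'

/-- `M` is popular among the feasible matchings. -/
def Popular (I : CPMInstance n m) (M : Finset (Fin n × Fin m)) : Prop :=
  I.Feasible M ∧ ∀ M', I.Feasible M' → ¬ I.MorePopular M' M

/-! ### The input of the algorithm -/

/-- A way of writing the finite sets of an instance as lists without repetitions, in any order:
the neighbours of every applicant, the classes of every post, and the members of every class. -/
structure Listing (I : CPMInstance n m) where
  nbrs : Fin n → List (Fin m)
  nbrs_nodup : ∀ a, (nbrs a).Nodup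
  mem_nbrs : ∀ a p, p ∈ nbrs a ↔ (a, p) ∈ I.edges
  classList : Fin m → List (List (Fin n))
  members_nodup : ∀ p, ∀ l ∈ classList p, l.Nodup
  classList_nodup : ∀ p, ((classList p).map List.toFinset).Nodup
  mem_classList : ∀ p C, C ∈ (classList p).map List.toFinset ↔ C ∈ I.classes p

/-- The block of an applicant: the number of neighbours, then every neighbour with its rank. -/
def Listing.applicantBlock {I : CPMInstance n m} (L : Listing I) (a : Fin n) : List ℕ :=
  (L.nbrs a).length :: (L.nbrs a).flatMap fun p => [p.val, I.rank a p]

/-- The block of a post: its quota, the number of its classes, then for every class its quota, the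
number of its members, and the members. -/
def Listing.postBlock {I : CPMInstance n m} (L : Listing I) (p : Fin m) : List ℕ :=
  I.quota p :: (L.classList p).length ::
    (L.classList p).flatMap fun l =>
      I.classQuota p l.toFinset :: l.length :: l.map Fin.val

/-- The input: the numbers of applicants and of posts, then the blocks of all the applicants, then
the blocks of all the posts. -/
def Listing.encode {I : CPMInstance n m} (L : Listing I) : List ℕ :=
  n :: m :: ((List.finRange n).flatMap L.applicantBlock ++ (List.finRange m).flatMap L.postBlock)

end CPMInstance

/-! ### Random access machines with the uniform cost measure

Programs are structured programs over registers `0, 1, 2, …` and arrays `0, 1, 2, …` of natural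
numbers (a program mentions only finitely many of them).  The arithmetic operations are addition and
truncated subtraction.  Every operation, array access, assignment and test costs one unit. -/

namespace RAM

/-- A state: the contents of the registers and of the cells of the arrays. -/
structure State where
  reg : ℕ → ℕ
  arr : ℕ → ℕ → ℕ

/-- Expressions: constants, registers, array cells (`get k e` is cell `e` of array `k`), sums and
truncated differences. -/
inductive Expr where
  | const (k : ℕ)
  | reg (i : ℕ)
  | get (k : ℕ) (e : Expr)
  | add (e f : Expr)
  | sub (e f : Expr)

/-- The value of an expression. -/
def Expr.eval (s : State) : Expr → ℕ
  | .const k => k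
  | .reg i => s.reg i
  | .get k e => s.arr k (e.eval s)
  | .add e f => e.eval s + f.eval s
  | .sub e f => e.eval s - f.eval s

/-- The time needed to evaluate an expression: its number of symbols. -/
def Expr.cost : Expr → ℕ
  | .const _ => 1
  | .reg _ => 1
  | .get _ e => e.cost + 1
  | .add e f => e.cost + f.cost + 1
  | .sub e f => e.cost + f.cost + 1

/-- Programs; `set i e` assigns to a register, `put k e f` assigns the value of `f` to cell `e` of
array `k`, and a test succeeds if the value of the expression is not zero. -/
inductive Prog where
  | skip
  | set (i : ℕ) (e : Expr)
  | put (k : ℕ) (e f : Expr)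
  | seq (c d : Prog)
  | ite (e : Expr) (c d : Prog)
  | loop (e : Expr) (c : Prog)

/-- The register `i` receives the value `v`. -/
def State.setReg (s : State) (i v : ℕ) : State :=
  { s with reg := Function.update s.reg i v }

/-- Cell `j` of array `k` receives the value `v`. -/
def State.setCell (s : State) (k j v : ℕ) : State :=
  { s with arr := Function.update s.arr k (Function.update (s.arr k) j v) }

/-- `Exec c s t s'`: started in the state `s`, the program `c` halts after exactly `t` units of time
in the state `s'`. -/
inductive Exec : Prog → State → ℕ → State → Prop where
  | skip (s : State) : Exec .skip s 1 s
  | set (i : ℕ) (e : Expr) (s : State) :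
      Exec (.set i e) s (e.cost + 1) (s.setReg i (e.eval s))
  | put (k : ℕ) (e f : Expr) (s : State) :
      Exec (.put k e f) s (e.cost + f.cost + 1) (s.setCell k (e.eval s) (f.eval s))
  | seq {c d : Prog} {s s' s'' : State} {t u : ℕ} (hc : Exec c s t s') (hd : Exec d s' u s'') :
      Exec (.seq c d) s (t + u) s''
  | ite_true {e : Expr} {c d : Prog} {s s' : State} {t : ℕ} (he : e.eval s ≠ 0)
      (hc : Exec c s t s') : Exec (.ite e c d) s (e.cost + 1 + t) s'
  | ite_false {e : Expr} {c d : Prog} {s s' : State} {t : ℕ} (he : e.eval s = 0)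
      (hd : Exec d s t s') : Exec (.ite e c d) s (e.cost + 1 + t) s'
  | loop_true {e : Expr} {c : Prog} {s s' s'' : State} {t u : ℕ} (he : e.eval s ≠ 0)
      (hc : Exec c s t s') (hl : Exec (.loop e c) s' u s'') :
      Exec (.loop e c) s (e.cost + 1 + t + u) s''
  | loop_false {e : Expr} {c : Prog} {s : State} (he : e.eval s = 0) :
      Exec (.loop e c) s (e.cost + 1) s

/-- The initial state: the input is in array `0`, everything else is zero. -/
def init (x : List ℕ) : State where
  reg := fun _ => 0
  arr := fun k j => if k = 0 then x.getD j 0 else 0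

end RAM

namespace CPMInstance

variable {n m : ℕ}

/-- Array `1` of the state `s` describes the matching `M`: cell `a + 1` holds `p + 1` if the applicant
`a` is matched to the post `p`, and `0` if `a` is unmatched. -/
def Outputs (s : RAM.State) (M : Finset (Fin n × Fin m)) : Prop :=
  ∀ a : Fin n, (∀ p : Fin m, (a, p) ∈ M → s.arr 1 (a.val + 1) = p.val + 1) ∧
    ((∀ p : Fin m, (a, p) ∉ M) → s.arr 1 (a.val + 1) = 0)

/-- The state `s` holds a correct answer: cell `0` of array `1` is `1`, followed by a popular matching,
if there is one, and cell `0` of array `1` is `0` if there is none. -/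
def CorrectAnswer (I : CPMInstance n m) (s : RAM.State) : Prop :=
  ((∃ M, I.Popular M) → s.arr 1 0 = 1 ∧ ∃ M, I.Popular M ∧ Outputs s M) ∧
    ((¬ ∃ M, I.Popular M) → s.arr 1 0 = 0)

end CPMInstance

/-! ### A weakest-precondition calculus with time credits -/

namespace RAM

/-! Give every applicant that has an edge a last resort that is worse than all its posts; being
unmatched then means being matched to the last resort, and votes do not change. By laminarity the
posts and their nonempty classes form a forest whose leaves are the edges. A matching sends one
token per applicant along an edge and up to the root, and the quotas bound the number of tokens that
pass through a node. An edge is live if it lies in no class of quota zero.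

Take a maximum matching of the best live edges of the applicants. A node is good if the root can be
reached from it in the residual network, and an applicant is good if it has a best edge to a good
node. The good applicants together with the maximal classes that are not good form a minimum cut
(`Cut.weak_duality`, `Flow.strong_duality`), so the matching fills these classes.

Sufficiency (`SecondMax.popular`). Let a complete matching fill all these classes, and let every
applicant use a best edge among its live edges to good nodes or, if it is not good, possibly a best
live edge. An applicant can prefer another matching only if that matching moves it from a good node
to one that is not good, and every applicant that is moved the other way votes against the change.
So the difference of the votes is at most the number of additional tokens below the cut, which is
not positive because the cut is already full.

Necessity (`SecondMax.full`). A closed residual walk along which the votes of the swapping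
applicants sum to a positive number would improve the matching, so a popular matching has none
(`PopularMate.no_walk`). Hence, starting from an edge that its applicant prefers to its own, one
reaches without loss neither the root nor a matched edge that is not best. The classes reached in
this way yield a cut of the network of best edges whose value is at most the number of best edges in
the popular matching. Both cuts and both matchings are therefore optimal, and complementary
slackness yields the structure above (`PopularMate.structure`).

It remains to search for such a matching while the cut stays full. For this the maximal classes that
are not good are detached: they become roots of their own, and the other capacities are reduced by
what passes through the detached classes. Augmentations never take tokens away from a class directly
below the root, so continuing from the first matching keeps the cut full. A popular matching exists
if and only if the second maximum matching covers all applicants that have an edge.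

Running time. A laminar family of nonempty subsets of a set of size d has at most 2d members
(`card_le_of_laminar`), so the forest has O(|E|) nodes. One search and one augmentation are linear
in this number and match one more applicant, which gives O(|A||E|). The forest is built from the
unsorted input by inserting classes by decreasing size. Scanning all classes of a post of degree d
once for every size costs O(d²), and d is at most |A|. Time is accounted for by credits, which serve
as potentials in the loop invariants. -/

@[simp] theorem State.setReg_reg (s : State) (i v j : ℕ) :
    (s.setReg i v).reg j = if j = i then v else s.reg j := by
  simp [State.setReg, Function.update_apply]

@[simp] theorem State.setReg_arr (s : State) (i v : ℕ) : (s.setReg i v).arr = s.arr := rfl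

@[simp] theorem State.setCell_reg (s : State) (k j v : ℕ) : (s.setCell k j v).reg = s.reg := rfl

@[simp] theorem State.setCell_arr (s : State) (k j v l : ℕ) :
    (s.setCell k j v).arr l = if l = k then Function.update (s.arr k) j v else s.arr l := by
  simp only [State.setCell, Function.update_apply]

/-- The registers that a program may write. -/
def Prog.regs : Prog → List ℕ
  | .skip => []
  | .set i _ => [i]
  | .put _ _ _ => []
  | .seq c d => c.regs ++ d.regs
  | .ite _ c d => c.regs ++ d.regs
  | .loop _ c => c.regs

/-- The arrays that a program may write. -/
def Prog.arrs : Prog → List ℕ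
  | .skip => []
  | .set _ _ => []
  | .put k _ _ => [k]
  | .seq c d => c.arrs ++ d.arrs
  | .ite _ c d => c.arrs ++ d.arrs
  | .loop _ c => c.arrs

/-- The states `s` and `s'` agree on everything that `c` does not write. -/
structure Frame (c : Prog) (s s' : State) : Prop where
  reg : ∀ i, i ∉ c.regs → s'.reg i = s.reg i
  arr : ∀ k, k ∉ c.arrs → s'.arr k = s.arr k

theorem Frame.refl (c : Prog) (s : State) : Frame c s s := ⟨fun _ _ => rfl, fun _ _ => rfl⟩

theorem Frame.trans {c : Prog} {s s' s'' : State} (h : Frame c s s') (h' : Frame c s' s'') :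
    Frame c s s'' :=
  ⟨fun i hi => (h'.reg i hi).trans (h.reg i hi), fun k hk => (h'.arr k hk).trans (h.arr k hk)⟩

theorem Frame.of_exec {c : Prog} {s s' : State} {t : ℕ} (h : Exec c s t s') : Frame c s s' := by
  induction h with
  | skip s => exact Frame.refl _ _
  | set i e s =>
    refine ⟨fun j hj => ?_, fun _ _ => rfl⟩
    have : j ≠ i := by simpa [Prog.regs] using hj
    simp [this]
  | put k e f s =>
    refine ⟨fun _ _ => rfl, fun l hl => ?_⟩
    have : l ≠ k := by simpa [Prog.arrs] using hl
    simp [this]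
  | seq _ _ hc hd =>
    refine ⟨fun i hi => ?_, fun k hk => ?_⟩
    · simp only [Prog.regs, List.mem_append, not_or] at hi
      exact (hd.reg i hi.2).trans (hc.reg i hi.1)
    · simp only [Prog.arrs, List.mem_append, not_or] at hk
      exact (hd.arr k hk.2).trans (hc.arr k hk.1)
  | ite_true _ _ hc =>
    refine ⟨fun i hi => ?_, fun k hk => ?_⟩
    · simp only [Prog.regs, List.mem_append, not_or] at hi
      exact hc.reg i hi.1
    · simp only [Prog.arrs, List.mem_append, not_or] at hk
      exact hc.arr k hk.1
  | ite_false _ _ hc =>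
    refine ⟨fun i hi => ?_, fun k hk => ?_⟩
    · simp only [Prog.regs, List.mem_append, not_or] at hi
      exact hc.reg i hi.2
    · simp only [Prog.arrs, List.mem_append, not_or] at hk
      exact hc.arr k hk.2
  | loop_true _ _ _ hc hl =>
    exact ⟨fun i hi => (hl.reg i hi).trans (hc.reg i hi), fun k hk => (hl.arr k hk).trans (hc.arr k hk)⟩
  | loop_false _ => exact Frame.refl _ _

/-- With `k` credits, the program `c` started in `s` halts with a state and a number of credits left
that satisfy `Q`. -/
def wp (c : Prog) (Q : State → ℕ → Prop) (s : State) (k : ℕ) : Prop :=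
  ∃ t s' k', Exec c s t s' ∧ t + k' ≤ k ∧ Q s' k'

/-- The frame condition is handed to the implication for free, so postconditions and invariants need
not mention what the program cannot write. -/
theorem wp.mono {c : Prog} {Q Q' : State → ℕ → Prop} {s : State} {k : ℕ} (h : wp c Q s k)
    (hQ : ∀ s' k', Frame c s s' → Q s' k' → Q' s' k') : wp c Q' s k := by
  obtain ⟨t, s', k', he, hk, hq⟩ := h
  exact ⟨t, s', k', he, hk, hQ s' k' (Frame.of_exec he) hq⟩

theorem wp.weaken {c : Prog} {Q : State → ℕ → Prop} {s : State} {k l : ℕ} (h : wp c Q s k)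
    (hk : k ≤ l) : wp c Q s l := by
  obtain ⟨t, s', k', he, hk', hq⟩ := h
  exact ⟨t, s', k', he, hk'.trans hk, hq⟩

theorem wp.seq {c d : Prog} {Q : State → ℕ → Prop} {s : State} {k : ℕ}
    (h : wp c (fun s' k' => wp d Q s' k') s k) : wp (.seq c d) Q s k := by
  obtain ⟨t, s', k', he, hk, t', s'', k'', he', hk', hq⟩ := h
  exact ⟨t + t', s'', k'', .seq he he', by omega, hq⟩

/-- Credits that a program does not need are preserved. -/
theorem wp.keep {c : Prog} {Q : State → Prop} {s : State} {T r k : ℕ}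
    (h : wp c (fun s' _ => Q s') s T) (hk : T + r ≤ k) :
    wp c (fun s' k' => Q s' ∧ r ≤ k' ∧ Frame c s s') s k := by
  obtain ⟨t, s', k', he, hk', hq⟩ := h
  exact ⟨t, s', r, he, by omega, hq, le_rfl, Frame.of_exec he⟩

/-- This form suits specifications with a fixed time bound: the bounds are simply added, and no
credits occur in the intermediate assertion. -/
theorem wp.then {c d : Prog} {P Q : State → Prop} {s : State} {T T' k : ℕ}
    (h : wp c (fun s' _ => P s') s T)
    (h' : ∀ s', P s' → Frame c s s' → wp d (fun s'' _ => Q s'') s' T') (hk : T + T' ≤ k) :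
    wp (.seq c d) (fun s' _ => Q s') s k :=
  wp.seq ((h.keep hk).mono fun s' _ _ hs => (h' s' hs.1 hs.2.2).weaken hs.2.1)

theorem wp.ite {e : Expr} {c d : Prog} {Q : State → ℕ → Prop} {s : State} {k k' : ℕ}
    (hk : e.cost + 1 + k' ≤ k) (hc : e.eval s ≠ 0 → wp c Q s k')
    (hd : e.eval s = 0 → wp d Q s k') : wp (.ite e c d) Q s k := by
  by_cases he : e.eval s = 0
  · obtain ⟨t, s', l, hx, hl, hq⟩ := hd he
    exact ⟨_, s', l, .ite_false he hx, by omega, hq⟩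
  · obtain ⟨t, s', l, hx, hl, hq⟩ := hc he
    exact ⟨_, s', l, .ite_true he hx, by omega, hq⟩

/-- Every test costs at least one credit, so strong induction on the credits proves termination and
the time bound at once. The invariant sees the credits that are left, which makes amortised
arguments possible. -/
theorem wp.loop {e : Expr} {c : Prog} {Q : State → ℕ → Prop} {s : State} {k : ℕ}
    (J : State → ℕ → Prop) (h0 : J s k)
    (step : ∀ s' k', J s' k' → Frame c s s' → e.eval s' ≠ 0 →
      ∃ l, e.cost + 1 + l ≤ k' ∧ wp c J s' l)
    (fin : ∀ s' k', J s' k' → Frame c s s' → e.eval s' = 0 → ∃ l, e.cost + 1 + l ≤ k' ∧ Q s' l) :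
    wp (.loop e c) Q s k := by
  suffices H : ∀ k s', J s' k → Frame c s s' → wp (.loop e c) Q s' k from H k s h0 (Frame.refl _ _)
  intro k
  induction k using Nat.strong_induction_on with
  | _ k ih =>
    intro s' hJ hF
    by_cases he : e.eval s' = 0
    · obtain ⟨l, hl, hq⟩ := fin s' k hJ hF he
      exact ⟨_, s', l, .loop_false he, hl, hq⟩
    · obtain ⟨l, hl, t, s'', l', hx, hl', hJ'⟩ := step s' k hJ hF he
      obtain ⟨u, s3, k3, hx3, hk3, hq⟩ := ih l' (by omega) s'' hJ' (hF.trans (Frame.of_exec hx))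
      exact ⟨_, s3, k3, .loop_true he hx hx3, by omega, hq⟩

/-! ### Loop-free programs and counting loops -/

/-- Programs without loops. -/
def Prog.flat : Prog → Bool
  | .seq c d => c.flat && d.flat
  | .ite _ c d => c.flat && d.flat
  | .loop _ _ => false
  | _ => true

/-- The effect of a program without loops. -/
def Prog.step : Prog → State → State
  | .skip, s => s
  | .set i e, s => s.setReg i (e.eval s)
  | .put k e f, s => s.setCell k (e.eval s) (f.eval s)
  | .seq c d, s => d.step (c.step s)
  | .ite e c d, s => if e.eval s ≠ 0 then c.step s else d.step s
  | .loop _ _, s => s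

/-- A bound for the running time of a program without loops. -/
def Prog.bound : Prog → ℕ
  | .skip => 1
  | .set _ e => e.cost + 1
  | .put _ e f => e.cost + f.cost + 1
  | .seq c d => c.bound + d.bound
  | .ite e c d => e.cost + 1 + (c.bound + d.bound)
  | .loop _ _ => 0

theorem Prog.exec_step {c : Prog} (h : c.flat = true) (s : State) :
    ∃ t ≤ c.bound, Exec c s t (c.step s) := by
  induction c generalizing s with
  | skip => exact ⟨_, le_rfl, .skip s⟩
  | set i e => exact ⟨_, le_rfl, .set i e s⟩
  | put k e f => exact ⟨_, le_rfl, .put k e f s⟩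
  | seq c d hc hd =>
    simp only [Prog.flat, Bool.and_eq_true] at h
    obtain ⟨t, ht, hx⟩ := hc h.1 s
    obtain ⟨u, hu, hy⟩ := hd h.2 (c.step s)
    exact ⟨_, Nat.add_le_add ht hu, .seq hx hy⟩
  | ite e c d hc hd =>
    simp only [Prog.flat, Bool.and_eq_true] at h
    by_cases he : e.eval s = 0
    · obtain ⟨u, hu, hy⟩ := hd h.2 s
      refine ⟨e.cost + 1 + u, by simp only [Prog.bound]; omega, ?_⟩
      simp only [Prog.step, he, ne_eq, not_true_eq_false, if_false]
      exact .ite_false he hy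
    · obtain ⟨u, hu, hy⟩ := hc h.1 s
      refine ⟨e.cost + 1 + u, by simp only [Prog.bound]; omega, ?_⟩
      simp only [Prog.step, he, ne_eq, not_false_eq_true, if_true]
      exact .ite_true he hy
  | loop e c => simp [Prog.flat] at h

theorem wp.flat {c : Prog} {Q : State → ℕ → Prop} {s : State} {k : ℕ} (k' : ℕ)
    (h : c.flat = true) (hk : c.bound + k' ≤ k) (hQ : Q (c.step s) k') : wp c Q s k := by
  obtain ⟨t, ht, hx⟩ := Prog.exec_step h s
  exact ⟨t, _, k', hx, by omega, hQ⟩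

/-- `c; d` for a program `c` without loops. -/
theorem wp.flat_seq {c d : Prog} {Q : State → ℕ → Prop} {s : State} {k : ℕ} (k' : ℕ)
    (h : c.flat = true) (hk : c.bound + k' ≤ k) (hQ : wp d Q (c.step s) k') :
    wp (.seq c d) Q s k :=
  wp.seq (wp.flat k' h hk hQ)

/-- Run `c` while register `i` is smaller than register `h`, incrementing `i` after each round. -/
def Prog.forUp (i h : ℕ) (c : Prog) : Prog :=
  .loop (.sub (.reg h) (.reg i)) (.seq c (.set i (.add (.reg i) (.const 1))))

/-- The 8 credits of a round pay for the test and the increment, 4 each; the final test costs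
another 4. The body has to establish the invariant for the state after the increment. -/
theorem wp.forUp {i h : ℕ} {c : Prog} {Q : State → ℕ → Prop} {s : State} {k : ℕ}
    (J : ℕ → State → ℕ → Prop) (hi : i ∉ c.regs) (hh : h ∉ c.regs) (hne : i ≠ h)
    (hle : s.reg i ≤ s.reg h) (h0 : J (s.reg i) s k)
    (step : ∀ j s' k', j < s.reg h → J j s' k' → Frame (Prog.forUp i h c) s s' → s'.reg i = j →
      ∃ l, 8 + l ≤ k' ∧ wp c (fun s2 l2 => J (j + 1) (s2.setReg i (j + 1)) l2) s' l)
    (fin : ∀ s' k', J (s.reg h) s' k' → Frame (Prog.forUp i h c) s s' → s'.reg i = s.reg h →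
      ∃ l, 4 + l ≤ k' ∧ Q s' l) :
    wp (Prog.forUp i h c) Q s k := by
  have hreg : h ∉ (Prog.forUp i h c).regs := by
    simp [Prog.forUp, Prog.regs, hh, Ne.symm hne]
  refine wp.loop (fun s' k' => s'.reg i ≤ s.reg h ∧ J (s'.reg i) s' k') ⟨hle, h0⟩ ?_ ?_
  · rintro s' k' ⟨hl, hJ⟩ hF he
    have hF' : Frame (Prog.forUp i h c) s s' := ⟨hF.reg, hF.arr⟩
    have hrh := hF'.reg h hreg
    have hlt : s'.reg i < s.reg h := by
      simp only [Expr.eval, hrh] at he; omega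
    obtain ⟨l, hl', hw⟩ := step _ s' k' hlt hJ hF' rfl
    refine ⟨l + 4, by simp only [Expr.cost]; omega, wp.seq ?_⟩
    obtain ⟨t, s2, l2, hx, hk, hq⟩ := hw
    have hr2 := (Frame.of_exec hx).reg i hi
    refine ⟨t, s2, l2 + 4, hx, by omega, wp.flat l2 rfl (by simp [Prog.bound, Expr.cost]; omega) ?_⟩
    simp only [Prog.step, Expr.eval, hr2, State.setReg_reg, if_true]
    exact ⟨hlt, hq⟩
  · rintro s' k' ⟨hl, hJ⟩ hF he
    have hF' : Frame (Prog.forUp i h c) s s' := ⟨hF.reg, hF.arr⟩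
    have hrh := hF'.reg h hreg
    have heq : s'.reg i = s.reg h := by
      simp only [Expr.eval, hrh] at he; omega
    rw [heq] at hJ
    exact fin s' k' hJ hF' heq

/-- The rule for loops whose body has no loops. -/
theorem wp.forUp_flat {i h : ℕ} {c : Prog} {Q : State → Prop} {s : State} {k : ℕ}
    (J : ℕ → State → Prop) (hc : c.flat = true) (hi : i ∉ c.regs) (hh : h ∉ c.regs) (hne : i ≠ h)
    (hle : s.reg i ≤ s.reg h) (hk : (s.reg h - s.reg i) * (c.bound + 8) + 4 ≤ k)
    (h0 : J (s.reg i) s)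
    (step : ∀ j s', j < s.reg h → s.reg i ≤ j → J j s' → Frame (Prog.forUp i h c) s s' →
      s'.reg i = j → J (j + 1) ((c.step s').setReg i (j + 1)))
    (fin : ∀ s', J (s.reg h) s' → Frame (Prog.forUp i h c) s s' → s'.reg i = s.reg h → Q s') :
    wp (Prog.forUp i h c) (fun s' _ => Q s') s k := by
  refine wp.forUp (fun j s' k' => (s.reg h - j) * (c.bound + 8) + 4 ≤ k' ∧ s.reg i ≤ j ∧ J j s')
    hi hh hne hle ⟨hk, le_rfl, h0⟩ ?_ ?_
  · rintro j s' k' hj ⟨hk', hij, hJ⟩ hF hr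
    have hs : (s.reg h - j) * (c.bound + 8) = (s.reg h - (j + 1)) * (c.bound + 8) + (c.bound + 8) := by
      rw [← Nat.succ_mul]; congr 1; omega
    refine ⟨c.bound + ((s.reg h - (j + 1)) * (c.bound + 8) + 4), by omega,
      wp.flat ((s.reg h - (j + 1)) * (c.bound + 8) + 4) hc le_rfl ⟨le_rfl, by omega, ?_⟩⟩
    exact step j s' hj hij hJ hF hr
  · rintro s' k' ⟨hk', _, hJ⟩ hF hr
    exact ⟨0, by omega, fin s' hJ hF hr⟩

end RAM

/-! ### Forests, matchings and cuts -/

namespace Forest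

open Finset

open Classical in
/-- The indicator of a proposition. -/
noncomputable def ind (p : Prop) : ℕ := if p then 1 else 0

theorem ind_pos {p : Prop} (h : p) : ind p = 1 := if_pos h
theorem ind_neg {p : Prop} (h : ¬ p) : ind p = 0 := if_neg h
theorem ind_le_one (p : Prop) : ind p ≤ 1 := by unfold ind; split <;> simp
theorem ind_congr {p q : Prop} (h : p ↔ q) : ind p = ind q := by rw [propext h]
theorem ind_mono {p q : Prop} (h : p → q) : ind p ≤ ind q := by
  by_cases hp : p
  · rw [ind_pos hp, ind_pos (h hp)]
  · rw [ind_neg hp]; exact Nat.zero_le _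
theorem of_ind_eq_one {p : Prop} (h : ind p = 1) : p := by
  by_contra hp; rw [ind_neg hp] at h; exact absurd h (by decide)
theorem ind_split (p q : Prop) : ind p = ind (p ∧ q) + ind (p ∧ ¬ q) := by
  by_cases hp : p <;> by_cases hq : q <;> simp [ind, hp, hq]

/-- `v` is an ancestor of `u`, or equal to it. -/
def Anc (par : ℕ → ℕ) (v u : ℕ) : Prop := ∃ k, par^[k] u = v

theorem Anc.refl (par : ℕ → ℕ) (v : ℕ) : Anc par v v := ⟨0, rfl⟩

theorem anc_iff {par : ℕ → ℕ} {v u : ℕ} : Anc par v u ↔ v = u ∨ Anc par v (par u) := by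
  constructor
  · rintro ⟨k, hk⟩
    cases k with
    | zero => exact .inl hk.symm
    | succ k => exact .inr ⟨k, by rwa [Function.iterate_succ_apply] at hk⟩
  · rintro (rfl | ⟨k, hk⟩)
    · exact Anc.refl _ _
    · exact ⟨k + 1, by rwa [Function.iterate_succ_apply]⟩

theorem Anc.of_par {par : ℕ → ℕ} {v u : ℕ} (h : Anc par v (par u)) : Anc par v u :=
  anc_iff.2 (.inr h)

theorem Anc.trans {par : ℕ → ℕ} {w v u : ℕ} (h : Anc par w v) (h' : Anc par v u) :
    Anc par w u := by
  obtain ⟨k, rfl⟩ := h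
  obtain ⟨l, rfl⟩ := h'
  exact ⟨k + l, by rw [Function.iterate_add_apply]⟩

theorem Anc.up {par : ℕ → ℕ} {v u : ℕ} (h : Anc par v u) : Anc par (par v) u :=
  Anc.trans ⟨1, rfl⟩ h

theorem Anc.comparable {par : ℕ → ℕ} {v w u : ℕ} (hv : Anc par v u) (hw : Anc par w u) :
    Anc par v w ∨ Anc par w v := by
  obtain ⟨k, rfl⟩ := hv
  obtain ⟨l, rfl⟩ := hw
  rcases le_total k l with h | h
  · right; exact ⟨l - k, by rw [← Function.iterate_add_apply, Nat.sub_add_cancel h]⟩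
  · left; exact ⟨k - l, by rw [← Function.iterate_add_apply, Nat.sub_add_cancel h]⟩

/-- The nodes are the root `0`, the edges `1, …, E` (which are leaves) and the classes
`E + 1, …, V`. -/
structure Tree (E V : ℕ) (par : ℕ → ℕ) : Prop where
  le : E ≤ V
  root : par 0 = 0
  edge : ∀ e, 1 ≤ e → e ≤ E → par e = 0 ∨ (E < par e ∧ par e ≤ V)
  cls : ∀ v, E < v → v ≤ V → par v = 0 ∨ (E < par v ∧ par v < v)

variable {n E V : ℕ} {own par cap rem mate rnk : ℕ → ℕ}

theorem Tree.iterate_zero (ht : Tree E V par) (k : ℕ) : par^[k] 0 = 0 := by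
  induction k with
  | zero => rfl
  | succ k ih => rw [Function.iterate_succ_apply, ht.root, ih]

theorem Tree.anc_zero (ht : Tree E V par) {v : ℕ} (h : Anc par v 0) : v = 0 := by
  obtain ⟨k, rfl⟩ := h
  exact ht.iterate_zero k

/-- The parent of a node is the root or a class. -/
theorem Tree.par_node (ht : Tree E V par) {v : ℕ} (hv : v ≤ V) :
    par v = 0 ∨ (E < par v ∧ par v ≤ V) := by
  rcases Nat.eq_zero_or_pos v with rfl | h0
  · exact .inl ht.root
  rcases Nat.lt_or_ge E v with h | h
  · rcases ht.cls v h hv with h' | h'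
    · exact .inl h'
    · exact .inr ⟨h'.1, by omega⟩
  · exact ht.edge v h0 h

/-- A class has a larger number than its parent, so climbing decreases the number. Edges are leaves
but carry the smallest numbers, and hence the bound is confined to the root and the classes. -/
theorem Tree.anc_le (ht : Tree E V par) {v u : ℕ} (hu : u = 0 ∨ (E < u ∧ u ≤ V))
    (h : Anc par v u) : v ≤ u ∧ (v = 0 ∨ (E < v ∧ v ≤ V)) := by
  obtain ⟨k, hk⟩ := h
  induction k generalizing u with
  | zero => subst hk; exact ⟨le_rfl, hu⟩
  | succ k ih =>
    rw [Function.iterate_succ_apply] at hk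
    rcases hu with rfl | hu
    · rw [ht.root] at hk; exact ih (.inl rfl) hk
    · rcases ht.cls u hu.1 hu.2 with h' | h'
      · have := ih (.inl h') hk
        exact ⟨by omega, this.2⟩
      · have := ih (.inr ⟨h'.1, by omega⟩) hk
        exact ⟨by omega, this.2⟩

/-- The forest has no cycles. Consequently, moving a token from a node to its parent changes the
indicator of being above the token at that node only. -/
theorem Tree.not_anc_par (ht : Tree E V par) {v : ℕ} (h0 : v ≠ 0) (hv : v ≤ V) :
    ¬ Anc par v (par v) := by
  intro h
  have h1 := ht.anc_le (ht.par_node hv) h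
  rcases Nat.lt_or_ge E v with h' | h'
  · rcases ht.cls v h' hv with h2 | h2 <;> omega
  · rcases h1.2 with h2 | h2 <;> omega

theorem Tree.anc_edge (_ht : Tree E V par) {v e : ℕ} (hv : E < v) (he : e ≤ E) :
    Anc par v e ↔ Anc par v (par e) := by
  rw [anc_iff]
  exact or_iff_right (by omega)

/-- The number of applicants that are matched along an edge below `v`. -/
noncomputable def cnt (n : ℕ) (par mate : ℕ → ℕ) (v : ℕ) : ℕ :=
  ∑ a ∈ Icc 1 n, ind (mate a ≠ 0 ∧ Anc par v (mate a))

/-- Only the summand of `a` changes. The additive form avoids truncated subtraction. -/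
theorem cnt_update {a e v : ℕ} (ha : a ∈ Icc 1 n) :
    cnt n par (Function.update mate a e) v + ind (mate a ≠ 0 ∧ Anc par v (mate a)) =
      cnt n par mate v + ind (e ≠ 0 ∧ Anc par v e) := by
  unfold cnt
  rw [← Finset.add_sum_erase _ _ ha, ← Finset.add_sum_erase (Icc 1 n) (fun a => ind (mate a ≠ 0 ∧ _)) ha]
  have : ∀ b ∈ (Icc 1 n).erase a, ind (Function.update mate a e b ≠ 0 ∧
      Anc par v (Function.update mate a e b)) = ind (mate b ≠ 0 ∧ Anc par v (mate b)) := by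
    intro b hb
    rw [Function.update_of_ne (Finset.ne_of_mem_erase hb)]
  rw [Finset.sum_congr rfl this, Function.update_self]
  ring

theorem cnt_pos_iff {v : ℕ} :
    0 < cnt n par mate v ↔ ∃ a, 1 ≤ a ∧ a ≤ n ∧ mate a ≠ 0 ∧ Anc par v (mate a) := by
  unfold cnt
  constructor
  · intro h
    obtain ⟨a, ha, hp⟩ := Finset.exists_ne_zero_of_sum_ne_zero h.ne'
    rw [mem_Icc] at ha
    exact ⟨a, ha.1, ha.2, by by_contra hc; exact hp (ind_neg hc)⟩
  · rintro ⟨a, h1, h2, h3⟩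
    have h := Finset.single_le_sum (f := fun a => ind (mate a ≠ 0 ∧ Anc par v (mate a)))
      (fun _ _ => Nat.zero_le _) (mem_Icc.2 ⟨h1, h2⟩)
    exact lt_of_lt_of_le Nat.one_pos ((ind_pos h3).symm.le.trans h)

/-! ### Cuts and duality -/

/-- A set of nodes that contains the root and with every class its parent. -/
structure UpClosed (E V : ℕ) (par : ℕ → ℕ) (T : ℕ → Prop) : Prop where
  root : T 0
  up : ∀ v, E < v → v ≤ V → T v → T (par v)

open Classical in
/-- The maximal classes outside `T`. -/
noncomputable def tops (E V : ℕ) (par : ℕ → ℕ) (T : ℕ → Prop) : Finset ℕ :=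
  (Ioc E V).filter fun v => ¬ T v ∧ T (par v)

theorem mem_tops {T : ℕ → Prop} {v : ℕ} :
    v ∈ tops E V par T ↔ (E < v ∧ v ≤ V) ∧ ¬ T v ∧ T (par v) := by
  simp [tops]

theorem UpClosed.anc {T : ℕ → Prop} (hT : UpClosed E V par T) (ht : Tree E V par) {v u : ℕ}
    (hu : u = 0 ∨ (E < u ∧ u ≤ V)) (h : Anc par v u) (hTu : T u) : T v := by
  obtain ⟨k, hk⟩ := h
  induction k generalizing u with
  | zero => subst hk; exact hTu
  | succ k ih =>
    rw [Function.iterate_succ_apply] at hk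
    rcases hu with rfl | hu
    · rw [ht.root] at hk; exact ih (.inl rfl) hTu hk
    · exact ih (ht.par_node hu.2) (hT.up u hu.1 hu.2 hTu) hk

/-- Climb until the parent lies in `T`; this happens because the root does, and the numbers decrease
on the way. -/
theorem exists_top {T : ℕ → Prop} (hT : UpClosed E V par T) (ht : Tree E V par) (u : ℕ)
    (hu : u = 0 ∨ (E < u ∧ u ≤ V)) (h : ¬ T u) : ∃ d ∈ tops E V par T, Anc par d u := by
  induction u using Nat.strong_induction_on with
  | _ u ih =>
    rcases hu with rfl | hu
    · exact absurd hT.root h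
    by_cases hp : T (par u)
    · exact ⟨u, mem_tops.2 ⟨hu, h, hp⟩, Anc.refl _ _⟩
    · rcases ht.cls u hu.1 hu.2 with h' | h'
      · rw [h'] at hp; exact absurd hT.root hp
      · obtain ⟨d, hd, hda⟩ := ih (par u) h'.2 (.inr ⟨h'.1, by omega⟩) hp
        exact ⟨d, hd, hda.of_par⟩

/-- Two ancestors of `u` are comparable. If one lay properly above the other, it would be an
ancestor of the other one's parent, which is in `T`, and would be in `T` itself. -/
theorem top_unique {T : ℕ → Prop} (hT : UpClosed E V par T) (ht : Tree E V par) {d d' u : ℕ}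
    (hd : d ∈ tops E V par T) (hd' : d' ∈ tops E V par T) (h : Anc par d u) (h' : Anc par d' u) :
    d = d' := by
  have key : ∀ {c c' : ℕ}, c ∈ tops E V par T → c' ∈ tops E V par T → Anc par c c' → c = c' := by
    intro c c' hc hc' hcc
    rw [mem_tops] at hc hc'
    rcases anc_iff.1 hcc with rfl | hcc
    · rfl
    · exact absurd (hT.anc ht (ht.par_node hc'.1.2) hcc hc'.2.2) hc.2.1
  rcases h.comparable h' with h'' | h''
  · exact key hd hd' h''
  · exact (key hd' hd h'').symm

theorem not_of_top {T : ℕ → Prop} (hT : UpClosed E V par T) (ht : Tree E V par) {d u : ℕ}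
    (hu : u = 0 ∨ (E < u ∧ u ≤ V)) (hd : d ∈ tops E V par T) (h : Anc par d u) : ¬ T u :=
  fun hc => (mem_tops.1 hd).2.1 (hT.anc ht hu h hc)

theorem sum_ind_top {T : ℕ → Prop} (hT : UpClosed E V par T) (ht : Tree E V par) {u : ℕ}
    (hu : u = 0 ∨ (E < u ∧ u ≤ V)) : ∑ d ∈ tops E V par T, ind (Anc par d u) = ind (¬ T u) := by
  by_cases h : T u
  · rw [ind_neg (not_not.2 h)]
    refine Finset.sum_eq_zero fun d hd => ind_neg fun hc => not_of_top hT ht hu hd hc h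
  · obtain ⟨d, hd, hda⟩ := exists_top hT ht u hu h
    rw [ind_pos h, Finset.sum_eq_single_of_mem d hd fun d' hd' hne =>
      ind_neg fun hc => hne (top_unique hT ht hd' hd hc hda), ind_pos hda]

/-- The matched edges that lie outside `T` are counted by the maximal classes outside `T`. -/
theorem sum_cnt_tops {T : ℕ → Prop} (hT : UpClosed E V par T) (ht : Tree E V par)
    (hm : ∀ a, 1 ≤ a → a ≤ n → mate a ≠ 0 → 1 ≤ mate a ∧ mate a ≤ E) :
    ∑ d ∈ tops E V par T, cnt n par mate d =
      ∑ a ∈ Icc 1 n, ind (mate a ≠ 0 ∧ ¬ T (par (mate a))) := by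
  unfold cnt
  rw [Finset.sum_comm]
  refine Finset.sum_congr rfl fun a ha => ?_
  rw [mem_Icc] at ha
  by_cases h0 : mate a = 0
  · rw [ind_neg fun h => h.1 h0]
    exact Finset.sum_eq_zero fun d _ => ind_neg fun h => h.1 h0
  · have hma := hm a ha.1 ha.2 h0
    rw [ind_congr (and_iff_right h0), ← sum_ind_top hT ht (ht.edge _ hma.1 hma.2)]
    refine Finset.sum_congr rfl fun d hd => ind_congr ?_
    rw [and_iff_right h0]
    exact ht.anc_edge (mem_tops.1 hd).1.1 hma.2

/-- `mate` matches applicants along edges of their own that satisfy `ok`. -/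
def IsMate (n E : ℕ) (own : ℕ → ℕ) (ok : ℕ → Prop) (mate : ℕ → ℕ) : Prop :=
  ∀ a, 1 ≤ a → a ≤ n → mate a ≠ 0 → (1 ≤ mate a ∧ mate a ≤ E) ∧ own (mate a) = a ∧ ok (mate a)

/-- A cut consists of an up-closed set of nodes and the set of applicants that have an admissible
edge into it. -/
structure Cut (n E V : ℕ) (own par : ℕ → ℕ) (ok : ℕ → Prop) (T X : ℕ → Prop) : Prop where
  tree : Tree E V par
  upClosed : UpClosed E V par T
  cover : ∀ e, 1 ≤ e → e ≤ E → ok e → T (par e) → X (own e)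

/-- A matched edge whose parent is in `T` belongs to an applicant of `X` by the covering condition;
any other one is counted at the unique maximal class outside `T` above it. -/
theorem Cut.matched_le {ok T X : ℕ → Prop} (hc : Cut n E V own par ok T X)
    (hm : IsMate n E own ok mate) :
    ∑ a ∈ Icc 1 n, ind (mate a ≠ 0) ≤
      ∑ a ∈ Icc 1 n, ind (X a) + ∑ d ∈ tops E V par T, cnt n par mate d := by
  rw [sum_cnt_tops hc.upClosed hc.tree fun a h1 h2 h3 => (hm a h1 h2 h3).1, ← Finset.sum_add_distrib]
  refine Finset.sum_le_sum fun a ha => ?_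
  rw [mem_Icc] at ha
  rw [ind_split _ (T (par (mate a)))]
  refine Nat.add_le_add_right (ind_mono ?_) _
  rintro ⟨h0, hT⟩
  have h := hm a ha.1 ha.2 h0
  have := hc.cover _ h.1.1 h.1.2 h.2.2 hT
  rwa [h.2.1] at this

/-- Weak duality. -/
theorem Cut.weak_duality {ok T X : ℕ → Prop} (hc : Cut n E V own par ok T X)
    (hm : IsMate n E own ok mate) (hcap : ∀ v, E < v → v ≤ V → cnt n par mate v ≤ cap v) :
    ∑ a ∈ Icc 1 n, ind (mate a ≠ 0) ≤
      ∑ a ∈ Icc 1 n, ind (X a) + ∑ d ∈ tops E V par T, cap d :=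
  (hc.matched_le hm).trans <| Nat.add_le_add_left (Finset.sum_le_sum fun d hd =>
    hcap d (mem_tops.1 hd).1.1 (mem_tops.1 hd).1.2) _

/-- Complementary slackness. -/
theorem Cut.tight {ok T X : ℕ → Prop} (hc : Cut n E V own par ok T X)
    (hm : IsMate n E own ok mate) (hcap : ∀ v, E < v → v ≤ V → cnt n par mate v ≤ cap v)
    (hle : ∑ a ∈ Icc 1 n, ind (X a) + ∑ d ∈ tops E V par T, cap d ≤
      ∑ a ∈ Icc 1 n, ind (mate a ≠ 0)) :
    (∀ a, 1 ≤ a → a ≤ n → X a → mate a ≠ 0 ∧ T (par (mate a))) ∧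
      ∀ d ∈ tops E V par T, cnt n par mate d = cap d := by
  have h1 : ∀ d ∈ tops E V par T, cnt n par mate d ≤ cap d := fun d hd =>
    hcap d (mem_tops.1 hd).1.1 (mem_tops.1 hd).1.2
  have h2 := Finset.sum_le_sum h1
  have h3 := hc.matched_le hm
  constructor
  · have hsplit : ∑ a ∈ Icc 1 n, ind (mate a ≠ 0) =
        ∑ a ∈ Icc 1 n, ind (mate a ≠ 0 ∧ T (par (mate a))) +
          ∑ d ∈ tops E V par T, cnt n par mate d := by
      rw [sum_cnt_tops hc.upClosed hc.tree fun a h1 h2 h3 => (hm a h1 h2 h3).1,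
        ← Finset.sum_add_distrib]
      exact Finset.sum_congr rfl fun a _ => ind_split _ _
    have hle' : ∀ a ∈ Icc 1 n, ind (mate a ≠ 0 ∧ T (par (mate a))) ≤ ind (X a) := by
      intro a ha
      rw [mem_Icc] at ha
      refine ind_mono ?_
      rintro ⟨h0, hT⟩
      have h := hm a ha.1 ha.2 h0
      have := hc.cover _ h.1.1 h.1.2 h.2.2 hT
      rwa [h.2.1] at this
    -- Two sums that agree although their terms are ordered agree term by term.
    have heq := (Finset.sum_eq_sum_iff_of_le hle').1
      (le_antisymm (Finset.sum_le_sum hle') (by omega))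
    intro a ha1 ha2 hX
    exact of_ind_eq_one ((heq a (mem_Icc.2 ⟨ha1, ha2⟩)).trans (ind_pos hX))
  · exact (Finset.sum_eq_sum_iff_of_le h1).1 (le_antisymm h2 (by omega))

/-! ### The residual network of a flow -/

/-- The nodes from which the root can be reached in the residual network: upwards through classes
with remaining capacity, and downwards to a matched edge whose applicant then takes another
admissible edge. -/
inductive Good (n E V : ℕ) (own par rem mate : ℕ → ℕ) : ℕ → Prop
  | root : Good n E V own par rem mate 0
  | up {v : ℕ} : E < v → v ≤ V → rem v ≠ 0 → Good n E V own par rem mate (par v) →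
      Good n E V own par rem mate v
  | down {e w : ℕ} : 1 ≤ e → e ≤ E → rem e ≠ 0 → mate (own e) ≠ 0 → E < w → w ≤ V →
      Anc par w (mate (own e)) → Good n E V own par rem mate (par e) →
      Good n E V own par rem mate w

/-- The applicants that have an admissible edge to a good node. -/
def GoodApp (n E V : ℕ) (own par rem mate : ℕ → ℕ) (a : ℕ) : Prop :=
  ∃ e, 1 ≤ e ∧ e ≤ E ∧ own e = a ∧ rem e ≠ 0 ∧ Good n E V own par rem mate (par e)

/-- `mate` is a matching, `rem` gives the remaining capacities of the classes, and its values at the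
edges mark the admissible edges. -/
structure Flow (n E V : ℕ) (own par cap rem mate : ℕ → ℕ) : Prop where
  tree : Tree E V par
  own_mem : ∀ e, 1 ≤ e → e ≤ E → 1 ≤ own e ∧ own e ≤ n
  isMate : IsMate n E own (fun e => rem e ≠ 0) mate
  count : ∀ v, E < v → v ≤ V → rem v + cnt n par mate v = cap v

/-- A class that is good because of a matched edge below it shares this edge with its parent, so the
parent is good for the same reason. -/
theorem good_upClosed (ht : Tree E V par) : UpClosed E V par (Good n E V own par rem mate) where
  root := .root
  up v h1 h2 h := by
    cases h with
    | root => omega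
    | up _ _ _ h => exact h
    | down he1 he2 hr hm _ _ ha hg =>
      rcases ht.cls v h1 h2 with h' | h'
      · rw [h']; exact .root
      · exact .down he1 he2 hr hm h'.1 (by omega) ha.up hg

theorem Flow.cut (hf : Flow n E V own par cap rem mate) :
    Cut n E V own par (fun e => rem e ≠ 0) (Good n E V own par rem mate)
      (GoodApp n E V own par rem mate) where
  tree := hf.tree
  upClosed := good_upClosed hf.tree
  cover e h1 h2 h3 h4 := ⟨e, h1, h2, rfl, h3, h4⟩

theorem Flow.cnt_le (hf : Flow n E V own par cap rem mate) (v : ℕ) (h1 : E < v) (h2 : v ≤ V) :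
    cnt n par mate v ≤ cap v := by
  have := hf.count v h1 h2; omega

/-- From the parent of its matched edge one can go down to this edge, and the applicant can then
take its admissible edge to a good node instead. -/
theorem Flow.good_mate (hf : Flow n E V own par cap rem mate) {a : ℕ}
    (hX : GoodApp n E V own par rem mate a) (hm : mate a ≠ 0) :
    Good n E V own par rem mate (par (mate a)) := by
  obtain ⟨e, h1, h2, rfl, h3, h4⟩ := hX
  have ho := hf.own_mem e h1 h2
  have hma := hf.isMate _ ho.1 ho.2 hm
  rcases hf.tree.edge _ hma.1.1 hma.1.2 with h | h
  · rw [h]; exact .root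
  · exact .down h1 h2 h3 hm h.1 h.2 ⟨1, rfl⟩ h4

theorem Flow.rem_top (_hf : Flow n E V own par cap rem mate) {d : ℕ}
    (hd : d ∈ tops E V par (Good n E V own par rem mate)) : rem d = 0 := by
  rw [mem_tops] at hd
  by_contra h
  exact hd.2.1 (.up hd.1.1 hd.1.2 h hd.2.2)

/-- If no unmatched applicant is good, then the matching is as large as the cut of the good nodes. -/
theorem Flow.strong_duality (hf : Flow n E V own par cap rem mate)
    (hs : ∀ a, GoodApp n E V own par rem mate a → mate a ≠ 0) :
    ∑ a ∈ Icc 1 n, ind (GoodApp n E V own par rem mate a) +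
        ∑ d ∈ tops E V par (Good n E V own par rem mate), cap d ≤
      ∑ a ∈ Icc 1 n, ind (mate a ≠ 0) := by
  have h1 : ∑ d ∈ tops E V par (Good n E V own par rem mate), cap d =
      ∑ d ∈ tops E V par (Good n E V own par rem mate), cnt n par mate d := by
    refine Finset.sum_congr rfl fun d hd => ?_
    have h := hf.count d (mem_tops.1 hd).1.1 (mem_tops.1 hd).1.2
    rw [hf.rem_top hd] at h
    omega
  rw [h1, sum_cnt_tops (good_upClosed hf.tree) hf.tree fun a h1 h2 h3 => (hf.isMate a h1 h2 h3).1,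
    ← Finset.sum_add_distrib]
  refine Finset.sum_le_sum fun a ha => ?_
  rw [ind_split (mate a ≠ 0) (Good n E V own par rem mate (par (mate a)))]
  refine Nat.add_le_add_right (ind_mono fun hX => ?_) _
  exact ⟨hs a hX, hf.good_mate hX (hs a hX)⟩

/-- A matching of the same size as a cut saturates it, and so no node outside the cut is good. -/
theorem Flow.not_good (hf : Flow n E V own par cap rem mate) {T X : ℕ → Prop}
    (hc : Cut n E V own par (fun e => rem e ≠ 0) T X)
    (hle : ∑ a ∈ Icc 1 n, ind (X a) + ∑ d ∈ tops E V par T, cap d ≤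
      ∑ a ∈ Icc 1 n, ind (mate a ≠ 0)) {v : ℕ} (hv : Good n E V own par rem mate v) : T v := by
  obtain ⟨hX, hD⟩ := hc.tight hf.isMate hf.cnt_le hle
  induction hv with
  | root => exact hc.upClosed.root
  | @up v h1 h2 hr _ ih =>
    by_contra h
    have hd : v ∈ tops E V par T := mem_tops.2 ⟨⟨h1, h2⟩, h, ih⟩
    have := hf.count v h1 h2
    have := hD v hd
    omega
  | @down e w h1 h2 hr hm hw1 hw2 ha _ ih =>
    have ho := hf.own_mem e h1 h2
    have hT := (hX _ ho.1 ho.2 (hc.cover e h1 h2 hr ih)).2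
    have hma := hf.isMate _ ho.1 ho.2 hm
    rw [hf.tree.anc_edge hw1 hma.1.2] at ha
    exact hc.upClosed.anc hf.tree (hf.tree.edge _ hma.1.1 hma.1.2) ha hT

end Forest

/-! ### Residual walks -/

namespace Forest

open Finset

variable {n E V : ℕ} {own par cap rem mate rnk : ℕ → ℕ} {live : ℕ → Prop}

/-- Applicants with their edges, ranks and class capacities; `live` marks the edges that lie in no
class of capacity zero. Every applicant with an edge has a last resort, which lies in no class. -/
structure Market (n E V : ℕ) (own par cap rnk : ℕ → ℕ) (live : ℕ → Prop) : Prop where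
  tree : Tree E V par
  own_mem : ∀ e, 1 ≤ e → e ≤ E → 1 ≤ own e ∧ own e ≤ n
  last : ∀ e, 1 ≤ e → e ≤ E → ∃ l, (1 ≤ l ∧ l ≤ E) ∧ own l = own e ∧ par l = 0 ∧ live l
  cap_pos : ∀ e, 1 ≤ e → e ≤ E → live e → ∀ v, E < v → v ≤ V → Anc par v e → 1 ≤ cap v
  dead : ∀ e, 1 ≤ e → e ≤ E → ¬ live e → ∃ v, E < v ∧ v ≤ V ∧ Anc par v e ∧ cap v = 0

/-- Feasible matchings of all applicants that have an edge. -/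
structure Complete (n E V : ℕ) (own par cap mate : ℕ → ℕ) : Prop where
  mem : ∀ a, 1 ≤ a → a ≤ n → mate a ≠ 0 → (1 ≤ mate a ∧ mate a ≤ E) ∧ own (mate a) = a
  full : ∀ e, 1 ≤ e → e ≤ E → mate (own e) ≠ 0
  cnt_le : ∀ v, E < v → v ≤ V → cnt n par mate v ≤ cap v

/-- The vote of an applicant between two of its edges. -/
def vote (rnk : ℕ → ℕ) (e f : ℕ) : ℤ :=
  if rnk e < rnk f then 1 else if rnk f < rnk e then -1 else 0

theorem vote_of_lt {e f : ℕ} (h : rnk e < rnk f) : vote rnk e f = 1 := if_pos h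
theorem vote_of_eq {e f : ℕ} (h : rnk e = rnk f) : vote rnk e f = 0 := by simp [vote, h]
theorem vote_of_gt {e f : ℕ} (h : rnk f < rnk e) : vote rnk e f = -1 := by
  simp [vote, h, h.le]
theorem vote_self (e : ℕ) : vote rnk e e = 0 := vote_of_eq rfl
theorem neg_one_le_vote (e f : ℕ) : -1 ≤ vote rnk e f := by unfold vote; split_ifs <;> simp
theorem vote_le_one (e f : ℕ) : vote rnk e f ≤ 1 := by unfold vote; split_ifs <;> simp

/-- No complete matching gets more votes than `M`. -/
structure PopularMate (n E V : ℕ) (own par cap rnk M : ℕ → ℕ) : Prop where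
  complete : Complete n E V own par cap M
  le : ∀ N, Complete n E V own par cap N → ∑ a ∈ Icc 1 n, vote rnk (N a) (M a) ≤ 0

/-- Walks along arcs, with the list of the starting points of the arcs and the total weight. -/
inductive Walk (arc : ℕ → ℕ → Prop) (wt : ℕ → ℕ → ℤ) : ℕ → ℕ → List ℕ → ℤ → Prop
  | nil (u : ℕ) : Walk arc wt u u [] 0
  | cons {u v x : ℕ} {l : List ℕ} {z : ℤ} : arc u v → Walk arc wt v x l z →
      Walk arc wt u x (u :: l) (wt u v + z)

variable {arc : ℕ → ℕ → Prop} {wt : ℕ → ℕ → ℤ}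

theorem Walk.append {u v x : ℕ} {l l' : List ℕ} {z z' : ℤ} (h : Walk arc wt u v l z)
    (h' : Walk arc wt v x l' z') : Walk arc wt u x (l ++ l') (z + z') := by
  induction h with
  | nil => simpa using h'
  | cons ha _ ih => rw [List.cons_append, add_assoc]; exact .cons ha (ih h')

theorem Walk.split {u x y : ℕ} {l l' : List ℕ} {z : ℤ} (h : Walk arc wt u x (l ++ y :: l') z) :
    ∃ z1 z2, Walk arc wt u y l z1 ∧ Walk arc wt y x (y :: l') z2 ∧ z = z1 + z2 := by
  induction l generalizing u z with
  | nil =>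
    cases h with
    | cons ha h => exact ⟨0, _, .nil _, .cons ha h, (zero_add _).symm⟩
  | cons w l ih =>
    cases h with
    | cons ha h =>
      obtain ⟨z1, z2, h1, h2, rfl⟩ := ih h
      exact ⟨_, z2, .cons ha h1, h2, by ring⟩

/-- A closed walk that visits a node twice splits there into two closed walks, and the weights add
up. -/
theorem Walk.exists_nodup {u : ℕ} {l : List ℕ} {z : ℤ} (h : Walk arc wt u u l z) (hz : 0 < z) :
    ∃ u l z, Walk arc wt u u l z ∧ 0 < z ∧ l.Nodup := by
  induction hn : l.length using Nat.strong_induction_on generalizing u l z with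
  | _ m ih =>
    by_cases hl : l.Nodup
    · exact ⟨u, l, z, h, hz, hl⟩
    · obtain ⟨y, hy⟩ := List.exists_duplicate_iff_not_nodup.2 hl
      rw [List.duplicate_iff_sublist] at hy
      obtain ⟨l1, l2, l3, rfl⟩ : ∃ l1 l2 l3, l = l1 ++ y :: (l2 ++ y :: l3) := by
        obtain ⟨r1, r2, rfl, _, hs⟩ := List.cons_sublist_iff.1 hy
        rename_i hmem
        obtain ⟨s1, s2, rfl⟩ := List.append_of_mem hmem
        obtain ⟨t1, t2, rfl⟩ := List.append_of_mem (List.singleton_sublist.1 hs)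
        exact ⟨s1, s2 ++ t1, t2, by simp⟩
      obtain ⟨z1, z2, h1, h2, rfl⟩ := h.split
      rw [← List.cons_append] at h2
      obtain ⟨z3, z4, h3, h4, rfl⟩ := h2.split
      -- Either the inner closed walk has positive weight, or deleting it does not decrease the
      -- total weight. Both walks are shorter.
      by_cases hp : 0 < z3
      · exact ih _ (by simp only [← hn, List.length_append, List.length_cons]; omega) h3 hp rfl
      · exact ih _ (by simp only [← hn, List.length_append, List.length_cons]; omega) (h1.append h4) (by omega) rfl

/-- A walk without repetitions is described by a successor function. -/
theorem Walk.exists_succ {u x : ℕ} {l : List ℕ} {z : ℤ} (h : Walk arc wt u x l z) (hl : l.Nodup) :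
    ∃ f : ℕ → ℕ, (∀ v ∈ l, arc v (f v)) ∧ (l.map fun v => wt v (f v)).sum = z ∧
      u :: l.map f = l ++ [x] := by
  induction h with
  | nil u => exact ⟨id, by simp, by simp, by simp⟩
  | @cons u v x l z ha h ih =>
    rw [List.nodup_cons] at hl
    obtain ⟨f, h1, h2, h3⟩ := ih hl.2
    have hf : ∀ w ∈ l, Function.update f u v w = f w := fun w hw =>
      Function.update_of_ne (by rintro rfl; exact hl.1 hw) _ _
    refine ⟨Function.update f u v, ?_, ?_, ?_⟩
    · intro w hw
      rcases List.mem_cons.1 hw with rfl | hw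
      · rwa [Function.update_self]
      · rw [hf w hw]; exact h1 w hw
    · rw [List.map_cons, List.sum_cons, Function.update_self, ← h2]
      congr 2
      exact List.map_congr_left fun w hw => by rw [hf w hw]
    · rw [List.map_cons, Function.update_self, List.map_congr_left hf, h3, List.cons_append]

/-- The node `u` is a matched edge. -/
def Matched (n : ℕ) (mate : ℕ → ℕ) (u : ℕ) : Prop := u ≠ 0 ∧ ∃ a, 1 ≤ a ∧ a ≤ n ∧ mate a = u

/-- The arcs of the residual network of a matching. -/
inductive Arc (n E V : ℕ) (own par cap : ℕ → ℕ) (live : ℕ → Prop) (mate : ℕ → ℕ) :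
    ℕ → ℕ → Prop
  | leave {e : ℕ} : 1 ≤ e → e ≤ E → ¬ Matched n mate e → Arc n E V own par cap live mate e (par e)
  | up {v : ℕ} : E < v → v ≤ V → cnt n par mate v < cap v →
      Arc n E V own par cap live mate v (par v)
  | down {v : ℕ} : v ≠ 0 → v ≤ V → 0 < cnt n par mate v →
      Arc n E V own par cap live mate (par v) v
  | swap {f e : ℕ} : Matched n mate f → 1 ≤ e → e ≤ E → own e = own f → live e → e ≠ f →
      Arc n E V own par cap live mate f e

open Classical in
/-- The weight of an arc: the vote of the applicant that changes its edge. -/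
noncomputable def arcWeight (n : ℕ) (rnk mate : ℕ → ℕ) (u v : ℕ) : ℤ :=
  if Matched n mate u then vote rnk v u else 0

theorem Complete.matched_own {M : ℕ → ℕ} (hM : Complete n E V own par cap M) {u : ℕ}
    (h : Matched n M u) : (1 ≤ u ∧ u ≤ E) ∧ (1 ≤ own u ∧ own u ≤ n) ∧ M (own u) = u := by
  obtain ⟨h0, a, h1, h2, rfl⟩ := h
  have := hM.mem a h1 h2 h0
  rw [this.2]
  exact ⟨this.1, ⟨h1, h2⟩, rfl⟩

theorem Complete.matched {M : ℕ → ℕ} (_hM : Complete n E V own par cap M) {a : ℕ} (h1 : 1 ≤ a)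
    (h2 : a ≤ n) (h0 : M a ≠ 0) : Matched n M (M a) := ⟨h0, a, h1, h2, rfl⟩

theorem Complete.eq_of_matched {M : ℕ → ℕ} (hM : Complete n E V own par cap M) {e f : ℕ}
    (he : Matched n M e) (hf : Matched n M f) (h : own e = own f) : e = f := by
  rw [← (hM.matched_own he).2.2, ← (hM.matched_own hf).2.2, h]

/-- Functions on nodes sum up over a set of matched edges as they do over the applicants. -/
theorem Complete.sum_matched {M : ℕ → ℕ} (hM : Complete n E V own par cap M) (S : Finset ℕ)
    (g : ℕ → ℤ) [DecidablePred (Matched n M)] :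
    ∑ a ∈ Icc 1 n, (if M a ≠ 0 ∧ M a ∈ S then g (M a) else 0) =
      ∑ u ∈ S with Matched n M u, g u := by
  rw [← Finset.sum_filter]
  refine Finset.sum_bij (fun a _ => M a) ?_ ?_ ?_ (fun _ _ => rfl)
  · intro a ha
    simp only [Finset.mem_filter, mem_Icc] at ha ⊢
    exact ⟨ha.2.2, hM.matched ha.1.1 ha.1.2 ha.2.1⟩
  · intro a ha b hb hab
    simp only [Finset.mem_filter, mem_Icc] at ha hb
    rw [← (hM.mem a ha.1.1 ha.1.2 ha.2.1).2, ← (hM.mem b hb.1.1 hb.1.2 hb.2.1).2, hab]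
  · intro u hu
    simp only [Finset.mem_filter] at hu
    obtain ⟨h1, h2, h3⟩ := hM.matched_own hu.2
    exact ⟨own u, by simp only [Finset.mem_filter, mem_Icc, h3]; exact ⟨h2, hu.2.1, hu.1⟩, h3⟩

/-- A popular matching has no closed residual walk of positive weight. -/
theorem PopularMate.no_walk (hk : Market n E V own par cap rnk live) {M : ℕ → ℕ}
    (hM : PopularMate n E V own par cap rnk M) {u : ℕ} {l : List ℕ} {z : ℤ}
    (hw : Walk (Arc n E V own par cap live M) (arcWeight n rnk M) u u l z) : z ≤ 0 := by
  classical
  by_contra hz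
  push Not at hz
  obtain ⟨u, l, z, hw, hz, hl⟩ := hw.exists_nodup hz
  obtain ⟨f, harc, hsum, hmap⟩ := hw.exists_succ hl
  have hc := hM.complete
  -- On a closed walk without repetitions the successor function permutes the nodes, so the
  -- differences `g (f v) - g v` sum up to zero for every `g`.
  have hperm : (l.map f).Perm l := by
    have : (u :: l.map f).Perm (u :: l) := by
      rw [hmap]; exact List.perm_append_singleton u l
    exact List.Perm.cons_inv this
  set S := l.toFinset with hS
  have hmem : ∀ v, v ∈ S ↔ v ∈ l := fun v => List.mem_toFinset
  have hSsum : ∀ g : ℕ → ℤ, ∑ v ∈ S, g v = (l.map g).sum := fun g => List.sum_toFinset g hl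
  have hinv : ∀ g : ℕ → ℤ, ∑ v ∈ S, (g (f v) - g v) = 0 := by
    intro g
    rw [Finset.sum_sub_distrib, hSsum g, hSsum fun v => g (f v), sub_eq_zero,
      ← (hperm.map g).sum_eq, List.map_map]
    rfl
  -- A matched edge can only be left by a swap: `leave` excludes it, and the other arcs start at the
  -- root or at classes.
  have hswap : ∀ v ∈ S, Matched n M v → (1 ≤ f v ∧ f v ≤ E) ∧ own (f v) = own v := by
    intro v hv hmv
    have hvE := (hc.matched_own hmv).1
    have ha := harc v ((hmem v).1 hv)
    generalize f v = w at ha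
    cases ha with
    | leave _ _ h => exact absurd hmv h
    | up h _ _ => omega
    | @down w h1 h2 _ => rcases hk.tree.par_node h2 with h | h <;> omega
    | swap _ h1 h2 h3 _ _ => exact ⟨⟨h1, h2⟩, h3⟩
  -- Every applicant whose matched edge lies on the walk takes the next node of the walk instead.
  set N : ℕ → ℕ := fun a => if M a ≠ 0 ∧ M a ∈ S then f (M a) else M a with hN
  have hNsum : ∀ g : ℕ → ℕ → ℤ, (∀ v, g v v = 0) → ∑ a ∈ Icc 1 n, g (N a) (M a) =
      ∑ v ∈ S with Matched n M v, g (f v) v := by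
    intro g hg
    rw [← hc.sum_matched S fun v => g (f v) v]
    refine Finset.sum_congr rfl fun a _ => ?_
    simp only [hN]
    split_ifs <;> simp [hg]
  have hNc : Complete n E V own par cap N := by
    refine ⟨?_, ?_, ?_⟩
    · intro a h1 h2 h0
      simp only [hN] at h0 ⊢
      split_ifs at h0 ⊢ with h
      · have := hswap (M a) h.2 (hc.matched h1 h2 h.1)
        exact ⟨this.1, this.2.trans (hc.mem a h1 h2 h.1).2⟩
      · exact hc.mem a h1 h2 h0
    · intro e h1 h2
      have h0 := hc.full e h1 h2
      have ho := hk.own_mem e h1 h2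
      simp only [hN]
      split_ifs with h
      · have := hswap _ h.2 (hc.matched ho.1 ho.2 h.1)
        omega
      · exact h0
    · intro v h1 h2
      have hcnt : (cnt n par N v : ℤ) - cnt n par M v =
          ∑ w ∈ S with Matched n M w, ((ind (Anc par v (f w)) : ℤ) - ind (Anc par v w)) := by
        rw [← hNsum (fun x y => (ind (Anc par v x) : ℤ) - ind (Anc par v y)) (by simp)]
        unfold cnt
        push_cast
        rw [← Finset.sum_sub_distrib]
        refine Finset.sum_congr rfl fun a ha => ?_
        rw [mem_Icc] at ha
        by_cases h0 : M a = 0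
        · have : N a = 0 := by simp [hN, h0]
          simp [h0, this, ind_neg]
        · have : N a ≠ 0 := by
            simp only [hN]
            split_ifs with h
            · have := hswap _ h.2 (hc.matched ha.1 ha.2 h.1)
              omega
            · exact h0
          rw [ind_congr (and_iff_right h0), ind_congr (and_iff_right this)]
      -- The total change of the indicator "below `v`" along the walk is zero. So the change at the
      -- swaps, which is the change of the count at `v`, is minus the change along the other arcs.
      have htot := hinv fun w => (ind (Anc par v w) : ℤ)
      rw [← Finset.sum_filter_add_sum_filter_not S (Matched n M)] at htot
      -- Apart from swaps, the walk leaves the part below `v` only along the arc from `v` to its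
      -- parent. It does so at most once, and only if `v` has capacity left.
      have hlow : ∀ w ∈ S.filter (fun w => ¬ Matched n M w),
          -(if w = v then (if cnt n par M v < cap v then 1 else 0 : ℤ) else 0) ≤
            (ind (Anc par v (f w)) : ℤ) - ind (Anc par v w) := by
        intro w hw
        simp only [Finset.mem_filter] at hw
        have ha := harc w ((hmem w).1 hw.1)
        generalize f w = x at ha
        cases ha with
        | leave h3 h4 _ =>
          rw [ind_congr (hk.tree.anc_edge h1 h4), if_neg (by omega)]
          simp
        | up h3 h4 h5 =>
          by_cases hwv : w = v
          · subst hwv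
            rw [if_pos rfl, if_pos h5, ind_pos (Anc.refl par w),
              ind_neg (hk.tree.not_anc_par (by omega) h4)]
            simp
          · have : Anc par v w ↔ Anc par v (par w) := by
              rw [anc_iff]; exact or_iff_right fun h => hwv h.symm
            rw [if_neg hwv, ind_congr this]
            simp
        | @down x h3 h4 h5 =>
          have h6 : ind (Anc par v (par x)) ≤ ind (Anc par v x) := ind_mono Anc.of_par
          have h7 : (0 : ℤ) ≤ if par x = v then
              (if cnt n par M v < cap v then 1 else 0 : ℤ) else 0 := by split_ifs <;> simp
          omega
        | swap h3 _ _ _ _ _ => exact absurd h3 hw.2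
      have hlow' := Finset.sum_le_sum hlow
      rw [Finset.sum_neg_distrib, Finset.sum_ite_eq'] at hlow'
      have hle := hc.cnt_le v h1 h2
      split_ifs at hlow' <;> omega
  have hvote : ∑ a ∈ Icc 1 n, vote rnk (N a) (M a) = z := by
    rw [hNsum _ vote_self, ← hsum, ← hSsum, Finset.sum_filter]
    rfl
  have := hM.le N hNc
  omega

end Forest

/-! ### The characterisation of popular matchings -/

namespace Forest

open Finset

variable {n E V : ℕ} {own par cap rem mate rnk : ℕ → ℕ} {live : ℕ → Prop} {M : ℕ → ℕ}

/-- Among the edges of its owner that satisfy `P`, the edge `e` has the best rank. -/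
def Best (E : ℕ) (own rnk : ℕ → ℕ) (P : ℕ → Prop) (e : ℕ) : Prop :=
  P e ∧ ∀ e', 1 ≤ e' → e' ≤ E → own e' = own e → P e' → rnk e ≤ rnk e'

theorem exists_best {P : ℕ → Prop} {e₀ : ℕ} (h1 : 1 ≤ e₀) (h2 : e₀ ≤ E) (hP : P e₀) :
    ∃ e, (1 ≤ e ∧ e ≤ E) ∧ own e = own e₀ ∧ Best E own rnk P e := by
  classical
  obtain ⟨e, he, hmin⟩ := Finset.exists_min_image
    ((Icc 1 E).filter fun e => own e = own e₀ ∧ P e) rnk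
    ⟨e₀, Finset.mem_filter.2 ⟨mem_Icc.2 ⟨h1, h2⟩, rfl, hP⟩⟩
  simp only [Finset.mem_filter, mem_Icc] at he hmin
  exact ⟨e, he.1, he.2.1, he.2.2, fun e' h1 h2 h3 h4 => hmin e' ⟨⟨h1, h2⟩, h3.trans he.2.1, h4⟩⟩

/-- A dead edge lies below a class of capacity zero, so no feasible matching contains it. -/
theorem Complete.live_of_matched (hk : Market n E V own par cap rnk live) (hM : Complete n E V own par cap M)
    {f : ℕ} (hf : Matched n M f) : live f := by
  obtain ⟨h1, h2, h3⟩ := hM.matched_own hf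
  by_contra h
  obtain ⟨v, hv1, hv2, ha, hc⟩ := hk.dead f h1.1 h1.2 h
  have h4 : 0 < cnt n par M v := cnt_pos_iff.2 ⟨own f, h2.1, h2.2, by rw [h3]; exact hf.1, by rwa [h3]⟩
  have := hM.cnt_le v hv1 hv2
  omega

theorem not_matched_of_node (hM : Complete n E V own par cap M) {u : ℕ}
    (hu : u = 0 ∨ (E < u ∧ u ≤ V)) : ¬ Matched n M u := by
  intro h
  have := (hM.matched_own h).1
  omega

/-- Induction down a chain of ancestors of a matched edge. -/
theorem Complete.down_induction (hk : Market n E V own par cap rnk live)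
    (hM : Complete n E V own par cap M) {f : ℕ} (hf : Matched n M f) {P : ℕ → Prop}
    (step : ∀ x, Arc n E V own par cap live M (par x) x → (par x = 0 ∨ (E < par x ∧ par x ≤ V)) →
      P (par x) → P x) {w : ℕ} (hw : Anc par w f) (h : P w) : P f := by
  obtain ⟨k, rfl⟩ := hw
  obtain ⟨h1, h2, h3⟩ := hM.matched_own hf
  have hle : ∀ k, par^[k] f ≤ V := by
    intro k
    induction k with
    | zero => have := hk.tree.le; simp only [Function.iterate_zero, id]; omega
    | succ k ih =>
      rw [Function.iterate_succ_apply']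
      rcases hk.tree.par_node ih with h | h <;> omega
  induction k with
  | zero => exact h
  | succ k ih =>
    apply ih
    rw [Function.iterate_succ_apply'] at h
    by_cases h0 : par^[k] f = 0
    · rw [h0, hk.tree.root] at h
      rwa [h0]
    · refine step _ (.down h0 (hle k) (cnt_pos_iff.2 ⟨own f, h2.1, h2.2, ?_, ?_⟩))
        (hk.tree.par_node (hle k)) h
      · rw [h3]; exact hf.1
      · rw [h3]; exact ⟨k, rfl⟩

/-- There is a residual walk of weight `z` from `u` to `v`. -/
def Reach (n E V : ℕ) (own par cap rnk : ℕ → ℕ) (live : ℕ → Prop) (M : ℕ → ℕ) (u v : ℕ) (z : ℤ) :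
    Prop :=
  ∃ l, Walk (Arc n E V own par cap live M) (arcWeight n rnk M) u v l z

theorem Reach.refl (u : ℕ) : Reach n E V own par cap rnk live M u u 0 := ⟨[], .nil u⟩

theorem Reach.trans {u v w : ℕ} {y z : ℤ} (h : Reach n E V own par cap rnk live M u v y)
    (h' : Reach n E V own par cap rnk live M v w z) :
    Reach n E V own par cap rnk live M u w (y + z) := by
  obtain ⟨l, h⟩ := h
  obtain ⟨l', h'⟩ := h'
  exact ⟨_, h.append h'⟩

theorem Reach.arc {u v : ℕ} (h : Arc n E V own par cap live M u v) :
    Reach n E V own par cap rnk live M u v (arcWeight n rnk M u v) :=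
  ⟨[u], by simpa using Walk.cons h (.nil v)⟩

theorem Reach.arc_zero {u v : ℕ} (h : Arc n E V own par cap live M u v) (hu : ¬ Matched n M u) :
    Reach n E V own par cap rnk live M u v 0 := by
  have := Reach.arc (rnk := rnk) h
  rwa [arcWeight, if_neg hu] at this

theorem Reach.swap {f e : ℕ} (hf : Matched n M f) (h1 : 1 ≤ e) (h2 : e ≤ E) (h3 : own e = own f)
    (h4 : live e) (h5 : e ≠ f) : Reach n E V own par cap rnk live M f e (vote rnk e f) := by
  have := Reach.arc (rnk := rnk) (Arc.swap (V := V) (par := par) (cap := cap) hf h1 h2 h3 h4 h5)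
  rwa [arcWeight, if_pos hf] at this

theorem Complete.reach_down (hk : Market n E V own par cap rnk live)
    (hM : Complete n E V own par cap M) {w f : ℕ} (hf : Matched n M f) (hw : Anc par w f) :
    Reach n E V own par cap rnk live M w f 0 := by
  refine hM.down_induction hk hf (P := fun x => Reach n E V own par cap rnk live M w x 0)
    (fun x ha hx h => ?_) hw (Reach.refl w)
  simpa using h.trans (Reach.arc_zero ha (not_matched_of_node hM hx))

theorem Market.anc_zero_edge (hk : Market n E V own par cap rnk live) {e : ℕ} (h1 : 1 ≤ e)
    (h2 : e ≤ E) : Anc par 0 e := by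
  have key : ∀ u, (u = 0 ∨ (E < u ∧ u ≤ V)) → Anc par 0 u := by
    intro u
    induction u using Nat.strong_induction_on with
    | _ u ih =>
      rintro (rfl | hu)
      · exact Anc.refl _ _
      · rcases hk.tree.cls u hu.1 hu.2 with h | h
        · exact Anc.of_par (by rw [h]; exact Anc.refl _ _)
        · exact Anc.of_par (ih _ h.2 (.inr ⟨h.1, by omega⟩))
  exact Anc.of_par (key _ (hk.tree.edge e h1 h2))

/-- A live edge that is not matched leads to the root, or to a matched edge inside a class. -/
theorem Complete.reach_of_live (hk : Market n E V own par cap rnk live)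
    (hM : Complete n E V own par cap M) {e : ℕ} (h1 : 1 ≤ e) (h2 : e ≤ E) (hl : live e)
    (he : ¬ Matched n M e) :
    Reach n E V own par cap rnk live M e 0 0 ∨
      ∃ f, Matched n M f ∧ par f ≠ 0 ∧ Reach n E V own par cap rnk live M e f 0 := by
  have key : ∀ u, (u = 0 ∨ (E < u ∧ u ≤ V)) → Anc par u e →
      Reach n E V own par cap rnk live M u 0 0 ∨
        ∃ f, Matched n M f ∧ par f ≠ 0 ∧ Reach n E V own par cap rnk live M u f 0 := by
    intro u
    induction u using Nat.strong_induction_on with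
    | _ u ih =>
      rintro hu ha
      rcases hu with rfl | hu
      · exact .inl (Reach.refl 0)
      by_cases hc : cnt n par M u < cap u
      · have hup := Reach.arc_zero (rnk := rnk)
          (Arc.up (own := own) (live := live) hu.1 hu.2 hc) (not_matched_of_node hM (.inr hu))
        have hlt : par u < u := by rcases hk.tree.cls u hu.1 hu.2 with h | h <;> omega
        rcases ih _ hlt (hk.tree.par_node hu.2) ha.up with h | ⟨f, hf, hp, h⟩
        · exact .inl (by simpa using hup.trans h)
        · exact .inr ⟨f, hf, hp, by simpa using hup.trans h⟩
      -- A full class above a live edge has positive capacity, so it contains a matched edge to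
      -- which one can go down.
      · have hpos : 0 < cnt n par M u := by
          have := hk.cap_pos e h1 h2 hl u hu.1 hu.2 ha; omega
        obtain ⟨c, hc1, hc2, hc0, hca⟩ := cnt_pos_iff.1 hpos
        have hf := hM.matched hc1 hc2 hc0
        refine .inr ⟨M c, hf, fun h0 => ?_, hM.reach_down hk hf hca⟩
        rw [hk.tree.anc_edge hu.1 (hM.matched_own hf).1.2, h0] at hca
        have := hk.tree.anc_zero hca
        omega
  have hup := Reach.arc_zero (rnk := rnk)
    (Arc.leave (V := V) (own := own) (par := par) (cap := cap) (live := live) h1 h2 he) he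
  rcases key _ (hk.tree.edge e h1 h2) ⟨1, rfl⟩ with h | ⟨f, hf, hp, h⟩
  · exact .inl (by simpa using hup.trans h)
  · exact .inr ⟨f, hf, hp, by simpa using hup.trans h⟩

/-- The applicant of a matched edge inside a class can resort to its last edge. -/
theorem Complete.reach_last (hk : Market n E V own par cap rnk live)
    (hM : Complete n E V own par cap M) {f : ℕ} (hf : Matched n M f) (hp : par f ≠ 0) :
    ∃ z, -1 ≤ z ∧ Reach n E V own par cap rnk live M f 0 z := by
  have hfE := (hM.matched_own hf).1
  obtain ⟨l, hl, ho, hpl, hll⟩ := hk.last f hfE.1 hfE.2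
  have hne : l ≠ f := by rintro rfl; exact hp hpl
  have hnm : ¬ Matched n M l := fun h => hne (hM.eq_of_matched h hf ho)
  have h1 : Reach n E V own par cap rnk live M f l (vote rnk l f) :=
    Reach.swap hf hl.1 hl.2 ho hll hne
  have h2 := Reach.arc_zero (rnk := rnk)
    (Arc.leave (V := V) (own := own) (par := par) (cap := cap) (live := live) hl.1 hl.2 hnm) hnm
  rw [hpl] at h2
  exact ⟨_, neg_one_le_vote _ _, by simpa using h1.trans h2⟩

/-- The edge `e` is better than the matched edge of its applicant. -/
structure Blocking (n E : ℕ) (own rnk : ℕ → ℕ) (live : ℕ → Prop) (M : ℕ → ℕ) (e : ℕ) : Prop where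
  mem : 1 ≤ e ∧ e ≤ E
  live : live e
  ne : M (own e) ≠ 0
  lt : rnk e < rnk (M (own e))

theorem Blocking.matched (hk : Market n E V own par cap rnk live)
    (hM : Complete n E V own par cap M) {e : ℕ} (hb : Blocking n E own rnk live M e) :
    Matched n M (M (own e)) ∧ own (M (own e)) = own e ∧ e ≠ M (own e) ∧ ¬ Matched n M e := by
  have ho := hk.own_mem e hb.mem.1 hb.mem.2
  have hm := hM.matched ho.1 ho.2 hb.ne
  have h2 := (hM.mem _ ho.1 ho.2 hb.ne).2
  have hne : e ≠ M (own e) := by intro h; have := hb.lt; rw [← h] at this; omega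
  exact ⟨hm, h2, hne, fun h => hne (hM.eq_of_matched h hm h2.symm)⟩

/-- The owner of `e` gains one vote by swapping to `e`. From the root one returns to its matched
edge at no cost, since the arcs down through classes have weight zero; this would close a walk of
positive weight. -/
theorem PopularMate.not_reach_root (hk : Market n E V own par cap rnk live)
    (hM : PopularMate n E V own par cap rnk M) {e : ℕ} (hb : Blocking n E own rnk live M e) {z : ℤ}
    (hz : 0 ≤ z) : ¬ Reach n E V own par cap rnk live M e 0 z := by
  intro h
  obtain ⟨hm, h2, hne, _⟩ := hb.matched hk hM.complete
  have h1 : Reach n E V own par cap rnk live M (M (own e)) e 1 := by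
    rw [← vote_of_lt hb.lt]
    exact Reach.swap hm hb.mem.1 hb.mem.2 h2.symm hb.live hne
  have hmE := (hM.complete.matched_own hm).1
  have h3 := hM.complete.reach_down hk hm (hk.anc_zero_edge hmE.1 hmE.2)
  obtain ⟨l, hw⟩ := (h1.trans h).trans h3
  have := hM.no_walk hk hw
  omega

/-- The owner of `g` would gain one vote by swapping to a best edge. From there the root is reached
directly, or via the last resort of one more applicant, which loses at most one vote. The total is
not negative, contrary to `PopularMate.not_reach_root`. -/
theorem PopularMate.not_reach_second (hk : Market n E V own par cap rnk live)
    (hM : PopularMate n E V own par cap rnk M) {e g : ℕ} (hb : Blocking n E own rnk live M e)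
    (hg : Matched n M g) (hgb : ¬ Best E own rnk live g) :
    ¬ Reach n E V own par cap rnk live M e g 0 := by
  intro h
  have hc := hM.complete
  obtain ⟨hgE, hgo, hgM⟩ := hc.matched_own hg
  have hgl := hc.live_of_matched hk hg
  obtain ⟨e', he', ho', hbest⟩ := exists_best (own := own) (rnk := rnk) hgE.1 hgE.2 hgl
  have hlt : rnk e' < rnk g := by
    by_contra hge
    refine hgb ⟨hgl, fun x h1 h2 h3 h4 => ?_⟩
    have := hbest.2 x h1 h2 (h3.trans ho'.symm) h4
    omega
  have hb' : Blocking n E own rnk live M e' :=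
    ⟨he', hbest.1, by rw [ho', hgM]; exact hg.1, by rwa [ho', hgM]⟩
  obtain ⟨_, _, hne, hnm⟩ := hb'.matched hk hc
  rw [ho', hgM] at hne
  have h1 : Reach n E V own par cap rnk live M g e' 1 := by
    rw [← vote_of_lt hlt]
    exact Reach.swap hg he'.1 he'.2 ho' hbest.1 hne
  rcases hc.reach_of_live hk he'.1 he'.2 hbest.1 hnm with h2 | ⟨f, hf, hp, h2⟩
  · exact hM.not_reach_root hk hb (by norm_num) ((h.trans h1).trans h2)
  · obtain ⟨z, hz, h3⟩ := hc.reach_last hk hf hp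
    exact hM.not_reach_root hk hb (by omega) (((h.trans h1).trans h2).trans h3)

/-! ### The cut defined by a popular matching -/

/-- The nodes reached from blocking edges along arcs that change best edges only. -/
inductive Reached (n E V : ℕ) (own par cap rnk : ℕ → ℕ) (live : ℕ → Prop) (M : ℕ → ℕ) : ℕ → Prop
  | start {e : ℕ} : Blocking n E own rnk live M e → Reached n E V own par cap rnk live M e
  | arc {u v : ℕ} : Reached n E V own par cap rnk live M u → Arc n E V own par cap live M u v →
      (Matched n M u → Best E own rnk live u ∧ Best E own rnk live v ∧ own v = own u ∧
        (1 ≤ u ∧ u ≤ E) ∧ (1 ≤ v ∧ v ≤ E)) →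
      Reached n E V own par cap rnk live M v

/-- The swaps allowed here exchange best edges of one applicant. These have equal rank, so the walk
has weight zero. -/
theorem Reached.reach {v : ℕ} (h : Reached n E V own par cap rnk live M v) :
    ∃ e, Blocking n E own rnk live M e ∧ Reach n E V own par cap rnk live M e v 0 := by
  induction h with
  | start hb => exact ⟨_, hb, Reach.refl _⟩
  | @arc u v _ ha hm ih =>
    obtain ⟨e, hb, hr⟩ := ih
    refine ⟨e, hb, ?_⟩
    have h0 : arcWeight n rnk M u v = 0 := by
      unfold arcWeight
      split_ifs with hmu
      · obtain ⟨h1, h2, h3, h4, h5⟩ := hm hmu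
        exact vote_of_eq (le_antisymm (h2.2 u h4.1 h4.2 h3.symm h1.1) (h1.2 v h5.1 h5.2 h3 h2.1))
      · rfl
    have := hr.trans (Reach.arc (rnk := rnk) ha)
    rwa [h0, add_zero] at this

/-- The nodes without a reached class above them. -/
def Apart (n E V : ℕ) (own par cap rnk : ℕ → ℕ) (live : ℕ → Prop) (M : ℕ → ℕ) (v : ℕ) : Prop :=
  ∀ u, E < u → u ≤ V → Anc par u v → ¬ Reached n E V own par cap rnk live M u

theorem PopularMate.not_reached_root (hk : Market n E V own par cap rnk live)
    (hM : PopularMate n E V own par cap rnk M) : ¬ Reached n E V own par cap rnk live M 0 := by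
  intro h
  obtain ⟨e, hb, hr⟩ := h.reach
  exact hM.not_reach_root hk hb le_rfl hr

theorem PopularMate.best_of_reached (hk : Market n E V own par cap rnk live)
    (hM : PopularMate n E V own par cap rnk M) {f : ℕ} (hf : Matched n M f)
    (h : Reached n E V own par cap rnk live M f) : Best E own rnk live f := by
  by_contra hb
  obtain ⟨e, hb', hr⟩ := h.reach
  exact hM.not_reach_second hk hb' hf hb hr

theorem PopularMate.reached_leave (hk : Market n E V own par cap rnk live)
    (hM : PopularMate n E V own par cap rnk M) {e : ℕ} (h1 : 1 ≤ e) (h2 : e ≤ E) (he : ¬ Matched n M e)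
    (h : Reached n E V own par cap rnk live M e) :
    ¬ Apart n E V own par cap rnk live M (par e) := by
  have hr : Reached n E V own par cap rnk live M (par e) :=
    .arc h (.leave h1 h2 he) fun hc => absurd hc he
  intro ha
  rcases hk.tree.edge e h1 h2 with h' | h'
  · rw [h'] at hr; exact hM.not_reached_root hk hr
  · exact ha _ h'.1 h'.2 (Anc.refl _ _) hr

/-- Going down from a reached class to a matched edge is free and unrestricted. -/
theorem PopularMate.reached_of_not_apart (hk : Market n E V own par cap rnk live)
    (hM : PopularMate n E V own par cap rnk M) {f : ℕ} (hf : Matched n M f)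
    (h : ¬ Apart n E V own par cap rnk live M (par f)) :
    Reached n E V own par cap rnk live M f := by
  unfold Apart at h
  push Not at h
  obtain ⟨u, _, _, ha, hr⟩ := h
  exact hM.complete.down_induction hk hf
    (fun x harc hx hP => .arc hP harc fun hc => absurd hc (not_matched_of_node hM.complete hx))
    ha.of_par hr

/-- Let `e` be a best edge whose parent is apart from the reached classes. If its owner had no best
edge in `M`, then `e` would be blocking. If its owner had a best edge below a reached class, then
this edge and, by a swap, `e` would be reached. In both cases the parent of `e` would be reached,
too. -/
theorem PopularMate.cut (hk : Market n E V own par cap rnk live)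
    (hM : PopularMate n E V own par cap rnk M) : Cut n E V own par (Best E own rnk live)
    (Apart n E V own par cap rnk live M)
    (fun a => M a ≠ 0 ∧ Best E own rnk live (M a) ∧ Apart n E V own par cap rnk live M (par (M a)))
    where
  tree := hk.tree
  upClosed :=
    { root := fun u h1 _ ha => by have := hk.tree.anc_zero ha; omega
      up := fun v _ _ h u h1 h2 ha => h u h1 h2 ha.of_par }
  cover e h1 h2 hb ha := by
    have hc := hM.complete
    have ho := hk.own_mem e h1 h2
    have h0 := hc.full e h1 h2
    have hm := hc.matched ho.1 ho.2 h0
    have hmo := hc.mem _ ho.1 ho.2 h0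
    have hml := hc.live_of_matched hk hm
    have hbm : Best E own rnk live (M (own e)) := by
      by_contra hnb
      have hlt : rnk e < rnk (M (own e)) := by
        by_contra hge
        refine hnb ⟨hml, fun x h3 h4 h5 h6 => ?_⟩
        have := hb.2 x h3 h4 (h5.trans hmo.2) h6
        omega
      have hbl : Blocking n E own rnk live M e := ⟨⟨h1, h2⟩, hb.1, h0, hlt⟩
      exact hM.reached_leave hk h1 h2 (hbl.matched hk hc).2.2.2 (.start hbl) ha
    refine ⟨h0, hbm, ?_⟩
    by_contra hna
    have hr := hM.reached_of_not_apart hk hm hna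
    by_cases hne : e = M (own e)
    · rw [← hne] at hna; exact hna ha
    · exact hM.reached_leave hk h1 h2 (fun h => hne (hc.eq_of_matched h hm hmo.2.symm))
        (.arc hr (.swap hm h1 h2 hmo.2.symm hb.1 hne) fun _ =>
          ⟨hbm, hb, hmo.2.symm, hmo.1, ⟨h1, h2⟩⟩) ha

open Classical in
/-- The restriction of a matching to the best edges. -/
noncomputable def bestPart (E : ℕ) (own rnk : ℕ → ℕ) (live : ℕ → Prop) (M : ℕ → ℕ) (a : ℕ) : ℕ :=
  if Best E own rnk live (M a) then M a else 0

theorem bestPart_ne {a : ℕ} (h : bestPart E own rnk live M a ≠ 0) :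
    bestPart E own rnk live M a = M a ∧ Best E own rnk live (M a) := by
  unfold bestPart at h ⊢
  split_ifs at h ⊢ with hb
  · exact ⟨rfl, hb⟩
  · exact absurd rfl h

theorem bestPart_of_best {a : ℕ} (h : Best E own rnk live (M a)) :
    bestPart E own rnk live M a = M a := if_pos h

theorem ind_bestPart_le (v a : ℕ) :
    ind (bestPart E own rnk live M a ≠ 0 ∧ Anc par v (bestPart E own rnk live M a)) ≤
      ind (M a ≠ 0 ∧ Anc par v (M a)) := by
  refine ind_mono fun h => ?_
  have := (bestPart_ne h.1).1
  rwa [this] at h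

theorem cnt_bestPart_le (v : ℕ) : cnt n par (bestPart E own rnk live M) v ≤ cnt n par M v :=
  Finset.sum_le_sum fun a _ => ind_bestPart_le v a

theorem PopularMate.isMate_bestPart (hM : PopularMate n E V own par cap rnk M) {ok : ℕ → Prop}
    (hok : ∀ e, 1 ≤ e → e ≤ E → Best E own rnk live e → ok e) :
    IsMate n E own ok (bestPart E own rnk live M) := by
  intro a h1 h2 h0
  obtain ⟨h3, h4⟩ := bestPart_ne h0
  rw [h3] at h0 ⊢
  have := hM.complete.mem a h1 h2 h0
  exact ⟨this.1, this.2, hok _ this.1.1 this.1.2 h4⟩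

/-- The maximal classes of the cut are reached and full, since otherwise their parents would be
reached as well. All matched edges below them are reached and therefore best. So every unit of the
cut is paid for by a best edge of `M`. -/
theorem PopularMate.cut_le (hk : Market n E V own par cap rnk live)
    (hM : PopularMate n E V own par cap rnk M) :
    ∑ a ∈ Icc 1 n, ind (M a ≠ 0 ∧ Best E own rnk live (M a) ∧
        Apart n E V own par cap rnk live M (par (M a))) +
      ∑ d ∈ tops E V par (Apart n E V own par cap rnk live M), cap d ≤
    ∑ a ∈ Icc 1 n, ind (bestPart E own rnk live M a ≠ 0) := by
  have hcut := hM.cut hk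
  have hc := hM.complete
  have h1 : ∑ d ∈ tops E V par (Apart n E V own par cap rnk live M), cap d =
      ∑ d ∈ tops E V par (Apart n E V own par cap rnk live M), cnt n par M d := by
    refine Finset.sum_congr rfl fun d hd => ?_
    rw [mem_tops] at hd
    -- Some class above `d` or equal to it is reached, but none above the parent of `d`.
    have hr : Reached n E V own par cap rnk live M d := by
      by_contra hr
      refine hd.2.1 fun u hu1 hu2 ha hru => ?_
      rcases anc_iff.1 ha with rfl | ha
      · exact hr hru
      · exact hd.2.2 u hu1 hu2 ha hru
    refine le_antisymm ?_ (hc.cnt_le d hd.1.1 hd.1.2)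
    by_contra hlt
    have hr' : Reached n E V own par cap rnk live M (par d) :=
      .arc hr (.up hd.1.1 hd.1.2 (by omega)) fun hcm =>
        absurd hcm (not_matched_of_node hc (.inr hd.1))
    rcases hk.tree.cls d hd.1.1 hd.1.2 with h | h
    · rw [h] at hr'; exact hM.not_reached_root hk hr'
    · exact hd.2.2 _ h.1 (by omega) (Anc.refl _ _) hr'
  rw [h1, sum_cnt_tops hcut.upClosed hk.tree fun a h1 h2 h3 => (hc.mem a h1 h2 h3).1,
    ← Finset.sum_add_distrib]
  refine Finset.sum_le_sum fun a ha => ?_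
  rw [mem_Icc] at ha
  have hb : M a ≠ 0 → Best E own rnk live (M a) → bestPart E own rnk live M a ≠ 0 := by
    intro h0 hb
    rwa [bestPart_of_best hb]
  by_cases hA : Apart n E V own par cap rnk live M (par (M a))
  · rw [ind_neg (p := M a ≠ 0 ∧ ¬ _) fun h => h.2 hA, add_zero]
    exact ind_mono fun h => hb h.1 h.2.1
  · rw [ind_neg (p := M a ≠ 0 ∧ _ ∧ _) fun h => hA h.2.2, zero_add]
    refine ind_mono fun h => hb h.1 ?_
    have hm := hc.matched ha.1 ha.2 h.1
    exact hM.best_of_reached hk hm (hM.reached_of_not_apart hk hm hA)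

/-- A maximum matching of the best edges, found by a search that got stuck. -/
structure BestMax (n E V : ℕ) (own par cap rnk : ℕ → ℕ) (live : ℕ → Prop) (rem mate : ℕ → ℕ) :
    Prop where
  flow : Flow n E V own par cap rem mate
  admissible : ∀ e, 1 ≤ e → e ≤ E → (rem e ≠ 0 ↔ Best E own rnk live e)
  stuck : ∀ a, GoodApp n E V own par rem mate a → mate a ≠ 0

/-- Popular matchings in terms of the good nodes of a maximum matching of the best edges. -/
theorem PopularMate.structure (hk : Market n E V own par cap rnk live)
    (hM : PopularMate n E V own par cap rnk M)
    (h1 : BestMax n E V own par cap rnk live rem mate) :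
    (∀ e, Blocking n E own rnk live M e → ¬ Good n E V own par rem mate (par e)) ∧
    (∀ a, 1 ≤ a → a ≤ n → M a ≠ 0 → ¬ Good n E V own par rem mate (par (M a)) →
      Best E own rnk live (M a)) ∧
    (∀ a, 1 ≤ a → a ≤ n → GoodApp n E V own par rem mate a →
      Good n E V own par rem mate (par (M a))) ∧
    ∀ d ∈ tops E V par (Good n E V own par rem mate), cnt n par M d = cap d := by
  have hc := hM.complete
  have hf := h1.flow
  have hok : ∀ e, 1 ≤ e → e ≤ E → Best E own rnk live e → rem e ≠ 0 := fun e h2 h3 h4 =>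
    (h1.admissible e h2 h3).2 h4
  have hmate := hM.isMate_bestPart (live := live) hok
  have hcnt : ∀ v, E < v → v ≤ V → cnt n par (bestPart E own rnk live M) v ≤ cap v :=
    fun v h2 h3 => (cnt_bestPart_le v).trans (hc.cnt_le v h2 h3)
  have hcut : Cut n E V own par (fun e => rem e ≠ 0) (Apart n E V own par cap rnk live M)
      (fun a => M a ≠ 0 ∧ Best E own rnk live (M a) ∧
        Apart n E V own par cap rnk live M (par (M a))) :=
    { tree := hk.tree
      upClosed := (hM.cut hk).upClosed
      cover := fun e h2 h3 h4 h5 => (hM.cut hk).cover e h2 h3 ((h1.admissible e h2 h3).1 h4) h5 }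
  -- These four inequalities form a cycle: the best edges of `M` are at most the cut of the good
  -- nodes, which is at most `mate`, which is at most the cut of `M`, which is at most the best
  -- edges of `M`. Hence all are equal, and either matching is tight for either cut.
  have i1 := hf.cut.weak_duality hmate hcnt
  have i2 := hf.strong_duality h1.stuck
  have i3 := hcut.weak_duality hf.isMate hf.cnt_le
  have i4 := hM.cut_le hk
  obtain ⟨hX, hD⟩ := hf.cut.tight hmate hcnt (by omega)
  have hDM : ∀ d ∈ tops E V par (Good n E V own par rem mate), cnt n par M d = cap d := by
    intro d hd
    have h2 := cnt_bestPart_le (n := n) (par := par) (M := M) (E := E) (own := own) (rnk := rnk)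
      (live := live) d
    have h3 := hD d hd
    have h4 := hc.cnt_le d (mem_tops.1 hd).1.1 (mem_tops.1 hd).1.2
    omega
  refine ⟨?_, ?_, ?_, hDM⟩
  · intro e hb hg
    exact hM.reached_leave hk hb.mem.1 hb.mem.2 (hb.matched hk hc).2.2.2 (.start hb)
      (hf.not_good hcut (by omega) hg)
  · intro a ha1 ha2 h0 hg
    have hmem := hc.mem a ha1 ha2 h0
    obtain ⟨d, hd, hda⟩ := exists_top (good_upClosed hf.tree) hf.tree _
      (hf.tree.edge _ hmem.1.1 hmem.1.2) hg
    -- Already the best edges of `M` fill the class `d`, so `M` has no other edges below it.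
    have heq : cnt n par (bestPart E own rnk live M) d = cnt n par M d := by
      rw [hD d hd, hDM d hd]
    have := (Finset.sum_eq_sum_iff_of_le fun b _ => ind_bestPart_le d b).1 heq a
      (mem_Icc.2 ⟨ha1, ha2⟩)
    rw [ind_pos (p := M a ≠ 0 ∧ _) ⟨h0, hda.of_par⟩] at this
    exact (bestPart_ne (of_ind_eq_one this).1).2
  · intro a ha1 ha2 hXa
    have h2 := hX a ha1 ha2 hXa
    rw [(bestPart_ne h2.1).1] at h2
    exact h2.2

end Forest

/-! ### Detaching the saturated classes -/

namespace Forest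

open Finset

variable {n E V : ℕ} {own par par' cap rem rem' mate mate' rnk : ℕ → ℕ} {live : ℕ → Prop}
  {M : ℕ → ℕ} {T : ℕ → Prop}

/-- The forest `par'` arises from `par` by making the maximal classes outside `T` roots. -/
structure Detached (E V : ℕ) (par par' : ℕ → ℕ) (T : ℕ → Prop) : Prop where
  top : ∀ v ∈ tops E V par T, par' v = 0
  other : ∀ v, v ≤ V → v ∉ tops E V par T → par' v = par v

theorem Detached.edge (hd : Detached E V par par' T) (ht : Tree E V par) {e : ℕ} (he : e ≤ E) :
    par' e = par e :=
  hd.other e (he.trans ht.le) fun h => by have := (mem_tops.1 h).1.1; omega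

theorem Detached.tree (hd : Detached E V par par' T) (ht : Tree E V par) : Tree E V par' where
  le := ht.le
  root := by rw [hd.edge ht (Nat.zero_le _), ht.root]
  edge e h1 h2 := by rw [hd.edge ht h2]; exact ht.edge e h1 h2
  cls v h1 h2 := by
    by_cases h : v ∈ tops E V par T
    · exact .inl (hd.top v h)
    · rw [hd.other v h2 h]; exact ht.cls v h1 h2

/-- Detaching breaks exactly the paths that lead from outside `T` into `T`, because such a path
passes through a maximal class outside `T`. -/
theorem Detached.anc_iff (hd : Detached E V par par' T) (ht : Tree E V par)
    (hT : UpClosed E V par T) {v : ℕ} (hv : v ≠ 0) (u : ℕ) (hu : u = 0 ∨ (E < u ∧ u ≤ V)) :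
    Anc par' v u ↔ Anc par v u ∧ (T v → T u) := by
  induction u using Nat.strong_induction_on with
  | _ u ih =>
    rcases hu with rfl | hu
    · exact ⟨fun h => absurd ((hd.tree ht).anc_zero h) hv, fun h => absurd (ht.anc_zero h.1) hv⟩
    rw [Forest.anc_iff, Forest.anc_iff (par := par)]
    by_cases hvu : v = u
    · subst hvu; exact ⟨fun _ => ⟨.inl rfl, id⟩, fun _ => .inl rfl⟩
    rw [or_iff_right hvu, or_iff_right hvu]
    have hlt : par u < u := by rcases ht.cls u hu.1 hu.2 with h | h <;> omega
    by_cases h : u ∈ tops E V par T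
    · rw [hd.top u h]
      rw [mem_tops] at h
      exact ⟨fun h' => absurd ((hd.tree ht).anc_zero h') hv, fun h' => absurd
        (h'.2 (hT.anc ht (ht.par_node hu.2) h'.1 h.2.2)) h.2.1⟩
    · rw [hd.other u hu.2 h, ih _ hlt (ht.par_node hu.2)]
      rw [mem_tops] at h
      refine and_congr_right fun ha => imp_congr_right fun hTv => ?_
      exact ⟨fun h' => by by_contra hc; exact h ⟨hu, hc, h'⟩, hT.up u hu.1 hu.2⟩

theorem Detached.anc_edge_iff (hd : Detached E V par par' T) (ht : Tree E V par)
    (hT : UpClosed E V par T) {v e : ℕ} (hv : E < v) (he1 : 1 ≤ e) (he : e ≤ E) :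
    Anc par' v e ↔ Anc par v e ∧ (T v → T (par e)) := by
  rw [(hd.tree ht).anc_edge hv he, ht.anc_edge hv he, hd.edge ht he]
  exact hd.anc_iff ht hT (by omega) _ (ht.edge e he1 he)

open Classical in
/-- The matched edges of a class are those of the detached forest and those of the detached
classes below it. -/
theorem Detached.cnt_eq (hd : Detached E V par par' T) (ht : Tree E V par)
    (hT : UpClosed E V par T)
    (hm : ∀ a, 1 ≤ a → a ≤ n → mate a ≠ 0 → 1 ≤ mate a ∧ mate a ≤ E) {v : ℕ} (hv : E < v)
    (hTv : T v) :
    cnt n par mate v = cnt n par' mate v +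
      ∑ d ∈ (tops E V par T).filter (fun d => Anc par v d), cnt n par mate d := by
  unfold cnt
  rw [Finset.sum_comm, ← Finset.sum_add_distrib]
  refine Finset.sum_congr rfl fun a ha => ?_
  rw [mem_Icc] at ha
  by_cases h0 : mate a = 0
  · simp [h0, ind_neg]
  have hma := hm a ha.1 ha.2 h0
  have h1 : ∀ x, ind (mate a ≠ 0 ∧ x) = ind x := fun x => ind_congr (and_iff_right h0)
  simp only [h1]
  rw [ind_congr (hd.anc_edge_iff ht hT hv hma.1 hma.2)]
  have hnode := ht.edge _ hma.1 hma.2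
  by_cases hTe : T (par (mate a))
  · rw [ind_congr (and_iff_left fun _ => hTe), Finset.sum_eq_zero, add_zero]
    intro d hdd
    rw [Finset.mem_filter] at hdd
    refine ind_neg fun hc => ?_
    rw [ht.anc_edge (mem_tops.1 hdd.1).1.1 hma.2] at hc
    exact not_of_top hT ht hnode hdd.1 hc hTe
  · rw [ind_neg (p := Anc par v (mate a) ∧ (T v → T (par (mate a)))) fun h => hTe (h.2 hTv), zero_add]
    obtain ⟨d, hdt, hda⟩ := exists_top hT ht _ hnode hTe
    have hd' := mem_tops.1 hdt
    have hsingle : ∀ d' ∈ (tops E V par T).filter (fun d => Anc par v d), d' ≠ d →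
        ind (Anc par d' (mate a)) = 0 := by
      intro d' hd'' hne
      rw [Finset.mem_filter] at hd''
      exact ind_neg fun hc => hne (top_unique hT ht hd''.1 hdt hc hda.of_par)
    by_cases hva : Anc par v (mate a)
    · have hvd : Anc par v d := by
        rcases hva.comparable hda.of_par with h | h
        · exact h
        · have hvn : v = 0 ∨ (E < v ∧ v ≤ V) :=
            (ht.anc_le hnode ((ht.anc_edge hv hma.2).1 hva)).2
          exact absurd (hT.anc ht hvn h hTv) hd'.2.1
      rw [ind_pos hva, Finset.sum_eq_single_of_mem d (Finset.mem_filter.2 ⟨hdt, hvd⟩) hsingle,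
        ind_pos hda.of_par]
    · rw [ind_neg hva, eq_comm]
      refine Finset.sum_eq_zero fun d' hd'' => ind_neg fun hc => ?_
      rw [Finset.mem_filter] at hd''
      exact hva (hd''.2.trans hc)

/-- Below a node outside `T` no link is removed. -/
theorem Detached.cnt_eq_of_not (hd : Detached E V par par' T) (ht : Tree E V par)
    (hT : UpClosed E V par T)
    (hm : ∀ a, 1 ≤ a → a ≤ n → mate a ≠ 0 → 1 ≤ mate a ∧ mate a ≤ E) {v : ℕ} (hv : E < v)
    (hTv : ¬ T v) : cnt n par' mate v = cnt n par mate v := by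
  refine Finset.sum_congr rfl fun a ha => ind_congr (and_congr_right fun h0 => ?_)
  rw [mem_Icc] at ha
  have hma := hm a ha.1 ha.2 h0
  rw [hd.anc_edge_iff ht hT hv hma.1 hma.2]
  exact and_iff_left fun h => absurd h hTv

/-! ### The second phase -/

/-- The edges along which popular matchings match: the best edges among those to good nodes, and
the best edges of the applicants that are not good. -/
def Second (n E V : ℕ) (own par rnk : ℕ → ℕ) (live : ℕ → Prop) (rem mate : ℕ → ℕ) (e : ℕ) : Prop :=
  Best E own rnk (fun e => live e ∧ Good n E V own par rem mate (par e)) e ∨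
    (¬ GoodApp n E V own par rem mate (own e) ∧ Best E own rnk live e)

/-- The capacities of the detached classes. -/
noncomputable def detachedCap (n : ℕ) (par' rem mate : ℕ → ℕ) (v : ℕ) : ℕ :=
  rem v + cnt n par' mate v

/-- A matching of the best edges remains admissible after detaching. -/
theorem BestMax.flow_detached (hk : Market n E V own par cap rnk live)
    (h1 : BestMax n E V own par cap rnk live rem mate)
    (hd : Detached E V par par' (Good n E V own par rem mate))
    (hcls : ∀ v, E < v → v ≤ V → rem' v = rem v)
    (hok : ∀ e, 1 ≤ e → e ≤ E → (rem' e ≠ 0 ↔ Second n E V own par rnk live rem mate e)) :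
    Flow n E V own par' (detachedCap n par' rem mate) rem' mate where
  tree := hd.tree hk.tree
  own_mem := hk.own_mem
  isMate a ha1 ha2 h0 := by
    obtain ⟨hm1, hm2, hm3⟩ := h1.flow.isMate a ha1 ha2 h0
    refine ⟨hm1, hm2, (hok _ hm1.1 hm1.2).2 ?_⟩
    have hb := (h1.admissible _ hm1.1 hm1.2).1 hm3
    by_cases hX : GoodApp n E V own par rem mate a
    -- The matched edge of a good applicant leads to a good node; being best among all live edges,
    -- it is best among those to good nodes.
    · exact .inl ⟨⟨hb.1, h1.flow.good_mate hX h0⟩, fun e' h3 h4 h5 h6 => hb.2 e' h3 h4 h5 h6.1⟩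
    · exact .inr ⟨by rwa [hm2], hb⟩
  count v h2 h3 := by rw [hcls v h2 h3]; rfl

/-- The result of the second search. -/
structure SecondMax (n E V : ℕ) (own par cap rnk : ℕ → ℕ) (live : ℕ → Prop)
    (rem mate par' rem' mate' : ℕ → ℕ) : Prop where
  market : Market n E V own par cap rnk live
  first : BestMax n E V own par cap rnk live rem mate
  detached : Detached E V par par' (Good n E V own par rem mate)
  flow : Flow n E V own par' (detachedCap n par' rem mate) rem' mate'
  admissible : ∀ e, 1 ≤ e → e ≤ E → (rem' e ≠ 0 ↔ Second n E V own par rnk live rem mate e)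
  stuck : ∀ a, GoodApp n E V own par' rem' mate' a → mate' a ≠ 0
  top : ∀ v, E < v → v ≤ V → par' v = 0 → rem' v ≤ rem v

/-- The first matching leaves no capacity at these classes, and after detaching they are directly
below the root, where the remaining capacity never increases. -/
theorem SecondMax.cap_top (h : SecondMax n E V own par cap rnk live rem mate par' rem' mate') {d : ℕ}
    (hd : d ∈ tops E V par (Good n E V own par rem mate)) :
    cnt n par mate d = cap d ∧ detachedCap n par' rem mate d = cap d ∧
      cnt n par' mate' d = cap d := by
  have hf := h.first.flow
  have hd' := mem_tops.1 hd
  have h0 := hf.rem_top hd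
  have h1 := hf.count d hd'.1.1 hd'.1.2
  have h2 := h.detached.cnt_eq_of_not hf.tree (good_upClosed hf.tree)
    (fun a h1 h2 h3 => (hf.isMate a h1 h2 h3).1) hd'.1.1 hd'.2.1
  have h3 := h.flow.count d hd'.1.1 hd'.1.2
  have h4 := h.top d hd'.1.1 hd'.1.2 (h.detached.top d hd)
  unfold detachedCap at h3 ⊢
  omega

/-- The count at a good node splits into the count in the detached forest and the counts at the
detached classes below. The former respects `detachedCap`, and the latter are the same for both
matchings, as both fill these classes. -/
theorem SecondMax.cnt_le (h : SecondMax n E V own par cap rnk live rem mate par' rem' mate') (v : ℕ)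
    (hv1 : E < v) (hv2 : v ≤ V) : cnt n par mate' v ≤ cap v := by
  have hf := h.first.flow
  have hT := good_upClosed (n := n) (own := own) (rem := rem) (mate := mate) hf.tree
  have hm1 : ∀ a, 1 ≤ a → a ≤ n → mate a ≠ 0 → 1 ≤ mate a ∧ mate a ≤ E :=
    fun a h1 h2 h3 => (hf.isMate a h1 h2 h3).1
  have hm2 : ∀ a, 1 ≤ a → a ≤ n → mate' a ≠ 0 → 1 ≤ mate' a ∧ mate' a ≤ E :=
    fun a h1 h2 h3 => (h.flow.isMate a h1 h2 h3).1
  have hle := h.flow.cnt_le v hv1 hv2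
  have hc := hf.count v hv1 hv2
  unfold detachedCap at hle
  by_cases hTv : Good n E V own par rem mate v
  · classical
    rw [h.detached.cnt_eq hf.tree hT hm1 hv1 hTv] at hc
    rw [h.detached.cnt_eq hf.tree hT hm2 hv1 hTv]
    have : ∑ d ∈ (tops E V par (Good n E V own par rem mate)).filter (fun d => Anc par v d),
        cnt n par mate' d =
      ∑ d ∈ (tops E V par (Good n E V own par rem mate)).filter (fun d => Anc par v d),
        cnt n par mate d := by
      refine Finset.sum_congr rfl fun d hd => ?_
      have hd' := (Finset.mem_filter.1 hd).1
      obtain ⟨h1, _, h3⟩ := h.cap_top hd'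
      rw [h1, ← h3, ← h.detached.cnt_eq_of_not hf.tree hT hm2 (mem_tops.1 hd').1.1
        (mem_tops.1 hd').2.1]
    omega
  · rw [h.detached.cnt_eq_of_not hf.tree hT hm1 hv1 hTv] at hle
    rw [h.detached.cnt_eq_of_not hf.tree hT hm2 hv1 hTv] at hle
    omega

/-- If the second search matches all applicants that have an edge, then its matching is popular. -/
theorem SecondMax.popular (h : SecondMax n E V own par cap rnk live rem mate par' rem' mate')
    (hfull : ∀ e, 1 ≤ e → e ≤ E → mate' (own e) ≠ 0) :
    PopularMate n E V own par cap rnk mate' := by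
  have hk := h.market
  have hf := h.first.flow
  have hT := good_upClosed (n := n) (own := own) (rem := rem) (mate := mate) hf.tree
  have hc : Complete n E V own par cap mate' :=
    ⟨fun a h1 h2 h3 => ⟨(h.flow.isMate a h1 h2 h3).1, (h.flow.isMate a h1 h2 h3).2.1⟩, hfull, h.cnt_le⟩
  refine ⟨hc, fun N hN => ?_⟩
  -- A vote for `N` has to be paid for by a new token at a node that is not good. Within the good
  -- nodes, and within the others, nobody can improve on `mate'`.
  have hpt : ∀ a ∈ Icc 1 n, vote rnk (N a) (mate' a) ≤
      (ind (N a ≠ 0 ∧ ¬ Good n E V own par rem mate (par (N a))) : ℤ) -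
        ind (mate' a ≠ 0 ∧ ¬ Good n E V own par rem mate (par (mate' a))) := by
    intro a ha
    rw [mem_Icc] at ha
    by_cases hM0 : mate' a = 0
    · have hN0 : N a = 0 := by
        by_contra hN0
        have := hN.mem a ha.1 ha.2 hN0
        have := hfull _ this.1.1 this.1.2
        rw [(hN.mem a ha.1 ha.2 hN0).2] at this
        exact this hM0
      simp [hM0, hN0, vote_self, ind_neg]
    have hMm := h.flow.isMate a ha.1 ha.2 hM0
    have hN0 : N a ≠ 0 := by
      have := hN.full _ hMm.1.1 hMm.1.2
      rwa [hMm.2.1] at this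
    have hNm := hN.mem a ha.1 ha.2 hN0
    have hNl := hN.live_of_matched hk (hN.matched ha.1 ha.2 hN0)
    have hsec := (h.admissible _ hMm.1.1 hMm.1.2).1 hMm.2.2
    rw [ind_congr (and_iff_right hN0), ind_congr (and_iff_right hM0)]
    have hown : own (N a) = own (mate' a) := hNm.2.trans hMm.2.1.symm
    by_cases hNg : Good n E V own par rem mate (par (N a))
    · rw [ind_neg (not_not.2 hNg)]
      rcases hsec with hb | ⟨hX, hb⟩
      · rw [ind_neg (not_not.2 hb.1.2)]
        have := hb.2 _ hNm.1.1 hNm.1.2 hown ⟨hNl, hNg⟩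
        unfold vote
        split_ifs <;> simp
        omega
      -- An applicant that is not good has no best edge to a good node, so moving there is a strict
      -- loss.
      · have hlt : rnk (mate' a) < rnk (N a) := by
          by_contra hge
          refine hX ⟨N a, hNm.1.1, hNm.1.2, hown, ?_, hNg⟩
          refine (h.first.admissible _ hNm.1.1 hNm.1.2).2 ⟨hNl, fun x h1 h2 h3 h4 => ?_⟩
          have := hb.2 x h1 h2 (h3.trans hown) h4
          omega
        rw [vote_of_gt hlt]
        have := ind_le_one (¬ Good n E V own par rem mate (par (mate' a)))
        push_cast
        omega
    · rw [ind_pos hNg]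
      by_cases hMg : Good n E V own par rem mate (par (mate' a))
      · rw [ind_neg (not_not.2 hMg)]
        simpa using vote_le_one _ _
      · rw [ind_pos hMg]
        rcases hsec with hb | ⟨hX, hb⟩
        · exact absurd hb.1.2 hMg
        · have := hb.2 _ hNm.1.1 hNm.1.2 hown hNl
          unfold vote
          split_ifs <;> simp
          omega
  refine (Finset.sum_le_sum hpt).trans ?_
  rw [Finset.sum_sub_distrib]
  have e1 := sum_cnt_tops (n := n) (mate := N) hT hf.tree
    fun a h1 h2 h3 => (hN.mem a h1 h2 h3).1
  have e2 := sum_cnt_tops (n := n) (mate := mate') hT hf.tree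
    fun a h1 h2 h3 => (hc.mem a h1 h2 h3).1
  -- The classes of the cut are full in `mate'`, so `N` cannot send more tokens through them.
  have hle : ∑ d ∈ tops E V par (Good n E V own par rem mate), cnt n par N d ≤
      ∑ d ∈ tops E V par (Good n E V own par rem mate), cnt n par mate' d := by
    refine Finset.sum_le_sum fun d hd => ?_
    have hd' := mem_tops.1 hd
    rw [← h.detached.cnt_eq_of_not hf.tree hT (fun a h1 h2 h3 => (hc.mem a h1 h2 h3).1) hd'.1.1
      hd'.2.1, (h.cap_top hd).2.2]
    exact hN.cnt_le d hd'.1.1 hd'.1.2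
  rw [e1, e2] at hle
  have hle' : (∑ a ∈ Icc 1 n, (ind (N a ≠ 0 ∧ ¬ Good n E V own par rem mate (par (N a))) : ℤ)) ≤
      ∑ a ∈ Icc 1 n, (ind (mate' a ≠ 0 ∧ ¬ Good n E V own par rem mate (par (mate' a))) : ℤ) := by
    exact_mod_cast hle
  omega

/-- If there is a popular matching, then the second search matches all applicants that have an
edge. -/
theorem SecondMax.full (h : SecondMax n E V own par cap rnk live rem mate par' rem' mate')
    (hM : PopularMate n E V own par cap rnk M) :
    ∀ e, 1 ≤ e → e ≤ E → mate' (own e) ≠ 0 := by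
  have hk := h.market
  have hf := h.first.flow
  have hc := hM.complete
  have hT := good_upClosed (n := n) (own := own) (rem := rem) (mate := mate) hf.tree
  have hm1 : ∀ a, 1 ≤ a → a ≤ n → mate a ≠ 0 → 1 ≤ mate a ∧ mate a ≤ E :=
    fun a h1 h2 h3 => (hf.isMate a h1 h2 h3).1
  have hm2 : ∀ a, 1 ≤ a → a ≤ n → M a ≠ 0 → 1 ≤ M a ∧ M a ≤ E :=
    fun a h1 h2 h3 => (hc.mem a h1 h2 h3).1
  obtain ⟨s1, s2, s3, s4⟩ := hM.structure hk h.first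
  -- A live edge to a good node that is better than the edge of `M` would be blocking, and blocking
  -- edges do not lead to good nodes. So the popular matching only uses edges that are admissible in
  -- the second search.
  have hmate : IsMate n E own (fun e => rem' e ≠ 0) M := by
    intro a ha1 ha2 h0
    have hmem := hc.mem a ha1 ha2 h0
    refine ⟨hmem.1, hmem.2, (h.admissible _ hmem.1.1 hmem.1.2).2 ?_⟩
    by_cases hg : Good n E V own par rem mate (par (M a))
    · refine .inl ⟨⟨hc.live_of_matched hk (hc.matched ha1 ha2 h0), hg⟩, fun x h1 h2 h3 h4 => ?_⟩
      by_contra hlt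
      rw [hmem.2] at h3
      refine s1 x ⟨⟨h1, h2⟩, h4.1, ?_, ?_⟩ h4.2
      · rwa [h3]
      · rw [h3]; omega
    · exact .inr ⟨fun hX => hg (by rw [hmem.2] at hX; exact s3 a ha1 ha2 hX), s2 a ha1 ha2 h0 hg⟩
  -- Both `M` and `mate` fill the detached classes, so `M` respects the reduced capacities as well.
  have hcnt : ∀ v, E < v → v ≤ V → cnt n par' M v ≤ detachedCap n par' rem mate v := by
    intro v hv1 hv2
    have hle := hc.cnt_le v hv1 hv2
    have hcount := hf.count v hv1 hv2
    unfold detachedCap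
    by_cases hTv : Good n E V own par rem mate v
    · classical
      rw [h.detached.cnt_eq hf.tree hT hm1 hv1 hTv] at hcount
      rw [h.detached.cnt_eq hf.tree hT hm2 hv1 hTv] at hle
      have : ∑ d ∈ (tops E V par (Good n E V own par rem mate)).filter (fun d => Anc par v d),
          cnt n par M d =
        ∑ d ∈ (tops E V par (Good n E V own par rem mate)).filter (fun d => Anc par v d),
          cnt n par mate d := by
        refine Finset.sum_congr rfl fun d hd => ?_
        have hd' := (Finset.mem_filter.1 hd).1
        rw [s4 d hd', (h.cap_top hd').1]
      omega
    · rw [h.detached.cnt_eq_of_not hf.tree hT hm1 hv1 hTv,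
        h.detached.cnt_eq_of_not hf.tree hT hm2 hv1 hTv]
      omega
  have i1 := h.flow.cut.weak_duality hmate hcnt
  have i2 := h.flow.strong_duality h.stuck
  have hle : ∀ a ∈ Icc 1 n, ind (mate' a ≠ 0) ≤ ind (M a ≠ 0) := by
    intro a ha
    rw [mem_Icc] at ha
    refine ind_mono fun h0 => ?_
    have hma := h.flow.isMate a ha.1 ha.2 h0
    have := hc.full _ hma.1.1 hma.1.2
    rwa [hma.2.1] at this
  -- The second matching is maximum, hence at least as large as `M`. All applicants that it matches
  -- are matched by `M`, so both match the same applicants.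
  have heq := (Finset.sum_eq_sum_iff_of_le hle).1
    (le_antisymm (Finset.sum_le_sum hle) (i1.trans i2))
  intro e h1 h2
  have ho := hk.own_mem e h1 h2
  exact of_ind_eq_one ((heq _ (mem_Icc.2 ho)).trans (ind_pos (hc.full e h1 h2)))

end Forest

/-! ### The search for good nodes and the augmentation -/

namespace Forest

open Finset

/-- The list of the elements of a linked list that starts at `c`. -/
inductive Chain (nx : ℕ → ℕ) : ℕ → List ℕ → Prop
  | nil : Chain nx 0 []
  | cons {c : ℕ} {l : List ℕ} : c ≠ 0 → Chain nx (nx c) l → Chain nx c (c :: l)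

theorem Chain.congr {nx nx' : ℕ → ℕ} {c : ℕ} {l : List ℕ} (h : Chain nx c l)
    (hn : ∀ x ∈ l, nx' x = nx x) : Chain nx' c l := by
  induction h with
  | nil => exact .nil
  | @cons c l h0 _ ih =>
    refine .cons h0 ?_
    rw [hn c (by simp)]
    exact ih fun x hx => hn x (by simp [hx])

theorem Chain.ne_nil {nx : ℕ → ℕ} {c : ℕ} {l : List ℕ} (h : Chain nx c l) (hc : c ≠ 0) :
    ∃ l', l = c :: l' ∧ Chain nx (nx c) l' := by
  cases h with
  | nil => exact absurd rfl hc
  | cons _ h => exact ⟨_, rfl, h⟩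

theorem Chain.eq_nil {nx : ℕ → ℕ} {l : List ℕ} (h : Chain nx 0 l) : l = [] := by
  cases h with
  | nil => rfl
  | cons h _ => exact absurd rfl h

/-- The linked lists with heads `hd v`, `v ≤ B`, contain the numbers `1, …, j - 1` with key `v`. -/
def Buckets (B : ℕ) (hd nx key : ℕ → ℕ) (j : ℕ) : Prop :=
  ∀ v ≤ B, ∃ l, Chain nx (hd v) l ∧ l.Nodup ∧ ∀ c, c ∈ l ↔ 1 ≤ c ∧ c < j ∧ key c = v

theorem Buckets.start {B : ℕ} {hd nx key : ℕ → ℕ} (h : ∀ v ≤ B, hd v = 0) :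
    Buckets B hd nx key 1 := fun v hv =>
  ⟨[], by rw [h v hv]; exact .nil, List.nodup_nil, fun c => by simp; omega⟩

/-- The new number becomes the head of the list of its key. The keys need to agree only below `j`,
so the key of `j` may be written at the same time. -/
theorem Buckets.insert {B : ℕ} {hd nx key key' : ℕ → ℕ} {j x : ℕ} (h : Buckets B hd nx key j)
    (hj : 1 ≤ j) (hk : ∀ c < j, key' c = key c) (hx : key' j = x) :
    Buckets B (Function.update hd x j) (Function.update nx j (hd x)) key' (j + 1) := by
  intro v hv
  obtain ⟨l, hl, hnd, hm⟩ := h v hv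
  have hjl : j ∉ l := fun hc => by have := ((hm j).1 hc).2.1; omega
  have hl' : Chain (Function.update nx j (hd x)) (hd v) l :=
    hl.congr fun c hc => Function.update_of_ne (by rintro rfl; exact hjl hc) _ _
  have hlt : ∀ c, (1 ≤ c ∧ c < j ∧ key c = v) ↔ (1 ≤ c ∧ c < j ∧ key' c = v) := by
    intro c
    refine and_congr_right fun _ => and_congr_right fun h2 => ?_
    rw [hk c h2]
  by_cases hvx : v = x
  · subst hvx
    refine ⟨j :: l, ?_, List.nodup_cons.2 ⟨hjl, hnd⟩, fun c => ?_⟩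
    · rw [Function.update_self]
      exact .cons (by omega) (by rwa [Function.update_self])
    · rw [List.mem_cons, hm, hlt]
      constructor
      · rintro (rfl | h)
        · exact ⟨hj, by omega, hx⟩
        · exact ⟨h.1, by omega, h.2.2⟩
      · rintro ⟨h1, h2, h3⟩
        rcases Nat.lt_succ_iff_lt_or_eq.1 h2 with h4 | h4
        · exact .inr ⟨h1, h4, h3⟩
        · exact .inl h4
  · refine ⟨l, by rwa [Function.update_of_ne hvx], hnd, fun c => ?_⟩
    rw [hm, hlt]
    constructor
    · rintro ⟨h1, h2, h3⟩
      exact ⟨h1, by omega, h3⟩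
    · rintro ⟨h1, h2, h3⟩
      rcases Nat.lt_succ_iff_lt_or_eq.1 h2 with h4 | h4
      · exact ⟨h1, h4, h3⟩
      · subst h4; exact absurd (h3.symm.trans hx) hvx

/-- The applicant `b` has an edge. -/
def Owner (E : ℕ) (own : ℕ → ℕ) (b : ℕ) : Prop := ∃ e, 1 ≤ e ∧ e ≤ E ∧ own e = b

/-- The state of a breadth-first search backwards from the root. Nodes are numbered by `vis` in the
order in which they enter the queue. From a visited node `v` one moves up if `via v = 0`, and
otherwise down to the matched edge of `via v`, which then takes the edge `nxt (via v)`. The search is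
just climbing from `w`, or `w` is visited. -/
structure Search (E V : ℕ) (own par rem mate vis via nxt gd queue : ℕ → ℕ) (tail found w : ℕ) :
    Prop where
  root : vis 0 = 1
  via_root : via 0 ≠ 0
  tail_pos : 1 ≤ tail
  queue_mem : ∀ i < tail, (queue i = 0 ∨ (E < queue i ∧ queue i ≤ V)) ∧ vis (queue i) = i + 1
  vis_queue : ∀ v, (v = 0 ∨ (E < v ∧ v ≤ V)) → vis v ≠ 0 → vis v ≤ tail ∧ queue (vis v - 1) = v
  par_vis : ∀ v, E < v → v ≤ V → vis v ≠ 0 → vis (par v) ≠ 0 ∨ par v = w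
  up : ∀ v, E < v → v ≤ V → vis v ≠ 0 → via v = 0 →
    rem v ≠ 0 ∧ vis (par v) ≠ 0 ∧ vis (par v) < vis v
  down : ∀ v, E < v → v ≤ V → vis v ≠ 0 → via v ≠ 0 →
    Owner E own (via v) ∧ gd (via v) ≠ 0 ∧ mate (via v) ≠ 0 ∧ vis (par (nxt (via v))) < vis v ∧
      (v = par (mate (via v)) ∨
        ∃ u, E < u ∧ u ≤ V ∧ vis u ≠ 0 ∧ via u = via v ∧ par u = v ∧ vis u < vis v)
  gd_mem : ∀ b, Owner E own b → gd b ≠ 0 →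
    (1 ≤ nxt b ∧ nxt b ≤ E) ∧ own (nxt b) = b ∧ rem (nxt b) ≠ 0 ∧ vis (par (nxt b)) ≠ 0
  mate_vis : ∀ b, Owner E own b → gd b ≠ 0 → mate b ≠ 0 →
    vis (par (mate b)) ≠ 0 ∨ par (mate b) = w
  found_mem : found ≠ 0 → Owner E own found ∧ gd found ≠ 0 ∧ mate found = 0
  found_of : ∀ b, Owner E own b → gd b ≠ 0 → mate b = 0 → found ≠ 0

variable {n E V : ℕ} {own par cap rem mate vis via nxt gd queue : ℕ → ℕ} {tail found w : ℕ}

/-- The value `1` of `via` at the root is a sentinel: it differs from the mark `0` for moving up, so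
a walk upwards stops at the root. -/
theorem Search.start (hv : ∀ v, E < v → v ≤ V → vis v = 0) (hg : ∀ b, Owner E own b → gd b = 0) :
    Search E V own par rem mate (Function.update vis 0 1) (Function.update via 0 1) nxt gd
      (Function.update queue 0 0) 1 0 0 := by
  have hvis : ∀ v, E < v → v ≤ V → Function.update vis 0 1 v = 0 := fun v h1 h2 => by
    rw [Function.update_of_ne (by omega), hv v h1 h2]
  refine ⟨by simp, by simp, le_rfl, ?_, ?_, ?_, ?_, ?_, ?_, ?_, ?_, ?_⟩
  · intro i hi
    obtain rfl : i = 0 := by omega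
    simp
  · rintro v (rfl | h) h0
    · simp
    · exact absurd (hvis v h.1 h.2) h0
  · exact fun v h1 h2 h3 => absurd (hvis v h1 h2) h3
  · exact fun v h1 h2 h3 => absurd (hvis v h1 h2) h3
  · exact fun v h1 h2 h3 => absurd (hvis v h1 h2) h3
  · exact fun b h1 h2 => absurd (hg b h1) h2
  · exact fun b h1 h2 => absurd (hg b h1) h2
  · exact fun h => absurd rfl h
  · exact fun b h1 h2 => absurd (hg b h1) h2

/-- A node enters the queue. -/
theorem Search.push {w' x b : ℕ}
    (h : Search E V own par rem mate vis via nxt gd queue tail found w) (hf : Tree E V par)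
    (hx : E < x ∧ x ≤ V) (hvx : vis x = 0)
    (hb : (b = 0 ∧ rem x ≠ 0 ∧ vis (par x) ≠ 0 ∧ w' = w) ∨
      (b ≠ 0 ∧ Owner E own b ∧ gd b ≠ 0 ∧ mate b ≠ 0 ∧ x = w ∧ w' = par w ∧
        (x = par (mate b) ∨ ∃ u, E < u ∧ u ≤ V ∧ vis u ≠ 0 ∧ via u = b ∧ par u = x))) :
    Search E V own par rem mate (Function.update vis x (tail + 1)) (Function.update via x b) nxt gd
      (Function.update queue tail x) (tail + 1) found w' := by
  have hx0 : x ≠ 0 := by omega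
  have hvis : ∀ v, vis v ≠ 0 → Function.update vis x (tail + 1) v = vis v := fun v hv =>
    Function.update_of_ne (by rintro rfl; exact hv hvx) _ _
  have hvis' : ∀ v, vis v ≠ 0 → Function.update vis x (tail + 1) v ≠ 0 := fun v hv => by
    rwa [hvis v hv]
  -- While climbing, the pending node `w` is the node that enters the queue, and its parent becomes
  -- pending.
  have hvw : ∀ v, (vis v ≠ 0 ∨ v = w) → Function.update vis x (tail + 1) v ≠ 0 ∨ v = w' := by
    intro v hv
    rcases hb with ⟨_, _, _, h4⟩ | ⟨_, _, _, _, h5, _⟩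
    · rw [h4]; exact hv.imp_left (hvis' v)
    · rcases hv with hv | hv
      · exact .inl (hvis' v hv)
      · subst hv; subst h5; left; simp
  have hvia : ∀ v, v ≠ x → Function.update via x b v = via v := fun v hv =>
    Function.update_of_ne hv _ _
  have hold : ∀ v, Function.update vis x (tail + 1) v ≠ 0 → v ≠ x → vis v ≠ 0 := fun v h1 h2 => by
    rwa [Function.update_of_ne h2] at h1
  have hnode : ∀ v, v ≤ V → vis (par v) ≠ 0 → vis (par v) ≤ tail := fun v hv h1 =>
    (h.vis_queue _ (hf.par_node hv) h1).1
  refine ⟨?_, ?_, by omega, ?_, ?_, ?_, ?_, ?_, ?_, ?_, h.found_mem, h.found_of⟩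
  · rw [Function.update_of_ne (Ne.symm hx0)]; exact h.root
  · rw [hvia 0 (Ne.symm hx0)]; exact h.via_root
  · intro i hi
    rcases Nat.lt_succ_iff_lt_or_eq.1 hi with hi | rfl
    · have h1 := h.queue_mem i hi
      rw [Function.update_of_ne (by omega : i ≠ tail), hvis _ (by omega)]
      exact h1
    · simp only [Function.update_self, and_true]; exact .inr hx
  · intro v hv h0
    by_cases hvx' : v = x
    · subst hvx'; simp
    · have h1 := hold v h0 hvx'
      have h2 := h.vis_queue v hv h1
      rw [hvis v h1, Function.update_of_ne (by omega : vis v - 1 ≠ tail)]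
      exact ⟨by omega, h2.2⟩
  · intro v h1 h2 h3
    by_cases hvx' : v = x
    · subst hvx'
      rcases hb with ⟨_, _, h6, _⟩ | ⟨_, _, _, _, h5, h6, _⟩
      · exact .inl (hvis' _ h6)
      · right; rw [h6, h5]
    · exact hvw _ (h.par_vis v h1 h2 (hold v h3 hvx'))
  · intro v h1 h2 h3 h4
    by_cases hvx' : v = x
    · subst hvx'
      rw [Function.update_self] at h4
      rcases hb with ⟨_, h5, h6, _⟩ | ⟨h5, _⟩
      · rw [hvis _ h6, Function.update_self]
        exact ⟨h5, h6, by have := hnode v h2 h6; omega⟩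
      · exact absurd h4 h5
    · rw [hvia v hvx'] at h4
      have h5 := hold v h3 hvx'
      have h6 := h.up v h1 h2 h5 h4
      rw [hvis _ h6.2.1, hvis _ h5]
      exact h6
  · intro v h1 h2 h3 h4
    by_cases hvx' : v = x
    · subst hvx'
      rw [Function.update_self] at h4 ⊢
      rw [Function.update_self]
      rcases hb with ⟨h5, _⟩ | ⟨_, h6, h7, h8, _, _, h9⟩
      · exact absurd h5 h4
      · have h10 := h.gd_mem b h6 h7
        have h11 : E ≤ V := hf.le
        rw [hvis _ h10.2.2.2]
        have h12 := hnode (nxt b) (by omega) h10.2.2.2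
        refine ⟨h6, h7, h8, by omega, h9.imp_right ?_⟩
        rintro ⟨u, u1, u2, u3, u4, u5⟩
        have hne : u ≠ v := by rintro rfl; exact u3 hvx
        have h13 := (h.vis_queue u (.inr ⟨u1, u2⟩) u3).1
        exact ⟨u, u1, u2, hvis' u u3, by rw [hvia u hne, u4], u5, by rw [hvis u u3]; omega⟩
    · rw [hvia v hvx'] at h4 ⊢
      have h5 := hold v h3 hvx'
      obtain ⟨h6, h7, h8, h9, h10⟩ := h.down v h1 h2 h5 h4
      rw [hvis _ (h.gd_mem _ h6 h7).2.2.2, hvis _ h5]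
      refine ⟨h6, h7, h8, h9, h10.imp_right ?_⟩
      rintro ⟨u, u1, u2, u3, u4, u5, u6⟩
      have hne : u ≠ x := by rintro rfl; exact u3 hvx
      exact ⟨u, u1, u2, hvis' u u3, by rw [hvia u hne, u4], u5, by rwa [hvis u u3]⟩
  · intro c h1 h2
    obtain ⟨h3, h4, h5, h6⟩ := h.gd_mem c h1 h2
    exact ⟨h3, h4, h5, hvis' _ h6⟩
  · exact fun c h1 h2 h3 => hvw _ (h.mate_vis c h1 h2 h3)

/-- An applicant becomes good. -/
theorem Search.mark {c : ℕ} (h : Search E V own par rem mate vis via nxt gd queue tail found w)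
    (hw : vis w ≠ 0) (hc : 1 ≤ c ∧ c ≤ E) (hr : rem c ≠ 0) (hv : vis (par c) ≠ 0)
    (hg : gd (own c) = 0) (ho : own c ≠ 0) :
    Search E V own par rem mate vis via (Function.update nxt (own c) c)
      (Function.update gd (own c) 1) queue tail (if mate (own c) = 0 then own c else found)
      (par (mate (own c))) := by
  have hgd : ∀ b, b ≠ own c → Function.update gd (own c) 1 b = gd b := fun b hb =>
    Function.update_of_ne hb _ _
  have hnx : ∀ b, b ≠ own c → Function.update nxt (own c) c b = nxt b := fun b hb =>
    Function.update_of_ne hb _ _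
  have hvw : ∀ v, (vis v ≠ 0 ∨ v = w) → vis v ≠ 0 := by
    rintro v (h | rfl)
    · exact h
    · exact hw
  refine ⟨h.root, h.via_root, h.tail_pos, h.queue_mem, h.vis_queue, ?_, h.up, ?_, ?_, ?_, ?_, ?_⟩
  · exact fun v h1 h2 h3 => .inl (hvw _ (h.par_vis v h1 h2 h3))
  · intro v h1 h2 h3 h4
    obtain ⟨h5, h6, h7⟩ := h.down v h1 h2 h3 h4
    have hne : via v ≠ own c := fun hc => h6 (by rw [hc, hg])
    rw [hgd _ hne, hnx _ hne]
    exact ⟨h5, h6, h7⟩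
  · intro b h1 h2
    by_cases hb : b = own c
    · subst hb; rw [Function.update_self]; exact ⟨hc, rfl, hr, hv⟩
    · rw [hgd b hb] at h2; rw [hnx b hb]; exact h.gd_mem b h1 h2
  · intro b h1 h2 h3
    by_cases hb : b = own c
    · subst hb; exact .inr rfl
    · rw [hgd b hb] at h2; exact .inl (hvw _ (h.mate_vis b h1 h2 h3))
  · intro h0
    split_ifs at h0 ⊢ with hm
    · exact ⟨⟨c, hc.1, hc.2, rfl⟩, by simp, hm⟩
    · obtain ⟨h1, h2, h3⟩ := h.found_mem h0
      have hne : found ≠ own c := fun hc => h2 (by rw [hc, hg])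
      rw [hgd _ hne]
      exact ⟨h1, h2, h3⟩
  · intro b h1 h2 h3 h0
    split_ifs at h0 with hm
    · exact ho h0
    · have hb : b ≠ own c := by rintro rfl; exact hm h3
      rw [hgd b hb] at h2
      exact h.found_of b h1 h2 h3 h0

/-- Every admissible child of a visited node has been dealt with. -/
def Closed (E V : ℕ) (own par rem vis gd : ℕ → ℕ) : Prop :=
  ∀ c, 1 ≤ c → c ≤ V → rem c ≠ 0 → vis (par c) ≠ 0 →
    (c ≤ E → gd (own c) ≠ 0) ∧ (E < c → vis c ≠ 0)

theorem Search.par_visited (h : Search E V own par rem mate vis via nxt gd queue tail found w)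
    (hw : vis w ≠ 0) {v : ℕ} (h1 : E < v) (h2 : v ≤ V) (h3 : vis v ≠ 0) : vis (par v) ≠ 0 := by
  rcases h.par_vis v h1 h2 h3 with h | h
  · exact h
  · rwa [h]

theorem Search.anc_visited (h : Search E V own par rem mate vis via nxt gd queue tail found w)
    (ht : Tree E V par) (hw : vis w ≠ 0) {u v : ℕ} (hu : u = 0 ∨ (E < u ∧ u ≤ V)) (ha : Anc par v u)
    (h0 : vis u ≠ 0) : vis v ≠ 0 :=
  UpClosed.anc (T := fun v => vis v ≠ 0)
    ⟨by rw [h.root]; exact one_ne_zero, fun _ h1 h2 h3 => h.par_visited hw h1 h2 h3⟩ ht hu ha h0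

/-- Induction on the number of the node: the nodes visited via one applicant are entered one after
the other, starting at the parent of its matched edge. -/
theorem Search.anc_via (h : Search E V own par rem mate vis via nxt gd queue tail found w) {v : ℕ}
    (h1 : E < v) (h2 : v ≤ V) (h3 : vis v ≠ 0) (h4 : via v ≠ 0) : Anc par v (mate (via v)) := by
  induction hk : vis v using Nat.strong_induction_on generalizing v with
  | _ k ih =>
    obtain ⟨_, _, _, _, h5⟩ := h.down v h1 h2 h3 h4
    rcases h5 with h5 | ⟨u, u1, u2, u3, u4, u5, u6⟩
    · exact anc_iff.2 (.inr (by rw [← h5]; exact Anc.refl _ _))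
    · have := ih (vis u) (by omega) u1 u2 u3 (by rwa [u4]) rfl
      rw [u4] at this
      rw [← u5] at this ⊢
      exact this.up

/-- Every visited node other than the root points to a node with a smaller number, its parent or the
parent of `nxt (via v)`, so induction on the numbers follows a residual path to the root. -/
theorem Search.sound (h : Search E V own par rem mate vis via nxt gd queue tail found w)
    (ht : Tree E V par) {v : ℕ} (hv : v = 0 ∨ (E < v ∧ v ≤ V)) (h0 : vis v ≠ 0) :
    Good n E V own par rem mate v := by
  induction hk : vis v using Nat.strong_induction_on generalizing v with
  | _ k ih =>
    rcases hv with rfl | hv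
    · exact .root
    by_cases hvia : via v = 0
    · obtain ⟨h1, h2, h3⟩ := h.up v hv.1 hv.2 h0 hvia
      exact .up hv.1 hv.2 h1 (ih _ (by omega) (ht.par_node hv.2) h2 rfl)
    · obtain ⟨h1, h2, h3, h4, _⟩ := h.down v hv.1 hv.2 h0 hvia
      obtain ⟨g1, g2, g3, g4⟩ := h.gd_mem _ h1 h2
      exact .down g1.1 g1.2 g3 (by rwa [g2]) hv.1 hv.2 (by rw [g2]; exact h.anc_via hv.1 hv.2 h0 hvia)
        (ih _ (by omega) (ht.edge _ g1.1 g1.2) g4 rfl)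

/-- Both ways of becoming good are covered. Moving up is the closure property at classes; for moving
down, the closure property marks the applicant, and the search has visited all ancestors of the
matched edge of a marked applicant. -/
theorem Search.complete (h : Search E V own par rem mate vis via nxt gd queue tail found w)
    (ht : Tree E V par) (hm : ∀ e, 1 ≤ e → e ≤ E → mate (own e) ≠ 0 →
      1 ≤ mate (own e) ∧ mate (own e) ≤ E) (hw : vis w ≠ 0) (hc : Closed E V own par rem vis gd)
    {v : ℕ} (hv : Good n E V own par rem mate v) : vis v ≠ 0 := by
  induction hv with
  | root => rw [h.root]; exact one_ne_zero
  | @up v h1 h2 h3 _ ih => exact (hc v (by omega) h2 h3 ih).2 h1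
  | @down e v h1 h2 h3 h4 h5 h6 h7 _ ih =>
    have hg := (hc e h1 (h2.trans ht.le) h3 ih).1 h2
    have hme := hm e h1 h2 h4
    rw [ht.anc_edge h5 hme.2] at h7
    refine h.anc_visited ht hw (ht.edge _ hme.1 hme.2) h7 ?_
    rcases h.mate_vis _ ⟨e, h1, h2, rfl⟩ hg h4 with h8 | h8
    · exact h8
    · rwa [h8]

theorem Search.good_iff (h : Search E V own par rem mate vis via nxt gd queue tail found w)
    (ht : Tree E V par) (hm : ∀ e, 1 ≤ e → e ≤ E → mate (own e) ≠ 0 →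
      1 ≤ mate (own e) ∧ mate (own e) ≤ E) (hw : vis w ≠ 0) (hc : Closed E V own par rem vis gd)
    {v : ℕ} (hv : v = 0 ∨ (E < v ∧ v ≤ V)) : vis v ≠ 0 ↔ Good n E V own par rem mate v :=
  ⟨h.sound ht hv, h.complete ht hm hw hc⟩

theorem Search.goodApp_iff (h : Search E V own par rem mate vis via nxt gd queue tail found w)
    (ht : Tree E V par) (hm : ∀ e, 1 ≤ e → e ≤ E → mate (own e) ≠ 0 →
      1 ≤ mate (own e) ∧ mate (own e) ≤ E) (hw : vis w ≠ 0) (hc : Closed E V own par rem vis gd)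
    {b : ℕ} (hb : Owner E own b) : gd b ≠ 0 ↔ GoodApp n E V own par rem mate b := by
  constructor
  · intro hg
    obtain ⟨g1, g2, g3, g4⟩ := h.gd_mem b hb hg
    exact ⟨nxt b, g1.1, g1.2, g2, g3, h.sound ht (ht.edge _ g1.1 g1.2) g4⟩
  · rintro ⟨e, h1, h2, rfl, h3, h4⟩
    exact (hc e h1 (h2.trans ht.le) h3 (h.complete ht hm hw hc h4)).1 h2

/-- The numbers `vis` invert the queue, so its entries are distinct; they are classes or the root.
-/
theorem Search.tail_le (h : Search E V own par rem mate vis via nxt gd queue tail found w) :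
    tail ≤ V - E + 1 := by
  have h1 : (Finset.range tail).card ≤ (insert 0 (Ioc E V)).card := by
    refine Finset.card_le_card_of_injOn queue (fun i hi => ?_) (fun i hi j hj hij => ?_)
    · have := (h.queue_mem i (by simpa using hi)).1
      simpa using this
    · have h2 := (h.queue_mem i (by simpa using hi)).2
      have h3 := (h.queue_mem j (by simpa using hj)).2
      rw [hij] at h2
      omega
  have h2 := Finset.card_insert_le 0 (Ioc E V)
  simp only [Finset.card_range, Nat.card_Ioc] at h1 h2
  omega

/-- The way down from `w` to the matched edge of `b`, from its lower end `u`. -/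
inductive Run (E V : ℕ) (par vis via : ℕ → ℕ) (b : ℕ) : ℕ → ℕ → Prop
  | refl (w : ℕ) : Run E V par vis via b w w
  | step {u w : ℕ} : E < u → u ≤ V → vis u ≠ 0 → via u = b → vis u < vis (par u) →
      Run E V par vis via b (par u) w → Run E V par vis via b u w

theorem Run.snoc {b u w : ℕ} (h : Run E V par vis via b u w) (h1 : E < w) (h2 : w ≤ V)
    (h3 : vis w ≠ 0) (h4 : via w = b) (h5 : vis w < vis (par w)) :
    Run E V par vis via b u (par w) := by
  induction h with
  | refl w => exact .step h1 h2 h3 h4 h5 (.refl _)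
  | step g1 g2 g3 g4 g5 _ ih => exact .step g1 g2 g3 g4 g5 (ih h1 h2 h3 h4 h5)

theorem Run.le {b u w : ℕ} (h : Run E V par vis via b u w) : vis u ≤ vis w := by
  induction h with
  | refl => exact le_rfl
  | step _ _ _ _ h5 _ ih => omega

theorem Run.cases {b u w : ℕ} (h : Run E V par vis via b u w) (hne : u ≠ w) :
    (E < u ∧ u ≤ V) ∧ vis u ≠ 0 ∧ via u = b ∧ vis u < vis (par u) ∧
      Run E V par vis via b (par u) w := by
  cases h with
  | refl => exact absurd rfl hne
  | step h1 h2 h3 h4 h5 h6 => exact ⟨⟨h1, h2⟩, h3, h4, h5, h6⟩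

/-- While the nodes of `via v` were being entered the search was climbing, so they form an interval
of ancestors with increasing numbers. -/
theorem Search.run (h : Search E V own par rem mate vis via nxt gd queue tail found w) {v : ℕ}
    (h1 : E < v) (h2 : v ≤ V) (h3 : vis v ≠ 0) (h4 : via v ≠ 0) :
    Run E V par vis via (via v) (par (mate (via v))) v := by
  induction hk : vis v using Nat.strong_induction_on generalizing v with
  | _ k ih =>
    obtain ⟨_, _, _, _, h5⟩ := h.down v h1 h2 h3 h4
    rcases h5 with h5 | ⟨u, u1, u2, u3, u4, u5, u6⟩
    · rw [← h5]; exact .refl _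
    · have := ih (vis u) (by omega) u1 u2 u3 (by rwa [u4]) rfl
      rw [u4] at this
      have := this.snoc u1 u2 u3 u4 (by rwa [u5])
      rwa [u5] at this

/-! The augmentation moves a token from a found applicant to the root. -/

/-- What does not depend on the position of the token: `rem₀` and `mate₀` are the values at the
beginning, and nothing has been changed below the level `k`. -/
structure AugCore (n E V : ℕ) (own par vis nxt gd rem₀ mate₀ rem mate : ℕ → ℕ) (found a k : ℕ) :
    Prop where
  isMate : IsMate n E own (fun e => rem₀ e ≠ 0) mate
  flag : ∀ e, e ≤ E → rem e = rem₀ e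
  mate_eq : ∀ b, Owner E own b → gd b ≠ 0 → vis (par (nxt b)) < k → mate b = mate₀ b
  rem_eq : ∀ v, E < v → v ≤ V → vis v ≠ 0 → vis v < k → rem v = rem₀ v
  keep : ∀ b, b ≠ 0 → (mate₀ b ≠ 0 ∨ b = found) → mate b ≠ 0 ∨ b = a
  top : ∀ v, E < v → v ≤ V → par v = 0 → rem v ≤ rem₀ v

/-- The applicant `a` is about to take the edge `nxt a` instead of the edge `mate a`, if any. -/
structure AugAt (n E V : ℕ) (own par cap vis nxt gd rem₀ mate₀ rem mate : ℕ → ℕ) (found a : ℕ) :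
    Prop where
  core : AugCore n E V own par vis nxt gd rem₀ mate₀ rem mate found a (vis (par (nxt a)) + 1)
  owner : Owner E own a
  good : gd a ≠ 0
  count : ∀ v, E < v → v ≤ V → rem v + cnt n par (Function.update mate a 0) v = cap v

/-- The token is at `w` on its way up. -/
structure AugUp (n E V : ℕ) (own par cap vis nxt gd rem₀ mate₀ rem mate : ℕ → ℕ) (found w : ℕ) :
    Prop where
  core : AugCore n E V own par vis nxt gd rem₀ mate₀ rem mate found 0 (vis w)
  rem_eq : E < w → rem w = rem₀ w
  node : w = 0 ∨ (E < w ∧ w ≤ V)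
  visited : vis w ≠ 0
  count : ∀ v, E < v → v ≤ V → rem v + cnt n par mate v = cap v + ind (Anc par v w)

/-- The token is at `w`, and the way down from `w` to the matched edge of `b` has been corrected from
its lower end up to `u`. -/
structure AugDown (n E V : ℕ) (own par cap vis via nxt gd rem₀ mate₀ rem mate : ℕ → ℕ)
    (found w b u : ℕ) : Prop where
  core : AugCore n E V own par vis nxt gd rem₀ mate₀ rem mate found 0 (vis (par (nxt b)) + 1)
  owner : Owner E own b
  good : gd b ≠ 0
  mate_ne : mate b ≠ 0
  run : Run E V par vis via b u w
  count : ∀ v, E < v → v ≤ V → rem v + cnt n par mate v + ind (Anc par v u) =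
    cap v + ind (Anc par v w) + ind (Anc par v (par (mate b)))

section Augment

variable {rem₀ mate₀ : ℕ → ℕ} {a : ℕ}

theorem AugCore.mono {k k' a : ℕ}
    (h : AugCore n E V own par vis nxt gd rem₀ mate₀ rem mate found a k) (hk : k' ≤ k) :
    AugCore n E V own par vis nxt gd rem₀ mate₀ rem mate found a k' :=
  { h with
    mate_eq := fun b h1 h2 h3 => h.mate_eq b h1 h2 (by omega)
    rem_eq := fun v h1 h2 h3 h4 => h.rem_eq v h1 h2 h3 (by omega) }

theorem AugAt.start (hf : Flow n E V own par cap rem₀ mate₀)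
    (hs : Search E V own par rem₀ mate₀ vis via nxt gd queue tail found w) (h0 : found ≠ 0) :
    AugAt n E V own par cap vis nxt gd rem₀ mate₀ rem₀ mate₀ found found where
  core := ⟨hf.isMate, fun _ _ => rfl, fun _ _ _ _ => rfl, fun _ _ _ _ _ => rfl,
    fun _ _ h => h, fun _ _ _ _ => le_rfl⟩
  owner := (hs.found_mem h0).1
  good := (hs.found_mem h0).2.1
  count v h1 h2 := by
    have : Function.update mate₀ found 0 = mate₀ := by
      rw [← (hs.found_mem h0).2.2]; exact Function.update_eq_self _ _
    rw [this]; exact hf.count v h1 h2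

/-- The new edge puts a surplus token on all ancestors of `nxt a`, which is the excess that `AugUp`
records. Everything below the level of the parent of `nxt a` is still in its initial state. -/
theorem AugAt.take (hf : Flow n E V own par cap rem₀ mate₀)
    (hs : Search E V own par rem₀ mate₀ vis via nxt gd queue tail found w) 
    (h : AugAt n E V own par cap vis nxt gd rem₀ mate₀ rem mate found a) :
    AugUp n E V own par cap vis nxt gd rem₀ mate₀ rem (Function.update mate a (nxt a)) found
      (par (nxt a)) := by
  obtain ⟨g1, g2, g3, g4⟩ := hs.gd_mem a h.owner h.good
  have ha := hf.own_mem _ g1.1 g1.2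
  rw [g2] at ha
  have hnode := hf.tree.edge _ g1.1 g1.2
  have hother : ∀ b, b ≠ a → Function.update mate a (nxt a) b = mate b := fun b hb =>
    Function.update_of_ne hb _ _
  refine ⟨⟨?_, h.core.flag, ?_, ?_, ?_, h.core.top⟩, ?_, hnode, g4, ?_⟩
  · intro b h1 h2 h3
    by_cases hb : b = a
    · subst hb; rw [Function.update_self]; exact ⟨g1, g2, g3⟩
    · rw [hother b hb] at h3 ⊢; exact h.core.isMate b h1 h2 h3
  · intro b h1 h2 h3
    have hb : b ≠ a := by rintro rfl; omega
    rw [hother b hb]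
    exact h.core.mate_eq b h1 h2 (by omega)
  · intro v h1 h2 h3 h4
    exact h.core.rem_eq v h1 h2 h3 (by omega)
  · intro b hb0 hb
    left
    by_cases hba : b = a
    · subst hba; rw [Function.update_self]; omega
    · rw [hother b hba]; exact (h.core.keep b hb0 hb).resolve_right hba
  · intro hw
    rcases hnode with h' | h'
    · omega
    · exact h.core.rem_eq _ h'.1 h'.2 g4 (by omega)
  · intro v h1 h2
    have h3 := h.count v h1 h2
    have h4 := cnt_update (par := par) (mate := Function.update mate a 0) (e := nxt a) (v := v)
      (mem_Icc.2 ha)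
    rw [Function.update_idem, Function.update_self, ind_neg (p := 0 ≠ 0 ∧ _) fun h => h.1 rfl,
      ind_congr (and_iff_right (by omega : nxt a ≠ 0)),
      ind_congr (hf.tree.anc_edge h1 g1.2)] at h4
    omega

/-- The node has not been touched yet, so it still has the capacity that the search found. Using one
unit of it moves the excess to the parent, which has a smaller number. -/
theorem AugUp.rise (hf : Flow n E V own par cap rem₀ mate₀)
    (hs : Search E V own par rem₀ mate₀ vis via nxt gd queue tail found w) {x : ℕ}
    (h : AugUp n E V own par cap vis nxt gd rem₀ mate₀ rem mate found x) (hv : via x = 0) :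
    AugUp n E V own par cap vis nxt gd rem₀ mate₀ (Function.update rem x (rem x - 1)) mate found
      (par x) ∧ vis (par x) < vis x := by
  have hx : E < x ∧ x ≤ V := by
    rcases h.node with rfl | hx
    · exact absurd hv hs.via_root
    · exact hx
  obtain ⟨g1, g2, g3⟩ := hs.up x hx.1 hx.2 h.visited hv
  rw [← h.rem_eq hx.1] at g1
  have hother : ∀ v, v ≠ x → Function.update rem x (rem x - 1) v = rem v := fun v hv =>
    Function.update_of_ne hv _ _
  refine ⟨⟨⟨h.core.isMate, ?_, ?_, ?_, h.core.keep, ?_⟩, ?_, hf.tree.par_node hx.2, g2, ?_⟩, g3⟩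
  · intro e he
    rw [hother e (by omega)]; exact h.core.flag e he
  · exact fun b h1 h2 h3 => h.core.mate_eq b h1 h2 (by omega)
  · intro v h1 h2 h3 h4
    rw [hother v (by rintro rfl; omega)]
    exact h.core.rem_eq v h1 h2 h3 (by omega)
  · intro v h1 h2 h3
    by_cases hvx : v = x
    · subst hvx
      rw [Function.update_self]
      exact (Nat.sub_le _ _).trans (h.core.top v h1 h2 h3)
    · rw [hother v hvx]; exact h.core.top v h1 h2 h3
  · intro hp
    rcases hf.tree.cls x hx.1 hx.2 with h' | h'
    · omega
    · rw [hother _ (by omega)]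
      exact h.core.rem_eq _ hp (by omega) g2 g3
  · intro v h1 h2
    have h3 := h.count v h1 h2
    by_cases hvx : v = x
    · subst hvx
      rw [Function.update_self, ind_neg (hf.tree.not_anc_par (by omega) h2)]
      rw [ind_pos (Anc.refl _ _)] at h3
      omega
    · rw [hother v hvx]
      have : Anc par v x ↔ Anc par v (par x) := by
        rw [anc_iff]; exact or_iff_right hvx
      rwa [ind_congr this] at h3

theorem AugUp.finish (hf : Flow n E V own par cap rem₀ mate₀)
    (h : AugUp n E V own par cap vis nxt gd rem₀ mate₀ rem mate found 0) :
    Flow n E V own par cap rem mate where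
  tree := hf.tree
  own_mem := hf.own_mem
  isMate a h1 h2 h3 := by
    have h4 := h.core.isMate a h1 h2 h3
    exact ⟨h4.1, h4.2.1, by show rem (mate a) ≠ 0; rw [h.core.flag _ h4.1.2]; exact h4.2.2⟩
  count v h1 h2 := by
    have h3 := h.count v h1 h2
    rwa [ind_neg fun hc => by have := hf.tree.anc_zero hc; omega, add_zero] at h3

/-- The edge `nxt (via x)` ends at a smaller number than `x`, hence the applicant `via x` still has
its initial edge and the run recorded by the search is valid. -/
theorem AugUp.turn
    (hs : Search E V own par rem₀ mate₀ vis via nxt gd queue tail found w) {x : ℕ}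
    (h : AugUp n E V own par cap vis nxt gd rem₀ mate₀ rem mate found x) (hx : x ≠ 0)
    (hv : via x ≠ 0) :
    AugDown n E V own par cap vis via nxt gd rem₀ mate₀ rem mate found x (via x)
      (par (mate (via x))) ∧ vis (par (nxt (via x))) < vis x := by
  have hx' : E < x ∧ x ≤ V := h.node.resolve_left hx
  obtain ⟨g1, g2, g3, g4, _⟩ := hs.down x hx'.1 hx'.2 h.visited hv
  have hm := h.core.mate_eq _ g1 g2 g4
  refine ⟨⟨h.core.mono (by omega), g1, g2, by rwa [hm], ?_, ?_⟩, g4⟩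
  · rw [hm]; exact hs.run hx'.1 hx'.2 h.visited hv
  · intro v h1 h2
    have := h.count v h1 h2
    omega

/-- Releasing one unit at each node of the run removes the token of `b` from the nodes below `x`.
The numbers along the run exceed that of the node to which `b` will move, so the untouched levels
stay untouched. -/
theorem AugDown.lower (hf : Flow n E V own par cap rem₀ mate₀)
    (hs : Search E V own par rem₀ mate₀ vis via nxt gd queue tail found w) {x b u : ℕ}
    (h : AugDown n E V own par cap vis via nxt gd rem₀ mate₀ rem mate found x b u) (hx : x ≠ 0)
    (hb : b ≠ 0) (hne : u ≠ x) :
    AugDown n E V own par cap vis via nxt gd rem₀ mate₀ (Function.update rem u (rem u + 1)) mate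
      found x b (par u) ∧ vis u < vis (par u) := by
  obtain ⟨hu, g1, g2, g3, g4⟩ := h.run.cases hne
  have hlt : vis (par (nxt b)) < vis u := by
    have := (hs.down u hu.1 hu.2 g1 (by rwa [g2])).2.2.2.1
    rwa [g2] at this
  have hother : ∀ v, v ≠ u → Function.update rem u (rem u + 1) v = rem v := fun v hv =>
    Function.update_of_ne hv _ _
  refine ⟨⟨⟨h.core.isMate, ?_, h.core.mate_eq, ?_, h.core.keep, ?_⟩, h.owner, h.good, h.mate_ne,
    g4, ?_⟩, g3⟩
  · intro e he
    rw [hother e (by omega)]; exact h.core.flag e he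
  · intro v h1 h2 h3 h4
    rw [hother v (by rintro rfl; omega)]
    exact h.core.rem_eq v h1 h2 h3 h4
  · intro v h1 h2 h3
    by_cases hvu : v = u
    · subst hvu
      -- The run continues from `u` to `x`, which is not the root; so `u` is not directly below the
      -- root, and there the remaining capacity never increases. This is why a full detached class
      -- stays full.
      rw [h3] at g4
      exact absurd (g4.cases (Ne.symm hx)).1.1 (by omega)
    · rw [hother v hvu]; exact h.core.top v h1 h2 h3
  · intro v h1 h2
    have h3 := h.count v h1 h2
    by_cases hvu : v = u
    · subst hvu
      rw [Function.update_self, ind_neg (hf.tree.not_anc_par (by omega) h2)]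
      rw [ind_pos (Anc.refl _ _)] at h3
      omega
    · rw [hother v hvu]
      have : Anc par v u ↔ Anc par v (par u) := by
        rw [anc_iff]; exact or_iff_right hvu
      rwa [ind_congr this] at h3

/-- When the run is used up, the excess at `x` cancels against the corrected end, and what is left
is exactly the contribution of the edge that `b` gives up. -/
theorem AugDown.finish (hf : Flow n E V own par cap rem₀ mate₀) {x b : ℕ}
    (h : AugDown n E V own par cap vis via nxt gd rem₀ mate₀ rem mate found x b x) :
    AugAt n E V own par cap vis nxt gd rem₀ mate₀ rem mate found b where
  core :=
    { h.core with keep := fun c h0 hc => .inl ((h.core.keep c h0 hc).resolve_right h0) }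
  owner := h.owner
  good := h.good
  count v h1 h2 := by
    have h3 := h.count v h1 h2
    obtain ⟨e, h4, h5, rfl⟩ := h.owner
    have ho := hf.own_mem e h4 h5
    have h6 := cnt_update (par := par) (mate := mate) (e := 0) (v := v) (mem_Icc.2 ho)
    rw [ind_neg (p := 0 ≠ 0 ∧ _) fun h => h.1 rfl, ind_congr (and_iff_right h.mate_ne),
      ind_congr (hf.tree.anc_edge h1 (h.core.isMate _ ho.1 ho.2 h.mate_ne).1.2)] at h6
    omega

end Augment

end Forest

/-! ### The program: registers, arrays and the preparation of a search -/

namespace RAM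

open Forest

notation "regN" => (0 : ℕ)
notation "regM" => (1 : ℕ)
notation "regPtr" => (2 : ℕ)
notation "regE" => (3 : ℕ)
notation "regV" => (4 : ℕ)
notation "regFound" => (5 : ℕ)
notation "regHead" => (6 : ℕ)
notation "regTail" => (7 : ℕ)
notation "regC" => (8 : ℕ)
notation "regA" => (9 : ℕ)
notation "regW" => (10 : ℕ)
notation "regU" => (11 : ℕ)
notation "regB" => (12 : ℕ)
notation "regI" => (13 : ℕ)
notation "regH" => (14 : ℕ)
notation "arrIn" => (0 : ℕ)
notation "arrOut" => (1 : ℕ)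
notation "arrOwn" => (2 : ℕ)
notation "arrPost" => (3 : ℕ)
notation "arrRank" => (4 : ℕ)
notation "arrPar" => (5 : ℕ)
notation "arrRem" => (6 : ℕ)
notation "arrMate" => (7 : ℕ)
notation "arrVis" => (8 : ℕ)
notation "arrVia" => (9 : ℕ)
notation "arrNxt" => (10 : ℕ)
notation "arrGd" => (11 : ℕ)
notation "arrHd" => (12 : ℕ)
notation "arrNx" => (13 : ℕ)
notation "arrQueue" => (14 : ℕ)
infixr:60 " ;; " => Prog.seq

/-- The cell of array `k` whose index is in register `i`. -/
abbrev cell (k i : ℕ) : Expr := .get k (.reg i)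

/-- Increment register `i`. -/
abbrev inc (i : ℕ) : Prog := .set i (.add (.reg i) (.const 1))

/-- Run `c` for all values of register `regI` from `lo` to the value of register `i`. -/
abbrev forTo (lo i : ℕ) (c : Prog) : Prog :=
  .set regI (.const lo) ;; .set regH (.add (.reg i) (.const 1)) ;; .forUp regI regH c

/-- The range is `lo, …, s.reg i`. The constant 10 consists of the two assignments, which cost 2 and
4, and the final test, which costs 4. -/
theorem wp.forTo {lo i : ℕ} {c : Prog} {Q : State → Prop} {s : State} {k : ℕ}
    (J : ℕ → State → Prop) (hc : c.flat = true) (hi : regI ∉ c.regs) (hh : regH ∉ c.regs)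
    (hir : i ≠ regI) (hle : lo ≤ s.reg i + 1)
    (hk : (s.reg i + 1 - lo) * (c.bound + 8) + 10 ≤ k)
    (h0 : ∀ s', s'.arr = s.arr → (∀ j, j ≠ regI → j ≠ regH → s'.reg j = s.reg j) → J lo s')
    (step : ∀ j s', j ≤ s.reg i → lo ≤ j → J j s' → Frame (forTo lo i c) s s' → s'.reg regI = j →
      J (j + 1) ((c.step s').setReg regI (j + 1)))
    (fin : ∀ s', J (s.reg i + 1) s' → Frame (forTo lo i c) s s' → Q s') :
    wp (forTo lo i c) (fun s' _ => Q s') s k := by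
  refine wp.flat_seq ((s.reg i + 1 - lo) * (c.bound + 8) + 8) rfl
    (by simp only [Prog.bound, Expr.cost]; omega) ?_
  refine wp.flat_seq ((s.reg i + 1 - lo) * (c.bound + 8) + 4) rfl
    (by simp only [Prog.bound, Expr.cost]; omega) ?_
  set s1 := (Prog.set regH (.add (.reg i) (.const 1))).step ((Prog.set regI (.const lo)).step s) with hs1
  have hI : s1.reg regI = lo := by simp [hs1, Prog.step, Expr.eval]
  have hH : s1.reg regH = s.reg i + 1 := by simp [hs1, Prog.step, Expr.eval, hir]
  have hF : ∀ {s'}, Frame (Prog.forUp regI regH c) s1 s' → Frame (RAM.forTo lo i c) s s' := by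
    intro s' hf
    refine ⟨fun j hj => ?_, fun j hj => ?_⟩
    · simp only [Prog.regs, Prog.forUp, List.mem_append, List.mem_cons, List.not_mem_nil, or_false,
        not_or] at hj
      rw [hf.reg j (by simp [Prog.regs, Prog.forUp, hj])]
      simp [hs1, Prog.step, hj.1, hj.2.1]
    · exact hf.arr j (by simpa [Prog.arrs, Prog.forUp] using hj)
  refine wp.forUp_flat J hc hi hh (by decide) (by rw [hI, hH]; exact hle) (by rw [hI, hH]) ?_ ?_ ?_
  · rw [hI]
    exact h0 s1 rfl fun j h1 h2 => by simp [hs1, Prog.step, h1, h2]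
  · intro j s' h1 h2 h3 h4 h5
    rw [hI] at h2
    rw [hH] at h1
    exact step j s' (by omega) h2 h3 (hF h4) h5
  · intro s' h1 h2 _
    rw [hH] at h1
    exact fin s' h1 (hF h2)

/-- Forget the last search, and list the children of every node. -/
def prepare : Prog :=
  forTo 0 regV (.put arrHd (.reg regI) (.const 0) ;; .put arrVis (.reg regI) (.const 0)) ;;
  forTo 1 regE (.put arrGd (cell arrOwn regI) (.const 0)) ;;
  forTo 1 regV (.put arrNx (.reg regI) (.get arrHd (cell arrPar regI)) ;;
    .put arrHd (cell arrPar regI) (.reg regI))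

/-- The state after `prepare`. -/
structure Prepared (s : State) : Prop where
  vis : ∀ v ≤ s.reg regV, s.arr arrVis v = 0
  gd : ∀ b, Owner (s.reg regE) (s.arr arrOwn) b → s.arr arrGd b = 0
  buckets : Buckets (s.reg regV) (s.arr arrHd) (s.arr arrNx) (s.arr arrPar) (s.reg regV + 1)

/-- The marks of the applicants are cleared along the edges, so the time depends on the number of
nodes only and not on the number of applicants without edges. -/
theorem prepare_spec {s : State} (ht : Tree (s.reg regE) (s.reg regV) (s.arr arrPar)) :
    wp prepare (fun s' _ => Prepared s') s (70 * s.reg regV + 70) := by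
  have hEV := ht.le
  refine wp.then (T := 15 * s.reg regV + 25) (T' := 55 * s.reg regV + 45)
    (P := fun s' => ∀ v ≤ s.reg regV, s'.arr arrHd v = 0 ∧ s'.arr arrVis v = 0) ?_ ?_ (by omega)
  · refine wp.forTo (fun j s' => ∀ v < j, s'.arr arrHd v = 0 ∧ s'.arr arrVis v = 0) rfl (by decide)
      (by decide) (by decide) (by omega) (by simp [Prog.bound, Expr.cost]; omega) ?_ ?_ ?_
    · intro s' _ _ v hv; omega
    · intro j s' hj _ hJ hF hr v hv
      simp only [Prog.step, Expr.eval, hr, State.setReg_arr, State.setCell_arr, State.setCell_reg]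
      norm_num [Function.update_apply]
      exact ⟨fun h => (hJ v (by omega)).1, fun h => (hJ v (by omega)).2⟩
    · intro s' hJ _ v hv
      exact hJ v (by omega)
  intro s1 h1 hF1
  have r1 : s1.reg regE = s.reg regE := hF1.reg _ (by decide)
  have r2 : s1.reg regV = s.reg regV := hF1.reg _ (by decide)
  have a1 : s1.arr arrPar = s.arr arrPar := hF1.arr _ (by decide)
  have a2 : s1.arr arrOwn = s.arr arrOwn := hF1.arr _ (by decide)
  refine wp.then (T := 15 * s.reg regV + 20) (T' := 30 * s.reg regV + 25)
    (P := fun s' => ∀ b, Owner (s.reg regE) (s.arr arrOwn) b → s'.arr arrGd b = 0) ?_ ?_ (by omega)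
  · refine wp.forTo (fun j s' => ∀ e, 1 ≤ e → e < j → s'.arr arrGd (s.arr arrOwn e) = 0) rfl
      (by decide) (by decide) (by decide) (by omega)
      (by simp [Prog.bound, Expr.cost, r1]; omega) ?_ ?_ ?_
    · intro s' _ _ e h1 h2; omega
    · intro j s' hj _ hJ hF hr e he1 he2
      have a3 : s'.arr arrOwn = s.arr arrOwn := (hF.arr _ (by decide)).trans a2
      simp only [Prog.step, Expr.eval, hr, a3, State.setReg_arr, State.setCell_arr]
      norm_num [Function.update_apply]
      intro h
      exact hJ e he1 (by rcases Nat.lt_succ_iff_lt_or_eq.1 he2 with h' | rfl; exacts [h', absurd rfl h])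
    · rintro s' hJ _ b ⟨e, he1, he2, rfl⟩
      exact hJ e he1 (by omega)
  intro s2 h2 hF2
  have r3 : s2.reg regE = s.reg regE := (hF2.reg _ (by decide)).trans r1
  have r4 : s2.reg regV = s.reg regV := (hF2.reg _ (by decide)).trans r2
  have a3 : s2.arr arrPar = s.arr arrPar := (hF2.arr _ (by decide)).trans a1
  have a4 : s2.arr arrOwn = s.arr arrOwn := (hF2.arr _ (by decide)).trans a2
  have a5 : s2.arr arrVis = s1.arr arrVis := hF2.arr _ (by decide)
  have a6 : s2.arr arrHd = s1.arr arrHd := hF2.arr _ (by decide)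
  refine wp.forTo (fun j s' =>
    Buckets (s.reg regV) (s'.arr arrHd) (s'.arr arrNx) (s.arr arrPar) j) rfl (by decide) (by decide)
    (by decide) (by omega) (by simp [Prog.bound, Expr.cost, r4]; omega) ?_ ?_ ?_
  · intro s' he _
    rw [he, a6]
    exact Buckets.start fun v hv => (h1 v hv).1
  · intro j s' hj hj1 hJ hF hr
    have a7 : s'.arr arrPar = s.arr arrPar := (hF.arr _ (by decide)).trans a3
    simp only [Prog.step, Expr.eval, hr, a7, State.setReg_arr, State.setCell_arr,
      State.setCell_reg]
    norm_num
    exact hJ.insert hj1 (fun _ _ => rfl) rfl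
  · intro s' hJ hF
    have r5 : s'.reg regE = s.reg regE := (hF.reg _ (by decide)).trans r3
    have r6 : s'.reg regV = s.reg regV := (hF.reg _ (by decide)).trans r4
    refine ⟨?_, ?_, ?_⟩
    · intro v hv
      rw [hF.arr arrVis (by decide), a5]
      exact (h1 v (by omega)).2
    · intro b hb
      rw [hF.arr arrGd (by decide)]
      rw [hF.arr arrOwn (by decide), a4, r5] at hb
      exact h2 b hb
    · rw [r6, hF.arr arrPar (by decide), a3]
      rw [r4] at hJ
      exact hJ

end RAM

/-! ### The breadth-first search -/

namespace Forest

variable {E V : ℕ} {own par rem mate vis via nxt gd queue : ℕ → ℕ} {tail found w : ℕ}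

/-- Once the pending node has been visited, the pending node is irrelevant. -/
theorem Search.settle (h : Search E V own par rem mate vis via nxt gd queue tail found w)
    (hw : vis w ≠ 0) (w' : ℕ) :
    Search E V own par rem mate vis via nxt gd queue tail found w' :=
  { h with
    par_vis := fun v h1 h2 h3 => .inl (h.par_visited hw h1 h2 h3)
    mate_vis := fun b h1 h2 h3 => .inl ((h.mate_vis b h1 h2 h3).elim id fun h => by rwa [h]) }

/-- The number of nodes whose parent is not among the first `head` elements of the queue. -/
def pending (V : ℕ) (par queue : ℕ → ℕ) (head : ℕ) : ℕ :=
  ((Finset.Icc 1 V).filter fun c => ∀ i < head, queue i ≠ par c).card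

theorem pending_congr {V head : ℕ} {par queue queue' : ℕ → ℕ}
    (h : ∀ i < head, queue' i = queue i) : pending V par queue' head = pending V par queue head := by
  unfold pending
  congr 1
  ext c
  simp only [Finset.mem_filter]
  exact and_congr_right fun _ => forall₂_congr fun i hi => by rw [h i hi]

theorem pending_le (V : ℕ) (par queue : ℕ → ℕ) (head : ℕ) : pending V par queue head ≤ V :=
  (Finset.card_filter_le _ _).trans (by simp)

/-- The queue has no repetitions, so the next element takes exactly its own children out of the
pending nodes. -/
theorem pending_succ {V head : ℕ} {par queue : ℕ → ℕ} {l : List ℕ} (hl : l.Nodup)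
    (hm : ∀ c, c ∈ l ↔ 1 ≤ c ∧ c < V + 1 ∧ par c = queue head)
    (hq : ∀ i < head, queue i ≠ queue head) :
    pending V par queue (head + 1) + l.length = pending V par queue head := by
  unfold pending
  rw [← List.toFinset_card_of_nodup hl, ← Finset.card_union_of_disjoint]
  · congr 1
    ext c
    simp only [Finset.mem_union, Finset.mem_filter, Finset.mem_Icc, List.mem_toFinset, hm]
    constructor
    · rintro (⟨h1, h2⟩ | ⟨h1, h2, h3⟩)
      · exact ⟨h1, fun i hi => h2 i (by omega)⟩
      · exact ⟨⟨h1, by omega⟩, fun i hi => by rw [h3]; exact hq i hi⟩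
    · rintro ⟨h1, h2⟩
      by_cases hc : par c = queue head
      · exact .inr ⟨h1.1, by omega, hc⟩
      · refine .inl ⟨h1, fun i hi => ?_⟩
        rcases Nat.lt_succ_iff_lt_or_eq.1 hi with hi | rfl
        · exact h2 i hi
        · exact Ne.symm hc
  · rw [Finset.disjoint_left]
    intro c h1 h2
    simp only [Finset.mem_filter, List.mem_toFinset, hm] at h1 h2
    exact h1.2 head (by omega) h2.2.2.symm

end Forest

namespace RAM

open Forest

/-- Visit the unvisited ancestors of register `regW`; they lead down to the edge of `regA`. -/
def climb : Prog :=
  .loop (.sub (.const 1) (cell arrVis regW))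
    (.put arrVis (.reg regW) (.add (.reg regTail) (.const 1)) ;;
      .put arrVia (.reg regW) (.reg regA) ;;
      .put arrQueue (.reg regTail) (.reg regW) ;; inc regTail ;; .set regW (cell arrPar regW))

/-- The edge `regC` leads to a visited node. -/
def visitEdge : Prog :=
  .set regA (cell arrOwn regC) ;;
  .ite (cell arrGd regA) .skip
    ((.put arrGd (.reg regA) (.const 1) ;; .put arrNxt (.reg regA) (.reg regC) ;;
      .set regW (.get arrPar (cell arrMate regA)) ;;
      .ite (cell arrMate regA) .skip (.set regFound (.reg regA))) ;; climb)

/-- The class `regC` has a visited parent. -/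
def visitClass : Prog :=
  .ite (cell arrVis regC) .skip
    (.put arrVis (.reg regC) (.add (.reg regTail) (.const 1)) ;;
      .put arrVia (.reg regC) (.const 0) ;; .put arrQueue (.reg regTail) (.reg regC) ;; inc regTail)

def visitChild : Prog :=
  .ite (cell arrRem regC)
    (.ite (.sub (.add (.reg regE) (.const 1)) (.reg regC)) visitEdge visitClass) .skip

def bfs : Prog :=
  (.put arrVis (.const 0) (.const 1) ;; .put arrVia (.const 0) (.const 1) ;;
    .put arrQueue (.const 0) (.const 0) ;; .set regHead (.const 0) ;; .set regTail (.const 1) ;;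
    .set regFound (.const 0)) ;;
  .loop (.sub (.reg regTail) (.reg regHead))
    ((.set regC (.get arrHd (cell arrQueue regHead)) ;; inc regHead) ;;
      .loop (.reg regC) (visitChild ;; .set regC (cell arrNx regC)))

/-- The arrays and registers that a search does not change. -/
structure Fixed (s₀ s : State) : Prop where
  own : s.arr arrOwn = s₀.arr arrOwn
  par : s.arr arrPar = s₀.arr arrPar
  rem : s.arr arrRem = s₀.arr arrRem
  mate : s.arr arrMate = s₀.arr arrMate
  hd : s.arr arrHd = s₀.arr arrHd
  nx : s.arr arrNx = s₀.arr arrNx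
  edges : s.reg regE = s₀.reg regE
  nodes : s.reg regV = s₀.reg regV

theorem Fixed.frame {s₀ s s' : State} {c : Prog} (h : Fixed s₀ s) (hf : Frame c s s')
    (ha : ∀ k ∈ [2, 5, 6, 7, 12, 13], k ∉ c.arrs) (hr : ∀ i ∈ [3, 4], i ∉ c.regs) : Fixed s₀ s' where
  own := (hf.arr _ (ha _ (by simp))).trans h.own
  par := (hf.arr _ (ha _ (by simp))).trans h.par
  rem := (hf.arr _ (ha _ (by simp))).trans h.rem
  mate := (hf.arr _ (ha _ (by simp))).trans h.mate
  hd := (hf.arr _ (ha _ (by simp))).trans h.hd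
  nx := (hf.arr _ (ha _ (by simp))).trans h.nx
  edges := (hf.reg _ (hr _ (by simp))).trans h.edges
  nodes := (hf.reg _ (hr _ (by simp))).trans h.nodes

/-- The search that was started in `s₀` has reached `s`. -/
def SearchAt (s₀ s : State) (w : ℕ) : Prop :=
  Search (s₀.reg regE) (s₀.reg regV) (s₀.arr arrOwn) (s₀.arr arrPar) (s₀.arr arrRem)
    (s₀.arr arrMate) (s.arr arrVis) (s.arr arrVia) (s.arr arrNxt) (s.arr arrGd) (s.arr arrQueue)
    (s.reg regTail) (s.reg regFound) w

/-- The progress of a search from `s` to `s'`. -/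
structure Grow (s s' : State) : Prop where
  vis : ∀ v, s.arr arrVis v ≠ 0 → s'.arr arrVis v ≠ 0
  gd : ∀ b, s.arr arrGd b ≠ 0 → s'.arr arrGd b ≠ 0
  queue : ∀ i < s.reg regTail, s'.arr arrQueue i = s.arr arrQueue i
  tail : s.reg regTail ≤ s'.reg regTail

theorem Grow.refl (s : State) : Grow s s := ⟨fun _ h => h, fun _ h => h, fun _ _ => rfl, le_rfl⟩

theorem Grow.trans {s s' s'' : State} (h : Grow s s') (h' : Grow s' s'') : Grow s s'' :=
  ⟨fun v hv => h'.vis v (h.vis v hv), fun b hb => h'.gd b (h.gd b hb),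
    fun i hi => (h'.queue i (hi.trans_le h.tail)).trans (h.queue i hi), h.tail.trans h'.tail⟩

/-- The node `c`, whose parent has been visited, has been dealt with. -/
def DoneAt (s₀ s : State) (c : ℕ) : Prop :=
  s₀.arr arrRem c ≠ 0 → (c ≤ s₀.reg regE → s.arr arrGd (s₀.arr arrOwn c) ≠ 0) ∧
    (s₀.reg regE < c → s.arr arrVis c ≠ 0)

theorem DoneAt.grow {s₀ s s' : State} {c : ℕ} (h : DoneAt s₀ s c) (hg : Grow s s') :
    DoneAt s₀ s' c :=
  fun hr => ⟨fun h1 => hg.gd _ ((h hr).1 h1), fun h1 => hg.vis _ ((h hr).2 h1)⟩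

theorem update_ne_zero {f : ℕ → ℕ} {x y : ℕ} (hy : y ≠ 0) (v : ℕ) (h : f v ≠ 0) :
    Function.update f x y v ≠ 0 := by
  rw [Function.update_apply]; split_ifs <;> assumption

/-- Every pass enters a new node and is paid for by the 25 credits reserved for it. The queue is
never longer than the number of classes plus one, so the reserve suffices. -/
theorem climb_spec {s₀ s : State} {R k : ℕ}
    (ht : Tree (s₀.reg regE) (s₀.reg regV) (s₀.arr arrPar)) (hfix : Fixed s₀ s)
    (hs : SearchAt s₀ s (s.reg regW)) (hw : s.reg regW = 0 ∨ (s₀.reg regE < s.reg regW ∧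
      s.reg regW ≤ s₀.reg regV)) (ha : s.reg regA ≠ 0)
    (ho : Owner (s₀.reg regE) (s₀.arr arrOwn) (s.reg regA)) (hg : s.arr arrGd (s.reg regA) ≠ 0)
    (hl : s.arr arrVis (s.reg regW) ≠ 0 ∨ (s₀.arr arrMate (s.reg regA) ≠ 0 ∧
      s.reg regW = s₀.arr arrPar (s₀.arr arrMate (s.reg regA))))
    (hk : 25 * (s₀.reg regV - s₀.reg regE + 1 - s.reg regTail) + 5 + R ≤ k) :
    wp climb (fun s' k' => SearchAt s₀ s' 0 ∧ Grow s s' ∧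
      25 * (s₀.reg regV - s₀.reg regE + 1 - s'.reg regTail) + R ≤ k') s k := by
  refine wp.loop (fun s' k' => SearchAt s₀ s' (s'.reg regW) ∧ Grow s s' ∧
    (s'.reg regW = 0 ∨ (s₀.reg regE < s'.reg regW ∧ s'.reg regW ≤ s₀.reg regV)) ∧
    (s'.arr arrVis (s'.reg regW) ≠ 0 ∨ (s₀.arr arrMate (s.reg regA) ≠ 0 ∧
      (s'.reg regW = s₀.arr arrPar (s₀.arr arrMate (s.reg regA)) ∨
        ∃ u, s₀.reg regE < u ∧ u ≤ s₀.reg regV ∧ s'.arr arrVis u ≠ 0 ∧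
          s'.arr arrVia u = s.reg regA ∧ s₀.arr arrPar u = s'.reg regW))) ∧
    25 * (s₀.reg regV - s₀.reg regE + 1 - s'.reg regTail) + 5 + R ≤ k')
    ⟨hs, Grow.refl s, hw, hl.imp_right fun h => ⟨h.1, .inl h.2⟩, hk⟩ ?_ ?_
  · rintro s1 k1 ⟨hs1, hg1, hw1, hl1, hk1⟩ hF he
    have hvis : s1.arr arrVis (s1.reg regW) = 0 := by
      simp only [Expr.eval] at he; omega
    obtain ⟨hm, hl2⟩ := hl1.resolve_left fun h => h hvis
    have hw2 := hw1.resolve_left fun h0 => by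
      have h1 := hs1.root
      rw [h0] at hvis; omega
    have hA : s1.reg regA = s.reg regA := hF.reg _ (by decide)
    have hgd : s1.arr arrGd = s.arr arrGd := hF.arr _ (by decide)
    have hpar : s1.arr arrPar = s₀.arr arrPar := (hF.arr _ (by decide)).trans hfix.par
    have hpush := hs1.push (w' := s₀.arr arrPar (s1.reg regW)) (b := s.reg regA) ht hw2 hvis
      (.inr ⟨ha, ho, by rwa [hgd], hm, rfl, rfl, hl2⟩)
    have htl := hpush.tail_le
    refine ⟨18 + (25 * (s₀.reg regV - s₀.reg regE + 1 - (s1.reg regTail + 1)) + 5 + R), ?_,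
      wp.flat (25 * (s₀.reg regV - s₀.reg regE + 1 - (s1.reg regTail + 1)) + 5 + R) rfl
        (by simp [Prog.bound, Expr.cost]) ?_⟩
    · simp only [Expr.cost]; omega
    have hW0 : s1.reg regW ≠ 0 := by omega
    simp only [Prog.step, Expr.eval, SearchAt, State.setReg_arr, State.setReg_reg,
      State.setCell_arr, State.setCell_reg, hpar, hA]
    norm_num
    refine ⟨hpush, hg1.trans ⟨?_, ?_, ?_, ?_⟩, ht.par_node hw2.2, .inr ⟨hm, .inr
      ⟨s1.reg regW, hw2.1, hw2.2, ?_, ?_, rfl⟩⟩⟩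
    · intro v hv
      simpa using update_ne_zero (Nat.succ_ne_zero _) v hv
    · intro b hb; simpa using hb
    · intro i hi
      simp only [State.setReg_arr, State.setCell_arr]
      norm_num [Function.update_apply]
      omega
    · simp
    · simp
    · simp
  · rintro s1 k1 ⟨hs1, hg1, hw1, hl1, hk1⟩ hF he
    have hvis : s1.arr arrVis (s1.reg regW) ≠ 0 := by
      simp only [Expr.eval] at he; omega
    exact ⟨25 * (s₀.reg regV - s₀.reg regE + 1 - s1.reg regTail) + R,
      by simp only [Expr.cost]; omega, hs1.settle hvis 0, hg1, le_rfl⟩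

/-- A child costs a constant, up to 60; the climb that it may cause is paid for by the reserves of
the nodes that are entered. -/
theorem visitChild_spec {s₀ s : State} {R k : ℕ}
    (ht : Tree (s₀.reg regE) (s₀.reg regV) (s₀.arr arrPar))
    (hown : ∀ e, 1 ≤ e → e ≤ s₀.reg regE → 1 ≤ s₀.arr arrOwn e)
    (hmate : ∀ e, 1 ≤ e → e ≤ s₀.reg regE → s₀.arr arrMate (s₀.arr arrOwn e) ≤ s₀.reg regE)
    (hfix : Fixed s₀ s) (hs : SearchAt s₀ s 0) (hc : 1 ≤ s.reg regC ∧ s.reg regC ≤ s₀.reg regV)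
    (hp : s.arr arrVis (s₀.arr arrPar (s.reg regC)) ≠ 0)
    (hk : 25 * (s₀.reg regV - s₀.reg regE + 1 - s.reg regTail) + 60 + R ≤ k) :
    wp visitChild (fun s' k' => SearchAt s₀ s' 0 ∧ Grow s s' ∧ DoneAt s₀ s' (s.reg regC) ∧
      25 * (s₀.reg regV - s₀.reg regE + 1 - s'.reg regTail) + R ≤ k') s k := by
  have h0 : s.arr arrVis 0 ≠ 0 := by rw [hs.root]; exact one_ne_zero
  refine wp.ite (k' := 25 * (s₀.reg regV - s₀.reg regE + 1 - s.reg regTail) + 55 + R)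
    (by simp only [Expr.cost]; omega) (fun he => ?_) (fun he => ?_)
  swap
  · refine wp.flat (25 * (s₀.reg regV - s₀.reg regE + 1 - s.reg regTail) + R) rfl
      (by simp only [Prog.bound]; omega) ⟨hs, Grow.refl s, fun hr => absurd ?_ hr, le_rfl⟩
    simpa only [Expr.eval, hfix.rem] using he
  have hrem : s₀.arr arrRem (s.reg regC) ≠ 0 := by simpa only [Expr.eval, hfix.rem] using he
  refine wp.ite (k' := 25 * (s₀.reg regV - s₀.reg regE + 1 - s.reg regTail) + 49 + R)
    (by simp only [Expr.cost]; omega) (fun he => ?_) (fun he => ?_)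
  · have hcE : s.reg regC ≤ s₀.reg regE := by
      simp only [Expr.eval, hfix.edges] at he; omega
    have ho := hown _ hc.1 hcE
    refine wp.flat_seq (25 * (s₀.reg regV - s₀.reg regE + 1 - s.reg regTail) + 46 + R) rfl
      (by simp only [Prog.bound, Expr.cost]; omega) ?_
    set b := s₀.arr arrOwn (s.reg regC) with hb
    set s1 := (Prog.set regA (cell arrOwn regC)).step s with hs1
    have r1 : ∀ j, s1.reg j = if j = regA then b else s.reg j := fun j => by
      simp only [hs1, Prog.step, State.setReg_reg, Expr.eval, hfix.own, hb]
    have a1 : s1.arr = s.arr := rfl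
    refine wp.ite (k' := 25 * (s₀.reg regV - s₀.reg regE + 1 - s.reg regTail) + 43 + R)
      (by simp only [Expr.cost]; omega) (fun he => ?_) (fun he => ?_)
    · refine wp.flat (25 * (s₀.reg regV - s₀.reg regE + 1 - s.reg regTail) + R) rfl
        (by simp only [Prog.bound]; omega) ⟨?_, ⟨?_, ?_, ?_, ?_⟩, fun _ => ⟨fun _ => ?_, fun h => ?_⟩, ?_⟩
      · simpa [Prog.step, SearchAt, a1, r1] using hs
      · exact fun _ h => h
      · exact fun _ h => h
      · exact fun _ _ => rfl
      · simp [Prog.step, r1]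
      · simpa [Prog.step, Expr.eval, a1, r1] using he
      · omega
      · simp [Prog.step, r1]
    · have hgd : s.arr arrGd b = 0 := by simpa [Expr.eval, a1, r1] using he
      have hmark := hs.mark h0 ⟨hc.1, hcE⟩ hrem hp hgd (by omega)
      rw [← hb] at hmark
      refine wp.flat_seq (25 * (s₀.reg regV - s₀.reg regE + 1 - s.reg regTail) + 5 + R) rfl
        (by simp only [Prog.bound, Expr.cost]; omega) ?_
      set s2 := Prog.step _ s1 with hs2
      have a2 : ∀ j, s2.arr j = if j = arrNxt then Function.update (s.arr arrNxt) b (s.reg regC) else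
          if j = arrGd then Function.update (s.arr arrGd) b 1 else s.arr j := by
        intro j
        simp only [hs2, Prog.step]
        split_ifs <;> simp_all [Expr.eval]
      have r2 : ∀ j, s2.reg j = if j = regW then s₀.arr arrPar (s₀.arr arrMate b) else
          if j = regFound then (if s₀.arr arrMate b = 0 then b else s.reg regFound) else
          if j = regA then b else s.reg j := by
        intro j
        by_cases hm : s₀.arr arrMate b = 0 <;>
        · simp [hs2, Prog.step, Expr.eval, a1, r1, hfix.mate, hfix.par, hm]
          split_ifs <;> simp_all
      have rW : s2.reg regW = s₀.arr arrPar (s₀.arr arrMate b) := by simp [r2]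
      have rA : s2.reg regA = b := by simp [r2]
      have rT : s2.reg regTail = s.reg regTail := by simp [r2]
      have hG : Grow s s2 := by
        refine ⟨fun v hv => ?_, fun c hc => ?_, fun i _ => ?_, rT.ge⟩
        · simpa [a2] using hv
        · simpa [a2] using update_ne_zero one_ne_zero c hc
        · simp [a2]
      have hgd2 : s2.arr arrGd b ≠ 0 := by simp [a2]
      refine (climb_spec (s := s2) (R := R) ht ?_ ?_ ?_ ?_ ?_ ?_ ?_ ?_).mono
        fun s3 k3 _ ⟨h1, h2, h3⟩ => ⟨h1, hG.trans h2, fun _ => ⟨fun _ => h2.gd _ hgd2, fun h => ?_⟩, h3⟩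
      · constructor <;> simp [a2, r2, hfix.own, hfix.par, hfix.rem, hfix.mate, hfix.hd, hfix.nx,
          hfix.edges, hfix.nodes]
      · rw [rW]
        simpa [SearchAt, a2, r2] using hmark
      · rw [rW]
        exact ht.par_node ((hmate _ hc.1 hcE).trans ht.le)
      · rw [rA]; omega
      · rw [rA]; exact ⟨_, hc.1, hcE, rfl⟩
      · rw [rA]; exact hgd2
      · rw [rW, rA]
        by_cases hm : s₀.arr arrMate b = 0
        · left
          rw [hm, ht.root]
          simpa [a2] using h0
        · exact .inr ⟨hm, rfl⟩
      · rw [rT]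
      · omega
  · have hcE : s₀.reg regE < s.reg regC := by
      simp only [Expr.eval, hfix.edges] at he; omega
    refine wp.ite (k' := 25 * (s₀.reg regV - s₀.reg regE + 1 - s.reg regTail) + 46 + R)
      (by simp only [Expr.cost]; omega) (fun he => ?_) (fun he => ?_)
    · exact wp.flat (25 * (s₀.reg regV - s₀.reg regE + 1 - s.reg regTail) + R) rfl
        (by simp only [Prog.bound]; omega)
        ⟨hs, Grow.refl s, fun _ => ⟨fun h => by omega, fun _ => he⟩, le_rfl⟩
    · have hvis : s.arr arrVis (s.reg regC) = 0 := he
      have hpush := hs.push (w' := 0) (b := 0) ht ⟨hcE, hc.2⟩ hvis (.inl ⟨rfl, hrem, hp, rfl⟩)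
      refine wp.flat (25 * (s₀.reg regV - s₀.reg regE + 1 - s.reg regTail) + R) rfl
        (by simp only [Prog.bound, Expr.cost]; omega) ?_
      simp only [Prog.step, Expr.eval, SearchAt, State.setReg_arr, State.setReg_reg,
        State.setCell_arr, State.setCell_reg]
      norm_num
      refine ⟨hpush, ⟨fun v hv => ?_, fun b hb => ?_, fun i hi => ?_, ?_⟩,
        fun _ => ⟨fun h => by omega, fun _ => ?_⟩, by omega⟩
      · simpa using update_ne_zero (Nat.succ_ne_zero _) v hv
      · simpa using hb
      · simp only [State.setReg_arr, State.setCell_arr]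
        norm_num [Function.update_apply]
        omega
      · simp
      · simp

/-- The potential consists of 25 credits for every node not yet in the queue, 65 for every child
whose parent has not been processed, and 20 for every queue element still to be processed. Every
node is in one bucket and every queue element is processed once, so the search is linear. -/
theorem bfs_spec {s : State} (ht : Tree (s.reg regE) (s.reg regV) (s.arr arrPar))
    (hown : ∀ e, 1 ≤ e → e ≤ s.reg regE → 1 ≤ s.arr arrOwn e)
    (hmate : ∀ e, 1 ≤ e → e ≤ s.reg regE → s.arr arrMate (s.arr arrOwn e) ≤ s.reg regE)
    (hp : Prepared s) :
    wp bfs (fun s' _ => Fixed s s' ∧ SearchAt s s' 0 ∧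
      Closed (s.reg regE) (s.reg regV) (s.arr arrOwn) (s.arr arrPar) (s.arr arrRem)
        (s'.arr arrVis) (s'.arr arrGd)) s (110 * s.reg regV + 70) := by
  have hEV := ht.le
  refine wp.flat_seq (110 * s.reg regV + 55) rfl (by simp [Prog.bound, Expr.cost]; omega) ?_
  set s1 := Prog.step _ s with hs1
  have f1 : Fixed s s1 := by constructor <;> simp [hs1, Prog.step]
  have h1 : SearchAt s s1 0 := by
    have := Search.start (own := s.arr arrOwn) (par := s.arr arrPar) (rem := s.arr arrRem)
      (mate := s.arr arrMate) (via := s.arr arrVia) (nxt := s.arr arrNxt)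
      (queue := s.arr arrQueue) (fun v _ h2 => hp.vis v h2) hp.gd
    simpa [hs1, Prog.step, SearchAt, Expr.eval] using this
  have hhead : s1.reg regHead = 0 := by simp [hs1, Prog.step, Expr.eval]
  have htail : s1.reg regTail = 1 := by simp [hs1, Prog.step, Expr.eval]
  refine wp.loop (fun s' k' => SearchAt s s' 0 ∧ s'.reg regHead ≤ s'.reg regTail ∧
    (∀ c, 1 ≤ c → c ≤ s.reg regV → (∃ i < s'.reg regHead, s'.arr arrQueue i = s.arr arrPar c) →
      DoneAt s s' c) ∧
    25 * (s.reg regV - s.reg regE + 1 - s'.reg regTail) +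
      (65 * pending (s.reg regV) (s.arr arrPar) (s'.arr arrQueue) (s'.reg regHead) +
        20 * (s.reg regV - s.reg regE + 1 - s'.reg regHead) + 8) ≤ k')
    ⟨h1, by omega, ?_, ?_⟩ ?_ ?_
  · rintro c _ _ ⟨i, hi, _⟩
    omega
  · have := pending_le (s.reg regV) (s.arr arrPar) (s1.arr arrQueue) (s1.reg regHead)
    omega
  · rintro s2 k2 ⟨h2, hle, hdone, hk⟩ hF he
    have f2 : Fixed s s2 := f1.frame hF (by decide) (by decide)
    have hlt : s2.reg regHead < s2.reg regTail := by
      simp only [Expr.eval] at he; omega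
    have htl := h2.tail_le
    obtain ⟨hx1, hx2⟩ := h2.queue_mem _ hlt
    set h := s2.reg regHead with hh
    set x := s2.arr arrQueue h with hx
    obtain ⟨l, hl, hnd, hmem⟩ := hp.buckets x (by omega)
    have hpend := pending_succ (queue := s2.arr arrQueue) hnd hmem fun i hi => by
      have h3 := (h2.queue_mem i (by omega)).2
      intro h4
      rw [h4, hx2] at h3
      omega
    set R := 65 * pending (s.reg regV) (s.arr arrPar) (s2.arr arrQueue) (h + 1) +
      20 * (s.reg regV - s.reg regE + 1 - (h + 1)) + 8 with hR
    refine ⟨_, (Nat.add_sub_of_le (by simp only [Expr.cost]; omega)).le, ?_⟩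
    refine wp.flat_seq (25 * (s.reg regV - s.reg regE + 1 - s2.reg regTail) + 65 * l.length + R + 2)
      rfl (by simp only [Prog.bound, Expr.cost]; omega) ?_
    set s3 := Prog.step _ s2 with hs3
    have f3 : Fixed s s3 := by
      refine f2.frame (c := .set regC (.get arrHd (cell arrQueue regHead)) ;; inc regHead) ?_
        (by decide) (by decide)
      obtain ⟨t, _, hx⟩ := Prog.exec_step (c := .set regC (.get arrHd (cell arrQueue regHead)) ;; inc regHead) rfl s2
      exact Frame.of_exec hx
    have a3 : s3.arr = s2.arr := rfl
    have r3 : ∀ j, s3.reg j = if j = regHead then h + 1 else if j = regC then s.arr arrHd x else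
        s2.reg j := by
      intro j
      simp [hs3, Prog.step, Expr.eval, f2.hd, hh, hx]
    refine wp.loop (fun s' k' => SearchAt s s' 0 ∧ Grow s3 s' ∧ ∃ l, Chain (s.arr arrNx) (s'.reg regC) l ∧
        (∀ c ∈ l, (1 ≤ c ∧ c ≤ s.reg regV) ∧ s.arr arrPar c = x) ∧
        (∀ c, 1 ≤ c → c ≤ s.reg regV → (∃ i < h + 1, s3.arr arrQueue i = s.arr arrPar c) →
          c ∉ l → DoneAt s s' c) ∧
        25 * (s.reg regV - s.reg regE + 1 - s'.reg regTail) + 65 * l.length + R + 2 ≤ k')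
      ⟨?_, Grow.refl _, l, ?_, ?_, ?_, ?_⟩ ?_ ?_
    · simpa [SearchAt, a3, r3] using h2
    · simpa [r3] using hl
    · intro c hc
      have := (hmem c).1 hc
      exact ⟨⟨this.1, by omega⟩, this.2.2⟩
    · rintro c hc1 hc2 ⟨i, hi, hq⟩ hcl
      rcases Nat.lt_succ_iff_lt_or_eq.1 hi with hi | rfl
      · exact hdone c hc1 hc2 ⟨i, hi, hq⟩
      · exact absurd ((hmem c).2 ⟨hc1, by omega, hq.symm⟩) hcl
    · simp [r3]
    · rintro s4 k4 ⟨h4, hg4, l4, hl4, hm4, hd4, hk4⟩ hF4 he4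
      have f4 : Fixed s s4 := f3.frame hF4 (by decide) (by decide)
      obtain ⟨l5, rfl, hl5⟩ := hl4.ne_nil he4
      have hc := hm4 _ (List.mem_cons_self ..)
      rw [List.length_cons] at hk4
      refine ⟨_, (Nat.add_sub_of_le (by simp only [Expr.cost]; omega)).le, wp.seq ?_⟩
      refine (visitChild_spec (R := 65 * l5.length + R + 2 + 3) ht hown hmate f4 h4 hc.1 ?_ ?_).mono ?_
      · rw [hc.2]
        exact hg4.vis _ (by rw [a3, hx2]; exact Nat.succ_ne_zero _)
      · simp only [Expr.cost]; omega
      · rintro s5 k5 hF5 ⟨h5, hg5, hd5, hk5⟩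
        have r5 : s5.reg regC = s4.reg regC := hF5.reg _ (by decide)
        have f5 : Fixed s s5 := f4.frame hF5 (by decide) (by decide)
        refine wp.flat (25 * (s.reg regV - s.reg regE + 1 - s5.reg regTail) + 65 * l5.length + R + 2)
          rfl (by simp only [Prog.bound, Expr.cost]; omega) ?_
        set s6 := Prog.step _ s5 with hs6
        have a6 : s6.arr = s5.arr := rfl
        have r6 : ∀ j, s6.reg j = if j = regC then s.arr arrNx (s4.reg regC) else s5.reg j := by
          intro j
          simp [hs6, Prog.step, Expr.eval, f5.nx, r5]
        have hg6 : Grow s5 s6 :=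
          ⟨fun _ h => h, fun _ h => h, fun _ _ => rfl, by simp [r6]⟩
        refine ⟨?_, (hg4.trans hg5).trans hg6, l5, ?_, ?_, ?_, ?_⟩
        · simpa [SearchAt, a6, r6] using h5
        · simpa [r6] using hl5
        · exact fun c hc => hm4 c (List.mem_cons_of_mem _ hc)
        · intro c hc1 hc2 hi hcl
          by_cases hcc : c = s4.reg regC
          · rw [hcc]; exact hd5.grow hg6
          · exact (hd4 c hc1 hc2 hi (by simp [hcc, hcl])).grow (hg5.trans hg6)
        · simp [r6]
    · rintro s4 k4 ⟨h4, hg4, l4, hl4, hm4, hd4, hk4⟩ hF4 he4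
      have he4 : s4.reg regC = 0 := he4
      rw [he4] at hl4
      obtain rfl := hl4.eq_nil
      have r4 : s4.reg regHead = h + 1 := by
        rw [hF4.reg regHead (by decide)]; simp [r3]
      have hT : s3.reg regTail = s2.reg regTail := by simp [r3]
      have hpc : pending (s.reg regV) (s.arr arrPar) (s4.arr arrQueue) (h + 1) =
          pending (s.reg regV) (s.arr arrPar) (s2.arr arrQueue) (h + 1) :=
        pending_congr fun i hi => by rw [hg4.queue i (by omega), a3]
      have htl4 := hg4.tail
      refine ⟨_, (Nat.add_sub_of_le (by simp only [Expr.cost]; omega)).le, h4, by omega, ?_, ?_⟩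
      · rintro c hc1 hc2 ⟨i, hi, hq⟩
        refine hd4 c hc1 hc2 ⟨i, by omega, ?_⟩ (by simp)
        rw [← hq, hg4.queue i (by omega)]
      · rw [r4, hpc]
        simp only [Expr.cost, List.length_nil] at *
        omega
  · rintro s2 k2 ⟨h2, hle, hdone, hk⟩ hF he
    refine ⟨_, (Nat.add_sub_of_le (by simp only [Expr.cost]; omega)).le,
      f1.frame hF (by decide) (by decide), h2, fun c hc1 hc2 hr hv => ?_⟩
    -- At the end the whole queue has been processed, so the children of every visited node have
    -- been dealt with.
    have heq : s2.reg regHead = s2.reg regTail := by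
      simp only [Expr.eval] at he; omega
    have h3 := h2.vis_queue _ (ht.par_node hc2) hv
    exact hdone c hc1 hc2 ⟨_, by omega, h3.2⟩ hr

end RAM

/-! ### The augmentation -/

namespace RAM

open Forest

/-- Go up from register `regW` as long as the search did. -/
def rise : Prog :=
  .loop (.sub (.const 1) (cell arrVia regW))
    (.put arrRem (.reg regW) (.sub (cell arrRem regW) (.const 1)) ;; .set regW (cell arrPar regW))

/-- Go up from register `regU` to register `regW`. -/
def lower : Prog :=
  .loop (.add (.sub (.reg regU) (.reg regW)) (.sub (.reg regW) (.reg regU)))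
    (.put arrRem (.reg regU) (.add (cell arrRem regU) (.const 1)) ;; .set regU (cell arrPar regU))

def augment : Prog :=
  .set regA (.reg regFound) ;;
  .loop (.reg regA)
    ((.set regC (cell arrNxt regA) ;; .put arrMate (.reg regA) (.reg regC) ;;
      .set regW (cell arrPar regC)) ;;
    rise ;;
    .ite (.reg regW)
      ((.set regB (cell arrVia regW) ;; .set regU (.get arrPar (cell arrMate regB))) ;;
        lower ;; .set regA (.reg regB))
      (.set regA (.const 0)))

variable {n E V : ℕ} {own par cap rem₀ mate₀ vis via nxt gd queue : ℕ → ℕ} {tail found w : ℕ}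

/-- The numbers `vis` strictly decrease on the way up, so 40 credits per number pay for the loop. -/
theorem rise_spec (hf : Flow n E V own par cap rem₀ mate₀)
    (hs : Search E V own par rem₀ mate₀ vis via nxt gd queue tail found w) {s : State} {R k : ℕ}
    (h : AugUp n E V own par cap vis nxt gd rem₀ mate₀ (s.arr arrRem) (s.arr arrMate) found
      (s.reg regW)) (hpar : s.arr arrPar = par) (hvia : s.arr arrVia = via)
    (hk : 40 * vis (s.reg regW) + 5 + R ≤ k) :
    wp rise (fun s' k' => AugUp n E V own par cap vis nxt gd rem₀ mate₀ (s'.arr arrRem)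
      (s'.arr arrMate) found (s'.reg regW) ∧ via (s'.reg regW) ≠ 0 ∧
      40 * vis (s'.reg regW) + R ≤ k') s k := by
  refine wp.loop (fun s' k' => AugUp n E V own par cap vis nxt gd rem₀ mate₀ (s'.arr arrRem)
    (s'.arr arrMate) found (s'.reg regW) ∧ 40 * vis (s'.reg regW) + 5 + R ≤ k') ⟨h, hk⟩ ?_ ?_
  · rintro s1 k1 ⟨h1, hk1⟩ hF he
    have hvia1 : s1.arr arrVia = via := (hF.arr _ (by decide)).trans hvia
    have hpar1 : s1.arr arrPar = par := (hF.arr _ (by decide)).trans hpar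
    obtain ⟨h2, h3⟩ := h1.rise hf hs (by simp only [Expr.eval, hvia1] at he; omega)
    refine ⟨_, (Nat.add_sub_of_le (by simp only [Expr.cost]; omega)).le,
      wp.flat (40 * vis (par (s1.reg regW)) + 5 + R) rfl
        (by simp only [Prog.bound, Expr.cost]; omega) ?_⟩
    simp only [Prog.step, Expr.eval, State.setReg_arr, State.setReg_reg, State.setCell_arr,
      State.setCell_reg]
    norm_num
    simp only [hpar1]
    exact ⟨h2, le_rfl⟩
  · rintro s1 k1 ⟨h1, hk1⟩ hF he
    have hvia1 : s1.arr arrVia = via := (hF.arr _ (by decide)).trans hvia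
    exact ⟨_, (Nat.add_sub_of_le (by simp only [Expr.cost]; omega)).le, h1,
      by simp only [Expr.eval, hvia1] at he; omega, by simp only [Expr.cost]; omega⟩

theorem lower_spec (hf : Flow n E V own par cap rem₀ mate₀)
    (hs : Search E V own par rem₀ mate₀ vis via nxt gd queue tail found w) {s : State} {b R k : ℕ}
    (h : AugDown n E V own par cap vis via nxt gd rem₀ mate₀ (s.arr arrRem) (s.arr arrMate) found
      (s.reg regW) b (s.reg regU)) (hpar : s.arr arrPar = par) (hW : s.reg regW ≠ 0) (hb : b ≠ 0)
    (hk : 40 * (vis (s.reg regW) - vis (s.reg regU)) + 8 + R ≤ k) :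
    wp lower (fun s' k' => AugDown n E V own par cap vis via nxt gd rem₀ mate₀ (s'.arr arrRem)
      (s'.arr arrMate) found (s.reg regW) b (s.reg regW) ∧ R ≤ k') s k := by
  refine wp.loop (fun s' k' => AugDown n E V own par cap vis via nxt gd rem₀ mate₀ (s'.arr arrRem)
    (s'.arr arrMate) found (s.reg regW) b (s'.reg regU) ∧
    40 * (vis (s.reg regW) - vis (s'.reg regU)) + 8 + R ≤ k') ⟨h, hk⟩ ?_ ?_
  · rintro s1 k1 ⟨h1, hk1⟩ hF he
    have hpar1 : s1.arr arrPar = par := (hF.arr _ (by decide)).trans hpar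
    have hW1 : s1.reg regW = s.reg regW := hF.reg _ (by decide)
    obtain ⟨h2, h3⟩ := h1.lower hf hs hW hb (by simp only [Expr.eval, hW1] at he; omega)
    have h4 := h2.run.le
    refine ⟨_, (Nat.add_sub_of_le (by simp only [Expr.cost]; omega)).le,
      wp.flat (40 * (vis (s.reg regW) - vis (par (s1.reg regU))) + 8 + R) rfl
        (by simp only [Prog.bound, Expr.cost]; omega) ?_⟩
    simp only [Prog.step, Expr.eval, State.setReg_arr, State.setReg_reg, State.setCell_arr,
      State.setCell_reg]
    norm_num
    simp only [hpar1]
    exact ⟨h2, by omega⟩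
  · rintro s1 k1 ⟨h1, hk1⟩ hF he
    have hW1 : s1.reg regW = s.reg regW := hF.reg _ (by decide)
    have heq : s1.reg regU = s.reg regW := by simp only [Expr.eval, hW1] at he; omega
    rw [heq] at h1
    exact ⟨_, (Nat.add_sub_of_le (by simp only [Expr.cost]; omega)).le, h1,
      by simp only [Expr.cost]; omega⟩

/-- The potential is 40 times the number of the node at which the token is. Both the way up and the
correction of a run use intervals of numbers, and these intervals do not overlap; hence the time is
linear although the token turns many times. -/
theorem augment_spec {s : State} (hf : Flow n E V own par cap (s.arr arrRem) (s.arr arrMate))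
    (hs : Search E V own par (s.arr arrRem) (s.arr arrMate) vis via nxt gd queue tail found w)
    (hpar : s.arr arrPar = par) (hvia : s.arr arrVia = via) (hnxt : s.arr arrNxt = nxt)
    (hfound : s.reg regFound = found) (h0 : found ≠ 0) :
    wp augment (fun s' _ => Flow n E V own par cap (s'.arr arrRem) (s'.arr arrMate) ∧
      (∀ e ≤ E, s'.arr arrRem e = s.arr arrRem e) ∧
      (∀ b, b ≠ 0 → s.arr arrMate b ≠ 0 ∨ b = found → s'.arr arrMate b ≠ 0) ∧
      ∀ v, E < v → v ≤ V → par v = 0 → s'.arr arrRem v ≤ s.arr arrRem v) s (40 * V + 90) := by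
  refine wp.flat_seq (40 * V + 88) rfl (by simp only [Prog.bound, Expr.cost]; omega) ?_
  set s1 := Prog.step _ s with hs1
  have a1 : s1.arr = s.arr := rfl
  have r1 : s1.reg regA = found := by simp [hs1, Prog.step, Expr.eval, hfound]
  refine wp.loop (fun s' k' => (s'.reg regA ≠ 0 ∧ AugAt n E V own par cap vis nxt gd (s.arr arrRem)
      (s.arr arrMate) (s'.arr arrRem) (s'.arr arrMate) found (s'.reg regA) ∧
      40 * vis (par (nxt (s'.reg regA))) + 48 ≤ k') ∨
    (s'.reg regA = 0 ∧ AugUp n E V own par cap vis nxt gd (s.arr arrRem)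
      (s.arr arrMate) (s'.arr arrRem) (s'.arr arrMate) found 0 ∧ 2 ≤ k')) (.inl ⟨?_, ?_, ?_⟩) ?_ ?_
  · rwa [r1]
  · rw [r1, a1]; exact AugAt.start hf hs h0
  · rw [r1]
    have h1 := hs.gd_mem found (hs.found_mem h0).1 (hs.found_mem h0).2.1
    have h2 := (hs.vis_queue _ (hf.tree.edge _ h1.1.1 h1.1.2) h1.2.2.2).1
    have h3 := hs.tail_le
    omega
  · rintro s2 k2 hJ hF he
    have he : s2.reg regA ≠ 0 := he
    obtain ⟨_, h2, hk2⟩ := hJ.resolve_right fun h => he h.1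
    have hpar2 : s2.arr arrPar = par := (hF.arr _ (by decide)).trans hpar
    have hvia2 : s2.arr arrVia = via := (hF.arr _ (by decide)).trans hvia
    have hnxt2 : s2.arr arrNxt = nxt := (hF.arr _ (by decide)).trans hnxt
    refine ⟨_, (Nat.add_sub_of_le (by simp only [Expr.cost]; omega)).le, ?_⟩
    refine wp.flat_seq (40 * vis (par (nxt (s2.reg regA))) + 5 + 32) rfl
      (by simp only [Prog.bound, Expr.cost]; omega) (wp.seq ?_)
    set s3 := Prog.step _ s2 with hs3
    have rem3 : s3.arr arrRem = s2.arr arrRem := by simp [hs3, Prog.step]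
    have mate3 : s3.arr arrMate = Function.update (s2.arr arrMate) (s2.reg regA) (nxt (s2.reg regA)) := by
      simp [hs3, Prog.step, Expr.eval, hnxt2]
    have par3 : s3.arr arrPar = par := by simp [hs3, Prog.step, hpar2]
    have via3 : s3.arr arrVia = via := by simp [hs3, Prog.step, hvia2]
    have W3 : s3.reg regW = par (nxt (s2.reg regA)) := by
      simp [hs3, Prog.step, Expr.eval, hnxt2, hpar2]
    refine (rise_spec (R := 32) hf hs (s := s3) ?_ par3 via3 (by rw [W3])).mono ?_
    · rw [rem3, mate3, W3]; exact h2.take hf hs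
    · rintro s4 k4 hF4 ⟨h4, hv4, hk4⟩
      have par4 : s4.arr arrPar = par := (hF4.arr _ (by decide)).trans par3
      have via4 : s4.arr arrVia = via := (hF4.arr _ (by decide)).trans via3
      refine wp.ite (Nat.add_sub_of_le (by simp only [Expr.cost]; omega)).le
        (fun he => ?_) (fun he => ?_)
      · have he : s4.reg regW ≠ 0 := he
        obtain ⟨h5, h6⟩ := h4.turn hs he hv4
        set b := via (s4.reg regW) with hb
        -- The token continues at a number below the whole run, so the correction of the run and the
        -- rest of the way are paid for by disjoint intervals.
        have hlt : vis (par (nxt b)) < vis (par (s4.arr arrMate b)) := by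
          by_cases hx : par (s4.arr arrMate b) = s4.reg regW
          · rwa [hx]
          · obtain ⟨hu, g1, g2, _, _⟩ := h5.run.cases hx
            have := (hs.down _ hu.1 hu.2 g1 (by rw [g2]; exact hv4)).2.2.2.1
            rwa [g2] at this
        have hle : vis (par (s4.arr arrMate b)) ≤ vis (s4.reg regW) := h5.run.le
        refine wp.flat_seq (40 * (vis (s4.reg regW) - vis (par (s4.arr arrMate b))) + 8 +
          (40 * vis (par (nxt b)) + 50)) rfl (by simp only [Prog.bound, Expr.cost]; omega) (wp.seq ?_)
        set s5 := Prog.step _ s4 with hs5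
        have a5 : s5.arr = s4.arr := rfl
        have W5 : s5.reg regW = s4.reg regW := by simp [hs5, Prog.step]
        have B5 : s5.reg regB = b := by simp [hs5, Prog.step, Expr.eval, via4, hb]
        have U5 : s5.reg regU = par (s4.arr arrMate b) := by
          simp [hs5, Prog.step, Expr.eval, via4, hb, par4]
        refine (lower_spec (R := 40 * vis (par (nxt b)) + 50) (b := b) hf hs (s := s5) ?_ ?_ ?_ hv4 ?_).mono ?_
        · rw [a5, W5, U5]; exact h5
        · rw [a5, par4]
        · rwa [W5]
        · rw [W5, U5]
        · rintro s6 k6 hF6 ⟨h6, hk6⟩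
          have B6 : s6.reg regB = b := (hF6.reg _ (by decide)).trans B5
          refine wp.flat (40 * vis (par (nxt b)) + 48) rfl
            (by simp only [Prog.bound, Expr.cost]; omega) (.inl ?_)
          rw [W5] at h6
          simp only [Prog.step, Expr.eval, State.setReg_arr, State.setReg_reg, B6, if_true]
          exact ⟨hv4, h6.finish hf, le_rfl⟩
      · have he : s4.reg regW = 0 := he
        refine wp.flat 2 rfl (by simp only [Prog.bound, Expr.cost]; omega) (.inr ?_)
        rw [he] at h4
        simp only [Prog.step, Expr.eval, State.setReg_arr, State.setReg_reg, if_true]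
        exact ⟨trivial, h4, le_rfl⟩
  · rintro s2 k2 hJ hF he
    have he : s2.reg regA = 0 := he
    obtain ⟨_, h2, hk2⟩ := hJ.resolve_left fun h => h.1 he
    exact ⟨_, (Nat.add_sub_of_le (by simp only [Expr.cost]; omega)).le, h2.finish hf, h2.core.flag,
      fun b h0 hb => (h2.core.keep b h0 hb).resolve_right h0, h2.core.top⟩

end RAM

/-! ### Maximum matchings -/

namespace RAM

open Forest

def maxMatch : Prog :=
  .set regFound (.const 1) ;;
  .loop (.reg regFound) (prepare ;; bfs ;; .ite (.reg regFound) augment .skip)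

/-- The current matching is maximum, and the good nodes and applicants are marked. -/
structure Searched (n : ℕ) (s : State) : Prop where
  good : ∀ v, v = 0 ∨ (s.reg regE < v ∧ v ≤ s.reg regV) → (s.arr arrVis v ≠ 0 ↔
    Good n (s.reg regE) (s.reg regV) (s.arr arrOwn) (s.arr arrPar) (s.arr arrRem) (s.arr arrMate) v)
  goodApp : ∀ b, Owner (s.reg regE) (s.arr arrOwn) b → (s.arr arrGd b ≠ 0 ↔
    GoodApp n (s.reg regE) (s.reg regV) (s.arr arrOwn) (s.arr arrPar) (s.arr arrRem)
      (s.arr arrMate) b)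
  stuck : ∀ b, GoodApp n (s.reg regE) (s.reg regV) (s.arr arrOwn) (s.arr arrPar) (s.arr arrRem)
    (s.arr arrMate) b → s.arr arrMate b ≠ 0

abbrev FlowAt (n : ℕ) (cap : ℕ → ℕ) (s : State) : Prop :=
  Flow n (s.reg regE) (s.reg regV) (s.arr arrOwn) (s.arr arrPar) cap (s.arr arrRem) (s.arr arrMate)

/-- The number of unmatched applicants. -/
def unmatched (n : ℕ) (mate : ℕ → ℕ) : ℕ := ((Finset.Icc 1 n).filter fun a => mate a = 0).card

theorem unmatched_le (n : ℕ) (mate : ℕ → ℕ) : unmatched n mate ≤ n :=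
  (Finset.card_filter_le _ _).trans (by simp)

theorem unmatched_lt {n found : ℕ} {mate mate' : ℕ → ℕ} (hf : 1 ≤ found ∧ found ≤ n)
    (h0 : mate found = 0) (h : ∀ b, b ≠ 0 → mate b ≠ 0 ∨ b = found → mate' b ≠ 0) :
    unmatched n mate' < unmatched n mate := by
  refine Finset.card_lt_card ((Finset.ssubset_iff_of_subset fun b hb => ?_).2 ⟨found, ?_, ?_⟩)
  · simp only [Finset.mem_filter, Finset.mem_Icc] at hb ⊢
    refine ⟨hb.1, ?_⟩
    by_contra hm
    exact h b (by omega) (.inl hm) hb.2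
  · simp [hf, h0]
  · simp [hf, h found (by omega) (.inr rfl)]

/-- What a maximum matching computation preserves. -/
structure Improved (s s' : State) : Prop where
  flag : ∀ e ≤ s.reg regE, s'.arr arrRem e = s.arr arrRem e
  top : ∀ v, s.reg regE < v → v ≤ s.reg regV → s.arr arrPar v = 0 →
    s'.arr arrRem v ≤ s.arr arrRem v

/-- The registers and arrays that describe the instance. -/
structure Same (s s' : State) : Prop where
  edges : s'.reg regE = s.reg regE
  nodes : s'.reg regV = s.reg regV
  own : s'.arr arrOwn = s.arr arrOwn
  par : s'.arr arrPar = s.arr arrPar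

theorem Same.frame {s s' : State} {c : Prog} (hf : Frame c s s')
    (ha : ∀ k ∈ [2, 5], k ∉ c.arrs) (hr : ∀ i ∈ [3, 4], i ∉ c.regs) : Same s s' where
  edges := hf.reg _ (hr _ (by simp))
  nodes := hf.reg _ (hr _ (by simp))
  own := hf.arr _ (ha _ (by simp))
  par := hf.arr _ (ha _ (by simp))

/-- Preparation, search and augmentation together take at most 220 V + 230 steps, and the tests fit
into 240. Every round but the last matches one more applicant and unmatches none. -/
theorem maxMatch_spec {n : ℕ} {cap : ℕ → ℕ} {s : State} (hf : FlowAt n cap s) :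
    wp maxMatch (fun s' _ => FlowAt n cap s' ∧ Improved s s' ∧ Searched n s') s
      ((220 * s.reg regV + 240) * (n + 1) + 10) := by
  refine wp.flat_seq ((220 * s.reg regV + 240) * (n + 1) + 8) rfl
    (by simp only [Prog.bound, Expr.cost]; omega) ?_
  set s1 := Prog.step _ s with hs1
  have a1 : s1.arr = s.arr := rfl
  have r1 : ∀ j, s1.reg j = if j = regFound then 1 else s.reg j := fun j => by
    simp [hs1, Prog.step, Expr.eval]
  have same1 : Same s s1 := by constructor <;> simp [a1, r1]
  refine wp.loop (fun s' k' => FlowAt n cap s' ∧ Improved s s' ∧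
    (s'.reg regFound = 0 → Searched n s' ∧ 2 ≤ k') ∧
    (s'.reg regFound ≠ 0 →
      (220 * s.reg regV + 240) * (unmatched n (s'.arr arrMate) + 1) + 8 ≤ k'))
    ⟨?_, ?_, fun h => ?_, fun _ => ?_⟩ ?_ ?_
  · simpa [FlowAt, a1, r1] using hf
  · exact ⟨fun _ _ => rfl, fun _ _ _ _ => le_rfl⟩
  · simp [r1] at h
  · have := unmatched_le n (s1.arr arrMate)
    gcongr
  · rintro s2 k2 ⟨h2, i2, _, hk2⟩ hF he
    have hk2 := hk2 he
    have ht := h2.tree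
    have hV : s2.reg regV = s.reg regV := (hF.reg _ (by decide)).trans same1.nodes
    have hE : s2.reg regE = s.reg regE := (hF.reg _ (by decide)).trans same1.edges
    have hP : s2.arr arrPar = s.arr arrPar := (hF.arr _ (by decide)).trans same1.par
    rw [Nat.mul_add, Nat.mul_one] at hk2
    refine ⟨_, (Nat.add_sub_of_le (by simp only [Expr.cost]; omega)).le, wp.seq ?_⟩
    refine ((prepare_spec ht).keep (r := 150 * s.reg regV + 168 +
      ((220 * s.reg regV + 240) * unmatched n (s2.arr arrMate) + 8)) (by
        rw [hV]; simp only [Expr.cost]; omega)).mono ?_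
    rintro s3 k3 - ⟨p3, hk3, hF3⟩
    have same3 := Same.frame hF3 (by decide) (by decide)
    have mate3 : s3.arr arrMate = s2.arr arrMate := hF3.arr _ (by decide)
    have rem3 : s3.arr arrRem = s2.arr arrRem := hF3.arr _ (by decide)
    have h3 : FlowAt n cap s3 := by
      simpa [FlowAt, same3.edges, same3.nodes, same3.own, same3.par, mate3, rem3] using h2
    refine wp.seq (((bfs_spec h3.tree (fun e h1 h2 => (h3.own_mem e h1 h2).1)
      (fun e h1 h2 => ?_) p3).keep (r := 40 * s.reg regV + 98 +
      ((220 * s.reg regV + 240) * unmatched n (s2.arr arrMate) + 8)) (by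
        rw [same3.nodes, hV]; omega)).mono ?_)
    · by_cases h0 : s3.arr arrMate (s3.arr arrOwn e) = 0
      · omega
      · have ho := h3.own_mem e h1 h2
        exact (h3.isMate _ ho.1 ho.2 h0).1.2
    rintro s4 k4 - ⟨⟨f4, h4, c4⟩, hk4, hF4⟩
    have hm : ∀ e, 1 ≤ e → e ≤ s3.reg regE → s3.arr arrMate (s3.arr arrOwn e) ≠ 0 →
        1 ≤ s3.arr arrMate (s3.arr arrOwn e) ∧ s3.arr arrMate (s3.arr arrOwn e) ≤ s3.reg regE :=
      fun e e1 e2 e3 => (h3.isMate _ (h3.own_mem e e1 e2).1 (h3.own_mem e e1 e2).2 e3).1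
    have hroot : s4.arr arrVis 0 ≠ 0 := by rw [h4.root]; exact one_ne_zero
    have h4f : FlowAt n cap s4 := by
      simpa [FlowAt, f4.edges, f4.nodes, f4.own, f4.par, f4.rem, f4.mate] using h3
    have i4 : Improved s s4 := by
      refine ⟨fun e he => ?_, fun v h1 h2 h3 => ?_⟩
      · rw [f4.rem, rem3]; exact i2.flag e he
      · rw [f4.rem, rem3]; exact i2.top v h1 h2 h3
    refine wp.ite (k' := 40 * s.reg regV + 96 +
      ((220 * s.reg regV + 240) * unmatched n (s2.arr arrMate) + 8))
      (by simp only [Expr.cost]; omega) (fun he => ?_) (fun he => ?_)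
    · have he : s4.reg regFound ≠ 0 := he
      have hsearch := h4
      rw [SearchAt, ← f4.rem, ← f4.mate] at hsearch
      have haug := augment_spec (cap := cap) (s := s4) (by rw [f4.rem, f4.mate]; exact h3) hsearch
        f4.par rfl rfl rfl he
      obtain ⟨⟨e, e1, e2, e3⟩, _, hfm⟩ := h4.found_mem he
      have hfn := h3.own_mem e e1 e2
      rw [e3] at hfn
      refine (haug.keep (r := (220 * s.reg regV + 240) * unmatched n (s2.arr arrMate) + 8)
        (by rw [same3.nodes, hV]; omega)).mono ?_
      rintro s5 k5 - ⟨⟨g1, g2, g3, g4⟩, hk5, hF5⟩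
      have r5 : s5.reg regFound = s4.reg regFound := hF5.reg _ (by decide)
      have same5 := Same.frame hF5 (by decide) (by decide)
      refine ⟨?_, ⟨fun e he => ?_, fun v v1 v2 v3 => ?_⟩, fun h0 => absurd (r5 ▸ h0) he, fun _ => ?_⟩
      · simpa [FlowAt, same5.edges, same5.nodes, same5.own, same5.par, f4.edges, f4.nodes, f4.own,
          f4.par] using g1
      · rw [g2 e (by rw [same3.edges, hE]; exact he)]; exact i4.flag e he
      · refine (g4 v ?_ ?_ ?_).trans (i4.top v v1 v2 v3)
        · rw [same3.edges, hE]; exact v1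
        · rw [same3.nodes, hV]; exact v2
        · rw [same3.par, hP]; exact v3
      · have hlt := unmatched_lt hfn (by rw [f4.mate]; exact hfm) g3
        rw [f4.mate, mate3] at hlt
        have hmul : ∀ T : ℕ, T * (unmatched n (s5.arr arrMate) + 1) ≤
            T * unmatched n (s2.arr arrMate) := fun T => Nat.mul_le_mul_left T hlt
        exact (Nat.add_le_add_right (hmul _) 8).trans hk5
    · have he : s4.reg regFound = 0 := he
      refine wp.flat 2 rfl (by simp only [Prog.bound]; omega) ⟨h4f, i4, fun _ => ⟨?_, le_rfl⟩,
        fun h0 => absurd he h0⟩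
      change Searched n s4
      have hga : ∀ b, Owner (s3.reg regE) (s3.arr arrOwn) b → (s4.arr arrGd b ≠ 0 ↔
          GoodApp n (s3.reg regE) (s3.reg regV) (s3.arr arrOwn) (s3.arr arrPar) (s3.arr arrRem)
            (s3.arr arrMate) b) :=
        fun b hb => h4.goodApp_iff h3.tree hm hroot c4 hb
      constructor
      · intro v hv
        rw [f4.edges, f4.nodes] at hv
        simp only [f4.edges, f4.nodes, f4.own, f4.par, f4.rem, f4.mate]
        exact h4.good_iff h3.tree hm hroot c4 hv
      · intro b hb
        simp only [f4.edges, f4.nodes, f4.own, f4.par, f4.rem, f4.mate] at hb ⊢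
        exact hga b hb
      · intro b hb
        simp only [f4.edges, f4.nodes, f4.own, f4.par, f4.rem, f4.mate] at hb ⊢
        -- The search records some unmatched good applicant whenever there is one; as none was
        -- found, no good applicant is unmatched.
        intro h0
        have hob : Owner (s3.reg regE) (s3.arr arrOwn) b := by
          obtain ⟨e, e1, e2, e3, _⟩ := hb
          exact ⟨e, e1, e2, e3⟩
        exact h4.found_of b hob ((hga b hob).2 hb) h0 he
  · rintro s2 k2 ⟨h2, i2, hk2, _⟩ hF he
    have hk2 := hk2 he
    exact ⟨0, by simp only [Expr.cost]; omega, h2, i2, hk2.1⟩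

end RAM

/-! ### The minimal ranks -/

namespace Forest

/-- `f b` is one more than the minimal rank of the edges `e < j` of `b` with `P e`, or zero. -/
structure MinAt (own rnk : ℕ → ℕ) (P : ℕ → Prop) (f : ℕ → ℕ) (j : ℕ) : Prop where
  le : ∀ e, 1 ≤ e → e < j → P e → f (own e) ≠ 0 ∧ f (own e) ≤ rnk e + 1
  attained : ∀ b, f b ≠ 0 → ∃ e, (1 ≤ e ∧ e < j) ∧ own e = b ∧ P e ∧ f b = rnk e + 1

variable {own rnk : ℕ → ℕ} {P : ℕ → Prop} {f : ℕ → ℕ} {j E : ℕ}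

theorem MinAt.skip (h : MinAt own rnk P f j)
    (hj : P j → f (own j) ≠ 0 ∧ f (own j) ≤ rnk j + 1) : MinAt own rnk P f (j + 1) where
  le e h1 h2 hp := by
    rcases Nat.lt_succ_iff_lt_or_eq.1 h2 with h2 | rfl
    · exact h.le e h1 h2 hp
    · exact hj hp
  attained b hb := by
    obtain ⟨e, h1, h2⟩ := h.attained b hb
    exact ⟨e, ⟨h1.1, by omega⟩, h2⟩

theorem MinAt.update (h : MinAt own rnk P f j) (hj : 1 ≤ j) (hp : P j)
    (hlt : f (own j) = 0 ∨ rnk j + 1 < f (own j)) :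
    MinAt own rnk P (Function.update f (own j) (rnk j + 1)) (j + 1) where
  le e h1 h2 hpe := by
    by_cases ho : own e = own j
    · rw [ho, Function.update_self]
      refine ⟨Nat.succ_ne_zero _, ?_⟩
      rcases Nat.lt_succ_iff_lt_or_eq.1 h2 with h2 | rfl
      · have := h.le e h1 h2 hpe
        rw [ho] at this
        omega
      · exact le_rfl
    · rw [Function.update_of_ne ho]
      rcases Nat.lt_succ_iff_lt_or_eq.1 h2 with h2 | rfl
      · exact h.le e h1 h2 hpe
      · exact absurd rfl ho
  attained b hb := by
    by_cases ho : b = own j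
    · subst ho
      exact ⟨j, ⟨hj, by omega⟩, rfl, hp, by rw [Function.update_self]⟩
    · rw [Function.update_of_ne ho] at hb ⊢
      obtain ⟨e, h1, h2⟩ := h.attained b hb
      exact ⟨e, ⟨h1.1, by omega⟩, h2⟩

/-- The stored value is the minimal rank plus one, so its truncated difference to a rank is nonzero
exactly for ranks that do not exceed the minimum. The same difference can thus serve as the flag of
the edge. -/
theorem MinAt.best_iff (h : MinAt own rnk P f (E + 1)) {e : ℕ} (h1 : 1 ≤ e) (h2 : e ≤ E)
    (hp : P e) : f (own e) - rnk e ≠ 0 ↔ Best E own rnk P e := by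
  obtain ⟨h3, h4⟩ := h.le e h1 (by omega) hp
  obtain ⟨e', h5, h6, h7, h8⟩ := h.attained _ h3
  constructor
  · intro h0
    refine ⟨hp, fun e'' g1 g2 g3 g4 => ?_⟩
    have := (h.le e'' g1 (by omega) g4).2
    rw [g3] at this
    omega
  · intro hb
    have := hb.2 e' h5.1 (by omega) h6 h7
    omega

end Forest

namespace RAM

open Forest

notation "arrDead" => (15 : ℕ)
notation "arrMn" => (16 : ℕ)
notation "arrSm" => (17 : ℕ)

/-- The minimal ranks of the live edges that satisfy a condition, for every applicant. -/
def minPass (k : ℕ) (e : Expr) : Prog :=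
  forTo 1 regE (.ite (cell arrDead regI) .skip (.ite e
    (.ite (.add (.sub (.const 1) (.get k (cell arrOwn regI)))
        (.sub (.get k (cell arrOwn regI)) (.add (cell arrRank regI) (.const 1))))
      (.put k (cell arrOwn regI) (.add (cell arrRank regI) (.const 1))) .skip) .skip))

/-- The bound on `k` keeps the written array apart from the arrays that are read; the condition `e`
may depend on `arrVis`, `arrPar` and the loop counter only. -/
theorem minPass_spec {k : ℕ} {e : Expr} {s : State} {P : ℕ → Prop} (hk : 16 ≤ k) (hc : e.cost ≤ 3)
    (hP : ∀ s', s'.arr arrVis = s.arr arrVis → s'.arr arrPar = s.arr arrPar →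
      (e.eval s' ≠ 0 ↔ P (s'.reg regI))) (h0 : ∀ b, s.arr k b = 0) :
    wp (minPass k e) (fun s' _ => MinAt (s.arr arrOwn) (s.arr arrRank)
      (fun e => s.arr arrDead e = 0 ∧ P e) (s'.arr k) (s.reg regE + 1)) s (50 * s.reg regE + 10) := by
  refine wp.forTo (fun j s' => MinAt (s.arr arrOwn) (s.arr arrRank)
    (fun e => s.arr arrDead e = 0 ∧ P e) (s'.arr k) j) rfl (by simp [Prog.regs])
    (by simp [Prog.regs]) (by decide) (by omega) ?_ ?_ ?_ ?_
  · rw [Nat.add_sub_cancel, Nat.mul_comm]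
    gcongr
    simp only [Prog.bound, Expr.cost]
    omega
  · intro s' ha _
    refine ⟨fun e h1 h2 => by omega, fun b hb => absurd ?_ hb⟩
    rw [ha]; exact h0 b
  · intro j s' hj h1 hJ hF hr
    have ho : s'.arr arrOwn = s.arr arrOwn := hF.arr _ (by simp [Prog.arrs, Prog.forUp]; omega)
    have hrk : s'.arr arrRank = s.arr arrRank := hF.arr _ (by simp [Prog.arrs, Prog.forUp]; omega)
    have hd : s'.arr arrDead = s.arr arrDead := hF.arr _ (by simp [Prog.arrs, Prog.forUp]; omega)
    have hv : s'.arr arrVis = s.arr arrVis := hF.arr _ (by simp [Prog.arrs, Prog.forUp]; omega)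
    have hp : s'.arr arrPar = s.arr arrPar := hF.arr _ (by simp [Prog.arrs, Prog.forUp]; omega)
    have hcnd := hP s' hv hp
    rw [hr] at hcnd
    simp only [State.setReg_arr, Prog.step]
    split_ifs with c1 c2 c3
    · exact hJ.skip fun h => absurd h.1 (by simpa [Expr.eval, hr, hd] using c1)
    · simp only [Expr.eval, hr, ho, hrk] at c3
      simp only [Expr.eval, hr, ho, hrk, State.setCell_arr, if_true]
      refine hJ.update h1 ⟨by simpa [Expr.eval, hr, hd] using c1, hcnd.1 c2⟩ (by omega)
    · simp only [Expr.eval, hr, ho, hrk] at c3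
      exact hJ.skip fun h => by omega
    · exact hJ.skip fun h => absurd (hcnd.2 h.2) c2
  · intro s' hJ _
    exact hJ

/-! ### Passes between and after the searches -/

/-- Mark the best live edges. -/
def flagBest : Prog :=
  forTo 1 regE (.put arrRem (.reg regI) (.const 0) ;; .ite (cell arrDead regI) .skip
    (.put arrRem (.reg regI) (.sub (.get arrMn (cell arrOwn regI)) (cell arrRank regI))))

/-- Mark the edges that are best among those to visited nodes, and the best edges of the other
applicants. -/
def flagSecond : Prog :=
  forTo 1 regE (.put arrRem (.reg regI) (.const 0) ;; .ite (cell arrDead regI) .skip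
    (.ite (.get arrVis (cell arrPar regI))
      (.put arrRem (.reg regI) (.sub (.get arrSm (cell arrOwn regI)) (cell arrRank regI)))
      (.ite (.get arrGd (cell arrOwn regI)) .skip
        (.put arrRem (.reg regI) (.sub (.get arrMn (cell arrOwn regI)) (cell arrRank regI))))))

/-- Detach the maximal nodes that have not been visited. -/
def detach : Prog :=
  forTo 1 regV (.ite (.sub (.reg regI) (.reg regE)) (.ite (cell arrVis regI) .skip
    (.ite (.get arrVis (cell arrPar regI)) (.put arrPar (.reg regI) (.const 0)) .skip)) .skip)

/-- Write the matching and whether it is complete. -/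
def output : Prog :=
  .put arrOut (.const 0) (.const 1) ;;
  forTo 1 regE (.ite (.get arrMate (cell arrOwn regI)) .skip (.put arrOut (.const 0) (.const 0))) ;;
  forTo 1 regN (.put arrOut (.reg regI) (.get arrPost (cell arrMate regI)))

/-- A pass that assigns a new value to every edge. -/
theorem flagPass_spec {c : Prog} {s : State} {g : ℕ → ℕ} {k : ℕ} (hc : c.flat = true)
    (hi : regI ∉ c.regs) (hh : regH ∉ c.regs) (hk : s.reg regE * (c.bound + 8) + 10 ≤ k)
    (hstep : ∀ s', Frame (forTo 1 regE c) s s' → ∀ v, (c.step s').arr arrRem v =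
      if v = s'.reg regI then g v else s'.arr arrRem v) :
    wp (forTo 1 regE c) (fun s' _ => (∀ e, 1 ≤ e → e ≤ s.reg regE → s'.arr arrRem e = g e) ∧
      ∀ v, s.reg regE < v → s'.arr arrRem v = s.arr arrRem v) s k := by
  refine wp.forTo (fun j s' => (∀ e, 1 ≤ e → e < j → s'.arr arrRem e = g e) ∧
    ∀ v, s.reg regE < v → s'.arr arrRem v = s.arr arrRem v) hc hi hh (by decide)
    (by omega) (by simpa using hk) ?_ ?_ ?_
  · intro s' ha _
    exact ⟨fun e h1 h2 => by omega, fun v _ => by rw [ha]⟩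
  · intro j s' hj h1 hJ hF hr
    simp only [State.setReg_arr, hstep s' hF, hr]
    refine ⟨fun e h2 h3 => ?_, fun v hv => ?_⟩
    · split_ifs with h4
      · rfl
      · exact hJ.1 e h2 (by omega)
    · rw [if_neg (by omega)]; exact hJ.2 v hv
  · intro s' hJ _
    exact ⟨fun e h1 h2 => hJ.1 e h1 (by omega), hJ.2⟩

theorem flagBest_spec {s : State} : wp flagBest (fun s' _ =>
    (∀ e, 1 ≤ e → e ≤ s.reg regE → s'.arr arrRem e = if s.arr arrDead e = 0 then
      s.arr arrMn (s.arr arrOwn e) - s.arr arrRank e else 0) ∧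
    ∀ v, s.reg regE < v → s'.arr arrRem v = s.arr arrRem v) s (30 * s.reg regE + 10) := by
  refine flagPass_spec rfl (by decide) (by decide) (by simp [Prog.bound, Expr.cost]; omega) ?_
  intro s' hF v
  rw [← hF.arr arrOwn (by decide), ← hF.arr arrRank (by decide), ← hF.arr arrDead (by decide),
    ← hF.arr arrMn (by decide)]
  by_cases hv : v = s'.reg regI
  · subst hv
    by_cases hdj : s'.arr arrDead (s'.reg regI) = 0 <;> simp [Prog.step, Expr.eval, hdj]
  · by_cases hdj : s'.arr arrDead (s'.reg regI) = 0 <;> simp [Prog.step, Expr.eval, hdj, hv]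

theorem flagSecond_spec {s : State} : wp flagSecond (fun s' _ =>
    (∀ e, 1 ≤ e → e ≤ s.reg regE → s'.arr arrRem e = if s.arr arrDead e = 0 then
      (if s.arr arrVis (s.arr arrPar e) = 0 then (if s.arr arrGd (s.arr arrOwn e) = 0 then
        s.arr arrMn (s.arr arrOwn e) - s.arr arrRank e else 0)
      else s.arr arrSm (s.arr arrOwn e) - s.arr arrRank e) else 0) ∧
    ∀ v, s.reg regE < v → s'.arr arrRem v = s.arr arrRem v) s (50 * s.reg regE + 10) := by
  refine flagPass_spec rfl (by decide) (by decide) (by simp [Prog.bound, Expr.cost]; omega) ?_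
  intro s' hF v
  rw [← hF.arr arrOwn (by decide), ← hF.arr arrRank (by decide), ← hF.arr arrDead (by decide),
    ← hF.arr arrMn (by decide), ← hF.arr arrSm (by decide), ← hF.arr arrVis (by decide),
    ← hF.arr arrGd (by decide), ← hF.arr arrPar (by decide)]
  by_cases hd : s'.arr arrDead (s'.reg regI) = 0 <;>
    by_cases hv : s'.arr arrVis (s'.arr arrPar (s'.reg regI)) = 0 <;>
    by_cases hg : s'.arr arrGd (s'.arr arrOwn (s'.reg regI)) = 0 <;>
    by_cases hj : v = s'.reg regI <;>
    first
      | (subst hj; simp [Prog.step, Expr.eval, hd, hv, hg])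
      | simp [Prog.step, Expr.eval, hd, hv, hg, hj]

/-- The test at a node only uses the visited marks and the parent of this node, so the parents may
be overwritten in place. -/
theorem detach_spec {s : State} {T : ℕ → Prop}
    (ht : Tree (s.reg regE) (s.reg regV) (s.arr arrPar))
    (hT : ∀ v, v = 0 ∨ (s.reg regE < v ∧ v ≤ s.reg regV) → (s.arr arrVis v ≠ 0 ↔ T v)) :
    wp detach (fun s' _ => Detached (s.reg regE) (s.reg regV) (s.arr arrPar) (s'.arr arrPar) T) s
      (40 * s.reg regV + 10) := by
  refine wp.forTo (fun j s' => ∀ v, s'.arr arrPar v =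
      if v < j ∧ (s.reg regE < v ∧ v ≤ s.reg regV) ∧ s.arr arrVis v = 0 ∧
        s.arr arrVis (s.arr arrPar v) ≠ 0
      then 0 else s.arr arrPar v) rfl (by decide) (by decide) (by decide)
    (by omega) (by simp [Prog.bound, Expr.cost]; omega) ?_ ?_ ?_
  · intro s' ha _ v
    rw [if_neg (by omega), ha]
  · intro j s' hj h1 hJ hF hr v
    have hvi : s'.arr arrVis = s.arr arrVis := hF.arr _ (by decide)
    have hE : s'.reg regE = s.reg regE := hF.reg _ (by decide)
    have hpj : s'.arr arrPar j = s.arr arrPar j := by rw [hJ j, if_neg (by omega)]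
    have hstep : ((Prog.ite (.sub (.reg regI) (.reg regE)) (.ite (cell arrVis regI) .skip
        (.ite (.get arrVis (cell arrPar regI)) (.put arrPar (.reg regI) (.const 0)) .skip))
          .skip).step s').arr arrPar v = if v = j ∧ s.reg regE < v ∧ s.arr arrVis v = 0 ∧
            s.arr arrVis (s.arr arrPar v) ≠ 0 then 0 else s'.arr arrPar v := by
      by_cases hvj : v = j
      · subst hvj
        simp only [Prog.step, Expr.eval, hr, hE, hvi, hpj]
        by_cases c1 : s.reg regE < v
        · rw [if_pos (by omega)]
          by_cases c2 : s.arr arrVis v = 0 <;>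
            by_cases c3 : s.arr arrVis (s.arr arrPar v) = 0 <;> simp [c1, c2, c3, hpj]
        · rw [if_neg (by omega), if_neg (by tauto), hpj]
      · rw [if_neg (by tauto)]
        simp only [Prog.step, Expr.eval, hr]
        split_ifs <;> simp [hvj]
    rw [State.setReg_arr, hstep, hJ v]
    by_cases c1 : s.reg regE < v <;> by_cases c2 : s.arr arrVis v = 0 <;>
      by_cases c3 : s.arr arrVis (s.arr arrPar v) = 0 <;> simp [c1, c2, c3]
    split_ifs <;> omega
  · intro s' hJ hF
    constructor
    · intro v hv
      obtain ⟨h1, h2, h3⟩ := mem_tops.1 hv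
      rw [← hT v (.inr h1), not_not] at h2
      rw [hJ v, if_pos ⟨by omega, h1, h2, (hT _ (ht.par_node h1.2)).2 h3⟩]
    · intro v hv1 hv
      rw [hJ v, if_neg]
      rintro ⟨_, h2, h3, h4⟩
      exact hv (mem_tops.2 ⟨h2, by rw [← hT v (.inr h2)]; simpa using h3,
        (hT _ (ht.par_node hv1)).1 h4⟩)

/-- No case distinction is needed when the posts are written: for an unmatched applicant the cell
`0` of `arrPost` is read, and the post of a last resort is stored as `0` in the edge table. -/
theorem output_spec {s : State} : wp output (fun s' _ =>
    ((∀ e, 1 ≤ e → e ≤ s.reg regE → s.arr arrMate (s.arr arrOwn e) ≠ 0) → s'.arr arrOut 0 = 1) ∧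
    ((¬ ∀ e, 1 ≤ e → e ≤ s.reg regE → s.arr arrMate (s.arr arrOwn e) ≠ 0) → s'.arr arrOut 0 = 0) ∧
    ∀ a, 1 ≤ a → a ≤ s.reg regN → s'.arr arrOut a = s.arr arrPost (s.arr arrMate a)) s
    (30 * s.reg regE + 20 * s.reg regN + 30) := by
  refine wp.flat_seq (30 * s.reg regE + 20 * s.reg regN + 25) rfl
    (by simp only [Prog.bound, Expr.cost]; omega) ?_
  set s1 := Prog.step _ s with hs1
  have r1 : s1.reg = s.reg := rfl
  have a1 : s1.arr arrOut 0 = 1 := by simp [hs1, Prog.step, Expr.eval]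
  have a2 : ∀ k, k ≠ arrOut → s1.arr k = s.arr k := fun k hk => by simp [hs1, Prog.step, hk]
  refine wp.then (T := 30 * s.reg regE + 10) (T' := 20 * s.reg regN + 10) (P := fun s' =>
    ((∀ e, 1 ≤ e → e ≤ s.reg regE → s.arr arrMate (s.arr arrOwn e) ≠ 0) → s'.arr arrOut 0 = 1) ∧
    ((¬ ∀ e, 1 ≤ e → e ≤ s.reg regE → s.arr arrMate (s.arr arrOwn e) ≠ 0) → s'.arr arrOut 0 = 0))
    ?_ ?_ (by omega)
  · refine wp.forTo (fun j s' => s'.arr arrMate = s.arr arrMate ∧ s'.arr arrOwn = s.arr arrOwn ∧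
      ((∀ e, 1 ≤ e → e < j → s.arr arrMate (s.arr arrOwn e) ≠ 0) → s'.arr arrOut 0 = 1) ∧
      ((¬ ∀ e, 1 ≤ e → e < j → s.arr arrMate (s.arr arrOwn e) ≠ 0) → s'.arr arrOut 0 = 0))
      rfl (by decide) (by decide) (by decide) (by omega)
      (by simp [Prog.bound, Expr.cost, r1]; omega) ?_ ?_ ?_
    · intro s' ha _
      rw [ha]
      exact ⟨a2 _ (by decide), a2 _ (by decide), fun _ => a1, fun h => absurd (fun e _ _ => by omega) h⟩
    · rintro j s' hj h1 ⟨hm, ho, h2, h3⟩ hF hr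
      simp only [State.setReg_arr, Prog.step]
      split_ifs with c1
      · simp only [Expr.eval, hr, hm, ho] at c1
        have hiff : (∀ e, 1 ≤ e → e < j + 1 → s.arr arrMate (s.arr arrOwn e) ≠ 0) ↔
            ∀ e, 1 ≤ e → e < j → s.arr arrMate (s.arr arrOwn e) ≠ 0 := by
          refine ⟨fun h e g1 g2 => h e g1 (by omega), fun h e g1 g2 => ?_⟩
          rcases Nat.lt_succ_iff_lt_or_eq.1 g2 with g2 | rfl
          · exact h e g1 g2
          · exact c1
        rw [hiff]
        exact ⟨hm, ho, h2, h3⟩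
      · simp only [Expr.eval, hr, hm, ho, ne_eq, not_not] at c1
        refine ⟨by simpa using hm, by simpa using ho, fun h => absurd c1 (h j h1 (by omega)),
          fun _ => by simp [Expr.eval]⟩
    · rintro s' ⟨_, _, h2, h3⟩ _
      rw [r1] at h2 h3
      exact ⟨fun h => h2 fun e g1 g2 => h e g1 (by omega),
        fun h => h3 fun h' => h fun e g1 g2 => h' e g1 (by omega)⟩
  · intro s2 h2 hF2
    have r2 : s2.reg regN = s.reg regN := hF2.reg _ (by decide)
    have m2 : s2.arr arrMate = s.arr arrMate := (hF2.arr _ (by decide)).trans (a2 _ (by decide))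
    have p2 : s2.arr arrPost = s.arr arrPost := (hF2.arr _ (by decide)).trans (a2 _ (by decide))
    refine wp.forTo (fun j s' => s'.arr arrOut 0 = s2.arr arrOut 0 ∧
      ∀ a, 1 ≤ a → a < j → s'.arr arrOut a = s.arr arrPost (s.arr arrMate a)) rfl (by decide)
      (by decide) (by decide) (by omega) (by simp [Prog.bound, Expr.cost, r2]; omega) ?_ ?_ ?_
    · intro s' ha _
      exact ⟨by rw [ha], fun a _ _ => by omega⟩
    · rintro j s' hj h1 ⟨h3, h4⟩ hF hr
      have m3 : s'.arr arrMate = s.arr arrMate := (hF.arr _ (by decide)).trans m2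
      have p3 : s'.arr arrPost = s.arr arrPost := (hF.arr _ (by decide)).trans p2
      simp only [State.setReg_arr, Prog.step, State.setCell_arr, if_true, Expr.eval, hr, m3, p3]
      refine ⟨by rw [Function.update_of_ne (by omega), h3], fun a g1 g2 => ?_⟩
      rcases Nat.lt_succ_iff_lt_or_eq.1 g2 with g2 | rfl
      · rw [Function.update_of_ne (by omega), h4 a g1 g2]
      · rw [Function.update_self]
    · rintro s' ⟨h3, h4⟩ _
      rw [h3]
      exact ⟨h2.1, h2.2, fun a g1 g2 => h4 a g1 (by omega)⟩

end RAM

/-! ### The main algorithm on the forest -/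

namespace RAM

open Forest

def solve : Prog :=
  minPass arrMn (.const 1) ;; flagBest ;; maxMatch ;; minPass arrSm (.get arrVis (cell arrPar regI)) ;;
  flagSecond ;; detach ;; maxMatch ;; output

/-- The state describes a market. -/
structure Ready (n : ℕ) (cap : ℕ → ℕ) (s : State) : Prop where
  applicants : s.reg regN = n
  market : Market n (s.reg regE) (s.reg regV) (s.arr arrOwn) (s.arr arrPar) cap (s.arr arrRank)
    (fun e => s.arr arrDead e = 0)
  rem : ∀ v, s.reg regE < v → v ≤ s.reg regV → s.arr arrRem v = cap v
  mate : ∀ a, s.arr arrMate a = 0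
  mn : ∀ a, s.arr arrMn a = 0
  sm : ∀ a, s.arr arrSm a = 0

abbrev PopularAt (n : ℕ) (cap : ℕ → ℕ) (s : State) (M : ℕ → ℕ) : Prop :=
  PopularMate n (s.reg regE) (s.reg regV) (s.arr arrOwn) (s.arr arrPar) cap (s.arr arrRank) M

theorem solve_spec {n : ℕ} {cap : ℕ → ℕ} {s : State} (h : Ready n cap s) :
    wp solve (fun s' _ =>
      ((∃ M, PopularAt n cap s M) → s'.arr arrOut 0 = 1 ∧ ∃ M, PopularAt n cap s M ∧
        ∀ a, 1 ≤ a → a ≤ n → s'.arr arrOut a = s.arr arrPost (M a)) ∧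
      ((¬ ∃ M, PopularAt n cap s M) → s'.arr arrOut 0 = 0)) s
      ((800 * s.reg regV + 800) * (n + 1)) := by
  obtain ⟨E, hE⟩ : ∃ E, s.reg regE = E := ⟨_, rfl⟩
  obtain ⟨V, hV⟩ : ∃ V, s.reg regV = V := ⟨_, rfl⟩
  have hk := h.market
  simp only [PopularAt, hE, hV] at hk ⊢
  have hEV := hk.tree.le
  -- The budget is split into the two maximum matchings and the remaining passes, which are linear
  -- in `V` and `n`.
  have hmul : (800 * V + 800) * (n + 1) = 2 * ((220 * V + 240) * (n + 1)) +
    (360 * V + 320) * n + (360 * V + 320) := by ring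
  have hmul' : 320 * n ≤ (360 * V + 320) * n := Nat.mul_le_mul_right _ (by omega)
  -- the best edges
  refine wp.then (minPass_spec (P := fun _ => True) (by decide) (by decide)
    (fun _ _ _ => by simp [Expr.eval]) h.mn) ?_
    (T' := 2 * ((220 * V + 240) * (n + 1)) + 310 * V + 320 * n + 200) (by omega)
  intro s1 p1 F1
  refine wp.then flagBest_spec ?_ (T' := 2 * ((220 * V + 240) * (n + 1)) + 280 * V + 320 * n + 190)
    (by have : s1.reg regE = E := (F1.reg _ (by decide)).trans hE
        omega)
  intro s2 p2 F2
  have e2 : s2.reg regE = E := ((F2.reg _ (by decide)).trans (F1.reg _ (by decide))).trans hE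
  have v2 : s2.reg regV = V := ((F2.reg _ (by decide)).trans (F1.reg _ (by decide))).trans hV
  have o2 : s2.arr arrOwn = s.arr arrOwn := (F2.arr _ (by decide)).trans (F1.arr _ (by decide))
  have a2 : s2.arr arrPar = s.arr arrPar := (F2.arr _ (by decide)).trans (F1.arr _ (by decide))
  have m2 : s2.arr arrMate = s.arr arrMate := (F2.arr _ (by decide)).trans (F1.arr _ (by decide))
  have adm : ∀ e, 1 ≤ e → e ≤ E → (s2.arr arrRem e ≠ 0 ↔
      Best E (s.arr arrOwn) (s.arr arrRank) (fun e => s.arr arrDead e = 0) e) := by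
    intro e h1 h2
    have hmin : MinAt (s.arr arrOwn) (s.arr arrRank) (fun e => s.arr arrDead e = 0)
        (s1.arr arrMn) (E + 1) := by simpa [hE] using p1
    have d1 : s1.arr arrDead = s.arr arrDead := F1.arr _ (by decide)
    have o1 : s1.arr arrOwn = s.arr arrOwn := F1.arr _ (by decide)
    have r1 : s1.arr arrRank = s.arr arrRank := F1.arr _ (by decide)
    rw [p2.1 e h1 (by rw [F1.reg regE (by decide), hE]; exact h2), d1, o1, r1]
    split_ifs with hd
    · exact hmin.best_iff h1 h2 hd
    · simp only [ne_eq, not_true_eq_false, false_iff]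
      exact fun hb => hd hb.1
  have f2 : FlowAt n cap s2 := by
    simp only [FlowAt, e2, v2, o2, a2]
    refine ⟨hk.tree, hk.own_mem, fun a _ _ h0 => absurd ?_ h0, fun v h1 h2 => ?_⟩
    · rw [m2]; exact h.mate a
    · have h3 : cnt n (s.arr arrPar) (s2.arr arrMate) v = 0 := by
        refine Finset.sum_eq_zero fun a _ => ind_neg fun hc => hc.1 ?_
        rw [m2]; exact h.mate a
      rw [h3, p2.2 v (by rw [F1.reg regE (by decide), hE]; exact h1), F1.arr arrRem (by decide),
        h.rem v (by omega) (by omega), Nat.add_zero]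
  -- a maximum matching of the best edges
  refine wp.then (maxMatch_spec f2) ?_
    (T' := (220 * V + 240) * (n + 1) + 280 * V + 320 * n + 180) (by rw [v2]; omega)
  rintro s3 ⟨f3, i3, g3⟩ F3
  have e3 : s3.reg regE = E := (F3.reg _ (by decide)).trans e2
  have v3 : s3.reg regV = V := (F3.reg _ (by decide)).trans v2
  have o3 : s3.arr arrOwn = s.arr arrOwn := (F3.arr _ (by decide)).trans o2
  have a3 : s3.arr arrPar = s.arr arrPar := (F3.arr _ (by decide)).trans a2
  have d3 : s3.arr arrDead = s.arr arrDead := (F3.arr _ (by decide)).trans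
    ((F2.arr _ (by decide)).trans (F1.arr _ (by decide)))
  have r3 : s3.arr arrRank = s.arr arrRank := (F3.arr _ (by decide)).trans
    ((F2.arr _ (by decide)).trans (F1.arr _ (by decide)))
  have mn3 : s3.arr arrMn = s1.arr arrMn := (F3.arr _ (by decide)).trans (F2.arr _ (by decide))
  have sm3 : s3.arr arrSm = s.arr arrSm := (F3.arr _ (by decide)).trans
    ((F2.arr _ (by decide)).trans (F1.arr _ (by decide)))
  obtain ⟨gd1, gd2, gd3⟩ := g3
  simp only [FlowAt, e3, v3, o3, a3] at f3 gd1 gd2 gd3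
  have first : BestMax n E V (s.arr arrOwn) (s.arr arrPar) cap (s.arr arrRank)
      (fun e => s.arr arrDead e = 0) (s3.arr arrRem) (s3.arr arrMate) :=
    ⟨f3, fun e h1 h2 => by rw [i3.flag e (by rw [e2]; exact h2)]; exact adm e h1 h2, gd3⟩
  -- the admissible edges of the second phase
  refine wp.then (minPass_spec (P := fun e => s3.arr arrVis (s.arr arrPar e) ≠ 0) (by decide)
    (by decide) (fun s' hv hp => by simp [Expr.eval, hv, hp, a3]) (by rw [sm3]; exact h.sm)) ?_
    (T' := (220 * V + 240) * (n + 1) + 230 * V + 320 * n + 170) (by rw [e3]; omega)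
  intro s4 p4 F4
  rw [o3, r3, d3, e3] at p4
  refine wp.then flagSecond_spec ?_ (T' := (220 * V + 240) * (n + 1) + 180 * V + 320 * n + 160)
    (by have : s4.reg regE = E := (F4.reg _ (by decide)).trans e3
        omega)
  intro s5 p5 F5
  have second : ∀ e, 1 ≤ e → e ≤ E → (s5.arr arrRem e ≠ 0 ↔
      Second n E V (s.arr arrOwn) (s.arr arrPar) (s.arr arrRank) (fun e => s.arr arrDead e = 0)
        (s3.arr arrRem) (s3.arr arrMate) e) := by
    intro e h1 h2
    have hnode := hk.tree.edge e h1 h2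
    rw [p5.1 e h1 (by rw [F4.reg regE (by decide), e3]; exact h2), F4.arr arrDead (by decide),
      F4.arr arrVis (by decide), F4.arr arrPar (by decide), F4.arr arrGd (by decide),
      F4.arr arrOwn (by decide), F4.arr arrMn (by decide), F4.arr arrRank (by decide), d3, a3, o3,
      r3, mn3]
    have hmin : MinAt (s.arr arrOwn) (s.arr arrRank) (fun e => s.arr arrDead e = 0)
        (s1.arr arrMn) (E + 1) := by simpa [hE] using p1
    have hmin' : MinAt (s.arr arrOwn) (s.arr arrRank) (fun e => s.arr arrDead e = 0 ∧
        s3.arr arrVis (s.arr arrPar e) ≠ 0) (s4.arr arrSm) (E + 1) := p4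
    have hcongr : Best E (s.arr arrOwn) (s.arr arrRank) (fun e => s.arr arrDead e = 0 ∧
        s3.arr arrVis (s.arr arrPar e) ≠ 0) e ↔ Best E (s.arr arrOwn) (s.arr arrRank)
        (fun e => s.arr arrDead e = 0 ∧ Good n E V (s.arr arrOwn) (s.arr arrPar) (s3.arr arrRem)
          (s3.arr arrMate) (s.arr arrPar e)) e := by
      refine and_congr (and_congr_right fun _ => gd1 _ hnode) (forall₃_congr fun e' g1 g2 =>
        imp_congr_right fun _ => imp_congr_left (and_congr_right fun _ => ?_))
      exact gd1 _ (hk.tree.edge e' g1 g2)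
    have ho : Owner E (s.arr arrOwn) (s.arr arrOwn e) := ⟨e, h1, h2, rfl⟩
    unfold Second
    rw [← hcongr, ← gd2 _ ho, not_not]
    by_cases hd : s.arr arrDead e = 0
    · rw [if_pos hd]
      by_cases hv : s3.arr arrVis (s.arr arrPar e) = 0
      · rw [if_pos hv]
        have hn : ¬ Best E (s.arr arrOwn) (s.arr arrRank) (fun e => s.arr arrDead e = 0 ∧
            s3.arr arrVis (s.arr arrPar e) ≠ 0) e := fun hb => hb.1.2 hv
        by_cases hg : s3.arr arrGd (s.arr arrOwn e) = 0
        · rw [if_pos hg, hmin.best_iff h1 h2 hd]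
          tauto
        · rw [if_neg hg]
          tauto
      · rw [if_neg hv, hmin'.best_iff h1 h2 ⟨hd, hv⟩]
        -- For an edge to a good node the second alternative of `Second` is void: if the edge were
        -- best, its owner would be good.
        refine ⟨.inl, fun hb => hb.resolve_right fun hb => ?_⟩
        refine (gd2 _ ho).2 ⟨e, h1, h2, rfl, ?_, (gd1 _ hnode).1 hv⟩ hb.1
        exact (first.admissible e h1 h2).2 hb.2
    · rw [if_neg hd]
      simp only [ne_eq, not_true_eq_false, false_iff]
      rintro (hb | hb)
      · exact hd hb.1.1
      · exact hd hb.2.1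
  have e5 : s5.reg regE = E := ((F5.reg _ (by decide)).trans (F4.reg _ (by decide))).trans e3
  have v5 : s5.reg regV = V := ((F5.reg _ (by decide)).trans (F4.reg _ (by decide))).trans v3
  have o5 : s5.arr arrOwn = s.arr arrOwn :=
    ((F5.arr _ (by decide)).trans (F4.arr _ (by decide))).trans o3
  have a5 : s5.arr arrPar = s.arr arrPar :=
    ((F5.arr _ (by decide)).trans (F4.arr _ (by decide))).trans a3
  have vi5 : s5.arr arrVis = s3.arr arrVis := (F5.arr _ (by decide)).trans (F4.arr _ (by decide))
  have m5 : s5.arr arrMate = s3.arr arrMate := (F5.arr _ (by decide)).trans (F4.arr _ (by decide))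
  have rem5 : ∀ v, E < v → s5.arr arrRem v = s3.arr arrRem v := fun v hv => by
    rw [p5.2 v (by rw [F4.reg regE (by decide), e3]; exact hv), F4.arr arrRem (by decide)]
  -- detaching
  refine wp.then (detach_spec (T := Good n E V (s.arr arrOwn) (s.arr arrPar) (s3.arr arrRem)
    (s3.arr arrMate)) (by rw [e5, v5, a5]; exact hk.tree)
    (by rw [e5, v5, vi5]; exact gd1)) ?_
    (T' := (220 * V + 240) * (n + 1) + 140 * V + 320 * n + 150) (by rw [v5]; omega)
  intro s6 det F6
  rw [e5, v5, a5] at det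
  have e6 : s6.reg regE = E := (F6.reg _ (by decide)).trans e5
  have v6 : s6.reg regV = V := (F6.reg _ (by decide)).trans v5
  have o6 : s6.arr arrOwn = s.arr arrOwn := (F6.arr _ (by decide)).trans o5
  have m6 : s6.arr arrMate = s3.arr arrMate := (F6.arr _ (by decide)).trans m5
  have rem6 : s6.arr arrRem = s5.arr arrRem := F6.arr _ (by decide)
  have f6 : FlowAt n (detachedCap n (s6.arr arrPar) (s3.arr arrRem) (s3.arr arrMate)) s6 := by
    simp only [FlowAt, e6, v6, o6, m6, rem6]
    exact first.flow_detached hk det (fun v h1 _ => rem5 v h1) second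
  -- a maximum matching of the admissible edges
  refine wp.then (maxMatch_spec f6) ?_ (T' := 140 * V + 320 * n + 140) (by rw [v6]; omega)
  rintro s7 ⟨f7, i7, g7⟩ F7
  have e7 : s7.reg regE = E := (F7.reg _ (by decide)).trans e6
  have v7 : s7.reg regV = V := (F7.reg _ (by decide)).trans v6
  have o7 : s7.arr arrOwn = s.arr arrOwn := (F7.arr _ (by decide)).trans o6
  have a7 : s7.arr arrPar = s6.arr arrPar := F7.arr _ (by decide)
  have gd7 := g7.stuck
  simp only [FlowAt, e7, v7, o7, a7] at f7 gd7
  have smax : SecondMax n E V (s.arr arrOwn) (s.arr arrPar) cap (s.arr arrRank)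
      (fun e => s.arr arrDead e = 0) (s3.arr arrRem) (s3.arr arrMate) (s6.arr arrPar) (s7.arr arrRem)
      (s7.arr arrMate) := by
    refine ⟨hk, first, det, f7, fun e h1 h2 => ?_, gd7, fun v h1 h2 h3 => ?_⟩
    · rw [i7.flag e (by rw [e6]; exact h2), rem6]; exact second e h1 h2
    · rw [← rem5 v h1, ← rem6]
      exact i7.top v (by rw [e6]; exact h1) (by rw [v6]; exact h2) h3
  have n7 : s7.reg regN = n := by
    rw [F7.reg _ (by decide), F6.reg _ (by decide), F5.reg _ (by decide), F4.reg _ (by decide),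
      F3.reg _ (by decide), F2.reg _ (by decide), F1.reg _ (by decide), h.applicants]
  have post7 : s7.arr arrPost = s.arr arrPost := by
    rw [F7.arr _ (by decide), F6.arr _ (by decide), F5.arr _ (by decide), F4.arr _ (by decide),
      F3.arr _ (by decide), F2.arr _ (by decide), F1.arr _ (by decide)]
  refine ((output_spec (s := s7)).weaken (by rw [e7, n7]; omega)).mono ?_
  rintro s8 _ - ⟨h8, h9, h10⟩
  rw [e7, o7] at h8 h9
  rw [n7, post7] at h10
  refine ⟨fun ⟨M, hM⟩ => ?_, fun hno => h9 fun hfull => hno ⟨_, smax.popular hfull⟩⟩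
  have hfull := smax.full hM
  exact ⟨h8 hfull, _, smax.popular hfull, h10⟩

end RAM

/-! ### Instances as forests -/

namespace CPMInstance

open Forest Finset

variable {n m : ℕ}

/-- The edges of the instance, and for every applicant with an edge a last resort, are numbered from
`1` to `E`. -/
structure EdgeTable (I : CPMInstance n m) (E : ℕ) (own post rnk : ℕ → ℕ) : Prop where
  post_zero : post 0 = 0
  entry : ∀ e, 1 ≤ e → e ≤ E → ∃ a : Fin n, own e = a.val + 1 ∧
    ((post e = 0 ∧ ∀ p, (a, p) ∈ I.edges → I.rank a p < rnk e) ∨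
      ∃ p : Fin m, post e = p.val + 1 ∧ (a, p) ∈ I.edges ∧ rnk e = I.rank a p)
  inj : ∀ e e', 1 ≤ e → e ≤ E → 1 ≤ e' → e' ≤ E → own e = own e' → post e = post e' → e = e'
  edge : ∀ (a : Fin n) (p : Fin m), (a, p) ∈ I.edges →
    ∃ e, (1 ≤ e ∧ e ≤ E) ∧ own e = a.val + 1 ∧ post e = p.val + 1
  last : ∀ e, 1 ≤ e → e ≤ E → ∃ l, (1 ≤ l ∧ l ≤ E) ∧ own l = own e ∧ post l = 0

/-- The edges to the members of the set `S` of neighbours of `p` are those below the node `v`. -/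
def Spans (E : ℕ) (own post par : ℕ → ℕ) (v : ℕ) (p : Fin m) (S : Finset (Fin n)) : Prop :=
  ∀ e, 1 ≤ e → e ≤ E → (Anc par v e ↔ post e = p.val + 1 ∧ ∃ a ∈ S, own e = a.val + 1)

def nbrSet (I : CPMInstance n m) (p : Fin m) : Finset (Fin n) := univ.filter fun a => (a, p) ∈ I.edges

/-- The posts with neighbours and their nonempty classes are the nodes of a forest. -/
structure NodeTable (I : CPMInstance n m) (E V : ℕ) (own post par cap dead : ℕ → ℕ) : Prop where
  tree : Tree E V par
  node : ∀ v, E < v → v ≤ V → ∃ (p : Fin m) (S : Finset (Fin n)), Spans E own post par v p S ∧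
    ((S = I.nbrSet p ∧ cap v = I.quota p) ∨ (S ∈ I.classes p ∧ cap v = I.classQuota p S))
  root : ∀ p, (I.nbrSet p).Nonempty → ∃ v, (E < v ∧ v ≤ V) ∧ Spans E own post par v p (I.nbrSet p) ∧
    cap v = I.quota p
  cls : ∀ p, ∀ C ∈ I.classes p, C.Nonempty → ∃ v, (E < v ∧ v ≤ V) ∧ Spans E own post par v p C ∧
    cap v = I.classQuota p C
  dead : ∀ e, 1 ≤ e → e ≤ E → (dead e = 0 ↔ ∀ v, E < v → v ≤ V → Anc par v e → cap v ≠ 0)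

/-- The matching that consists of the edges `mate a`. -/
def ofMate (post mate : ℕ → ℕ) : Finset (Fin n × Fin m) :=
  univ.filter fun x => mate (x.1.val + 1) ≠ 0 ∧ post (mate (x.1.val + 1)) = x.2.val + 1

theorem mem_ofMate {post mate : ℕ → ℕ} {a : Fin n} {p : Fin m} :
    (a, p) ∈ ofMate post mate ↔ mate (a.val + 1) ≠ 0 ∧ post (mate (a.val + 1)) = p.val + 1 := by
  simp [ofMate]

theorem sum_Icc_eq {M : Type*} [AddCommMonoid M] (f : ℕ → M) :
    ∑ a ∈ Icc 1 n, f a = ∑ a : Fin n, f (a.val + 1) := by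
  rw [Fin.sum_univ_eq_sum_range fun i => f (i + 1), Finset.range_eq_Ico,
    Finset.sum_Ico_add' f 0 n 1]
  rfl

variable {I : CPMInstance n m} {E V : ℕ} {own post rnk par cap dead mate mate' : ℕ → ℕ}

/-- All nodes span edges of proper posts, while last resorts have post `0`. So a last resort lies in
no class and is live. -/
theorem EdgeTable.market (h : I.EdgeTable E own post rnk)
    (h' : I.NodeTable E V own post par cap dead) :
    Market n E V own par cap rnk (fun e => dead e = 0) where
  tree := h'.tree
  own_mem e h1 h2 := by
    obtain ⟨a, ha, _⟩ := h.entry e h1 h2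
    omega
  last e h1 h2 := by
    obtain ⟨l, hl, ho, hp⟩ := h.last e h1 h2
    have hanc : ∀ v, E < v → v ≤ V → ¬ Anc par v l := by
      intro v h3 h4 h5
      obtain ⟨p, S, hs, _⟩ := h'.node v h3 h4
      have := ((hs l hl.1 hl.2).1 h5).1
      omega
    refine ⟨l, hl, ho, ?_, (h'.dead l hl.1 hl.2).2 fun v h3 h4 h5 => absurd h5 (hanc v h3 h4)⟩
    rcases h'.tree.edge l hl.1 hl.2 with h3 | h3
    · exact h3
    · exact absurd (anc_iff.2 (.inr (Anc.refl _ _))) (hanc _ h3.1 h3.2)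
  cap_pos e h1 h2 hl v h3 h4 ha := Nat.one_le_iff_ne_zero.2 ((h'.dead e h1 h2).1 hl v h3 h4 ha)
  dead e h1 h2 hl := by
    rw [h'.dead e h1 h2] at hl
    push Not at hl
    exact hl

/-- `mate` assigns edges to their owners. -/
def Assigns (n E : ℕ) (own mate : ℕ → ℕ) : Prop :=
  ∀ a, 1 ≤ a → a ≤ n → mate a ≠ 0 → (1 ≤ mate a ∧ mate a ≤ E) ∧ own (mate a) = a

theorem cnt_eq (hm : Assigns n E own mate) {v : ℕ} {p : Fin m} {S : Finset (Fin n)}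
    (hs : Spans E own post par v p S) :
    cnt n par mate v = (applicantsOf (ofMate post mate) p ∩ S).card := by
  rw [cnt, sum_Icc_eq, Finset.card_eq_sum_ones, ← Finset.sum_filter_add_sum_filter_not univ
    (fun a => a ∈ applicantsOf (ofMate post mate) p ∩ S)]
  have key : ∀ a : Fin n, (mate (a.val + 1) ≠ 0 ∧ Anc par v (mate (a.val + 1))) ↔
      a ∈ applicantsOf (ofMate post mate) p ∩ S := by
    intro a
    simp only [applicantsOf, mem_inter, Finset.mem_filter, Finset.mem_univ, true_and, mem_ofMate]
    rw [and_assoc]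
    refine and_congr_right fun h0 => ?_
    obtain ⟨h1, h2⟩ := hm (a.val + 1) (by omega) (by omega) h0
    rw [hs _ h1.1 h1.2, h2]
    refine and_congr_right fun _ => ⟨?_, fun h => ⟨a, h, rfl⟩⟩
    rintro ⟨b, hb, hab⟩
    rwa [Fin.ext (by omega : a.val = b.val)]
  have h2 : ∑ a ∈ univ.filter (fun a => ¬ a ∈ applicantsOf (ofMate post mate) p ∩ S),
      ind (mate (a.val + 1) ≠ 0 ∧ Anc par v (mate (a.val + 1))) = 0 :=
    Finset.sum_eq_zero fun a ha => ind_neg fun h => (Finset.mem_filter.1 ha).2 ((key a).1 h)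
  rw [h2, add_zero, Finset.filter_univ_mem]
  exact Finset.sum_congr rfl fun a ha => ind_pos ((key a).2 ha)

theorem Assigns.mem_edges (hm : Assigns n E own mate) (h : I.EdgeTable E own post rnk)
    {a : Fin n} {p : Fin m} (hap : (a, p) ∈ ofMate post mate) :
    (a, p) ∈ I.edges ∧ rnk (mate (a.val + 1)) = I.rank a p := by
  rw [mem_ofMate] at hap
  obtain ⟨h1, h2⟩ := hm (a.val + 1) (by omega) (by omega) hap.1
  obtain ⟨b, hb, h3⟩ := h.entry _ h1.1 h1.2
  obtain rfl : b = a := Fin.ext (by omega)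
  obtain ⟨p', h4, h5⟩ := h3.resolve_left fun h => by omega
  obtain rfl : p' = p := Fin.ext (by omega)
  exact h5

/-- Posts without neighbours and empty classes have no node, but their quotas hold trivially. -/
theorem NodeTable.feasible (h' : I.NodeTable E V own post par cap dead)
    (h : I.EdgeTable E own post rnk) (hm : Complete n E V own par cap mate) :
    I.Feasible (ofMate post mate) where
  subset_edges := fun ⟨a, p⟩ hx => (Assigns.mem_edges hm.mem h hx).1
  applicant_quota a := by
    refine Finset.card_le_one.2 fun p hp q hq => ?_
    simp only [postsOf, Finset.mem_filter, Finset.mem_univ, true_and, mem_ofMate] at hp hq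
    exact Fin.ext (by omega)
  post_quota p := by
    have hsub : applicantsOf (ofMate post mate) p ⊆ I.nbrSet p := fun a ha => by
      simp only [applicantsOf, Finset.mem_filter, Finset.mem_univ, true_and] at ha
      simpa [nbrSet] using (Assigns.mem_edges hm.mem h ha).1
    rcases (I.nbrSet p).eq_empty_or_nonempty with h0 | h0
    · rw [h0, Finset.subset_empty] at hsub
      simp [hsub]
    · obtain ⟨v, hv, hs, hc⟩ := h'.root p h0
      have h1 := hm.cnt_le v hv.1 hv.2
      rwa [cnt_eq hm.mem hs, Finset.inter_eq_left.2 hsub, hc] at h1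
  class_quota p C hC := by
    rcases C.eq_empty_or_nonempty with rfl | h0
    · simp
    · obtain ⟨v, hv, hs, hc⟩ := h'.cls p C hC h0
      have h1 := hm.cnt_le v hv.1 hv.2
      rwa [cnt_eq hm.mem hs, hc] at h1

/-- Unmatched applicants are sent to their last resorts if they have an edge, and get the value `0`
otherwise. -/
theorem Feasible.exists_mate {M : Finset (Fin n × Fin m)} (hM : I.Feasible M)
    (h : I.EdgeTable E own post rnk) (h' : I.NodeTable E V own post par cap dead) :
    ∃ mate, Complete n E V own par cap mate ∧ ofMate post mate = M := by
  have key : ∀ a : Fin n, ∃ f, (∀ p, (a, p) ∈ M → (1 ≤ f ∧ f ≤ E) ∧ own f = a.val + 1 ∧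
      post f = p.val + 1) ∧ ((∀ p, (a, p) ∉ M) → f ≠ 0 → (1 ≤ f ∧ f ≤ E) ∧ own f = a.val + 1 ∧
      post f = 0) ∧ ∀ e, 1 ≤ e → e ≤ E → own e = a.val + 1 → f ≠ 0 := by
    intro a
    by_cases h1 : ∃ p, (a, p) ∈ M
    · obtain ⟨p, hp⟩ := h1
      obtain ⟨e, he, ho, hpe⟩ := h.edge a p (hM.subset_edges hp)
      refine ⟨e, fun q hq => ?_, fun h => absurd hp (h p), fun _ _ _ _ => by omega⟩
      have := Finset.card_le_one.1 (hM.applicant_quota a) p (by simpa [postsOf] using hp) q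
        (by simpa [postsOf] using hq)
      exact ⟨he, ho, this ▸ hpe⟩
    · by_cases h2 : ∃ e, (1 ≤ e ∧ e ≤ E) ∧ own e = a.val + 1
      · obtain ⟨e, he, ho⟩ := h2
        obtain ⟨l, hl, hlo, hlp⟩ := h.last e he.1 he.2
        exact ⟨l, fun p hp => absurd ⟨p, hp⟩ h1, fun _ _ => ⟨hl, hlo.trans ho, hlp⟩,
          fun _ _ _ _ => by omega⟩
      · exact ⟨0, fun p hp => absurd ⟨p, hp⟩ h1, fun _ h => absurd rfl h,
          fun e e1 e2 e3 => absurd ⟨e, ⟨e1, e2⟩, e3⟩ h2⟩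
  choose g g1 g2 g3 using key
  refine ⟨fun x => if hx : 1 ≤ x ∧ x ≤ n then g ⟨x - 1, by omega⟩ else 0, ?_⟩
  set mate : ℕ → ℕ := fun x => if hx : 1 ≤ x ∧ x ≤ n then g ⟨x - 1, by omega⟩ else 0 with hmate
  have hg : ∀ a : Fin n, mate (a.val + 1) = g a := fun a => by
    simp only [hmate]
    rw [dif_pos ⟨by omega, by omega⟩]
    rfl
  have hof : ofMate post mate = M := by
    ext ⟨a, p⟩
    rw [mem_ofMate, hg]
    constructor
    · rintro ⟨h0, hp⟩
      by_cases h1 : ∃ q, (a, q) ∈ M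
      · obtain ⟨q, hq⟩ := h1
        have := (g1 a q hq).2.2
        rwa [Fin.ext (by omega : p.val = q.val)]
      · have := (g2 a (fun q hq => h1 ⟨q, hq⟩) h0).2.2
        omega
    · intro hp
      have := g1 a p hp
      exact ⟨by omega, this.2.2⟩
  have hass : Assigns n E own mate := by
    intro x h1 h2 h0
    obtain ⟨a, rfl⟩ : ∃ a : Fin n, x = a.val + 1 := ⟨⟨x - 1, by omega⟩, by simp; omega⟩
    rw [hg] at h0 ⊢
    by_cases h3 : ∃ q, (a, q) ∈ M
    · obtain ⟨q, hq⟩ := h3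
      exact ⟨(g1 a q hq).1, (g1 a q hq).2.1⟩
    · have := g2 a (fun q hq => h3 ⟨q, hq⟩) h0
      exact ⟨this.1, this.2.1⟩
  refine ⟨⟨hass, fun e h1 h2 => ?_, fun v h1 h2 => ?_⟩, hof⟩
  · obtain ⟨a, ha, _⟩ := h.entry e h1 h2
    rw [ha, hg]
    exact g3 a e h1 h2 ha
  · obtain ⟨p, S, hs, hc⟩ := h'.node v h1 h2
    rw [cnt_eq hass hs, hof]
    rcases hc with ⟨_, hc⟩ | ⟨hS, hc⟩
    · rw [hc]
      exact (Finset.card_le_card Finset.inter_subset_left).trans (hM.post_quota p)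
    · rw [hc]; exact hM.class_quota p S hS

/-- The last resort is ranked strictly after all neighbours, so comparing ranks also treats
unmatched applicants correctly. If both matchings use a last resort, it is the same edge and nobody
votes. -/
theorem EdgeTable.prefers_iff (h : I.EdgeTable E own post rnk) (hm : Assigns n E own mate)
    (hm' : Assigns n E own mate') {a : Fin n} (h0 : mate (a.val + 1) ≠ 0 ↔ mate' (a.val + 1) ≠ 0) :
    I.Prefers a (ofMate post mate) (ofMate post mate') ↔
      rnk (mate (a.val + 1)) < rnk (mate' (a.val + 1)) := by
  simp only [Prefers, postsOf, Finset.mem_filter, Finset.mem_univ, true_and]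
  by_cases h1 : mate (a.val + 1) = 0
  · have h2 : mate' (a.val + 1) = 0 := by tauto
    rw [h1, h2]
    refine iff_of_false ?_ (lt_irrefl _)
    rintro ⟨p, hp, _⟩
    exact (mem_ofMate.1 hp).1 h1
  have h2 := h0.1 h1
  obtain ⟨e1, e2⟩ := hm _ (by omega) (by omega) h1
  obtain ⟨f1, f2⟩ := hm' _ (by omega) (by omega) h2
  obtain ⟨b, hb, hb'⟩ := h.entry _ e1.1 e1.2
  obtain rfl : b = a := Fin.ext (by omega)
  obtain ⟨c, hc, hc'⟩ := h.entry _ f1.1 f1.2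
  obtain rfl : c = b := Fin.ext (by omega)
  constructor
  · rintro ⟨p, hp, hlt⟩
    have hp1 := hm.mem_edges h hp
    rcases hc' with ⟨_, hc'⟩ | ⟨q, hq, _, hr⟩
    · rw [hp1.2]; exact hc' p hp1.1
    · rw [hp1.2, hr]; exact hlt q (mem_ofMate.2 ⟨h2, hq⟩)
  · intro hlt
    rcases hb' with ⟨hb0, hb'⟩ | ⟨p, hp, _, hr⟩
    · rcases hc' with ⟨hc0, _⟩ | ⟨q, hq, he, hr⟩
      · rw [h.inj _ _ e1.1 e1.2 f1.1 f1.2 (by omega) (by omega)] at hlt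
        exact absurd hlt (lt_irrefl _)
      · have := hb' q he
        omega
    · refine ⟨p, mem_ofMate.2 ⟨h1, hp⟩, fun q hq => ?_⟩
      have := (hm'.mem_edges h hq).2
      omega

theorem EdgeTable.sum_vote (h : I.EdgeTable E own post rnk) (hm : Complete n E V own par cap mate)
    (hm' : Complete n E V own par cap mate') :
    ∑ a ∈ Icc 1 n, vote rnk (mate a) (mate' a) =
      (I.votes (ofMate post mate) (ofMate post mate') : ℤ) -
        I.votes (ofMate post mate') (ofMate post mate) := by
  classical
  have hiff : ∀ a : Fin n, mate (a.val + 1) ≠ 0 ↔ mate' (a.val + 1) ≠ 0 := by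
    intro a
    constructor <;> intro h0
    · obtain ⟨h1, h2⟩ := hm.mem _ (by omega) (by omega) h0
      have := hm'.full _ h1.1 h1.2
      rwa [h2] at this
    · obtain ⟨h1, h2⟩ := hm'.mem _ (by omega) (by omega) h0
      have := hm.full _ h1.1 h1.2
      rwa [h2] at this
  rw [sum_Icc_eq, votes, votes, Finset.card_filter, Finset.card_filter, Nat.cast_sum, Nat.cast_sum,
    ← Finset.sum_sub_distrib]
  refine Finset.sum_congr rfl fun a _ => ?_
  rw [h.prefers_iff hm.mem hm'.mem (hiff a), h.prefers_iff hm'.mem hm.mem (hiff a).symm]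
  unfold vote
  split_ifs <;> omega

theorem EdgeTable.popular (h : I.EdgeTable E own post rnk)
    (h' : I.NodeTable E V own post par cap dead) (hm : PopularMate n E V own par cap rnk mate) :
    I.Popular (ofMate post mate) := by
  refine ⟨h'.feasible h hm.complete, fun M' hM' hmore => ?_⟩
  obtain ⟨N, hN, rfl⟩ := hM'.exists_mate h h'
  have h1 := hm.le N hN
  rw [h.sum_vote hN hm.complete] at h1
  unfold MorePopular at hmore
  omega

theorem Popular.exists_mate {M : Finset (Fin n × Fin m)} (hM : I.Popular M)
    (h : I.EdgeTable E own post rnk) (h' : I.NodeTable E V own post par cap dead) :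
    ∃ mate, PopularMate n E V own par cap rnk mate := by
  obtain ⟨mate, hc, rfl⟩ := hM.1.exists_mate h h'
  refine ⟨mate, hc, fun N hN => ?_⟩
  have h1 := hM.2 _ (h'.feasible h hN)
  rw [h.sum_vote hN hc]
  unfold MorePopular at h1
  omega

theorem EdgeTable.correctAnswer (h : I.EdgeTable E own post rnk)
    (h' : I.NodeTable E V own post par cap dead) {s : RAM.State}
    (h1 : (∃ M, PopularMate n E V own par cap rnk M) → s.arr 1 0 = 1 ∧
      ∃ M, PopularMate n E V own par cap rnk M ∧ ∀ a, 1 ≤ a → a ≤ n → s.arr 1 a = post (M a))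
    (h2 : (¬ ∃ M, PopularMate n E V own par cap rnk M) → s.arr 1 0 = 0) : I.CorrectAnswer s := by
  constructor
  · rintro ⟨M, hM⟩
    obtain ⟨h3, mate, h4, h5⟩ := h1 (hM.exists_mate h h')
    refine ⟨h3, _, h.popular h' h4, fun a => ?_⟩
    rw [h5 _ (by omega) (by omega)]
    refine ⟨fun p hp => (mem_ofMate.1 hp).2, fun hno => ?_⟩
    by_cases h0 : mate (a.val + 1) = 0
    · rw [h0, h.post_zero]
    · obtain ⟨e1, e2⟩ := h4.complete.mem _ (by omega) (by omega) h0
      obtain ⟨b, hb, hb'⟩ := h.entry _ e1.1 e1.2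
      rcases hb' with ⟨hb', _⟩ | ⟨p, hp, _⟩
      · exact hb'
      · exact absurd (mem_ofMate.2 ⟨h0, hp⟩) (hno p)
  · intro hno
    exact h2 fun ⟨mate, hm⟩ => hno ⟨_, h.popular h' hm⟩

end CPMInstance

/-! ### The size of laminar families -/

section Laminar

variable {α : Type*} [DecidableEq α]

/-- A laminar family of nonempty subsets of `S` has at most `2 * S.card` members. -/
theorem card_le_of_laminar (S : Finset α) (F : Finset (Finset α))
    (hF : ∀ C ∈ F, ∀ D ∈ F, C ⊆ D ∨ D ⊆ C ∨ C ∩ D = ∅)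
    (hS : ∀ C ∈ F, C ⊆ S ∧ C.Nonempty) : F.card ≤ 2 * S.card := by
  induction S using Finset.induction_on generalizing F with
  | empty =>
    rw [Finset.eq_empty_of_forall_notMem (s := F) fun C hC => ?_]
    · simp
    · obtain ⟨h1, x, hx⟩ := hS C hC
      exact absurd (h1 hx) (Finset.notMem_empty x)
  | insert x S hx ih =>
    set A := F.filter fun C => x ∉ C with hA
    set B := F.filter fun C => x ∈ C with hB
    set B' := (B.image fun C => C.erase x).erase ∅ with hB'
    have hmA : ∀ C, C ∈ A ↔ C ∈ F ∧ x ∉ C := fun C => by simp [hA]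
    have hmB : ∀ C, C ∈ B ↔ C ∈ F ∧ x ∈ C := fun C => by simp [hB]
    have hmB' : ∀ C, C ∈ B' ↔ C.Nonempty ∧ ∃ D, (D ∈ F ∧ x ∈ D) ∧ D.erase x = C := fun C => by
      simp only [hB', Finset.mem_erase, Finset.mem_image, hmB, Finset.nonempty_iff_ne_empty]
    have hcard : F.card = B.card + A.card := (Finset.card_filter_add_card_filter_not _).symm
    -- Erasing `x` is injective on sets that contain `x`; only the set `{x}` is lost.
    have hcB : B.card ≤ B'.card + 1 := by
      have h1 : (B.image fun C => C.erase x).card = B.card := by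
        refine Finset.card_image_of_injOn fun C hC D hD h => ?_
        have hC := ((hmB C).1 hC).2
        have hD := ((hmB D).1 hD).2
        have h : C.erase x = D.erase x := h
        rw [← Finset.insert_erase hC, h, Finset.insert_erase hD]
      have h2 : (B.image fun C => C.erase x).card - 1 ≤ B'.card := Finset.pred_card_le_card_erase
      omega
    -- At most one set occurs both with and without `x`. Let `T₁` and `T₂` be two of them, with `D₁
    -- ⊆ D₂` their extensions by `x`. Then `T₂` meets `D₁` and does not contain `x`, so laminarity
    -- gives `T₂ ⊆ D₁`, and thus `T₂ ⊆ T₁`. So a new point accounts for at most two additional sets.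
    have hinter : (A ∩ B').card ≤ 1 := by
      have key : ∀ T₁ ∈ A ∩ B', ∀ T₂ ∈ A ∩ B', ∀ D₁ D₂, D₁ ∈ F → D₂ ∈ F → D₁.erase x = T₁ →
          D₂.erase x = T₂ → x ∈ D₁ → D₁ ⊆ D₂ → T₂ ⊆ T₁ := by
        intro T₁ h₁ T₂ h₂ D₁ D₂ d₁ d₂ e₁ e₂ hxD hsub
        rw [Finset.mem_inter, hmA, hmB'] at h₁ h₂
        have hsub' : T₁ ⊆ T₂ := by rw [← e₁, ← e₂]; exact Finset.erase_subset_erase x hsub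
        have hT₁ : T₁ ⊆ D₁ := by rw [← e₁]; exact Finset.erase_subset x D₁
        rcases hF D₁ d₁ T₂ h₂.1.1 with h | h | h
        · exact absurd (h hxD) h₂.1.2
        · intro y hy
          rw [← e₁, Finset.mem_erase]
          exact ⟨by rintro rfl; exact h₂.1.2 hy, h hy⟩
        · obtain ⟨y, hy⟩ := h₁.2.1
          have : y ∈ D₁ ∩ T₂ := Finset.mem_inter.2 ⟨hT₁ hy, hsub' hy⟩
          rw [h] at this
          exact absurd this (Finset.notMem_empty y)
      refine Finset.card_le_one.2 fun T₁ h₁ T₂ h₂ => ?_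
      obtain ⟨D₁, ⟨d₁, x₁⟩, e₁⟩ := ((hmB' T₁).1 (Finset.mem_inter.1 h₁).2).2
      obtain ⟨D₂, ⟨d₂, x₂⟩, e₂⟩ := ((hmB' T₂).1 (Finset.mem_inter.1 h₂).2).2
      rcases hF D₁ d₁ D₂ d₂ with h | h | h
      · exact ((Finset.erase_subset_erase x h).trans_eq e₂ |> e₁.symm.subset.trans).antisymm
          (key T₁ h₁ T₂ h₂ D₁ D₂ d₁ d₂ e₁ e₂ x₁ h)
      · exact (key T₂ h₂ T₁ h₁ D₂ D₁ d₂ d₁ e₂ e₁ x₂ h).antisymm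
          ((Finset.erase_subset_erase x h).trans_eq e₁ |> e₂.symm.subset.trans)
      · have : x ∈ D₁ ∩ D₂ := Finset.mem_inter.2 ⟨x₁, x₂⟩
        rw [h] at this
        exact absurd this (Finset.notMem_empty x)
    have hun := Finset.card_union_add_card_inter A B'
    have hmixed : ∀ C ∈ A, ∀ D ∈ B', C ⊆ D ∨ D ⊆ C ∨ C ∩ D = ∅ := by
      intro C hC D hD
      obtain ⟨E, ⟨hE, hxE⟩, rfl⟩ := ((hmB' D).1 hD).2
      obtain ⟨hC, hxC⟩ := (hmA C).1 hC
      rcases hF C hC E hE with h | h | h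
      · refine .inl fun y hy => Finset.mem_erase.2 ⟨by rintro rfl; exact hxC hy, h hy⟩
      · exact absurd (h hxE) hxC
      · refine .inr (.inr (Finset.subset_empty.1 ?_))
        rw [← h]
        exact Finset.inter_subset_inter_left (Finset.erase_subset x E)
    have hrec := ih (A ∪ B') ?_ ?_
    · rw [Finset.card_insert_of_notMem hx]
      omega
    · intro C hC D hD
      rcases Finset.mem_union.1 hC with hC | hC <;> rcases Finset.mem_union.1 hD with hD | hD
      · exact hF C ((hmA C).1 hC).1 D ((hmA D).1 hD).1
      · exact hmixed C hC D hD
      · rcases hmixed D hD C hC with h | h | h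
        · exact .inr (.inl h)
        · exact .inl h
        · exact .inr (.inr (by rwa [Finset.inter_comm]))
      · obtain ⟨C', ⟨hC', hxC⟩, rfl⟩ := ((hmB' C).1 hC).2
        obtain ⟨D', ⟨hD', hxD⟩, rfl⟩ := ((hmB' D).1 hD).2
        rcases hF C' hC' D' hD' with h | h | h
        · exact .inl (Finset.erase_subset_erase x h)
        · exact .inr (.inl (Finset.erase_subset_erase x h))
        · have : x ∈ C' ∩ D' := Finset.mem_inter.2 ⟨hxC, hxD⟩
          rw [h] at this
          exact absurd this (Finset.notMem_empty x)
    · intro C hC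
      rcases Finset.mem_union.1 hC with hC | hC
      · obtain ⟨hC, hxC⟩ := (hmA C).1 hC
        exact ⟨(Finset.subset_insert_iff_of_notMem hxC).1 (hS C hC).1, (hS C hC).2⟩
      · obtain ⟨h0, D, ⟨hD, hxD⟩, rfl⟩ := (hmB' C).1 hC
        exact ⟨Finset.subset_insert_iff.1 (hS D hD).1, h0⟩

end Laminar

/-! ### Reading the applicants -/

namespace RAM

open Forest

/-- A loop over the elements of a list. -/
theorem wp.loopList {α : Type*} {e : Expr} {c : Prog} {Q : State → ℕ → Prop} {s : State} {k : ℕ}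
    (l : List α) (J : List α → List α → State → ℕ → Prop) (h0 : J [] l s k)
    (test : ∀ pre suf s' k', l = pre ++ suf → J pre suf s' k' → (e.eval s' = 0 ↔ suf = []))
    (step : ∀ pre x suf s' k', l = pre ++ x :: suf → J pre (x :: suf) s' k' → Frame c s s' →
      ∃ r, e.cost + 1 + r ≤ k' ∧ wp c (fun s2 k2 => J (pre ++ [x]) suf s2 k2) s' r)
    (fin : ∀ s' k', J l [] s' k' → Frame c s s' → ∃ r, e.cost + 1 + r ≤ k' ∧ Q s' r) :
    wp (.loop e c) Q s k := by
  refine wp.loop (fun s' k' => ∃ pre suf, l = pre ++ suf ∧ J pre suf s' k') ⟨[], l, rfl, h0⟩ ?_ ?_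
  · rintro s' k' ⟨pre, suf, rfl, hJ⟩ hF he
    cases suf with
    | nil => exact absurd ((test pre [] s' k' rfl hJ).2 rfl) he
    | cons x suf =>
      obtain ⟨r, hr, hw⟩ := step pre x suf s' k' rfl hJ hF
      exact ⟨r, hr, hw.mono fun s2 k2 _ h2 => ⟨pre ++ [x], suf, by simp, h2⟩⟩
  · rintro s' k' ⟨pre, suf, rfl, hJ⟩ hF he
    obtain rfl := (test pre suf s' k' rfl hJ).1 he
    exact fin s' k' (by simpa using hJ) hF

/-- The list `l` is stored in `f` from position `p` on. -/
def Reads (f : ℕ → ℕ) (p : ℕ) (l : List ℕ) : Prop := ∀ j < l.length, f (p + j) = l.getD j 0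

theorem Reads.cons {f : ℕ → ℕ} {p x : ℕ} {l : List ℕ} (h : Reads f p (x :: l)) :
    f p = x ∧ Reads f (p + 1) l := by
  refine ⟨by simpa using h 0 (by simp), fun j hj => ?_⟩
  have := h (j + 1) (by simpa using hj)
  rw [List.getD_cons_succ] at this
  rw [← this]
  congr 1
  omega

theorem Reads.append {f : ℕ → ℕ} {p : ℕ} {l l' : List ℕ} (h : Reads f p (l ++ l')) :
    Reads f p l ∧ Reads f (p + l.length) l' := by
  constructor
  · intro j hj
    rw [h j (by simp; omega), List.getD_append _ _ _ _ hj]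
  · intro j hj
    have := h (l.length + j) (by simp; omega)
    rw [List.getD_append_right _ _ _ _ (by omega), Nat.add_sub_cancel_left] at this
    rw [← this, Nat.add_assoc]

notation "regD" => (15 : ℕ)
notation "regX" => (16 : ℕ)
notation "arrPhead" => (18 : ℕ)
notation "arrPnext" => (19 : ℕ)

/-- A new edge of the applicant in register `regA` to the post `p` with rank `r`. -/
def addEdge (p r : Expr) : Prog :=
  inc regE ;; .put arrOwn (.reg regE) (.reg regA) ;; .put arrPost (.reg regE) p ;;
  .put arrRank (.reg regE) r ;; .put arrPnext (.reg regE) (.get arrPhead (cell arrPost regE)) ;;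
  .put arrPhead (cell arrPost regE) (.reg regE)

def readApplicant : Prog :=
  (inc regA ;; .set regD (cell arrIn regPtr) ;; inc regPtr ;; .set regX (.const 0)) ;;
  .ite (.reg regD)
    (.loop (.reg regD)
      (addEdge (.add (cell arrIn regPtr) (.const 1)) (.get arrIn (.add (.reg regPtr) (.const 1))) ;;
        .set regX (.add (.reg regX) (.sub (.get arrIn (.add (.reg regPtr) (.const 1))) (.reg regX))) ;;
        .set regPtr (.add (.reg regPtr) (.const 2)) ;; .set regD (.sub (.reg regD) (.const 1))) ;;
      addEdge (.const 0) (.add (.reg regX) (.const 1)))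
    .skip

def readApplicants : Prog :=
  (.set regN (.get arrIn (.const 0)) ;; .set regM (.get arrIn (.const 1)) ;;
    .set regPtr (.const 2)) ;;
  .loop (.sub (.reg regN) (.reg regA)) readApplicant

/-- The owners, posts and ranks of the edges are those in the list `T`, and the edges are sorted into
buckets by their posts. -/
structure Edges (B : ℕ) (T : List (ℕ × ℕ × ℕ)) (s : State) : Prop where
  len : s.reg regE = T.length
  own : ∀ i, s.arr arrOwn (i + 1) = (T.getD i 0).1
  post_zero : s.arr arrPost 0 = 0
  post : ∀ i, s.arr arrPost (i + 1) = (T.getD i 0).2.1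
  rank : ∀ i, s.arr arrRank (i + 1) = (T.getD i 0).2.2
  buckets : Buckets B (s.arr arrPhead) (s.arr arrPnext) (s.arr arrPost) (T.length + 1)

theorem Edges.congr {B : ℕ} {T : List (ℕ × ℕ × ℕ)} {s s' : State} (h : Edges B T s)
    (h0 : s'.reg regE = s.reg regE) (h1 : ∀ k ∈ [2, 3, 4, 18, 19], s'.arr k = s.arr k) :
    Edges B T s' := by
  obtain ⟨g1, g2, g3, g4, g5, g6⟩ := h
  have h2 := h1 2 (by simp)
  have h3 := h1 3 (by simp)
  have h4 := h1 4 (by simp)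
  have h18 := h1 18 (by simp)
  have h19 := h1 19 (by simp)
  exact ⟨by rw [h0, g1], by rwa [h2], by rwa [h3], by rwa [h3], by rwa [h4],
    by rwa [h3, h18, h19]⟩

/-- The cells beyond the table hold the default value, so appending an entry is one update of the
whole array. Index `i` of the list corresponds to cell `i + 1`. -/
theorem update_getD {α : Type*} (T : List α) (x d : α) (g : α → ℕ) (f : ℕ → ℕ)
    (h : ∀ i, f (i + 1) = g (T.getD i d)) (i : ℕ) :
    Function.update f (T.length + 1) (g x) (i + 1) = g ((T ++ [x]).getD i d) := by
  rcases lt_trichotomy i T.length with h1 | rfl | h1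
  · rw [Function.update_of_ne (by omega), List.getD_append _ _ _ _ h1, h]
  · rw [Function.update_self, List.getD_append_right _ _ _ _ le_rfl, Nat.sub_self]
    rfl
  · rw [Function.update_of_ne (by omega), List.getD_append_right _ _ _ _ h1.le, h,
      List.getD_eq_default _ _ h1.le, List.getD_eq_default]
    simp only [List.length_singleton]
    omega

/-- The two expressions are evaluated after `regE` and some tables have changed, hence they may
depend on the input and on the other registers only. -/
theorem addEdge_step {B : ℕ} {T : List (ℕ × ℕ × ℕ)} {s : State} (h : Edges B T s) {p r : Expr}
    (hp : ∀ s', s'.arr arrIn = s.arr arrIn → (∀ j, j ≠ regE → s'.reg j = s.reg j) →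
      p.eval s' = p.eval s)
    (hr : ∀ s', s'.arr arrIn = s.arr arrIn → (∀ j, j ≠ regE → s'.reg j = s.reg j) →
      r.eval s' = r.eval s) :
    Edges B (T ++ [(s.reg regA, p.eval s, r.eval s)]) ((addEdge p r).step s) := by
  set s1 := (inc regE).step s with hs1
  have e1 : s1.reg regE = T.length + 1 := by simp [hs1, Prog.step, Expr.eval, h.len]
  have a1 : s1.arr = s.arr := rfl
  have r1 : ∀ j, j ≠ regE → s1.reg j = s.reg j := fun j hj => by simp [hs1, Prog.step, hj]
  set s2 := (Prog.put arrOwn (.reg regE) (.reg regA)).step s1 with hs2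
  have hp2 : p.eval s2 = p.eval s := hp s2 (by simp [hs2, Prog.step, a1]) r1
  set s3 := (Prog.put arrPost (.reg regE) p).step s2 with hs3
  have hr3 : r.eval s3 = r.eval s := hr s3 (by simp [hs3, hs2, Prog.step, a1]) r1
  set s4 := (Prog.put arrRank (.reg regE) r).step s3 with hs4
  set s5 := (Prog.put arrPnext (.reg regE) (.get arrPhead (cell arrPost regE))).step s4 with hs5
  set s6 := (Prog.put arrPhead (cell arrPost regE) (.reg regE)).step s5 with hs6
  have hres : (addEdge p r).step s = s6 := rfl
  have e2 : s2.reg = s1.reg := rfl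
  have e3 : s3.reg = s1.reg := rfl
  have e4 : s4.reg = s1.reg := rfl
  have e5 : s5.reg = s1.reg := rfl
  have e6 : s6.reg = s1.reg := rfl
  have own : s6.arr arrOwn = Function.update (s.arr arrOwn) (T.length + 1) (s.reg regA) := by
    simp [hs6, hs5, hs4, hs3, hs2, Prog.step, Expr.eval, e1, a1, r1]
  have post4 : s4.arr arrPost = Function.update (s.arr arrPost) (T.length + 1) (p.eval s) := by
    simp [hs4, hs3, Prog.step, Expr.eval, e2, e1, hp2]
    simp [hs2, Prog.step, a1]
  have post5 : s5.arr arrPost = s4.arr arrPost := by simp [hs5, Prog.step]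
  have post : s6.arr arrPost = s4.arr arrPost := by simp [hs6, Prog.step, post5]
  have rank : s6.arr arrRank = Function.update (s.arr arrRank) (T.length + 1) (r.eval s) := by
    simp [hs6, hs5, hs4, Prog.step, Expr.eval, e3, e1, hr3]
    simp [hs3, hs2, Prog.step, a1]
  have phead4 : s4.arr arrPhead = s.arr arrPhead := by simp [hs4, hs3, hs2, Prog.step, a1]
  have pnext : s6.arr arrPnext =
      Function.update (s.arr arrPnext) (T.length + 1) (s.arr arrPhead (p.eval s)) := by
    have : s4.arr arrPnext = s.arr arrPnext := by simp [hs4, hs3, hs2, Prog.step, a1]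
    simp [hs6, hs5, Prog.step, Expr.eval, e4, e1, this, phead4, post4]
  have phead : s6.arr arrPhead = Function.update (s.arr arrPhead) (p.eval s) (T.length + 1) := by
    have : s5.arr arrPhead = s.arr arrPhead := by simp [hs5, Prog.step, phead4]
    simp [hs6, Prog.step, Expr.eval, e5, e1, this, post5, post4]
  rw [hres]
  refine ⟨by rw [e6, e1]; simp, ?_, ?_, ?_, ?_, ?_⟩
  · rw [own]; exact update_getD T (s.reg regA, p.eval s, r.eval s) 0 (fun x => x.1) _ h.own
  · rw [post, post4, Function.update_of_ne (by omega)]; exact h.post_zero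
  · rw [post, post4]; exact update_getD T (s.reg regA, p.eval s, r.eval s) 0 (fun x => x.2.1) _ h.post
  · rw [rank]; exact update_getD T (s.reg regA, p.eval s, r.eval s) 0 (fun x => x.2.2) _ h.rank
  · rw [phead, pnext, post, post4, List.length_append, List.length_singleton]
    exact h.buckets.insert (by omega) (fun c hc => Function.update_of_ne (by omega) _ _)
      (Function.update_self ..)

theorem addEdge_reg {p r : Expr} {s : State} {j : ℕ} (hj : j ≠ regE) :
    ((addEdge p r).step s).reg j = s.reg j := by
  simp [addEdge, Prog.step, hj]

theorem addEdge_arrIn {p r : Expr} {s : State} :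
    ((addEdge p r).step s).arr arrIn = s.arr arrIn := by
  simp [addEdge, Prog.step]

end RAM

namespace CPMInstance

open RAM Forest

variable {n m : ℕ} {I : CPMInstance n m} (L : Listing I)

/-- The edge table entries of the first `l` neighbours of `a`. -/
def Listing.edgeEntries (_L : Listing I) (a : Fin n) (l : List (Fin m)) : List (ℕ × ℕ × ℕ) :=
  l.map fun p => (a.val + 1, p.val + 1, I.rank a p)

/-- The rank of the last resort of `a`. -/
def Listing.lastRank (a : Fin n) : ℕ := (L.nbrs a).toFinset.sup (I.rank a) + 1

/-- The edge table entries of `a`. -/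
def Listing.entries (a : Fin n) : List (ℕ × ℕ × ℕ) :=
  if L.nbrs a = [] then [] else
    L.edgeEntries a (L.nbrs a) ++ [(a.val + 1, 0, L.lastRank a)]

def Listing.table : List (ℕ × ℕ × ℕ) := (List.finRange n).flatMap L.entries

theorem val_of_finRange_eq {pre suf : List (Fin n)} {x : Fin n}
    (h : List.finRange n = pre ++ x :: suf) : x.val = pre.length := by
  have h1 : (List.finRange n)[pre.length]? = some x := by rw [h]; simp
  rw [List.getElem?_eq_some_iff] at h1
  obtain ⟨h2, h3⟩ := h1
  rw [← h3]
  simp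

theorem readApplicant_spec {B : ℕ} {T : List (ℕ × ℕ × ℕ)} {a : Fin n} {rest : List ℕ} {s : State}
    {R k : ℕ} (h : Edges B T s) (hA : s.reg regA = a.val)
    (hin : Reads (s.arr arrIn) (s.reg regPtr) (L.applicantBlock a ++ rest))
    (hk : 60 * (L.entries a).length + 30 + R ≤ k) :
    wp readApplicant (fun s' k' => Edges B (T ++ L.entries a) s' ∧ s'.reg regA = a.val + 1 ∧
      Reads (s'.arr arrIn) (s'.reg regPtr) rest ∧ R ≤ k') s k := by
  refine wp.flat_seq (60 * (L.entries a).length + 14 + R) rfl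
    (by simp only [Prog.bound, Expr.cost]; omega) ?_
  rw [Listing.applicantBlock, List.cons_append] at hin
  obtain ⟨hd, hin⟩ := hin.cons
  set s1 := Prog.step _ s with hs1
  have a1 : s1.arr = s.arr := rfl
  have rA : s1.reg regA = a.val + 1 := by simp [hs1, Prog.step, Expr.eval, hA]
  have rD : s1.reg regD = (L.nbrs a).length := by simp [hs1, Prog.step, Expr.eval, hd]
  have rP : s1.reg regPtr = s.reg regPtr + 1 := by simp [hs1, Prog.step, Expr.eval]
  have rX : s1.reg regX = 0 := by simp [hs1, Prog.step, Expr.eval]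
  have rE : s1.reg regE = s.reg regE := by simp [hs1, Prog.step]
  have h1 : Edges B T s1 := h.congr rE fun _ _ => rfl
  refine wp.ite (k' := 60 * (L.entries a).length + 10 + R) (by simp only [Expr.cost]; omega)
    (fun he => wp.seq ?_) (fun he => ?_)
  · have hne : L.nbrs a ≠ [] := fun h0 => he (by simp [Expr.eval, rD, h0])
    have hent : L.entries a = L.edgeEntries a (L.nbrs a) ++ [(a.val + 1, 0, L.lastRank a)] := by
      simp [Listing.entries, hne]
    have hlen : (L.entries a).length = (L.nbrs a).length + 1 := by
      simp [hent, Listing.edgeEntries]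
    refine wp.loopList (L.nbrs a) (fun pre suf s' k' =>
      Edges B (T ++ L.edgeEntries a pre) s' ∧ s'.reg regA = a.val + 1 ∧
      s'.reg regD = suf.length ∧ s'.reg regX = pre.toFinset.sup (I.rank a) ∧
      Reads (s'.arr arrIn) (s'.reg regPtr) ((suf.flatMap fun p => [p.val, I.rank a p]) ++ rest) ∧
      60 * suf.length + 60 + R ≤ k') ⟨?_, rA, rD, by simp [rX], ?_, ?_⟩ ?_ ?_ ?_
    · simpa [Listing.edgeEntries] using h1
    · rw [rP, a1]; exact hin
    · omega
    · rintro pre suf s' k' _ ⟨_, _, hD, _⟩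
      simp [Expr.eval, hD]
    · rintro pre x suf s' k' _ ⟨g1, g2, g3, g4, g5, g6⟩ _
      rw [List.flatMap_cons, List.append_assoc, List.cons_append, List.cons_append,
        List.nil_append] at g5
      obtain ⟨i1, g5⟩ := g5.cons
      obtain ⟨i2, g5⟩ := g5.cons
      rw [List.length_cons] at g6 g3
      refine ⟨60 * suf.length + 118 + R, by simp only [Expr.cost]; omega,
        wp.flat_seq (60 * suf.length + 80 + R) rfl (by simp only [addEdge, Prog.bound, Expr.cost]; omega) ?_⟩
      have hadd := addEdge_step g1 (p := .add (cell arrIn regPtr) (.const 1))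
        (r := .get arrIn (.add (.reg regPtr) (.const 1)))
        (fun s2 e1 e2 => by simp [Expr.eval, e1, e2]) (fun s2 e1 e2 => by simp [Expr.eval, e1, e2])
      set s2 := Prog.step _ s' with hs2
      have q1 : ∀ j, j ≠ regE → s2.reg j = s'.reg j := fun j hj => addEdge_reg hj
      have q2 : s2.arr arrIn = s'.arr arrIn := addEdge_arrIn
      refine wp.flat (60 * suf.length + 60 + R) rfl (by simp only [Prog.bound, Expr.cost]; omega) ?_
      set s3 := Prog.step _ s2 with hs3
      have a3 : s3.arr = s2.arr := rfl
      have E3 : s3.reg regE = s2.reg regE := by simp [hs3, Prog.step]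
      have A3 : s3.reg regA = s'.reg regA := by simp [hs3, Prog.step, q1]
      have P3 : s3.reg regPtr = s'.reg regPtr + 2 := by simp [hs3, Prog.step, q1, Expr.eval]
      have D3 : s3.reg regD = s'.reg regD - 1 := by simp [hs3, Prog.step, q1, Expr.eval]
      have X3 : s3.reg regX = s'.reg regX + (I.rank a x - s'.reg regX) := by
        simp [hs3, Prog.step, q1, q2, Expr.eval, i2]
      refine ⟨?_, by rw [A3, g2], by rw [D3, g3]; rfl, ?_, ?_, le_rfl⟩
      · refine Edges.congr ?_ E3 fun _ _ => rfl
        simpa [Listing.edgeEntries, Expr.eval, i1, i2, g2] using hadd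
      -- With truncated subtraction `x + (r - x)` is the maximum of `x` and `r`; the register
      -- collects the largest rank for the last resort.
      · rw [X3, g4]
        simp only [List.toFinset_append, Finset.sup_union, List.toFinset_cons, List.toFinset_nil,
          Finset.sup_insert, Finset.sup_empty, bot_eq_zero]
        rw [Nat.max_def]
        split_ifs <;> omega
      · rw [a3, q2, P3]
        exact g5
    · rintro s' k' ⟨g1, g2, g3, g4, g5, g6⟩ _
      refine ⟨58 + R, by simp only [Expr.cost]; simp at g6; omega,
        wp.flat R rfl (by simp only [addEdge, Prog.bound, Expr.cost]; omega) ?_⟩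
      have hadd := addEdge_step g1 (p := .const 0) (r := .add (.reg regX) (.const 1))
        (fun s2 e1 e2 => by simp [Expr.eval]) (fun s2 e1 e2 => by simp [Expr.eval, e2])
      refine ⟨?_, by rw [addEdge_reg (by decide), g2], ?_, le_rfl⟩
      · rw [hent, ← List.append_assoc]
        simpa [Expr.eval, g2, g4, Listing.lastRank] using hadd
      · rw [addEdge_arrIn, addEdge_reg (by decide)]
        simpa using g5
  · have hnil : L.nbrs a = [] := by
      simpa [Expr.eval, rD] using he
    have hent : L.entries a = [] := by simp [Listing.entries, hnil]
    refine wp.flat R rfl (by simp only [Prog.bound]; omega) ⟨?_, rA, ?_, le_rfl⟩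
    · rw [hent, List.append_nil]; exact h1
    · rw [hnil] at hin
      show Reads (s1.arr arrIn) (s1.reg regPtr) rest
      rw [a1, rP]
      exact hin

theorem readApplicants_spec :
    wp readApplicants (fun s' _ => Edges m L.table s' ∧ s'.reg regN = n ∧ s'.reg regM = m ∧
      Reads (s'.arr arrIn) (s'.reg regPtr) ((List.finRange m).flatMap L.postBlock))
      (init L.encode) (60 * L.table.length + 40 * n + 40) := by
  have hin : Reads ((init L.encode).arr arrIn) 0 (n :: m :: ((List.finRange n).flatMap
      L.applicantBlock ++ (List.finRange m).flatMap L.postBlock)) :=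
    fun j _ => by simp [init, Listing.encode]
  obtain ⟨i1, hin⟩ := hin.cons
  obtain ⟨i2, hin⟩ := hin.cons
  refine wp.flat_seq (60 * L.table.length + 40 * n + 10) rfl
    (by simp only [Prog.bound, Expr.cost]; omega) ?_
  set s1 := Prog.step _ (init L.encode) with hs1
  have a1 : s1.arr = (init L.encode).arr := rfl
  have rN : s1.reg regN = n := by simpa [hs1, Prog.step, Expr.eval] using i1
  have rM : s1.reg regM = m := by simpa [hs1, Prog.step, Expr.eval] using i2
  have rP : s1.reg regPtr = 2 := by simp [hs1, Prog.step, Expr.eval]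
  have rA : s1.reg regA = 0 := by simp [hs1, Prog.step, init]
  have rE : s1.reg regE = 0 := by simp [hs1, Prog.step, init]
  refine wp.loopList (List.finRange n) (fun pre suf s' k' =>
    Edges m (pre.flatMap L.entries) s' ∧ s'.reg regA = pre.length ∧ s'.reg regN = n ∧
    s'.reg regM = m ∧
    Reads (s'.arr arrIn) (s'.reg regPtr) (suf.flatMap L.applicantBlock ++
      (List.finRange m).flatMap L.postBlock) ∧
    60 * (suf.flatMap L.entries).length + 40 * suf.length + 4 ≤ k')
    ⟨⟨rE, ?_, ?_, ?_, ?_, ?_⟩, rA, rN, rM, ?_, ?_⟩ ?_ ?_ ?_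
  · intro i; simp [a1, init]
  · simp [a1, init]
  · intro i; simp [a1, init]
  · intro i; simp [a1, init]
  · exact Buckets.start fun v _ => by simp [a1, init]
  · rw [rP, a1]; exact hin
  · simp only [Listing.table, List.length_finRange]; omega
  · rintro pre suf s' k' hl ⟨_, hA, hN, _⟩
    have hlen := congrArg List.length hl
    rw [List.length_finRange, List.length_append] at hlen
    simp only [Expr.eval, hA, hN]
    rw [← List.length_eq_zero_iff]
    omega
  · rintro pre x suf s' k' hl ⟨g1, g2, g3, g4, g5, g6⟩ hF
    rw [List.flatMap_cons, List.append_assoc] at g5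
    rw [List.flatMap_cons, List.length_append, List.length_cons] at g6
    refine ⟨_, (Nat.add_sub_of_le (by simp only [Expr.cost]; omega)).le,
      (readApplicant_spec L (R := 60 * (suf.flatMap L.entries).length + 40 * suf.length + 4) g1
        (by rw [g2, val_of_finRange_eq hl]) g5 (by simp only [Expr.cost]; omega)).mono ?_⟩
    rintro s2 k2 hF2 ⟨f1, f2, f3, f4⟩
    refine ⟨by simpa using f1, by simp [f2, val_of_finRange_eq hl], ?_, ?_, f3, f4⟩
    · rw [hF2.reg _ (by decide), g3]
    · rw [hF2.reg _ (by decide), g4]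
  · rintro s' k' ⟨g1, g2, g3, g4, g5, g6⟩ _
    exact ⟨0, by simp only [Expr.cost]; omega, g1, g3, g4, by simpa using g5⟩

end CPMInstance

/-! ### The table of the edges -/

namespace CPMInstance

open RAM Forest

variable {n m : ℕ} {I : CPMInstance n m} (L : Listing I)

theorem Listing.mem_table {x : ℕ × ℕ × ℕ} : x ∈ L.table ↔
    ∃ a : Fin n, L.nbrs a ≠ [] ∧ ((∃ p ∈ L.nbrs a, (a.val + 1, p.val + 1, I.rank a p) = x) ∨
      x = (a.val + 1, 0, L.lastRank a)) := by
  simp only [Listing.table, List.mem_flatMap, List.mem_finRange, true_and, Listing.entries]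
  refine exists_congr fun a => ?_
  split_ifs with h
  · simp [h]
  · simp [h, Listing.edgeEntries]

/-- Owner and post determine an edge. Posts are shifted by one, so last resorts, with post `0`,
differ from all proper edges. -/
theorem Listing.table_nodup : (L.table.map fun x => (x.1, x.2.1)).Nodup := by
  rw [Listing.table, List.map_flatMap, List.nodup_flatMap]
  constructor
  · intro a _
    simp only [Listing.entries]
    split_ifs with h
    · simp
    · rw [List.map_append, Listing.edgeEntries, List.map_map]
      refine List.Nodup.append ?_ (by simp) ?_
      · refine (L.nbrs_nodup a).map fun p q hpq => ?_
        simpa [Fin.ext_iff] using hpq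
      · intro x hx hx'
        simp only [List.mem_map, Function.comp_apply] at hx
        obtain ⟨p, _, rfl⟩ := hx
        simp at hx'
  · refine (List.nodup_finRange n).imp fun {a b} hab => ?_
    have hown : ∀ (c : Fin n) x, x ∈ (L.entries c).map (fun x => (x.1, x.2.1)) → x.1 = c.val + 1 := by
      intro c x hx
      simp only [Listing.entries] at hx
      split_ifs at hx
      · simp at hx
      · simp only [Listing.edgeEntries, List.map_append, List.map_map, List.mem_append,
          List.mem_map, Function.comp_apply, List.map_cons, List.map_nil, List.mem_singleton] at hx
        rcases hx with ⟨p, _, rfl⟩ | rfl <;> rfl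
    intro x h1 h2
    have h3 := hown a x h1
    have h4 := hown b x h2
    exact hab (Fin.ext (by omega))

theorem Listing.nbrs_toFinset (a : Fin n) :
    (L.nbrs a).toFinset = Finset.univ.filter fun p => (a, p) ∈ I.edges := by
  ext p
  simp [L.mem_nbrs]

theorem Listing.sum_length : ∑ a, (L.nbrs a).length = I.edges.card := by
  have h1 : I.edges.card = ∑ x : Fin n × Fin m, if x ∈ I.edges then 1 else 0 := by simp
  rw [h1, Fintype.sum_prod_type]
  refine Finset.sum_congr rfl fun a _ => ?_
  rw [← Finset.card_filter, ← L.nbrs_toFinset, List.toFinset_card_of_nodup (L.nbrs_nodup a)]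

theorem sum_card_nbrSet (I : CPMInstance n m) : ∑ p, (I.nbrSet p).card = I.edges.card := by
  have h1 : I.edges.card = ∑ x : Fin n × Fin m, if x ∈ I.edges then 1 else 0 := by simp
  rw [h1, Fintype.sum_prod_type_right]
  exact Finset.sum_congr rfl fun a _ => Finset.card_filter _ _

/-- A last resort is added only for applicants that have an edge, so the number of edges at most
doubles. -/
theorem Listing.table_length : L.table.length ≤ 2 * I.edges.card := by
  rw [← L.sum_length, Listing.table, List.length_flatMap, ← Fin.sum_univ_def, Finset.mul_sum]
  refine Finset.sum_le_sum fun a _ => ?_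
  simp only [Listing.entries]
  split_ifs with h
  · simp
  · have := List.length_pos_iff.2 h
    simp only [Listing.edgeEntries, List.length_append, List.length_map, List.length_singleton]
    omega

theorem Listing.edgeTable {B : ℕ} {s : State} (h : Edges B L.table s) :
    I.EdgeTable (s.reg regE) (s.arr arrOwn) (s.arr arrPost) (s.arr arrRank) := by
  have hget : ∀ e, 1 ≤ e → e ≤ s.reg regE → ∃ i, ∃ hi : i < L.table.length, e = i + 1 ∧
      s.arr arrOwn e = L.table[i].1 ∧ s.arr arrPost e = L.table[i].2.1 ∧
      s.arr arrRank e = L.table[i].2.2 := by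
    intro e h1 h2
    rw [h.len] at h2
    refine ⟨e - 1, by omega, by omega, ?_⟩
    obtain ⟨i, rfl⟩ : ∃ i, e = i + 1 := ⟨e - 1, by omega⟩
    have hi : i < L.table.length := by omega
    have hg : L.table.getD i 0 = L.table[i] := List.getD_eq_getElem _ _ hi
    rw [h.own, h.post, h.rank, hg]
    exact ⟨rfl, rfl, rfl⟩
  have hput : ∀ x ∈ L.table, ∃ e, (1 ≤ e ∧ e ≤ s.reg regE) ∧ s.arr arrOwn e = x.1 ∧
      s.arr arrPost e = x.2.1 := by
    intro x hx
    obtain ⟨i, hi, rfl⟩ := List.getElem_of_mem hx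
    have hg : L.table.getD i 0 = L.table[i] := List.getD_eq_getElem _ _ hi
    refine ⟨i + 1, ⟨by omega, by rw [h.len]; omega⟩, ?_⟩
    rw [h.own, h.post, hg]
    exact ⟨rfl, rfl⟩
  refine ⟨h.post_zero, fun e h1 h2 => ?_, fun e e' h1 h2 h3 h4 ho hp => ?_, fun a p hap => ?_,
    fun e h1 h2 => ?_⟩
  · obtain ⟨i, hi, rfl, ho, hp, hr⟩ := hget e h1 h2
    obtain ⟨a, hne, hx⟩ := L.mem_table.1 (List.getElem_mem hi)
    rw [ho, hp, hr]
    refine ⟨a, ?_⟩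
    rcases hx with ⟨p, hpn, hx⟩ | hx
    · rw [← hx]
      exact ⟨rfl, .inr ⟨p, rfl, (L.mem_nbrs a p).1 hpn, rfl⟩⟩
    · rw [hx]
      refine ⟨rfl, .inl ⟨rfl, fun p hap => Nat.lt_succ_of_le ?_⟩⟩
      exact Finset.le_sup (f := I.rank a) (List.mem_toFinset.2 ((L.mem_nbrs a p).2 hap))
  · obtain ⟨i, hi, rfl, ho1, hp1, _⟩ := hget e h1 h2
    obtain ⟨j, hj, rfl, ho2, hp2, _⟩ := hget e' h3 h4
    have := (List.Nodup.getElem_inj_iff L.table_nodup (i := i) (j := j) (hi := by simpa using hi)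
      (hj := by simpa using hj)).1 (by
        simp only [List.getElem_map, Prod.mk.injEq]
        exact ⟨ho1.symm.trans (ho.trans ho2), hp1.symm.trans (hp.trans hp2)⟩)
    rw [this]
  · have hpn := (L.mem_nbrs a p).2 hap
    exact hput (a.val + 1, p.val + 1, I.rank a p)
      (L.mem_table.2 ⟨a, List.ne_nil_of_mem hpn, .inl ⟨p, hpn, rfl⟩⟩)
  · obtain ⟨i, hi, rfl, ho, _⟩ := hget e h1 h2
    obtain ⟨a, hne, hx⟩ := L.mem_table.1 (List.getElem_mem hi)
    obtain ⟨l, hl, hlo, hlp⟩ := hput (a.val + 1, 0, L.lastRank a) (L.mem_table.2 ⟨a, hne, .inr rfl⟩)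
    refine ⟨l, hl, ?_, hlp⟩
    rw [hlo, ho]
    rcases hx with ⟨p, hpn, hx⟩ | hx
    · rw [← hx]
    · rw [hx]

end CPMInstance

/-! ### Inserting the classes into the forest -/

namespace Forest

/-- Paths from classes never pass through edges, so the parents of the edges do not matter. -/
theorem Tree.anc_congr {E V : ℕ} {par par' : ℕ → ℕ} (ht : Tree E V par)
    (h : ∀ v, v = 0 ∨ (E < v ∧ v ≤ V) → par' v = par v) {u v : ℕ}
    (hu : u = 0 ∨ (E < u ∧ u ≤ V)) : Anc par' v u ↔ Anc par v u := by
  have key : ∀ k u, u = 0 ∨ (E < u ∧ u ≤ V) → par'^[k] u = par^[k] u := by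
    intro k
    induction k with
    | zero => exact fun _ _ => rfl
    | succ k ih =>
      intro u hu
      rw [Function.iterate_succ_apply, Function.iterate_succ_apply, h u hu]
      refine ih _ (ht.par_node ?_)
      rcases hu with rfl | hu <;> omega
  exact exists_congr fun k => by rw [key k u hu]

end Forest

namespace CPMInstance

open RAM Forest

variable {n m : ℕ} {I : CPMInstance n m}

/-- The edges of the post `p` to the members of `S`. -/
def EdgesTo (E : ℕ) (own post : ℕ → ℕ) (p : Fin m) (S : Finset (Fin n)) (e : ℕ) : Prop :=
  (1 ≤ e ∧ e ≤ E) ∧ post e = p.val + 1 ∧ ∃ a ∈ S, own e = a.val + 1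

/-- The nodes `E + 1, E + 2, …, V` of the forest are the sets in the list `N`, each with its post and its
quota. -/
structure Nodes (E : ℕ) (own post par cap dead : ℕ → ℕ) (V : ℕ)
    (N : List (Fin m × Finset (Fin n) × ℕ)) : Prop where
  len : V = E + N.length
  tree : Tree E V par
  spans : ∀ i x, N[i]? = some x → Spans E own post par (E + 1 + i) x.1 x.2.1
  cap : ∀ i x, N[i]? = some x → cap (E + 1 + i) = x.2.2
  dead : ∀ e, 1 ≤ e → e ≤ E → (dead e = 0 ↔ ∀ x ∈ N, EdgesTo E own post x.1 x.2.1 e → x.2.2 ≠ 0)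

variable {E V : ℕ} {own post par par' cap cap' dead dead' : ℕ → ℕ}
  {N : List (Fin m × Finset (Fin n) × ℕ)}

theorem Nodes.get (h : Nodes E own post par cap dead V N) {v : ℕ} (h1 : E < v) (h2 : v ≤ V) :
    ∃ i x, N[i]? = some x ∧ x ∈ N ∧ v = E + 1 + i := by
  have hlen := h.len
  have hi : v - E - 1 < N.length := by omega
  exact ⟨v - E - 1, N[v - E - 1], List.getElem?_eq_getElem hi, List.getElem_mem hi, by omega⟩

/-- The parent of `e` is a set that contains `e` and thus `e'`, so it is an ancestor of `e'`;
ancestors have smaller numbers. Applied in both directions, this shows that edges in the same sets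
have the same parent. -/
theorem Nodes.par_le (h : Nodes E own post par cap dead V N) {e e' : ℕ} (h1 : 1 ≤ e ∧ e ≤ E)
    (h2 : 1 ≤ e' ∧ e' ≤ E)
    (hx : ∀ x ∈ N, EdgesTo E own post x.1 x.2.1 e → EdgesTo E own post x.1 x.2.1 e') :
    par e ≤ par e' := by
  rcases h.tree.edge e h1.1 h1.2 with h0 | h0
  · omega
  · obtain ⟨i, x, hi, hxN, hv⟩ := h.get h0.1 h0.2
    have hs := h.spans i x hi
    rw [← hv] at hs
    have ha : Anc par (par e) e := anc_iff.2 (.inr (Anc.refl _ _))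
    have ha' := (hs e' h2.1 h2.2).2 (hx x hxN ⟨h1, (hs e h1.1 h1.2).1 ha⟩).2
    rw [h.tree.anc_edge h0.1 h2.2] at ha'
    exact (h.tree.anc_le (h.tree.edge e' h2.1 h2.2) ha').1

/-- A set that is contained in or disjoint from all the others is inserted as a leaf. -/
theorem Nodes.insert (h : Nodes E own post par cap dead V N) {x : Fin m × Finset (Fin n) × ℕ} {P : ℕ}
    (hP : ∀ e, EdgesTo E own post x.1 x.2.1 e → par e = P) (hne : ∃ e, EdgesTo E own post x.1 x.2.1 e)
    (hin : ∀ e, EdgesTo E own post x.1 x.2.1 e → par' e = V + 1) (hnew : par' (V + 1) = P)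
    (hother : ∀ v, ¬ EdgesTo E own post x.1 x.2.1 v → v ≠ V + 1 → par' v = par v)
    (hcap : cap' (V + 1) = x.2.2) (hcap' : ∀ v, E < v → v ≤ V → cap' v = cap v)
    (hdead : ∀ e, 1 ≤ e → e ≤ E →
      (dead' e = 0 ↔ dead e = 0 ∧ (EdgesTo E own post x.1 x.2.1 e → x.2.2 ≠ 0))) :
    Nodes E own post par' cap' dead' (V + 1) (N ++ [x]) := by
  have ht := h.tree
  have hEV := ht.le
  have hget : ∀ i y, (N ++ [x])[i]? = some y → N[i]? = some y ∨ (i = N.length ∧ y = x) := by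
    intro i y hi
    rw [List.getElem?_append] at hi
    split_ifs at hi with h1
    · exact .inl hi
    · right
      rw [List.getElem?_singleton] at hi
      split_ifs at hi with h2
      exact ⟨by omega, by simpa using hi.symm⟩
  have hlt : ∀ i y, N[i]? = some y → i < N.length := fun i y hi =>
    (List.getElem?_eq_some_iff.1 hi).1
  have hPn : P = 0 ∨ (E < P ∧ P ≤ V) := by
    obtain ⟨e, he⟩ := hne
    rw [← hP e he]
    exact ht.edge e he.1.1 he.1.2
  have hnode : ∀ v, v = 0 ∨ (E < v ∧ v ≤ V) → par' v = par v := fun v hv =>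
    hother v (fun he => by have := he.1; omega) (by omega)
  have hanc : ∀ {u v : ℕ}, u = 0 ∨ (E < u ∧ u ≤ V) → (Anc par' v u ↔ Anc par v u) :=
    fun hu => ht.anc_congr hnode hu
  have ht' : Tree E (V + 1) par' := by
    refine ⟨by omega, ?_, fun e h1 h2 => ?_, fun v h1 h2 => ?_⟩
    · rw [hnode 0 (.inl rfl), ht.root]
    · by_cases he : EdgesTo E own post x.1 x.2.1 e
      · rw [hin e he]; omega
      · rw [hother e he (by omega)]
        rcases ht.edge e h1 h2 with h3 | h3 <;> omega
    · by_cases hv : v = V + 1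
      · rw [hv, hnew]; omega
      · rw [hnode v (.inr ⟨h1, by omega⟩)]
        exact ht.cls v h1 (by omega)
  refine ⟨by rw [h.len]; simp; omega, ht', ?_, ?_, ?_⟩
  · intro i y hi e h1 h2
    rw [ht'.anc_edge (by omega) h2]
    by_cases he : EdgesTo E own post x.1 x.2.1 e
    · rw [hin e he, anc_iff, hnew, hanc hPn]
      rcases hget i y hi with hi | ⟨rfl, rfl⟩
      · have := hlt i y hi
        rw [or_iff_right (by have := h.len; omega), ← hP e he, ← ht.anc_edge (by omega) h2]
        exact h.spans i y hi e h1 h2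
      · exact iff_of_true (.inl (by have := h.len; omega)) he.2
    · have hne' : e ≠ V + 1 := by omega
      rw [hother e he hne', hanc (ht.edge e h1 h2)]
      rcases hget i y hi with hi | ⟨rfl, rfl⟩
      · rw [← ht.anc_edge (by omega) h2]
        exact h.spans i y hi e h1 h2
      · refine iff_of_false (fun ha => ?_) fun hh => he ⟨⟨h1, h2⟩, hh⟩
        have := (ht.anc_le (ht.edge e h1 h2) ha).1
        have := h.len
        rcases ht.edge e h1 h2 with h3 | h3 <;> omega
  · intro i y hi
    rcases hget i y hi with hi | ⟨rfl, rfl⟩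
    · have := hlt i y hi
      rw [hcap' _ (by omega) (by have := h.len; omega)]
      exact h.cap i y hi
    · rw [← hcap]
      congr 1
      have := h.len
      omega
  · intro e h1 h2
    rw [hdead e h1 h2, h.dead e h1 h2]
    simp only [List.mem_append, List.mem_singleton, or_imp, forall_and, forall_eq]

/-- `d, d - 1, …, 1`. -/
def countdown : ℕ → List ℕ
  | 0 => []
  | d + 1 => (d + 1) :: countdown d

theorem countdown_length (d : ℕ) : (countdown d).length = d := by
  induction d with
  | zero => rfl
  | succ d ih => simp [countdown, ih]

theorem mem_countdown {d x : ℕ} : x ∈ countdown d ↔ 1 ≤ x ∧ x ≤ d := by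
  induction d with
  | zero => simp [countdown]; omega
  | succ d ih => simp only [countdown, List.mem_cons, ih]; omega

theorem countdown_pairwise (d : ℕ) : (countdown d).Pairwise (fun x y => y < x) := by
  induction d with
  | zero => exact .nil
  | succ d ih => exact List.pairwise_cons.2 ⟨fun x hx => by have := mem_countdown.1 hx; omega, ih⟩

theorem countdown_eq {d x : ℕ} {pre suf : List ℕ} (h : countdown d = pre ++ x :: suf) :
    x = suf.length + 1 := by
  induction d generalizing pre with
  | zero => simp [countdown] at h
  | succ d ih =>
    cases pre with
    | nil =>
      simp only [countdown, List.nil_append, List.cons.injEq] at h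
      rw [← h.2, countdown_length]
      exact h.1.symm
    | cons y pre =>
      simp only [countdown, List.cons_append, List.cons.injEq] at h
      exact ih h.2

variable (L : Listing I)

/-- The nonempty classes of `p`, by decreasing size. -/
def Listing.order (p : Fin m) : List (List (Fin n)) :=
  (countdown ((I.nbrSet p).card + 1)).flatMap fun s => (L.classList p).filter fun l => l.length = s

def classEntry (I : CPMInstance n m) (p : Fin m) (l : List (Fin n)) : Fin m × Finset (Fin n) × ℕ :=
  (p, l.toFinset, I.classQuota p l.toFinset)

def rootEntry (I : CPMInstance n m) (p : Fin m) : List (Fin m × Finset (Fin n) × ℕ) :=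
  if I.nbrSet p = ∅ then [] else [(p, I.nbrSet p, I.quota p)]

/-- The nodes of the post `p`. -/
def Listing.postNodes (p : Fin m) : List (Fin m × Finset (Fin n) × ℕ) :=
  I.rootEntry p ++ (L.order p).map (I.classEntry p)

theorem Listing.mem_classes {p : Fin m} {l : List (Fin n)} (hl : l ∈ L.classList p) :
    l.toFinset ∈ I.classes p :=
  (L.mem_classList p _).1 (List.mem_map_of_mem hl)

theorem Listing.class_subset {p : Fin m} {l : List (Fin n)} (hl : l ∈ L.classList p) :
    l.toFinset ⊆ I.nbrSet p := fun a ha => by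
  simpa [nbrSet] using I.classes_subset p _ (L.mem_classes hl) a ha

theorem Listing.class_length {p : Fin m} {l : List (Fin n)} (hl : l ∈ L.classList p) :
    l.toFinset.card = l.length := List.toFinset_card_of_nodup (L.members_nodup p l hl)

theorem Listing.class_length_le {p : Fin m} {l : List (Fin n)} (hl : l ∈ L.classList p) :
    l.length ≤ (I.nbrSet p).card := by
  rw [← L.class_length hl]
  exact Finset.card_le_card (L.class_subset hl)

theorem Listing.mem_order {p : Fin m} {l : List (Fin n)} :
    l ∈ L.order p ↔ l ∈ L.classList p ∧ l ≠ [] := by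
  simp only [Listing.order, List.mem_flatMap, List.mem_filter, decide_eq_true_eq, mem_countdown]
  constructor
  · rintro ⟨s, hs, hl, rfl⟩
    exact ⟨hl, List.ne_nil_of_length_pos hs.1⟩
  · rintro ⟨hl, hne⟩
    have := L.class_length_le hl
    exact ⟨l.length, ⟨List.length_pos_iff.2 hne, by omega⟩, hl, rfl⟩

/-- In a laminar family a set can only contain a set of at most its own size, so by decreasing size
every class is contained in or disjoint from each earlier one. -/
theorem Listing.order_pairwise (hI : I.Laminar) (p : Fin m) :
    (L.order p).Pairwise fun d l => l.toFinset ⊆ d.toFinset ∨ l.toFinset ∩ d.toFinset = ∅ := by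
  have key : ∀ d ∈ L.classList p, ∀ l ∈ L.classList p, l.length ≤ d.length →
      l.toFinset ⊆ d.toFinset ∨ l.toFinset ∩ d.toFinset = ∅ := by
    intro d hd l hl hle
    rcases hI p _ (L.mem_classes hl) _ (L.mem_classes hd) with h | h | h
    · exact .inl h
    · refine .inl (Finset.eq_of_subset_of_card_le h ?_).symm.subset
      rwa [L.class_length hd, L.class_length hl]
    · exact .inr h
  rw [Listing.order, List.pairwise_flatMap]
  constructor
  · intro s _
    refine List.pairwise_of_forall_mem_list fun d hd l hl => ?_
    simp only [List.mem_filter, decide_eq_true_eq] at hd hl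
    exact key d hd.1 l hl.1 (by omega)
  · refine (countdown_pairwise _).imp fun hs d hd l hl => ?_
    simp only [List.mem_filter, decide_eq_true_eq] at hd hl
    exact key d hd.1 l hl.1 (by omega)

theorem Listing.order_nodup (p : Fin m) : ((L.order p).map List.toFinset).Nodup := by
  have h := L.classList_nodup p
  rw [List.Nodup, List.pairwise_map] at h ⊢
  rw [Listing.order, List.pairwise_flatMap]
  refine ⟨fun s _ => h.filter _, (countdown_pairwise _).imp fun hs d hd l hl heq => ?_⟩
  simp only [List.mem_filter, decide_eq_true_eq] at hd hl
  have h1 := L.class_length hd.1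
  have h2 := L.class_length hl.1
  rw [heq] at h1
  omega

theorem Listing.order_length (hI : I.Laminar) (p : Fin m) :
    (L.order p).length ≤ 2 * (I.nbrSet p).card := by
  rw [← List.length_map List.toFinset, ← List.toFinset_card_of_nodup (L.order_nodup p)]
  refine card_le_of_laminar _ _ ?_ ?_
  · intro C hC D hD
    simp only [List.mem_toFinset, List.mem_map, L.mem_order] at hC hD
    obtain ⟨c, hc, rfl⟩ := hC
    obtain ⟨d, hd, rfl⟩ := hD
    exact hI p _ (L.mem_classes hc.1) _ (L.mem_classes hd.1)
  · intro C hC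
    simp only [List.mem_toFinset, List.mem_map, L.mem_order] at hC
    obtain ⟨c, hc, rfl⟩ := hC
    exact ⟨L.class_subset hc.1, (List.toFinset_nonempty_iff c).2 hc.2⟩

/-- The additional one accounts for the empty class, which has no node but has to be read. -/
theorem Listing.classList_length (hI : I.Laminar) (p : Fin m) :
    (L.classList p).length ≤ 2 * (I.nbrSet p).card + 1 := by
  rw [← List.length_map List.toFinset, ← List.toFinset_card_of_nodup (L.classList_nodup p)]
  have h1 := card_le_of_laminar (I.nbrSet p) (((L.classList p).map List.toFinset).toFinset.erase ∅)
    ?_ ?_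
  · have := Finset.pred_card_le_card_erase (s := ((L.classList p).map List.toFinset).toFinset) (a := ∅)
    omega
  · intro C hC D hD
    simp only [Finset.mem_erase, List.mem_toFinset, L.mem_classList] at hC hD
    exact hI p _ hC.2 _ hD.2
  · intro C hC
    simp only [Finset.mem_erase, List.mem_toFinset, L.mem_classList] at hC
    refine ⟨fun a ha => ?_, Finset.nonempty_iff_ne_empty.2 hC.1⟩
    simpa [nbrSet] using I.classes_subset p _ hC.2 a ha

theorem Listing.postNodes_length (hI : I.Laminar) (p : Fin m) :
    (L.postNodes p).length ≤ 3 * (I.nbrSet p).card := by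
  have h1 := L.order_length hI p
  simp only [Listing.postNodes, rootEntry, List.length_append, List.length_map]
  split_ifs with h0
  · simp only [List.length_nil]; omega
  · have := Finset.card_pos.2 (Finset.nonempty_iff_ne_empty.2 h0)
    simp only [List.length_singleton]; omega

theorem Listing.nodeTable
    (h : Nodes E own post par cap dead V ((List.finRange m).flatMap L.postNodes)) :
    I.NodeTable E V own post par cap dead := by
  have hmem : ∀ x, x ∈ (List.finRange m).flatMap L.postNodes → ∃ p S, x.1 = p ∧ x.2.1 = S ∧
      ((S = I.nbrSet p ∧ x.2.2 = I.quota p) ∨ (S ∈ I.classes p ∧ x.2.2 = I.classQuota p S)) := by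
    intro x hx
    simp only [List.mem_flatMap, List.mem_finRange, true_and, Listing.postNodes, List.mem_append,
      List.mem_map] at hx
    obtain ⟨p, hx | ⟨l, hl, rfl⟩⟩ := hx
    · unfold rootEntry at hx
      split_ifs at hx
      · simp at hx
      · obtain rfl := List.mem_singleton.1 hx
        exact ⟨_, _, rfl, rfl, .inl ⟨rfl, rfl⟩⟩
    · exact ⟨_, _, rfl, rfl, .inr ⟨L.mem_classes (L.mem_order.1 hl).1, rfl⟩⟩
  have hput : ∀ x ∈ (List.finRange m).flatMap L.postNodes, ∃ v, (E < v ∧ v ≤ V) ∧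
      Spans E own post par v x.1 x.2.1 ∧ cap v = x.2.2 := by
    intro x hx
    obtain ⟨i, hi⟩ := List.mem_iff_getElem?.1 hx
    have := (List.getElem?_eq_some_iff.1 hi).1
    have hlen := h.len
    exact ⟨E + 1 + i, ⟨by omega, by omega⟩, h.spans i x hi, h.cap i x hi⟩
  refine ⟨h.tree, fun v h1 h2 => ?_, fun p hp => ?_, fun p C hC h0 => ?_, fun e h1 h2 => ?_⟩
  · obtain ⟨i, x, hi, hx, rfl⟩ := h.get h1 h2
    obtain ⟨p, S, rfl, rfl, hc⟩ := hmem x hx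
    refine ⟨x.1, x.2.1, h.spans i x hi, ?_⟩
    rwa [h.cap i x hi]
  · refine hput (p, I.nbrSet p, I.quota p) ?_
    simp only [List.mem_flatMap, List.mem_finRange, true_and, Listing.postNodes, List.mem_append]
    exact ⟨p, .inl (by simp [rootEntry, hp.ne_empty])⟩
  · obtain ⟨l, hl, rfl⟩ := List.mem_map.1 ((L.mem_classList p C).2 hC)
    refine hput (I.classEntry p l) ?_
    simp only [List.mem_flatMap, List.mem_finRange, true_and, Listing.postNodes, List.mem_append]
    exact ⟨p, .inr (List.mem_map_of_mem (L.mem_order.2 ⟨hl, (List.toFinset_nonempty_iff l).1 h0⟩))⟩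
  · rw [h.dead e h1 h2]
    constructor
    · intro hd v h3 h4 ha
      obtain ⟨i, x, hi, hx, rfl⟩ := h.get h3 h4
      rw [h.cap i x hi]
      exact hd x hx ⟨⟨h1, h2⟩, (h.spans i x hi e h1 h2).1 ha⟩
    · intro hd x hx he
      obtain ⟨v, hv, hs, hc⟩ := hput x hx
      rw [← hc]
      exact hd v hv.1 hv.2 ((hs e h1 h2).2 he.2)

end CPMInstance

/-! ### Reading the classes of a post -/

namespace RAM

notation "regS" => (17 : ℕ)
notation "regK" => (18 : ℕ)
notation "regQ" => (19 : ℕ)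
notation "regT" => (20 : ℕ)
notation "regJ" => (21 : ℕ)
notation "regY" => (22 : ℕ)
notation "arrSlot" => (20 : ℕ)

/-- The next member of the class becomes a child of the node in register `regV`. -/
def insertMember : Prog :=
  .set regC (.get arrSlot (.add (cell arrIn regY) (.const 1))) ;;
  .put arrPar (.reg regV) (cell arrPar regC) ;; .put arrPar (.reg regC) (.reg regV) ;;
  .ite (cell arrRem regV) .skip (.put arrDead (.reg regC) (.const 1)) ;;
  inc regY ;; .set regS (.sub (.reg regS) (.const 1))

/-- A new node for the class at position `regT` of the input. -/
def insertClass : Prog :=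
  (inc regV ;; .put arrRem (.reg regV) (cell arrIn regT) ;;
    .set regY (.add (.reg regT) (.const 2)) ;; .set regS (.reg regD)) ;;
  .loop (.reg regS) insertMember

/-- The number of members of the class at position `regT` of the input. -/
abbrev classSize : Expr := .get arrIn (.add (.reg regT) (.const 1))

/-- Insert the class at position `regT` of the input if its size is in register `regD`. -/
def readClass : Prog :=
  .ite (.add (.sub classSize (.reg regD)) (.sub (.reg regD) classSize)) .skip insertClass ;;
  .set regT (.add (.reg regT) (.add (.const 2) classSize)) ;;
  .set regJ (.sub (.reg regJ) (.const 1))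

end RAM

namespace CPMInstance

open RAM Forest

variable {n m : ℕ} {I : CPMInstance n m} {E : ℕ} {own post rnk : ℕ → ℕ}

/-- The nodes inserted so far are those in the list `N`. -/
def Holds (E : ℕ) (own post : ℕ → ℕ) (N : List (Fin m × Finset (Fin n) × ℕ)) (s : State) : Prop :=
  Nodes E own post (s.arr arrPar) (s.arr arrRem) (s.arr arrDead) (s.reg regV) N

theorem Holds.congr {N : List (Fin m × Finset (Fin n) × ℕ)} {s s' : State} (h : Holds E own post N s)
    (h0 : s'.reg regV = s.reg regV) (h1 : s'.arr arrPar = s.arr arrPar)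
    (h2 : s'.arr arrRem = s.arr arrRem) (h3 : s'.arr arrDead = s.arr arrDead) :
    Holds E own post N s' := by
  unfold Holds at h ⊢
  rwa [h0, h1, h2, h3]

/-- `slot` maps the members of `S` to their edges to `p`. -/
def Slots (E : ℕ) (own post slot : ℕ → ℕ) (p : Fin m) (S : Finset (Fin n)) : Prop :=
  ∀ a ∈ S, (1 ≤ slot (a.val + 1) ∧ slot (a.val + 1) ≤ E) ∧ own (slot (a.val + 1)) = a.val + 1 ∧
    post (slot (a.val + 1)) = p.val + 1

theorem Slots.edgesTo_iff {slot : ℕ → ℕ} {p : Fin m} {S T : Finset (Fin n)}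
    (h : Slots E own post slot p S) (hE : I.EdgeTable E own post rnk) (hT : T ⊆ S) {e : ℕ} :
    EdgesTo E own post p T e ↔ ∃ a ∈ T, e = slot (a.val + 1) := by
  constructor
  · rintro ⟨h1, h2, a, ha, h3⟩
    obtain ⟨g1, g2, g3⟩ := h a (hT ha)
    exact ⟨a, ha, hE.inj _ _ h1.1 h1.2 g1.1 g1.2 (h3.trans g2.symm) (h2.trans g3.symm)⟩
  · rintro ⟨a, ha, rfl⟩
    obtain ⟨g1, g2, g3⟩ := h a (hT ha)
    exact ⟨g1, g3, a, ha, g2⟩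

/-- All edges of the new class have the same parent `P` beforehand. The program copies the parent of
each member to the new node before rehanging the member, so it writes `P` every time and need not
single out a first member. -/
theorem insertClass_spec (hE : I.EdgeTable E own post rnk) {p : Fin m} {S : Finset (Fin n)}
    {N : List (Fin m × Finset (Fin n) × ℕ)} {l : List (Fin n)} {q R k : ℕ} {rest : List ℕ} {s : State}
    (h : Holds E own post N s) (hS : Slots E own post (s.arr arrSlot) p S) (hl : l.toFinset ⊆ S)
    (hnd : l.Nodup) (hne : l ≠ [])
    (hpar : ∀ e e', EdgesTo E own post p l.toFinset e → EdgesTo E own post p l.toFinset e' →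
      s.arr arrPar e = s.arr arrPar e')
    (hin : Reads (s.arr arrIn) (s.reg regT) (q :: l.length :: (l.map Fin.val ++ rest)))
    (hD : s.reg regD = l.length) (hk : 30 * l.length + 16 + R ≤ k) :
    wp insertClass (fun s' k' => Holds E own post (N ++ [(p, l.toFinset, q)]) s' ∧ R ≤ k') s k := by
  obtain ⟨i1, hin⟩ := hin.cons
  obtain ⟨_, hin⟩ := hin.cons
  have hiff : ∀ {e}, EdgesTo E own post p l.toFinset e ↔ ∃ a ∈ l, e = s.arr arrSlot (a.val + 1) := by
    intro e
    rw [hS.edgesTo_iff hE hl]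
    simp only [List.mem_toFinset]
  obtain ⟨a₀, ha₀⟩ := List.exists_mem_of_ne_nil l hne
  set P := s.arr arrPar (s.arr arrSlot (a₀.val + 1)) with hPdef
  have hP : ∀ e, EdgesTo E own post p l.toFinset e → s.arr arrPar e = P := fun e he =>
    hpar e _ he (hiff.2 ⟨a₀, ha₀, rfl⟩)
  have hEV : E ≤ s.reg regV := (show Nodes E own post _ _ _ (s.reg regV) N from h).tree.le
  have hslot : ∀ a ∈ l, 1 ≤ s.arr arrSlot (a.val + 1) ∧ s.arr arrSlot (a.val + 1) ≤ E := fun a ha =>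
    (hS a (hl (List.mem_toFinset.2 ha))).1
  have hinj : ∀ a ∈ l, ∀ b ∈ l, s.arr arrSlot (a.val + 1) = s.arr arrSlot (b.val + 1) → a = b := by
    intro a ha b hb hab
    have h1 := (hS a (hl (List.mem_toFinset.2 ha))).2.1
    have h2 := (hS b (hl (List.mem_toFinset.2 hb))).2.1
    rw [hab, h2] at h1
    exact Fin.ext (by omega)
  refine wp.flat_seq (30 * l.length + 2 + R) rfl (by simp only [Prog.bound, Expr.cost]; omega) ?_
  set s1 := Prog.step _ s with hs1
  have rV : s1.reg regV = s.reg regV + 1 := by simp [hs1, Prog.step, Expr.eval]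
  have rY : s1.reg regY = s.reg regT + 1 + 1 := by simp [hs1, Prog.step, Expr.eval]
  have rS : s1.reg regS = l.length := by simp [hs1, Prog.step, Expr.eval, hD]
  have aRem : s1.arr arrRem = Function.update (s.arr arrRem) (s.reg regV + 1) q := by
    simp [hs1, Prog.step, Expr.eval, i1]
  have aO : ∀ j, j ≠ arrRem → s1.arr j = s.arr j := fun j hj => by simp [hs1, Prog.step, hj]
  refine wp.loopList l (fun pre suf s' k' => s'.reg regS = suf.length ∧
    Reads (s'.arr arrIn) (s'.reg regY) (suf.map Fin.val ++ rest) ∧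
    (∀ a ∈ pre, s'.arr arrPar (s.arr arrSlot (a.val + 1)) = s.reg regV + 1) ∧
    (pre ≠ [] → s'.arr arrPar (s.reg regV + 1) = P) ∧
    (∀ u, u ≠ s.reg regV + 1 → (∀ a ∈ pre, u ≠ s.arr arrSlot (a.val + 1)) →
      s'.arr arrPar u = s.arr arrPar u) ∧
    (∀ e, s'.arr arrDead e = 0 ↔ s.arr arrDead e = 0 ∧
      ((∃ a ∈ pre, e = s.arr arrSlot (a.val + 1)) → q ≠ 0)) ∧
    30 * suf.length + 2 + R ≤ k') ⟨rS, ?_, by simp, by simp, ?_, ?_, le_rfl⟩ ?_ ?_ ?_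
  · rw [rY, aO _ (by decide)]; exact hin
  · intro u _ _; rw [aO _ (by decide)]
  · intro e; rw [aO _ (by decide)]; simp
  · rintro pre suf s' k' _ ⟨hs, _⟩
    simp [Expr.eval, hs]
  · rintro pre x suf s' k' heq ⟨g1, g2, g3, g4, g5, g6, g7⟩ hF
    rw [List.map_cons, List.cons_append] at g2
    obtain ⟨j1, g2⟩ := g2.cons
    rw [List.length_cons] at g1 g7
    have hx : x ∈ l := by rw [heq]; simp
    have hpl : ∀ a ∈ pre, a ∈ l := fun a ha => by rw [heq]; simp [ha]
    have hxpre : x ∉ pre := fun hc => by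
      rw [heq, List.nodup_append] at hnd
      exact hnd.2.2 x hc x (by simp) rfl
    have xs := hslot x hx
    have rV' : s'.reg regV = s.reg regV + 1 := by rw [hF.reg _ (by decide), rV]
    have aSlot : s'.arr arrSlot = s.arr arrSlot := by rw [hF.arr _ (by decide), aO _ (by decide)]
    have aRem' : s'.arr arrRem (s.reg regV + 1) = q := by
      rw [hF.arr _ (by decide), aRem, Function.update_self]
    -- The members of a class are distinct, so this edge has not been rehung yet.
    have hPx : s'.arr arrPar (s.arr arrSlot (x.val + 1)) = P := by
      rw [g5 _ (by omega) fun a ha hc => hxpre ((hinj x hx a (hpl a ha) hc) ▸ ha)]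
      exact hP _ (hiff.2 ⟨x, hx, rfl⟩)
    refine ⟨_, (Nat.add_sub_of_le (by simp only [Expr.cost]; omega)).le,
      wp.flat (30 * suf.length + 2 + R) rfl
        (by simp only [insertMember, Prog.bound, Expr.cost]; omega) ?_⟩
    set s2 := Prog.step _ s' with hs2
    have p2 : s2.arr arrPar = Function.update (Function.update (s'.arr arrPar) (s.reg regV + 1) P)
        (s.arr arrSlot (x.val + 1)) (s.reg regV + 1) := by
      rw [hs2]
      simp only [insertMember, Prog.step]
      by_cases hq : q = 0 <;> simp [Expr.eval, rV', aSlot, j1, hPx, aRem', hq]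
    have d2 : s2.arr arrDead = if q = 0 then
        Function.update (s'.arr arrDead) (s.arr arrSlot (x.val + 1)) 1 else s'.arr arrDead := by
      rw [hs2]
      simp only [insertMember, Prog.step]
      by_cases hq : q = 0 <;> simp [Expr.eval, rV', aSlot, j1, aRem', hq]
    have i2 : s2.arr arrIn = s'.arr arrIn := by
      rw [hs2]
      simp only [insertMember, Prog.step]
      by_cases hq : q = 0 <;> simp [Expr.eval, rV', aSlot, j1, hPx, aRem', hq]
    have y2 : s2.reg regY = s'.reg regY + 1 := by
      rw [hs2]
      simp only [insertMember, Prog.step]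
      by_cases hq : q = 0 <;> simp [Expr.eval, rV', aSlot, j1, hPx, aRem', hq]
    have S2 : s2.reg regS = s'.reg regS - 1 := by
      rw [hs2]
      simp only [insertMember, Prog.step]
      by_cases hq : q = 0 <;> simp [Expr.eval, rV', aSlot, j1, hPx, aRem', hq]
    refine ⟨by rw [S2, g1]; rfl, by rw [i2, y2]; exact g2, ?_, ?_, ?_, ?_, le_rfl⟩
    · intro a ha
      rw [p2]
      rcases List.mem_append.1 ha with ha | ha
      · have := hslot a (hpl a ha)
        rw [Function.update_of_ne, Function.update_of_ne (by omega), g3 a ha]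
        intro hc
        exact hxpre ((hinj a (hpl a ha) x hx hc) ▸ ha)
      · rw [List.mem_singleton.1 ha, Function.update_self]
    · intro _
      rw [p2, Function.update_of_ne (by omega), Function.update_self]
    · intro u hu hua
      rw [p2, Function.update_of_ne (hua x (by simp)), Function.update_of_ne hu]
      exact g5 u hu fun a ha => hua a (by simp [ha])
    · intro e
      rw [d2]
      have hex : (∃ a ∈ pre ++ [x], e = s.arr arrSlot (a.val + 1)) ↔
          (∃ a ∈ pre, e = s.arr arrSlot (a.val + 1)) ∨ e = s.arr arrSlot (x.val + 1) := by
        simp [or_and_right, exists_or]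
      rw [hex]
      by_cases hq : q = 0
      · rw [if_pos hq, Function.update_apply]
        split_ifs with he
        · simp [he, hq]
        · rw [g6 e]; simp [he]
      · simp only [hq, if_false]
        rw [g6 e]
        simp [hq]
  · rintro s' k' ⟨g1, g2, g3, g4, g5, g6, g7⟩ hF
    refine ⟨R, by simp only [Expr.cost]; simp at g7; omega, ?_, le_rfl⟩
    have rV' : s'.reg regV = s.reg regV + 1 := by rw [hF.reg _ (by decide), rV]
    have aRem' : s'.arr arrRem = Function.update (s.arr arrRem) (s.reg regV + 1) q := by
      rw [hF.arr _ (by decide), aRem]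
    unfold Holds at h ⊢
    rw [rV', aRem']
    refine h.insert hP ⟨_, hiff.2 ⟨a₀, ha₀, rfl⟩⟩ ?_ (g4 hne) ?_ (Function.update_self ..) ?_ ?_
    · intro e he
      obtain ⟨a, ha, rfl⟩ := hiff.1 he
      exact g3 a ha
    · intro v hv hv'
      exact g5 v hv' fun a ha hc => hv (hiff.2 ⟨a, ha, hc⟩)
    · intro v _ hv
      exact Function.update_of_ne (by omega) _ _
    · intro e _ _
      rw [g6 e]
      exact and_congr_right fun _ => by rw [hiff]

/-- Time to read a class during the scan for the classes with `d` members. -/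
def scanTime (d : ℕ) (l : List (Fin n)) : ℕ := if l.length = d then 30 * d + 50 else 30

/-- The sum of the two truncated differences vanishes exactly if the class has `d` members. Other
classes are skipped in constant time, because their length tells where the next one starts. -/
theorem readClass_spec (hE : I.EdgeTable E own post rnk) {p : Fin m} {S : Finset (Fin n)}
    {N : List (Fin m × Finset (Fin n) × ℕ)} {l : List (Fin n)} {q R k d : ℕ} {rest : List ℕ} {s : State}
    (h : Holds E own post N s) (hS : Slots E own post (s.arr arrSlot) p S) (hl : l.toFinset ⊆ S)
    (hnd : l.Nodup) (hd : 0 < d)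
    (hpar : l.length = d → ∀ e e', EdgesTo E own post p l.toFinset e →
      EdgesTo E own post p l.toFinset e' → s.arr arrPar e = s.arr arrPar e')
    (hin : Reads (s.arr arrIn) (s.reg regT) (q :: l.length :: (l.map Fin.val ++ rest)))
    (hD : s.reg regD = d) (hk : scanTime d l + R ≤ k) :
    wp readClass (fun s' k' =>
      Holds E own post (N ++ if l.length = d then [(p, l.toFinset, q)] else []) s' ∧
      Reads (s'.arr arrIn) (s'.reg regT) rest ∧ s'.reg regJ = s.reg regJ - 1 ∧ R ≤ k') s k := by
  have i2 := hin.cons.2.cons.1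
  have i3 : Reads (s.arr arrIn) (s.reg regT + (2 + l.length)) rest := by
    have := hin.cons.2.cons.2.append.2
    rw [List.length_map] at this
    rwa [← Nat.add_assoc]
  refine wp.seq (wp.mono (Q := fun s' k' => Holds E own post
    (N ++ if l.length = d then [(p, l.toFinset, q)] else []) s' ∧ 13 + R ≤ k') ?_ ?_)
  · by_cases hld : l.length = d
    · rw [if_pos hld]
      rw [scanTime, if_pos hld] at hk
      refine wp.ite (k' := 30 * d + 29 + R) (by simp only [Expr.cost]; omega) (fun he => ?_) fun _ =>
        insertClass_spec hE h hS hl hnd (fun h0 => by simp [h0] at hld; omega) (hpar hld) hin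
          (by rw [hD, hld]) (by omega)
      exfalso
      simp only [Expr.eval, i2, hD] at he
      omega
    · rw [if_neg hld, List.append_nil]
      rw [scanTime, if_neg hld] at hk
      refine wp.ite (k' := 14 + R) (by simp only [Expr.cost]; omega) (fun _ =>
        wp.flat (13 + R) rfl (by simp only [Prog.bound]; omega) ⟨h, le_rfl⟩) fun he => ?_
      exfalso
      simp only [Expr.eval, i2, hD] at he
      omega
  · rintro s1 k1 hF ⟨h1, hk1⟩
    have aI : s1.arr arrIn = s.arr arrIn := hF.arr _ (by decide)
    have rT : s1.reg regT = s.reg regT := hF.reg _ (by decide)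
    have rJ : s1.reg regJ = s.reg regJ := hF.reg _ (by decide)
    refine wp.flat R rfl (by simp only [Prog.bound, Expr.cost]; omega) ⟨?_, ?_, ?_, le_rfl⟩
    · exact h1.congr (by simp [Prog.step]) rfl rfl rfl
    · simp only [Prog.step, State.setReg_arr, aI]
      simpa [Expr.eval, rT, aI, i2] using i3
    · simp [Prog.step, Expr.eval, rJ]

end CPMInstance

/-! ### Reading the posts -/

namespace RAM

/-- A new node for the post in register `regQ`, if it has edges; `regD` receives the number of its
edges plus one. -/
def insertPost : Prog :=
  (inc regQ ;; .set regC (cell arrPhead regQ) ;;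
    .ite (.reg regC)
      (inc regV ;; .put arrRem (.reg regV) (cell arrIn regPtr) ;;
        .put arrPar (.reg regV) (.const 0)) .skip ;;
    .set regK (.get arrIn (.add (.reg regPtr) (.const 1))) ;;
    .set regPtr (.add (.reg regPtr) (.const 2)) ;; .set regD (.const 1)) ;;
  .loop (.reg regC)
    (.put arrPar (.reg regC) (.reg regV) ;; .put arrSlot (cell arrOwn regC) (.reg regC) ;;
      inc regD ;; .set regC (cell arrPnext regC))

/-- Insert the classes with `regD` members. -/
def scanClasses : Prog :=
  (.set regT (.reg regPtr) ;; .set regJ (.reg regK)) ;; .loop (.reg regJ) readClass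

/-- Insert the classes by decreasing size. -/
def readClasses : Prog :=
  .loop (.reg regD) (scanClasses ;; .set regD (.sub (.reg regD) (.const 1))) ;;
  .set regPtr (.reg regT)

def readPosts : Prog :=
  .set regV (.reg regE) ;; .loop (.sub (.reg regM) (.reg regQ)) (insertPost ;; readClasses)

end RAM

namespace CPMInstance

open RAM Forest

variable {n m : ℕ} {I : CPMInstance n m} {E : ℕ} {own post rnk : ℕ → ℕ}
  {N : List (Fin m × Finset (Fin n) × ℕ)}

theorem edgesTo_nbrSet_iff (hE : I.EdgeTable E own post rnk) {p : Fin m} {e : ℕ} :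
    EdgesTo E own post p (I.nbrSet p) e ↔ (1 ≤ e ∧ e ≤ E) ∧ post e = p.val + 1 := by
  refine ⟨fun h => ⟨h.1, h.2.1⟩, fun h => ⟨h.1, h.2, ?_⟩⟩
  obtain ⟨a, ha, h0 | ⟨p', hp', hmem, _⟩⟩ := hE.entry e h.1.1 h.1.2
  · omega
  · obtain rfl : p' = p := Fin.ext (by omega)
    exact ⟨a, by simpa [nbrSet] using hmem, ha⟩

/-- An edge of `p` is determined by its owner, so the edges of `p` correspond to its neighbours. -/
theorem length_bucket (hE : I.EdgeTable E own post rnk) {p : Fin m} {b : List ℕ} (hb : b.Nodup)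
    (hm : ∀ c, c ∈ b ↔ (1 ≤ c ∧ c ≤ E) ∧ post c = p.val + 1) : b.length = (I.nbrSet p).card := by
  rw [← List.toFinset_card_of_nodup hb]
  have h1 : (b.toFinset.image own).card = b.toFinset.card := by
    refine Finset.card_image_of_injOn fun x hx y hy hxy => ?_
    rw [Finset.mem_coe, List.mem_toFinset, hm] at hx hy
    exact hE.inj x y hx.1.1 hx.1.2 hy.1.1 hy.1.2 hxy (hx.2.trans hy.2.symm)
  have h2 : ((I.nbrSet p).image fun a => a.val + 1).card = (I.nbrSet p).card :=
    Finset.card_image_of_injective _ fun x y hxy => Fin.ext (by simpa using hxy)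
  rw [← h1, ← h2]
  congr 1
  ext i
  simp only [Finset.mem_image, List.mem_toFinset, hm, ← edgesTo_nbrSet_iff hE]
  constructor
  · rintro ⟨e, ⟨_, _, a, ha, hoa⟩, rfl⟩
    exact ⟨a, ha, hoa.symm⟩
  · rintro ⟨a, ha, rfl⟩
    obtain ⟨e, he, hoa, hpe⟩ := hE.edge a p (by simpa [nbrSet] using ha)
    exact ⟨e, ⟨he, hpe, a, ha, hoa⟩, hoa⟩

/-- A parent other than the root would be a set of another post. -/
theorem Nodes.par_eq_zero {V : ℕ} {par cap dead : ℕ → ℕ} (h : Nodes E own post par cap dead V N)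
    {p : Fin m} (hN : ∀ x ∈ N, x.1 ≠ p) {e : ℕ} (h1 : 1 ≤ e ∧ e ≤ E) (h2 : post e = p.val + 1) :
    par e = 0 := by
  rcases h.tree.edge e h1.1 h1.2 with h0 | h0
  · exact h0
  · obtain ⟨i, x, hi, hx, hv⟩ := h.get h0.1 h0.2
    have hs := h.spans i x hi
    rw [← hv] at hs
    have := ((hs e h1.1 h1.2).1 (anc_iff.2 (.inr (Anc.refl _ _)))).1
    exact absurd (Fin.ext (by omega)) (hN x hx)

theorem insertPost_spec {T : List (ℕ × ℕ × ℕ)} {p : Fin m} {j R k : ℕ} {rest : List ℕ} {s : State}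
    (hE : I.EdgeTable (s.reg regE) (s.arr arrOwn) (s.arr arrPost) rnk) (hT : Edges m T s)
    (h : Holds (s.reg regE) (s.arr arrOwn) (s.arr arrPost) N s) (hN : ∀ x ∈ N, x.1 ≠ p)
    (hQ : s.reg regQ = p.val) (hin : Reads (s.arr arrIn) (s.reg regPtr) (I.quota p :: j :: rest))
    (hk : 18 * (I.nbrSet p).card + 40 + R ≤ k) :
    wp insertPost (fun s' k' =>
      Holds (s.reg regE) (s.arr arrOwn) (s.arr arrPost) (N ++ I.rootEntry p) s' ∧
      Slots (s.reg regE) (s.arr arrOwn) (s.arr arrPost) (s'.arr arrSlot) p (I.nbrSet p) ∧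
      s'.reg regQ = p.val + 1 ∧ s'.reg regK = j ∧ s'.reg regD = (I.nbrSet p).card + 1 ∧
      Reads (s'.arr arrIn) (s'.reg regPtr) rest ∧ R ≤ k') s k := by
  obtain ⟨i1, hin⟩ := hin.cons
  obtain ⟨i2, hin⟩ := hin.cons
  obtain ⟨b, hchain, hbn, hbm⟩ := hT.buckets (p.val + 1) p.isLt
  have hbm' : ∀ c, c ∈ b ↔ (1 ≤ c ∧ c ≤ s.reg regE) ∧ s.arr arrPost c = p.val + 1 := by
    intro c
    rw [hbm, hT.len]
    omega
  have hlen := length_bucket hE hbn hbm'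
  have hinj : ∀ x ∈ b, ∀ y ∈ b, s.arr arrOwn x = s.arr arrOwn y → x = y := by
    intro x hx y hy hxy
    rw [hbm'] at hx hy
    exact hE.inj x y hx.1.1 hx.1.2 hy.1.1 hy.1.2 hxy (hx.2.trans hy.2.symm)
  have hhead : s.arr arrPhead (p.val + 1) = 0 ↔ b = [] := by
    constructor
    · intro h0
      rw [h0] at hchain
      exact hchain.eq_nil
    · rintro rfl
      by_contra h0
      obtain ⟨_, h1, _⟩ := hchain.ne_nil h0
      simp at h1
  refine wp.flat_seq (18 * (I.nbrSet p).card + 2 + R) rfl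
    (by simp only [Prog.bound, Expr.cost]; omega) ?_
  set s1 := Prog.step _ s with hs1
  set v := if b = [] then s.reg regV else s.reg regV + 1 with hv
  have rC : s1.reg regC = s.arr arrPhead (p.val + 1) := by
    simp only [hs1, Prog.step]
    by_cases hb : b = [] <;> simp [Expr.eval, hQ, hhead, hb]
  have rV : s1.reg regV = v := by
    simp only [hs1, Prog.step, hv]
    by_cases hb : b = [] <;> simp [Expr.eval, hQ, hhead, hb]
  have rQ : s1.reg regQ = p.val + 1 := by
    simp only [hs1, Prog.step]
    by_cases hb : b = [] <;> simp [Expr.eval, hQ, hhead, hb]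
  have rK : s1.reg regK = j := by
    simp only [hs1, Prog.step]
    by_cases hb : b = [] <;> simp [Expr.eval, hQ, hhead, hb, i2]
  have rP : s1.reg regPtr = s.reg regPtr + 1 + 1 := by
    simp only [hs1, Prog.step]
    by_cases hb : b = [] <;> simp [Expr.eval, hQ, hhead, hb]
  have rD : s1.reg regD = 1 := by
    simp only [hs1, Prog.step]
    by_cases hb : b = [] <;> simp [Expr.eval, hQ, hhead, hb]
  have aRem : s1.arr arrRem = if b = [] then s.arr arrRem else
      Function.update (s.arr arrRem) (s.reg regV + 1) (I.quota p) := by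
    simp only [hs1, Prog.step]
    by_cases hb : b = [] <;> simp [Expr.eval, hQ, hhead, hb, i1]
  have aPar : s1.arr arrPar = if b = [] then s.arr arrPar else
      Function.update (s.arr arrPar) (s.reg regV + 1) 0 := by
    simp only [hs1, Prog.step]
    by_cases hb : b = [] <;> simp [Expr.eval, hQ, hhead, hb]
  have aO : ∀ j, j ≠ arrRem → j ≠ arrPar → s1.arr j = s.arr j := by
    intro j h1 h2
    simp only [hs1, Prog.step]
    by_cases hb : b = [] <;> simp [Expr.eval, hQ, hhead, hb, h1, h2]
  clear_value s1
  refine wp.loopList b (fun pre suf s' k' => Chain (s.arr arrPnext) (s'.reg regC) suf ∧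
    (∀ u, s'.arr arrPar u = if u ∈ pre then v else s1.arr arrPar u) ∧
    (∀ e ∈ pre, s'.arr arrSlot (s.arr arrOwn e) = e) ∧ s'.reg regD = pre.length + 1 ∧
    18 * suf.length + 2 + R ≤ k') ⟨by rw [rC]; exact hchain, by simp, by simp, rD, by omega⟩ ?_ ?_ ?_
  · rintro pre suf s' k' _ ⟨hc, _⟩
    simp only [Expr.eval]
    constructor
    · intro h0
      rw [h0] at hc
      exact hc.eq_nil
    · rintro rfl
      by_contra h0
      obtain ⟨_, h1, _⟩ := hc.ne_nil h0
      simp at h1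
  · rintro pre x suf s' k' heq ⟨g1, g2, g3, g4, g5⟩ hF
    obtain ⟨rfl, hx0⟩ : s'.reg regC = x ∧ x ≠ 0 := by
      generalize s'.reg regC = c at g1
      cases g1 with
      | cons h0 _ => exact ⟨rfl, h0⟩
    obtain ⟨_, hl, g1⟩ := g1.ne_nil hx0
    obtain rfl := (List.cons.inj hl).2
    rw [List.length_cons] at g5
    have rV' : s'.reg regV = v := by rw [hF.reg _ (by decide), rV]
    have aOwn : s'.arr arrOwn = s.arr arrOwn := by
      rw [hF.arr _ (by decide), aO _ (by decide) (by decide)]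
    have aNext : s'.arr arrPnext = s.arr arrPnext := by
      rw [hF.arr _ (by decide), aO _ (by decide) (by decide)]
    refine ⟨_, (Nat.add_sub_of_le (by simp only [Expr.cost]; omega)).le,
      wp.flat (18 * suf.length + 2 + R) rfl (by simp only [Prog.bound, Expr.cost]; omega) ?_⟩
    refine ⟨?_, ?_, ?_, ?_, le_rfl⟩
    · simpa [Prog.step, Expr.eval, aNext] using g1
    · intro u
      by_cases hu : u = s'.reg regC
      · simp [Prog.step, Expr.eval, rV', hu]
      · simp [Prog.step, Expr.eval, rV', hu, g2]
    · intro e he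
      simp only [Prog.step, Expr.eval, State.setReg_arr, State.setCell_arr, if_true, State.setCell_reg,
        aOwn]
      norm_num [aOwn]
      rw [Function.update_apply]
      rcases List.mem_append.1 he with he | he
      · split_ifs with hc
        · exact (hinj _ (by rw [heq]; simp [he]) _ (by rw [heq]; simp) hc).symm
        · exact g3 e he
      · rw [List.mem_singleton.1 he, if_pos rfl]
    · simp [Prog.step, Expr.eval, g4]
  · rintro s' k' ⟨_, g2, g3, g4, g5⟩ hF
    have rV' : s'.reg regV = v := by rw [hF.reg _ (by decide), rV]
    have aRem' : s'.arr arrRem = s1.arr arrRem := hF.arr _ (by decide)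
    have aDead : s'.arr arrDead = s.arr arrDead := by
      rw [hF.arr _ (by decide), aO _ (by decide) (by decide)]
    have hiff : ∀ {e}, EdgesTo (s.reg regE) (s.arr arrOwn) (s.arr arrPost) p (I.nbrSet p) e ↔
        e ∈ b := fun {e} => by rw [edgesTo_nbrSet_iff hE, hbm']
    refine ⟨R, by simp only [Expr.cost]; simp at g5; omega, ?_, ?_, by rw [hF.reg _ (by decide), rQ],
      by rw [hF.reg _ (by decide), rK], by rw [g4, hlen], ?_, le_rfl⟩
    · by_cases hb : b = []
      · have h0 : I.nbrSet p = ∅ := by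
          rw [← Finset.card_eq_zero, ← hlen, hb]; rfl
        rw [rootEntry, if_pos h0, List.append_nil]
        refine h.congr (by rw [rV', hv, if_pos hb]) ?_ (by rw [aRem', aRem, if_pos hb]) aDead
        funext u
        rw [g2, aPar, if_pos hb, hb]
        simp
      · have h0 : I.nbrSet p ≠ ∅ := by
          intro h0
          rw [← Finset.card_eq_zero, ← hlen, List.length_eq_zero_iff] at h0
          exact hb h0
        have hvV : v = s.reg regV + 1 := by rw [hv, if_neg hb]
        have hbV : s.reg regV + 1 ∉ b := by
          rw [hbm']
          have := (show Nodes _ _ _ _ _ _ (s.reg regV) N from h).tree.le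
          omega
        rw [rootEntry, if_neg h0]
        unfold Holds at h ⊢
        rw [rV', hvV, aRem', aRem, if_neg hb, aDead]
        refine h.insert (P := 0) ?_ ?_ ?_ ?_ ?_ (Function.update_self ..) ?_ ?_
        · intro e he
          rw [hiff, hbm'] at he
          exact h.par_eq_zero hN he.1 he.2
        · obtain ⟨e, he⟩ := List.exists_mem_of_ne_nil b hb
          exact ⟨e, hiff.2 he⟩
        · intro e he
          rw [g2, if_pos (hiff.1 he), hvV]
        · rw [g2, if_neg hbV, aPar, if_neg hb, Function.update_self]
        · intro u hu huv
          rw [g2, if_neg (fun hc => hu (hiff.2 hc)), aPar, if_neg hb, Function.update_of_ne huv]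
        · intro u _ hu
          exact Function.update_of_ne (by omega) _ _
        · intro e _ _
          exact (and_iff_left fun _ => (I.quota_pos p).ne').symm
    · intro a ha
      obtain ⟨e, he, hoe, hpe⟩ := hE.edge a p (by simpa [nbrSet] using ha)
      have := g3 e ((hbm' e).2 ⟨he, hpe⟩)
      rw [hoe] at this
      rw [this]
      exact ⟨he, hoe, hpe⟩
    · rw [hF.arr _ (by decide), aO _ (by decide) (by decide), hF.reg _ (by decide), rP]
      exact hin

variable (L : Listing I)

/-- The classes of `p` with `d` members. -/
def Listing.sized (p : Fin m) (d : ℕ) : List (List (Fin n)) :=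
  (L.classList p).filter fun l => l.length = d

/-- The sets inserted before do not separate the members of `l`: sets of other posts contain none of
their edges at `p`, the set of all neighbours contains all, and an earlier class contains all or
none. -/
theorem Listing.same_par (hI : I.Laminar) {p : Fin m} {A B : List (List (Fin n))} {l : List (Fin n)}
    (hord : L.order p = A ++ l :: B) (hN : ∀ x ∈ N, x.1 ≠ p) {V : ℕ} {par cap dead : ℕ → ℕ}
    (h : Nodes E own post par cap dead V (N ++ I.rootEntry p ++ A.map (I.classEntry p))) {e e' : ℕ}
    (he : EdgesTo E own post p l.toFinset e) (he' : EdgesTo E own post p l.toFinset e') :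
    par e = par e' := by
  have hl : l ∈ L.classList p := (L.mem_order.1 (by rw [hord]; simp : l ∈ L.order p)).1
  have hpw := L.order_pairwise hI p
  rw [hord, List.pairwise_append] at hpw
  have key : ∀ {e e' : ℕ}, EdgesTo E own post p l.toFinset e → EdgesTo E own post p l.toFinset e' →
      par e ≤ par e' := by
    intro e e' he he'
    refine h.par_le he.1 he'.1 fun x hx hxe => ?_
    obtain ⟨_, h2, a, ha, h3⟩ := he
    obtain ⟨h1', h2', a', ha', h3'⟩ := he'
    rcases List.mem_append.1 hx with hx | hx
    · rcases List.mem_append.1 hx with hx | hx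
      · exact absurd (Fin.ext (by have := hxe.2.1; omega)) (hN x hx)
      · unfold rootEntry at hx
        split_ifs at hx
        · simp at hx
        · obtain rfl := List.mem_singleton.1 hx
          exact ⟨h1', h2', a', L.class_subset hl ha', h3'⟩
    · obtain ⟨c, hc, rfl⟩ := List.mem_map.1 hx
      refine ⟨h1', h2', a', ?_, h3'⟩
      rcases hpw.2.2 c hc l (by simp) with hlc | hlc
      · exact hlc ha'
      · obtain ⟨_, _, b, hb, h4⟩ := hxe
        obtain rfl : a = b := Fin.ext (by omega)
        exact absurd (Finset.mem_inter.2 ⟨ha, hb⟩ : a ∈ l.toFinset ∩ c.toFinset) (by rw [hlc]; simp)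
  exact le_antisymm (key he he') (key he' he)

/-- One scan pays a constant for every class, and an amount proportional to `d` only for the classes
of size `d`. Over all scans every class is paid for in full only once. -/
theorem sum_scanTime (d : ℕ) (c : List (List (Fin n))) : (c.map (scanTime d)).sum =
    30 * c.length + (c.filter fun l => l.length = d).length * (30 * d + 20) := by
  induction c with
  | nil => simp
  | cons l c ih =>
    rw [List.map_cons, List.sum_cons, ih, List.length_cons, List.filter_cons, scanTime]
    by_cases h : l.length = d
    · simp only [h, decide_true, if_true, List.length_cons]; ring
    · simp only [h, decide_false, if_false]; simp; ring

/-- The input block of a class. -/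
def classBlock (I : CPMInstance n m) (p : Fin m) (l : List (Fin n)) : List ℕ :=
  I.classQuota p l.toFinset :: l.length :: l.map Fin.val

theorem scanClasses_spec (hI : I.Laminar) (hE : I.EdgeTable E own post rnk) {p : Fin m}
    {A B : List (List (Fin n))} {d R k : ℕ} {rest : List ℕ} {s : State} (hd : 0 < d)
    (hord : L.order p = A ++ L.sized p d ++ B) (hN : ∀ x ∈ N, x.1 ≠ p)
    (h : Holds E own post (N ++ I.rootEntry p ++ A.map (I.classEntry p)) s)
    (hS : Slots E own post (s.arr arrSlot) p (I.nbrSet p))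
    (hin : Reads (s.arr arrIn) (s.reg regPtr) ((L.classList p).flatMap (I.classBlock p) ++ rest))
    (hD : s.reg regD = d) (hK : s.reg regK = (L.classList p).length)
    (hk : 32 * (L.classList p).length + (L.sized p d).length * (30 * d + 20) + 6 + R ≤ k) :
    wp scanClasses (fun s' k' =>
      Holds E own post (N ++ I.rootEntry p ++ (A ++ L.sized p d).map (I.classEntry p)) s' ∧
      Reads (s'.arr arrIn) (s'.reg regT) rest ∧ R ≤ k') s k := by
  have hsum := sum_scanTime d (L.classList p)
  rw [Listing.sized] at hk
  refine wp.flat_seq (((L.classList p).map (scanTime d)).sum + 2 * (L.classList p).length + 2 + R) rfl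
    (by simp only [Prog.bound, Expr.cost]; omega) ?_
  set s1 := Prog.step _ s with hs1
  have rJ : s1.reg regJ = (L.classList p).length := by simp [hs1, Prog.step, Expr.eval, hK]
  have rT : s1.reg regT = s.reg regPtr := by simp [hs1, Prog.step, Expr.eval]
  have rD : s1.reg regD = d := by simp [hs1, Prog.step, hD]
  have h1 : Holds E own post (N ++ I.rootEntry p ++ A.map (I.classEntry p)) s1 :=
    h.congr (by simp [hs1, Prog.step]) rfl rfl rfl
  have a1 : s1.arr = s.arr := rfl
  clear_value s1
  refine wp.loopList (L.classList p) (fun pre suf s' k' =>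
    Holds E own post (N ++ I.rootEntry p ++
      (A ++ pre.filter fun l => l.length = d).map (I.classEntry p)) s' ∧
    Reads (s'.arr arrIn) (s'.reg regT) (suf.flatMap (I.classBlock p) ++ rest) ∧
    s'.reg regJ = suf.length ∧ (suf.map (scanTime d)).sum + 2 * suf.length + 2 + R ≤ k')
    ⟨by simpa using h1, by rw [rT, a1]; exact hin, rJ, le_rfl⟩ ?_ ?_ ?_
  · rintro pre suf s' k' _ ⟨_, _, hJ, _⟩
    simp [Expr.eval, hJ]
  · rintro pre x suf s' k' heq ⟨g1, g2, g3, g4⟩ hF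
    rw [List.flatMap_cons, classBlock, List.append_assoc, List.cons_append, List.cons_append] at g2
    rw [List.map_cons, List.sum_cons, List.length_cons] at g4
    have hx : x ∈ L.classList p := by rw [heq]; simp
    refine ⟨_, (Nat.add_sub_of_le (by simp only [Expr.cost]; omega)).le,
      (readClass_spec (R := (suf.map (scanTime d)).sum + 2 * suf.length + 2 + R) hE g1
        (by rw [hF.arr _ (by decide), a1]; exact hS) (L.class_subset hx) (L.members_nodup p x hx) hd
        ?_ g2 (by rw [hF.reg _ (by decide), rD]) (by simp only [Expr.cost]; omega)).mono ?_⟩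
    · intro hxd e e' he he'
      refine L.same_par hI (A := A ++ pre.filter fun l => l.length = d)
        (B := (suf.filter fun l => l.length = d) ++ B) ?_ hN g1 he he'
      rw [hord, Listing.sized, heq, List.filter_append, List.filter_cons, if_pos (by simpa using hxd)]
      simp
    · rintro s2 k2 _ ⟨f1, f2, f3, f4⟩
      refine ⟨?_, f2, by rw [f3, g3]; rfl, f4⟩
      by_cases hxd : x.length = d
      · rw [if_pos hxd] at f1
        simpa [hxd, classEntry] using f1
      · rw [if_neg hxd] at f1
        simpa [hxd] using f1
  · rintro s' k' ⟨g1, g2, _, g4⟩ _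
    exact ⟨R, by simp only [Expr.cost]; simp at g4; omega, g1, by simpa using g2, le_rfl⟩

theorem readClasses_spec (hI : I.Laminar) (hE : I.EdgeTable E own post rnk) {p : Fin m}
    {R k D : ℕ} {rest : List ℕ} {s : State} (hDdef : D = (I.nbrSet p).card + 1)
    (hN : ∀ x ∈ N, x.1 ≠ p)
    (h : Holds E own post (N ++ I.rootEntry p) s)
    (hS : Slots E own post (s.arr arrSlot) p (I.nbrSet p))
    (hin : Reads (s.arr arrIn) (s.reg regPtr) ((L.classList p).flatMap (I.classBlock p) ++ rest))
    (hD : s.reg regD = D) (hK : s.reg regK = (L.classList p).length)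
    (hk : (L.order p).length * (30 * D + 20) + D * (32 * (L.classList p).length + 12) + 4 + R ≤ k) :
    wp readClasses (fun s' k' => Holds E own post (N ++ L.postNodes p) s' ∧
      Reads (s'.arr arrIn) (s'.reg regPtr) rest ∧ R ≤ k') s k := by
  have hord : L.order p = (countdown D).flatMap (L.sized p) := by rw [hDdef]; rfl
  refine wp.seq (wp.loopList (countdown D) (fun pre suf s' k' =>
    Holds E own post (N ++ I.rootEntry p ++ (pre.flatMap (L.sized p)).map (I.classEntry p)) s' ∧
    s'.reg regD = suf.length ∧ (pre ≠ [] → Reads (s'.arr arrIn) (s'.reg regT) rest) ∧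
    (suf.flatMap (L.sized p)).length * (30 * D + 20) +
      suf.length * (32 * (L.classList p).length + 12) + 4 + R ≤ k')
    ⟨by simpa using h, by rw [hD, countdown_length], by simp,
      by rw [← hord, countdown_length]; exact hk⟩ ?_ ?_ ?_)
  · rintro pre suf s' k' _ ⟨_, hd, _⟩
    simp [Expr.eval, hd]
  · rintro pre x suf s' k' heq ⟨g1, g2, g3, g4⟩ hF
    have hx := countdown_eq heq
    have hxD : x ≤ D := (mem_countdown.1 (by rw [heq]; simp : x ∈ countdown D)).2
    rw [List.length_cons] at g2 g4
    rw [List.flatMap_cons, List.length_append, Nat.add_mul, Nat.succ_mul suf.length] at g4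
    have hmul : (L.sized p x).length * (30 * x + 20) ≤ (L.sized p x).length * (30 * D + 20) :=
      Nat.mul_le_mul_left _ (by omega)
    set R' := (suf.flatMap (L.sized p)).length * (30 * D + 20) +
      suf.length * (32 * (L.classList p).length + 12) + 4 + R with hR'
    refine ⟨32 * (L.classList p).length + (L.sized p x).length * (30 * x + 20) + 6 + (4 + R'),
      by simp only [Expr.cost]; omega, wp.seq ?_⟩
    refine (scanClasses_spec L hI hE (A := pre.flatMap (L.sized p)) (B := suf.flatMap (L.sized p))
      (d := x) (rest := rest) (by omega) ?_ hN g1 ?_ ?_ (by rw [g2, hx]) ?_ le_rfl).mono ?_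
    · rw [hord, heq]; simp
    · rw [hF.arr _ (by decide)]; exact hS
    · rw [hF.arr _ (by decide), hF.reg _ (by decide)]; exact hin
    · rw [hF.reg _ (by decide)]; exact hK
    · rintro s2 k2 hF2 ⟨f1, f2, f3⟩
      have rD2 : s2.reg regD = suf.length + 1 := by rw [hF2.reg _ (by decide), g2]
      refine wp.flat R' rfl (by simp only [Prog.bound, Expr.cost]; omega) ⟨?_, ?_, ?_, le_rfl⟩
      · refine Holds.congr (s := s2) ?_ (by simp [Prog.step]) rfl rfl rfl
        simpa using f1
      · simp [Prog.step, Expr.eval, rD2]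
      · intro _
        simpa [Prog.step] using f2
  · rintro s' k' ⟨g1, _, g3, g4⟩ hF
    -- The sizes start at the number of neighbours plus one, which no class attains. So there is at
    -- least one scan, even for a post without neighbours, and the position behind the classes is
    -- known.
    have hne : countdown D ≠ [] := by
      rw [hDdef]
      simp [countdown]
    refine ⟨2 + R, by simp only [Expr.cost]; omega,
      wp.flat R rfl (by simp only [Prog.bound, Expr.cost]; omega) ⟨?_, ?_, le_rfl⟩⟩
    · refine Holds.congr (s := s') ?_ (by simp [Prog.step]) rfl rfl rfl
      rw [Listing.postNodes, ← List.append_assoc, hord]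
      exact g1
    · simpa [Prog.step, Expr.eval] using g3 hne

theorem Listing.postNodes_post {p : Fin m} {x : Fin m × Finset (Fin n) × ℕ}
    (hx : x ∈ L.postNodes p) : x.1 = p := by
  rcases List.mem_append.1 hx with hx | hx
  · unfold rootEntry at hx
    split_ifs at hx
    · simp at hx
    · rw [List.mem_singleton.1 hx]
  · obtain ⟨c, _, rfl⟩ := List.mem_map.1 hx
    rfl

/-- A bound for the time to read the post `p`. -/
def postTime (I : CPMInstance n m) (p : Fin m) : ℕ := 360 * (n * (I.nbrSet p).card) + 100

/-- For a post of degree d there are d + 1 scans over at most 2d + 1 classes, and at most 2d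
insertions of cost O(d). This is quadratic in d, and d is at most the number of applicants. -/
theorem Listing.le_postTime (hI : I.Laminar) (p : Fin m) : 18 * (I.nbrSet p).card + 40 +
    ((L.order p).length * (30 * ((I.nbrSet p).card + 1) + 20) +
      ((I.nbrSet p).card + 1) * (32 * (L.classList p).length + 12) + 4) ≤ I.postTime p := by
  have h1 := L.order_length hI p
  have h2 := L.classList_length hI p
  have h3 : (I.nbrSet p).card ≤ n := (Finset.card_le_univ _).trans_eq (Fintype.card_fin n)
  unfold postTime
  generalize (I.nbrSet p).card = d at *
  have h4 : (L.order p).length * (30 * (d + 1) + 20) ≤ 2 * d * (30 * (d + 1) + 20) :=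
    Nat.mul_le_mul_right _ h1
  have h5 : (d + 1) * (32 * (L.classList p).length + 12) ≤ (d + 1) * (32 * (2 * d + 1) + 12) :=
    Nat.mul_le_mul_left _ (by omega)
  have h6 : d * d ≤ n * d := Nat.mul_le_mul_right _ h3
  have h7 : d ≤ d * d := Nat.le_mul_self d
  nlinarith

theorem readPosts_spec (hI : I.Laminar) {s : State} (hT : Edges m L.table s) (hM : s.reg regM = m)
    (hQ : s.reg regQ = 0) (hpar : ∀ u, s.arr arrPar u = 0) (hdead : ∀ u, s.arr arrDead u = 0)
    (hin : Reads (s.arr arrIn) (s.reg regPtr) ((List.finRange m).flatMap L.postBlock)) :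
    wp readPosts (fun s' _ => Holds (s.reg regE) (s.arr arrOwn) (s.arr arrPost)
      ((List.finRange m).flatMap L.postNodes) s') s
      (360 * (n * I.edges.card) + 104 * m + 10) := by
  have hsum : ((List.finRange m).map I.postTime).sum = 360 * (n * I.edges.card) + 100 * m := by
    rw [← sum_card_nbrSet, ← Fin.sum_univ_def, Finset.mul_sum, Finset.mul_sum]
    unfold postTime
    rw [Finset.sum_add_distrib]
    simp [mul_comm]
  have hE := L.edgeTable hT
  refine wp.flat_seq (((List.finRange m).map I.postTime).sum + 4 * (List.finRange m).length + 8) rfl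
    (by simp only [Prog.bound, Expr.cost, List.length_finRange]; omega) ?_
  set s1 := Prog.step _ s with hs1
  have rV : s1.reg regV = s.reg regE := by simp [hs1, Prog.step, Expr.eval]
  have rO : ∀ j, j ≠ regV → s1.reg j = s.reg j := fun j hj => by simp [hs1, Prog.step, hj]
  have a1 : s1.arr = s.arr := rfl
  clear_value s1
  refine wp.loopList (List.finRange m) (fun pre suf s' k' =>
    Holds (s.reg regE) (s.arr arrOwn) (s.arr arrPost) (pre.flatMap L.postNodes) s' ∧
    s'.reg regQ = pre.length ∧ s'.reg regM = m ∧
    Reads (s'.arr arrIn) (s'.reg regPtr) (suf.flatMap L.postBlock ++ []) ∧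
    (suf.map I.postTime).sum + 4 * suf.length + 8 ≤ k')
    ⟨?_, by rw [rO _ (by decide), hQ]; rfl, by rw [rO _ (by decide), hM], ?_, le_rfl⟩ ?_ ?_ ?_
  · unfold Holds
    rw [rV, a1]
    refine ⟨rfl, ⟨le_rfl, hpar 0, fun e _ _ => .inl (hpar e), fun v h1 h2 => by omega⟩, ?_, ?_, ?_⟩
    · simp
    · simp
    · simp [hdead]
  · rw [a1, rO _ (by decide), List.append_nil]; exact hin
  · rintro pre suf s' k' hl ⟨_, hq, hm, _⟩
    have hlen := congrArg List.length hl
    rw [List.length_finRange, List.length_append] at hlen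
    simp only [Expr.eval, hq, hm]
    rw [← List.length_eq_zero_iff]
    omega
  · rintro pre p suf s' k' hl ⟨g1, g2, gM, g3, g4⟩ hF
    rw [List.flatMap_cons, List.append_assoc, Listing.postBlock, List.cons_append,
      List.cons_append] at g3
    rw [List.map_cons, List.sum_cons, List.length_cons] at g4
    have hp := val_of_finRange_eq hl
    have htime := L.le_postTime hI p
    have rE : s'.reg regE = s.reg regE := by rw [hF.reg _ (by decide), rO _ (by decide)]
    have aOwn : s'.arr arrOwn = s.arr arrOwn := by rw [hF.arr _ (by decide), a1]
    have aPost : s'.arr arrPost = s.arr arrPost := by rw [hF.arr _ (by decide), a1]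
    have hT' : Edges m L.table s' := hT.congr rE fun k hk => by
      rw [hF.arr k (by revert k; decide), a1]
    have hN : ∀ x ∈ pre.flatMap L.postNodes, x.1 ≠ p := by
      intro x hx
      obtain ⟨p', hp', hx⟩ := List.mem_flatMap.1 hx
      rw [L.postNodes_post hx]
      rintro rfl
      have hnd := List.nodup_finRange m
      rw [hl, List.nodup_append] at hnd
      exact hnd.2.2 _ hp' _ (by simp) rfl
    refine ⟨_, (Nat.add_sub_of_le (by simp only [Expr.cost]; omega)).le, wp.seq ?_⟩
    refine (insertPost_spec (R := (L.order p).length * (30 * ((I.nbrSet p).card + 1) + 20) +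
      ((I.nbrSet p).card + 1) * (32 * (L.classList p).length + 12) + 4 +
      ((suf.map I.postTime).sum + 4 * suf.length + 8)) (rnk := s.arr arrRank)
      (by rw [rE, aOwn, aPost]; exact hE) hT' (by rw [rE, aOwn, aPost]; exact g1) hN (by rw [g2, hp])
      g3 (by simp only [Expr.cost]; omega)).mono ?_
    rintro s2 k2 hF2 ⟨f1, f2, f3, f4, f5, f6, f7⟩
    rw [rE, aOwn, aPost] at f1 f2
    refine (readClasses_spec L hI hE rfl hN f1 f2 f6 f5 f4 f7).mono ?_
    rintro s3 k3 hF3 ⟨e1, e2, e3⟩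
    refine ⟨by simpa using e1, ?_, ?_, e2, e3⟩
    · rw [hF3.reg _ (by decide), f3, hp]
      simp
    · rw [hF3.reg _ (by decide), hF2.reg _ (by decide), gM]
  · rintro s' k' ⟨g1, _, _, _, g4⟩ _
    exact ⟨0, by simp only [Expr.cost]; omega, g1⟩

end CPMInstance

/-! ### The algorithm -/

namespace RAM

/-- The whole algorithm. -/
def popularMatching : Prog := readApplicants ;; readPosts ;; solve

end RAM

namespace CPMInstance

open RAM Forest

variable {n m : ℕ} {I : CPMInstance n m} (L : Listing I)

theorem popularMatching_spec (hI : I.Laminar) :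
    wp popularMatching (fun s' _ => I.CorrectAnswer s') (init L.encode)
      (8500 * (n * I.edges.card + n + m + 1)) := by
  have hT := L.table_length
  have hn : I.edges.card ≤ n * I.edges.card := by
    rcases Nat.eq_zero_or_pos n with rfl | hn
    · simp [Finset.eq_empty_of_isEmpty I.edges]
    · exact Nat.le_mul_of_pos_left _ hn
  refine wp.then (readApplicants_spec L)
    (T' := 360 * (n * I.edges.card) + 104 * m + 10 + (800 * (5 * I.edges.card) + 800) * (n + 1)) ?_
    (by ring_nf; ring_nf at hn; omega)
  rintro s1 ⟨h1, hN, hM, hin⟩ F1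
  have z1 : ∀ j, j ∉ readApplicants.arrs → j ≠ 0 → ∀ u, s1.arr j u = 0 := fun j hj h0 u => by
    rw [F1.arr j hj]
    simp [init, h0]
  refine wp.then (readPosts_spec L hI h1 hM (by rw [F1.reg _ (by decide)]; rfl)
    (z1 _ (by decide) (by decide)) (z1 _ (by decide) (by decide)) hin) ?_ le_rfl
  intro s2 h2 F2
  have eE : s2.reg regE = s1.reg regE := F2.reg _ (by decide)
  have eO : s2.arr arrOwn = s1.arr arrOwn := F2.arr _ (by decide)
  have eP : s2.arr arrPost = s1.arr arrPost := F2.arr _ (by decide)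
  have eR : s2.arr arrRank = s1.arr arrRank := F2.arr _ (by decide)
  have hE := L.edgeTable h1
  have hV := L.nodeTable h2
  rw [← eE, ← eO, ← eP] at hV
  rw [← eE, ← eO, ← eP, ← eR] at hE
  have z2 : ∀ j, j ∉ readApplicants.arrs → j ≠ 0 → j ∉ readPosts.arrs → ∀ u, s2.arr j u = 0 :=
    fun j hj h0 hj' u => by rw [F2.arr j hj', z1 j hj h0]
  -- There are at most 2|E| edges including the last resorts, and at most 3d nodes for a post of
  -- degree d: one for the post and 2d for its classes.
  have hlen : s2.reg regV ≤ 5 * I.edges.card := by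
    have h3 : ((List.finRange m).flatMap L.postNodes).length ≤ 3 * I.edges.card := by
      rw [← sum_card_nbrSet, List.length_flatMap, ← Fin.sum_univ_def, Finset.mul_sum]
      exact Finset.sum_le_sum fun p _ => L.postNodes_length hI p
    rw [Nodes.len h2, h1.len]
    omega
  have ready : Ready n (s2.arr arrRem) s2 :=
    ⟨by rw [F2.reg _ (by decide), hN], hE.market hV, fun _ _ _ => rfl,
      z2 _ (by decide) (by decide) (by decide), z2 _ (by decide) (by decide) (by decide),
      z2 _ (by decide) (by decide) (by decide)⟩
  refine ((solve_spec ready).mono fun s3 _ _ h3 => hE.correctAnswer hV h3.1 h3.2).weaken ?_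
  exact Nat.mul_le_mul_right _ (by omega)

end CPMInstance

/-- One program solves all laminar instances, in time `O(|A||E|)`.  The terms `n + m + 1` in the first
bound only account for isolated vertices and for the empty graph; they disappear, as stated
in the second bound, if there is an edge and no post is isolated. -/
theorem theorem2 :
    ∃ (c : RAM.Prog) (K : ℕ), ∀ (n m : ℕ) (I : CPMInstance n m) (L : I.Listing), I.Laminar →
      ∃ (t : ℕ) (s : RAM.State), RAM.Exec c (RAM.init L.encode) t s ∧
        I.CorrectAnswer s ∧
        t ≤ K * (n * I.edges.card + n + m + 1) ∧
        (I.edges.Nonempty → (∀ p : Fin m, ∃ a : Fin n, (a, p) ∈ I.edges) →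
          t ≤ K * (n * I.edges.card)) := by
  -- The constant is 4 · 8500: if there is an edge and no post is isolated, each of `n`, `m` and `1`
  -- is at most the product of `n` and the number of edges.
  refine ⟨RAM.popularMatching, 34000, fun n m I L hI => ?_⟩
  obtain ⟨t, s, k', hx, ht, hs⟩ := CPMInstance.popularMatching_spec L hI
  refine ⟨t, s, hx, hs, by omega, fun ⟨x, hx⟩ hp => ?_⟩
  have h1 : 1 ≤ I.edges.card := Finset.card_pos.2 ⟨x, hx⟩
  have h2 : 1 ≤ n := Nat.succ_le_of_lt (lt_of_le_of_lt (Nat.zero_le _) x.1.isLt)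
  have h3 : m ≤ I.edges.card := by
    calc m = ∑ _p : Fin m, 1 := by simp
      _ ≤ ∑ p, (I.nbrSet p).card := Finset.sum_le_sum fun p _ => by
        obtain ⟨a, ha⟩ := hp p
        exact Finset.card_pos.2 ⟨a, by simpa [CPMInstance.nbrSet] using ha⟩
      _ = I.edges.card := CPMInstance.sum_card_nbrSet I
  have h4 : n ≤ n * I.edges.card := Nat.le_mul_of_pos_right _ h1
  have h5 : I.edges.card ≤ n * I.edges.card := Nat.le_mul_of_pos_left _ h2
  omega
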